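/- **Setting.** Let $\pi:E\to S^2$ be the unit circle bundle of a Hermitian line bundle over the oriented sphere, and let $\alpha$ be the real connection $1$-form on $E$ of a unitary connection, normalised to equal $1$ on the generator of the fibre rotation $t\mapsto e^{it}\cdot p$. Define the curvature form $\Omega$ on $S^2$ by $\pi^*\Omega=-d\alpha$ and assume that $\Omega$ is strictly negative; thus $\alpha$ is a positive contact form, whose Reeb flow is the fibre rotation. Call $(E,\alpha)$ a *contact circle bundle*, and let $e(E)$ be its Euler number. **Decorated circles.** Let $\Gamma\subset S^2$ be a smoothly immersed circle whose only multiple points are transverse double points $p_1,\dots,p_r$. The components of $S^2\setminus\Gamma$ are the *regions* $U_i$. In $\Gamma^+$, two opposite quadrants at each $p_j$ are decorated with a $+$. Let $\vec n=(n_i)$ be an integer vector with one component for each region. **Diagrams.** Let $L\subset E$ be a Legendrian knot (a smoothly embedded circle tangent to $\ker\alpha$) such that $\pi|_L$ is an immersion with only transverse double points. Over each double point of $\pi(L)$ choose a Reeb chord that goes from one strand of $L$ to the other and has length in $(0,2\pi)$ (there are two such chords). Decorate a quadrant at a double point with a $+$ if, along its counter-clockwise boundary, the chosen chord goes from the incoming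 strand to the outgoing strand; two opposite quadrants are decorated in this way. The *defect* of a region $R$ of $S^2\setminus\pi(L)$ is $$\frac1{2\pi}\Big(\int_R\Omega+\sum \pm\, l\Big),$$ where the sum is over all quadrants at double points covered by $R$, $l$ is the length of the chord chosen there, and the sign is $+$ if the quadrant is decorated with a $+$ and $-$ otherwise. The pair $(\Gamma^+,\vec n)$ is a *diagram* of $L$, with these chords, if there is an orientation-preserving diffeomorphism $\phi$ of $S^2$ with $\phi(\Gamma)=\pi(L)$ that maps quadrants of $\Gamma$ decorated with a $+$ to quadrants of $\pi(L)$ decorated with a $+$ and such that $n_i$ is the defect of $\phi(U_i)$ for every $i$. **Linear algebra.** Let $Q_\Gamma$ and $V_\Gamma$ be the real vector spaces with bases the double points $p_j$ and the regions $U_i$, and let $\Psi:Q_\Gamma\to V_\Gamma$ be the linear map $$\Psi(p_j)=U_+^1(p_j)+U_+^2(p_j)-U_-^1(p_j)-U_-^2(p_j),$$ where $U_+^{1},U_+^2$ are the regions that cover the two $+$ quadrants at $p_j$ and $U_-^{1},U_-^2$ those that cover the other two. Let $Q_\Gamma^{(0,2\pi)}=\{\sum_j q_jp_j: 0<q_j<2\pi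 \text{ for all } j\}$ and $V_{\Gamma,e}^{<0}=\{\sum_i c_iU_i:\ \sum_i c_i=2\pi e(E),\ c_i<0 \text{ for all } i\}$. **Proposition.** Let $(E,\alpha)$ be a contact circle bundle over $S^2$. A pair $(\Gamma^+,\vec n)$ is the diagram of a Legendrian knot in $E$, for some choice of Reeb chords over the double points, if and only if $$\Psi\big(Q_\Gamma^{(0,2\pi)}\big)\cap\big(2\pi\vec n-V_{\Gamma,e}^{<0}\big)\neq\emptyset .$$ -/

import Mathlib

open Set Filter Topology MeasureTheory
open scoped Manifold ContDiff Real

noncomputable section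

/-- Euclidean three-space. -/
abbrev R3 : Type := EuclideanSpace ℝ (Fin 3)

/-- The unit sphere in `R3`, with Mathlib's smooth structure. -/
abbrev S2 : Type := Metric.sphere (0 : R3) 1

/-- The determinant of three vectors. For `x ∈ S2` and `v, w` tangent to the sphere at `x`, this is
the standard area form of the sphere, oriented by the outward normal. -/
def det3 (x v w : R3) : ℝ := (Matrix.of fun i j : Fin 3 => (![x, v, w] i) j).det

/-- The differential at `p` of a map into the sphere, with tangent vectors of the sphere regarded as
vectors of `R3`. -/
def dS {H M F : Type*} [NormedAddCommGroup F] [NormedSpace ℝ F] [TopologicalSpace H]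
    (I : ModelWithCorners ℝ F H) [TopologicalSpace M] [ChartedSpace H M]
    (f : M → S2) (p : M) (v : TangentSpace I p) : R3 :=
  mvfderiv I (fun q => (f q : R3)) p v

/-- Surface integral over a subset of the sphere, with respect to the standard area. -/
def surfaceIntegral (U : Set S2) (f : S2 → ℝ) : ℝ :=
  ∫ x in U, f x ∂((volume : Measure R3).toSphere)

/-- A diffeomorphism of the sphere is orientation preserving. -/
def OrientationPreserving (φ : Diffeomorph (𝓡 2) (𝓡 2) S2 S2 ∞) : Prop :=
  ∀ (x : S2) (v w : TangentSpace (𝓡 2) x),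
    0 < det3 x (dS (𝓡 2) id x v) (dS (𝓡 2) id x w) →
      0 < det3 (φ x) (dS (𝓡 2) φ x v) (dS (𝓡 2) φ x w)

/-! ### Generically immersed circles in the sphere and their complementary regions -/

/-- The velocity of a parametrized curve in the sphere, as a vector of `R3`. -/
def velocity (γ : ℝ → S2) (t : ℝ) : R3 := deriv (fun s => (γ s : R3)) t

/-- `γ` is a smooth immersion of the circle `ℝ / 2πℤ` in the sphere whose only multiple points are
transverse double points. -/
structure IsGenericCircle (γ : ℝ → S2) : Prop where
  smooth : ContMDiff 𝓘(ℝ, ℝ) (𝓡 2) ∞ γ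
  periodic : Function.Periodic γ (2 * π)
  immersive : ∀ t, velocity γ t ≠ 0
  transverse : ∀ s t, γ s = γ t → (s : Real.Angle) ≠ (t : Real.Angle) →
    LinearIndependent ℝ ![velocity γ s, velocity γ t]
  no_triple : ∀ s t u, γ s = γ t → γ t = γ u →
    (s : Real.Angle) = (t : Real.Angle) ∨ (t : Real.Angle) = (u : Real.Angle) ∨
      (s : Real.Angle) = (u : Real.Angle)

/-- The double points of a closed curve parametrized by `ℝ / 2πℤ`. -/
def doublePoints (γ : ℝ → S2) : Set S2 :=
  {x | ∃ s t : ℝ, (s : Real.Angle) ≠ (t : Real.Angle) ∧ γ s = x ∧ γ t = x}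

/-- The regions of the curve: the connected components of the complement of its image. -/
def regions (γ : ℝ → S2) : Set (Set S2) :=
  {U | ∃ x ∈ (range γ)ᶜ, U = connectedComponentIn (range γ)ᶜ x}

/-- The open cone spanned by the rays in the directions `a` and `b`. -/
def cone (a b : R3) : Set R3 := {w | ∃ r s : ℝ, 0 < r ∧ 0 < s ∧ w = r • a + s • b}

/-- The quadrants at the double point `x`: the (four) open cones in the tangent plane at `x` that
are bounded by a ray of the tangent line of one strand and a ray of the tangent line of the other
strand. -/
def quadrants (γ : ℝ → S2) (x : S2) : Set (Set R3) :=
  {Q | ∃ s t : ℝ, (s : Real.Angle) ≠ (t : Real.Angle) ∧ γ s = x ∧ γ t = x ∧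
    ∃ a b : R3, (a = velocity γ s ∨ a = -velocity γ s) ∧ (b = velocity γ t ∨ b = -velocity γ t) ∧
      Q = cone a b}

/-- The subset `U` of the sphere covers the quadrant `Q` near `x`: it contains the points near `x`
in the directions belonging to `Q`. -/
def CoversQuadrant (U : Set S2) (x : S2) (Q : Set R3) : Prop :=
  ∀ w ∈ Q, ∀ᶠ r : ℝ in 𝓝[>] 0,
    ∃ y ∈ U, (y : R3) = ‖(x : R3) + r • w‖⁻¹ • ((x : R3) + r • w)

/-- The image of a quadrant at `x` under the differential of a diffeomorphism of the sphere. -/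
def pushQuadrant (φ : Diffeomorph (𝓡 2) (𝓡 2) S2 S2 ∞) (x : S2) (Q : Set R3) : Set R3 :=
  {w | ∃ v : TangentSpace (𝓡 2) x, dS (𝓡 2) id x v ∈ Q ∧ dS (𝓡 2) φ x v = w}

/-- A generically immersed circle in the sphere with `+` decorations: at each double point two
opposing quadrants are decorated with a `+`. -/
structure DecoratedCircle where
  curve : ℝ → S2
  generic : IsGenericCircle curve
  plus : doublePoints curve → Set (Set R3)
  plus_spec : ∀ p : doublePoints curve, ∃ Q ∈ quadrants curve (p : S2),
    plus p = {Q, {w | -w ∈ Q}}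

namespace DecoratedCircle

variable (Γ : DecoratedCircle)

/-- The vertices of the decorated circle, viewed as a `4`-valent graph. -/
abbrev Vertex : Type := doublePoints Γ.curve

/-- The regions of the decorated circle. -/
abbrev Region : Type := regions Γ.curve

/-- The real vector space generated by the vertices. -/
abbrev Q : Type := Γ.Vertex →₀ ℝ

/-- The real vector space generated by the regions. -/
abbrev V : Type := Γ.Region →₀ ℝ

open Classical in
/-- The generator of `Γ.V` given by the region that covers the quadrant `A` at `p`. (There is always
exactly one such region if `A` is a quadrant at `p`.) -/
def regionOf (p : Γ.Vertex) (A : Set R3) : Γ.V :=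
  if h : ∃ U : Γ.Region, CoversQuadrant (U : Set S2) p A then Finsupp.single h.choose 1 else 0

/-- The linear map sending a vertex to the sum of the two regions decorated with a `+` near it minus
the sum of the other two regions near it. -/
def Psi : Γ.Q →ₗ[ℝ] Γ.V :=
  Finsupp.linearCombination ℝ fun p : Γ.Vertex =>
    (∑ᶠ A ∈ Γ.plus p, Γ.regionOf p A) -
      ∑ᶠ A ∈ quadrants Γ.curve (p : S2) \ Γ.plus p, Γ.regionOf p A

/-- The vectors of `Γ.Q` all of whose components lie strictly between `0` and `2π`. -/
def chordVectors : Set Γ.Q := {q | ∀ p, 0 < q p ∧ q p < 2 * π}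

/-- The hyperplane of the vectors of `Γ.V` whose components add up to `2πe`. -/
def hyperplane (e : ℤ) : Set Γ.V := {v | (v.sum fun _ c => c) = 2 * π * e}

/-- The vectors of the hyperplane all of whose components are negative. -/
def negHyperplane (e : ℤ) : Set Γ.V := {v | v ∈ Γ.hyperplane e ∧ ∀ U, v U < 0}

/-- An integer vector, with one component for each region, as an element of `Γ.V`. -/
def toV (n : Γ.Region →₀ ℤ) : Γ.V := n.mapRange (fun k : ℤ => (k : ℝ)) Int.cast_zero

end DecoratedCircle

/-! ### Contact circle bundles over the sphere -/

/-- The exterior derivative of a `1`-form on a `3`-manifold, computed in the preferred chart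
at `p`. -/
def extDerivOneForm {E : Type*} [TopologicalSpace E] [ChartedSpace R3 E]
    (α : ∀ p : E, TangentSpace (𝓡 3) p →L[ℝ] ℝ) (p : E) (v w : TangentSpace (𝓡 3) p) : ℝ :=
  extDeriv
    (fun y : R3 => ContinuousAlternatingMap.ofSubsingleton ℝ R3 ℝ (0 : Fin 1)
      ((α ((extChartAt (𝓡 3) p).symm y)).comp
        (mfderiv 𝓘(ℝ, R3) (𝓡 3) (extChartAt (𝓡 3) p).symm y)))
    (extChartAt (𝓡 3) p p)
    ![mvfderiv (𝓡 3) (extChartAt (𝓡 3) p) p v, mvfderiv (𝓡 3) (extChartAt (𝓡 3) p) p w]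

/-- The unit circle bundle of a Hermitian line bundle over the sphere, with a unitary connection:
a smooth principal circle bundle `proj : E → S2` (the circle acts by multiplication by unit complex
numbers in the fibres) together with a principal connection form. -/
structure CircleBundleWithConnection (E : Type*) [TopologicalSpace E] [ChartedSpace R3 E]
    [IsManifold (𝓡 3) ∞ E] [MulAction Circle E] where
  proj : E → S2
  smooth_smul : ContMDiffSMul (𝓡 1) (𝓡 3) ∞ Circle E
  smooth_proj : ContMDiff (𝓡 3) (𝓡 2) ∞ proj
  free : ∀ (z : Circle) (p : E), z • p = p → z = 1
  fibre : ∀ p q : E, proj p = proj q ↔ ∃ z : Circle, z • p = q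
  /-- Local triviality: there are smooth local sections near every point of the base. -/
  locally_trivial : ∀ x : S2, ∃ U : Set S2, IsOpen U ∧ x ∈ U ∧ ∃ σ : S2 → E,
    ContMDiffOn (𝓡 2) (𝓡 3) ∞ σ U ∧ ∀ y ∈ U, proj (σ y) = y
  form : ∀ p : E, TangentSpace (𝓡 3) p →L[ℝ] ℝ
  smooth_form : ContMDiff (𝓡 3).tangent 𝓘(ℝ, ℝ) ∞
    fun v : TangentBundle (𝓡 3) E => form v.1 v.2
  form_invariant : ∀ (z : Circle) (p : E) (v : TangentSpace (𝓡 3) p),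
    form (z • p) (mfderiv (𝓡 3) (𝓡 3) (fun q : E => z • q) p v) = form p v
  /-- The form takes the value `1` on the field generating the rotation of the fibres. -/
  form_vertical : ∀ p : E,
    form (Circle.exp 0 • p)
      (mfderiv 𝓘(ℝ, ℝ) (𝓡 3) (fun t : ℝ => Circle.exp t • p) 0 (1 : ℝ)) = 1

namespace CircleBundleWithConnection

variable {E : Type*} [TopologicalSpace E] [ChartedSpace R3 E] [IsManifold (𝓡 3) ∞ E]
  [MulAction Circle E]
  (B : CircleBundleWithConnection E)

/-- The real number `k` is the curvature at `x` if the curvature form `Ω`, which is determined by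
`π^* Ω = - dα`, is `k` times the standard area form of the sphere at `x`. -/
def IsCurvatureAt (x : S2) (k : ℝ) : Prop :=
  ∀ (p : E), B.proj p = x → ∀ v w : TangentSpace (𝓡 3) p,
    extDerivOneForm B.form p v w = -(k * det3 x (dS (𝓡 3) B.proj p v) (dS (𝓡 3) B.proj p w))

open Classical in
/-- The density of the curvature form with respect to the standard area form of the sphere. -/
def curvature (x : S2) : ℝ := if h : ∃ k, B.IsCurvatureAt x k then h.choose else 0

end CircleBundleWithConnection

/-- A contact circle bundle over the sphere: the connection form is a positive contact form, that
is, its curvature is strictly negative. The Reeb field is then the field generating the rotation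
of the fibres, so that the Reeb flow at time `t` is multiplication by `exp (i t)`. -/
structure ContactCircleBundle (E : Type*) [TopologicalSpace E] [ChartedSpace R3 E]
    [IsManifold (𝓡 3) ∞ E] [MulAction Circle E] extends CircleBundleWithConnection E where
  curvature_neg : ∀ x : S2, toCircleBundleWithConnection.curvature x < 0

/-- The point `(cos t, sin t, 0)` of the equator. -/
def equator (t : ℝ) : S2 :=
  ⟨!₂[Real.cos t, Real.sin t, 0], by
    simp [EuclideanSpace.norm_eq, Fin.sum_univ_three]⟩

namespace ContactCircleBundle

variable {E : Type*} [TopologicalSpace E] [ChartedSpace R3 E] [IsManifold (𝓡 3) ∞ E]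
  [MulAction Circle E]
  (B : ContactCircleBundle E)

/-- `e` is the Euler number of the bundle: `e` is the winding number along the equator of a section
over the sphere minus the north pole relative to a section over the sphere minus the south pole.
(The equator, with increasing `t`, is the positively oriented boundary of the northern
hemisphere.) -/
def IsEulerNumber (e : ℤ) : Prop :=
  ∃ σN σS : S2 → E,
    ContMDiffOn (𝓡 2) (𝓡 3) ∞ σN {x | (x : R3) 2 ≠ -1} ∧
    ContMDiffOn (𝓡 2) (𝓡 3) ∞ σS {x | (x : R3) 2 ≠ 1} ∧
    (∀ x : S2, (x : R3) 2 ≠ -1 → B.proj (σN x) = x) ∧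
    (∀ x : S2, (x : R3) 2 ≠ 1 → B.proj (σS x) = x) ∧
    ∃ θ : ℝ → ℝ, Continuous θ ∧ (∀ t, θ (t + 2 * π) = θ t + 2 * π * e) ∧
      ∀ t, σS (equator t) = Circle.exp (θ t) • σN (equator t)

/-- A Legendrian knot, parametrized by `ℝ / 2πℤ`: a smoothly embedded circle that is tangent to the
contact planes. As usual for diagrams, its projection to the base is required to be generic, that
is, to have only transverse double points. -/
structure LegendrianKnot where
  toFun : ℝ → E
  smooth : ContMDiff 𝓘(ℝ, ℝ) (𝓡 3) ∞ toFun
  periodic : Function.Periodic toFun (2 * π)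
  injective : ∀ s t, toFun s = toFun t → (s : Real.Angle) = (t : Real.Angle)
  immersive : ∀ t, mfderiv 𝓘(ℝ, ℝ) (𝓡 3) toFun t (1 : ℝ) ≠ 0
  legendrian : ∀ t, B.form (toFun t) (mfderiv 𝓘(ℝ, ℝ) (𝓡 3) toFun t (1 : ℝ)) = 0
  generic_projection : IsGenericCircle fun t => B.proj (toFun t)

namespace LegendrianKnot

variable {B} (L : B.LegendrianKnot)

/-- The projection of the knot to the base. -/
def projection (t : ℝ) : S2 := B.proj (L.toFun t)

/-- A Reeb chord of the knot above the double point `y` of its projection, with distinct endpoints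
`L initial` and `L terminal` and of minimal length among the Reeb chords with these endpoints; the length
of a chord is the time that the Reeb flow needs to traverse it, so minimality means that it is less
than `2π`. -/
structure ShortChord (y : doublePoints L.projection) where
  initial : ℝ
  terminal : ℝ
  initial_over : L.projection initial = y
  terminal_over : L.projection terminal = y
  distinct : (initial : Real.Angle) ≠ (terminal : Real.Angle)
  length : ℝ
  length_pos : 0 < length
  length_lt : length < 2 * π
  flow : Circle.exp length • L.toFun initial = L.toFun terminal

variable {L}

/-- The quadrants decorated with a `+` by a choice of Reeb chord: those for which, along the
counter-clockwise oriented boundary of the quadrant, the chord flows from the incoming strand to the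
outgoing strand. The boundary of the quadrant between the rays `a` and `b`, with `(a, b)` positively
oriented, comes in along `b` and goes out along `a`. -/
def ShortChord.plusQuadrants {y : doublePoints L.projection} (c : L.ShortChord y) :
    Set (Set R3) :=
  {A | ∃ a b : R3,
    (a = velocity L.projection c.terminal ∨ a = -velocity L.projection c.terminal) ∧
    (b = velocity L.projection c.initial ∨ b = -velocity L.projection c.initial) ∧
    0 < det3 (y : S2) a b ∧ A = cone a b}

variable (L)

open Classical in
/-- The defect of a region `U` of the projection with respect to chosen Reeb chords: `1 / 2π` times
the sum of the total curvature of `U` and of the signed lengths of the chords at the corners of `U`.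
Each quadrant covered by `U` is a corner, and its sign is `+1` if the chord flows from the incoming
to the outgoing strand and `-1` otherwise. -/
def defect (c : ∀ y : doublePoints L.projection, L.ShortChord y) (U : Set S2) : ℝ :=
  1 / (2 * π) * (surfaceIntegral U B.curvature +
    ∑ᶠ y : doublePoints L.projection,
      ∑ᶠ A ∈ {A | A ∈ quadrants L.projection (y : S2) ∧ CoversQuadrant U y A},
        (if A ∈ (c y).plusQuadrants then 1 else -1) * (c y).length)

/-- The pair `(Γ, n)` is a diagram for the Legendrian knot `L` with the chosen Reeb chords `c`. -/
def IsDiagram (c : ∀ y : doublePoints L.projection, L.ShortChord y)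
    (Γ : DecoratedCircle) (n : Γ.Region →₀ ℤ) : Prop :=
  ∃ φ : Diffeomorph (𝓡 2) (𝓡 2) S2 S2 ∞, OrientationPreserving φ ∧
    φ '' range Γ.curve = range L.projection ∧
    (∀ p : Γ.Vertex, ∃ y : doublePoints L.projection, (y : S2) = φ p ∧
      ∀ A ∈ Γ.plus p, pushQuadrant φ p A ∈ (c y).plusQuadrants) ∧
    ∀ U : Γ.Region, (n U : ℝ) = L.defect c (φ '' (U : Set S2))

end LegendrianKnot

end ContactCircleBundle

end

noncomputable section

/-! ### Smooth maps to and from the sphere -/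

/-! On a Legendrian curve the connection form vanishes, so by Stokes' theorem the change of the
fibre angle along a loop of the projection is the curvature enclosed by the loop, counted with
winding numbers. The proposition says that this is the only constraint.

Only if: let `q` be the vector of chord lengths and `v` the vector of total curvatures of the
regions. Multiplied by `2π`, the definition of the defect reads `2πn = v + Ψ(q)`
(`two_pi_mul_defect`). The entries of `v` are negative, and they add up to `2πe` because the total
curvature is `2π` times the Euler number (`surfaceIntegral_univ_curvature`).

If: let `Ψ(q) = 2πn - v`. A Moser type argument moves the curve by an orientation preserving
diffeomorphism such that `v` becomes the vector of curvatures of its regions (`exists_diffeo`). Now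
rotate a section over the curve by minus the primitive of the pulled back connection form
(`liftAngle`); this gives a Legendrian lift. Along a loop of the curve the angle changes by the sum
of winding number times curvature over the regions (`lineIntegral_planeCurve`). Inserting `v = 2πn -
Ψ(q)` turns this into a multiple of `2π` minus the sum over the double points `p` of `q p` times an
alternating sum of the winding numbers of the four quadrants at `p`. The alternating sum is `0` if
the loop is not based at `p`, however often it runs through `p` (`sum_winding_strand`), and `±1` if
it has its corner at `p` (`sum_winding_corner`). Hence the full loop, based away from the double
points, changes the angle by a multiple of `2π` and the lift closes up, while the loop from one
strand to the other over `p` shows that `q p` is the length of a chord there (`exists_lift`). Since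
`0 < q p < 2π` and the circle acts freely, the two strands are disjoint and the lift is a knot.

Stokes' theorem for curves with self-intersections is obtained without any triangulation: insert the
Cauchy–Pompeiu formula (`integral_dbar_div`) into the line integral and exchange the integrals; the
inner integral is then the logarithmic integral, that is, the winding number (`lineIntegral_eq`).
The jumps of the winding number at a crossing are computed as limits of arguments
(`tendsToCross_corner`, `tendsToCross_strand`). The Moser argument is explicit: in logarithmic
coordinates a density on a cylinder is flattened by integrating first along circles and then along
the axis (`exists_transport`). That there are only finitely many regions is never proved
topologically; in both directions it follows from finite supports. -/

/-- The chart of the sphere at `f x` is the stereographic projection from the antipode of `f x`, and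
its formula is smooth on an open subset of `R3`. Hence smoothness at a single point can be tested in
the ambient space. -/
theorem contMDiffAt_sphere_of_coe {F H M : Type*} [NormedAddCommGroup F] [NormedSpace ℝ F]
    [TopologicalSpace H] {I : ModelWithCorners ℝ F H} [TopologicalSpace M] [ChartedSpace H M]
    {m : ℕ∞ω} {f : M → S2} {x : M}
    (hf : ContMDiffAt I 𝓘(ℝ, R3) m (fun y => (f y : R3)) x) : ContMDiffAt I (𝓡 2) m f x := by
  have : Fact (Module.finrank ℝ R3 = 2 + 1) := ⟨by simp⟩
  rw [contMDiffAt_iff_target]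
  refine ⟨tendsto_subtype_rng.2 hf.continuousAt, ?_⟩
  let U : _ ≃ₗᵢ[ℝ] _ :=
    (OrthonormalBasis.fromOrthogonalSpanSingleton (𝕜 := ℝ)
        2 (ne_zero_of_mem_unit_sphere (-(f x)))).repr
  have hne : (f x : R3) ∈ {y : R3 | innerSL ℝ ((-(f x) : S2) : R3) y ≠ (1 : ℝ)} := by
    simp only [mem_ofPred_eq, innerSL_apply_apply]
    have : inner ℝ ((f x : S2) : R3) (f x : R3) = 1 := by
      rw [real_inner_self_eq_norm_sq, norm_eq_of_mem_sphere]; norm_num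
    rw [coe_neg_sphere, inner_neg_left, this]; norm_num
  have hopen : IsOpen {y : R3 | innerSL ℝ ((-(f x) : S2) : R3) y ≠ (1 : ℝ)} :=
    isOpen_ne.preimage (innerSL ℝ ((-(f x) : S2) : R3)).continuous
  have h1 : ContDiffAt ℝ m (stereoToFun ((-(f x) : S2) : R3)) (f x : R3) :=
    (contDiffOn_stereoToFun (v := ((-(f x) : S2) : R3))).contDiffAt (hopen.mem_nhds hne)
  have h2 : ContDiffAt ℝ m (U ∘ stereoToFun ((-(f x) : S2) : R3)) (f x : R3) :=
    U.contDiff.contDiffAt.comp _ h1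
  exact ContMDiffAt.comp (g := U ∘ stereoToFun ((-(f x) : S2) : R3)) x h2.contMDiffAt hf

/-- The north pole. -/
def northPole : S2 := ⟨!₂[0, 0, 1], by simp [EuclideanSpace.norm_eq, Fin.sum_univ_three]⟩

/-- The south pole. -/
def southPole : S2 := ⟨!₂[0, 0, -1], by simp [EuclideanSpace.norm_eq, Fin.sum_univ_three]⟩

open Classical in
/-- The radial retraction to the sphere, with a junk value at the origin. -/
def toS2 (v : R3) : S2 :=
  if h : v = 0 then northPole else ⟨‖v‖⁻¹ • v, by
    rw [mem_sphere_zero_iff_norm, norm_smul, norm_inv, norm_norm,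
      inv_mul_cancel₀ (norm_ne_zero_iff.2 h)]⟩

theorem coe_toS2 {v : R3} (h : v ≠ 0) : (toS2 v : R3) = ‖v‖⁻¹ • v := by
  simp [toS2, h]

theorem S2.norm_coe (x : S2) : ‖(x : R3)‖ = 1 := norm_eq_of_mem_sphere x

theorem S2.coe_ne_zero (x : S2) : (x : R3) ≠ 0 := ne_zero_of_mem_unit_sphere x

@[simp] theorem toS2_coe (x : S2) : toS2 x = x := by
  apply Subtype.ext
  rw [coe_toS2 x.coe_ne_zero, x.norm_coe]; simp

theorem contDiffAt_coe_toS2 {v : R3} (h : v ≠ 0) {m : ℕ∞ω} :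
    ContDiffAt ℝ m (fun v => (toS2 v : R3)) v := by
  have h1 : ContDiffAt ℝ m (fun v : R3 => ‖v‖⁻¹ • v) v :=
    ((contDiffAt_norm ℝ h).inv (norm_ne_zero_iff.2 h)).smul contDiffAt_id
  refine h1.congr_of_eventuallyEq ?_
  filter_upwards [isOpen_ne.mem_nhds h] with y hy using coe_toS2 hy

theorem contMDiffAt_toS2 {v : R3} (h : v ≠ 0) {m : ℕ∞ω} :
    ContMDiffAt 𝓘(ℝ, R3) (𝓡 2) m toS2 v :=
  contMDiffAt_sphere_of_coe (contDiffAt_coe_toS2 h).contMDiffAt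

theorem contMDiff_coe_S2 {m : ℕ∞ω} : ContMDiff (𝓡 2) 𝓘(ℝ, R3) m ((↑) : S2 → R3) :=
  have : Fact (Module.finrank ℝ R3 = 2 + 1) := ⟨by simp⟩
  contMDiff_coe_sphere

/-- The homogeneous extension of a self-map of the sphere. -/
def radialExt (f : S2 → S2) (y : R3) : R3 := f (toS2 y)

theorem radialExt_coe (f : S2 → S2) (x : S2) : radialExt f x = f x := by simp [radialExt]

theorem contDiffAt_radialExt {f : S2 → S2} {x : S2} {m : ℕ∞ω}
    (hf : ContMDiffAt (𝓡 2) (𝓡 2) m f x) : ContDiffAt ℝ m (radialExt f) x := by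
  rw [← contMDiffAt_iff_contDiffAt]
  have h1 : ContMDiffAt 𝓘(ℝ, R3) (𝓡 2) m toS2 (x : R3) := contMDiffAt_toS2 x.coe_ne_zero
  have h2 : ContMDiffAt 𝓘(ℝ, R3) (𝓡 2) m (fun y => f (toS2 y)) (x : R3) := by
    refine ContMDiffAt.comp (x : R3) (g := f) ?_ h1
    simpa using hf
  exact (contMDiff_coe_S2.contMDiffAt).comp (x : R3) h2

/-- Replaces differentials between tangent spaces of the sphere by Fréchet derivatives in `R3`, so
that from here on tangent vectors are vectors of `R3` orthogonal to the base point. -/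
theorem dS_eq_fderiv {f : S2 → S2} {x : S2} (hf : ContMDiffAt (𝓡 2) (𝓡 2) 1 f x)
    (v : TangentSpace (𝓡 2) x) :
    dS (𝓡 2) f x v = fderiv ℝ (radialExt f) x (dS (𝓡 2) id x v) := by
  have h1 : (fun q => (f q : R3)) = radialExt f ∘ ((↑) : S2 → R3) := by
    funext q; simp [radialExt]
  have h2 : MDifferentiableAt 𝓘(ℝ, R3) 𝓘(ℝ, R3) (radialExt f) (x : R3) :=
    ((contDiffAt_radialExt hf).differentiableAt one_ne_zero).mdifferentiableAt
  have h3 : MDifferentiableAt (𝓡 2) 𝓘(ℝ, R3) ((↑) : S2 → R3) x :=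
    contMDiff_coe_S2.contMDiffAt.mdifferentiableAt (n := 1) one_ne_zero
  have h4 := mfderiv_comp x h2 h3
  rw [mfderiv_eq_fderiv] at h4
  unfold dS mvfderiv
  rw [h1]
  exact congrArg (fun (L : TangentSpace (𝓡 2) x →L[ℝ] R3) => L v) h4

theorem exists_dS_id_eq_iff {x : S2} {w : R3} :
    (∃ v : TangentSpace (𝓡 2) x, dS (𝓡 2) id x v = w) ↔ inner ℝ (x : R3) w = 0 := by
  have : Fact (Module.finrank ℝ R3 = 2 + 1) := ⟨by simp⟩
  have := range_mvfderiv_subtypeVal (E := R3) (n := 2) x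
  rw [← Submodule.mem_orthogonal_singleton_iff_inner_right, ← this]
  rfl

theorem dS_id_inner (x : S2) (v : TangentSpace (𝓡 2) x) :
    inner ℝ (x : R3) (dS (𝓡 2) id x v) = 0 := exists_dS_id_eq_iff.1 ⟨v, rfl⟩

/-! ### Curves in the sphere -/

theorem contDiff_coe_curve {γ : ℝ → S2} (hγ : ContMDiff 𝓘(ℝ, ℝ) (𝓡 2) ∞ γ) :
    ContDiff ℝ ∞ (fun t => (γ t : R3)) :=
  contMDiff_iff_contDiff.1 (contMDiff_coe_S2.comp hγ)

theorem hasDerivAt_coe_curve {γ : ℝ → S2} (hγ : ContMDiff 𝓘(ℝ, ℝ) (𝓡 2) ∞ γ) (t : ℝ) :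
    HasDerivAt (fun t => (γ t : R3)) (velocity γ t) t :=
  ((contDiff_coe_curve hγ).differentiable (by simp) t).hasDerivAt

theorem inner_velocity {γ : ℝ → S2} (hγ : ContMDiff 𝓘(ℝ, ℝ) (𝓡 2) ∞ γ) (t : ℝ) :
    inner ℝ (γ t : R3) (velocity γ t) = 0 := by
  have h := hasDerivAt_coe_curve hγ t
  have h1 := h.inner ℝ h
  have h2 : (fun t => inner ℝ (γ t : R3) (γ t : R3)) = fun _ => (1 : ℝ) := by
    funext s; rw [real_inner_self_eq_norm_sq, S2.norm_coe]; norm_num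
  rw [h2] at h1
  have h3 := h1.unique (hasDerivAt_const t (1 : ℝ))
  rw [real_inner_comm (γ t : R3)] at h3
  linarith

theorem velocity_comp {f : S2 → S2} {γ : ℝ → S2} (hγ : ContMDiff 𝓘(ℝ, ℝ) (𝓡 2) ∞ γ) {t : ℝ}
    (hf : ContMDiffAt (𝓡 2) (𝓡 2) 1 f (γ t)) :
    velocity (fun s => f (γ s)) t = fderiv ℝ (radialExt f) (γ t) (velocity γ t) := by
  have h1 := ((contDiffAt_radialExt hf).differentiableAt one_ne_zero).hasFDerivAt
  have h2 := h1.comp_hasDerivAt t (hasDerivAt_coe_curve hγ t)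
  have h3 : (radialExt f ∘ fun t => (γ t : R3)) = fun s => (f (γ s) : R3) := by
    funext s; simp [radialExt]
  rw [h3] at h2
  exact h2.deriv

theorem velocity_periodic {γ : ℝ → S2} (h : Function.Periodic γ (2 * π)) :
    Function.Periodic (velocity γ) (2 * π) := by
  intro t
  have : (fun s => (γ s : R3)) = fun s => (γ (s + 2 * π) : R3) := by funext s; rw [h s]
  unfold velocity
  conv_rhs => rw [this]
  exact (deriv_comp_add_const (f := fun s => (γ s : R3)) (2 * π) t).symm

/-! ### The differential of a diffeomorphism of the sphere -/

section Diffeo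

variable (φ : Diffeomorph (𝓡 2) (𝓡 2) S2 S2 ∞)

theorem Diffeomorph.contMDiffAt_one (x : S2) : ContMDiffAt (𝓡 2) (𝓡 2) 1 φ x :=
  (φ.contMDiff.contMDiffAt).of_le (by simp)

/-- The homogeneous extensions compose to the extension of the identity, whose derivative is the
identity on tangent vectors only: it kills the radial direction, whence the orthogonality
hypothesis. -/
theorem fderiv_radialExt_symm_apply (x : S2) {w : R3} (hw : inner ℝ (x : R3) w = 0) :
    fderiv ℝ (radialExt φ.symm) (φ x) (fderiv ℝ (radialExt φ) x w) = w := by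
  have h1 : DifferentiableAt ℝ (radialExt φ) x :=
    (contDiffAt_radialExt (φ.contMDiffAt_one x)).differentiableAt one_ne_zero
  have h2 : DifferentiableAt ℝ (radialExt φ.symm) (radialExt φ x) := by
    rw [radialExt_coe]
    exact (contDiffAt_radialExt (φ.symm.contMDiffAt_one _)).differentiableAt one_ne_zero
  have h3 := fderiv_comp (x : R3) h2 h1
  have h4 : radialExt φ.symm ∘ radialExt φ = radialExt id := by
    funext y; simp [radialExt]
  obtain ⟨v, rfl⟩ := exists_dS_id_eq_iff.2 hw
  have h5 := dS_eq_fderiv (f := id) (x := x) contMDiffAt_id v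
  rw [h4, radialExt_coe] at h3
  conv_rhs => rw [h5, h3]
  rfl

theorem fderiv_radialExt_inner (x : S2) (w : R3) :
    inner ℝ (φ x : R3) (fderiv ℝ (radialExt φ) x w) = 0 := by
  have h1 : HasFDerivAt (radialExt φ) (fderiv ℝ (radialExt φ) x) x :=
    ((contDiffAt_radialExt (φ.contMDiffAt_one x)).differentiableAt one_ne_zero).hasFDerivAt
  have h2 := h1.inner ℝ h1
  have h3 : (fun y => inner ℝ (radialExt φ y) (radialExt φ y)) = fun _ => (1 : ℝ) := by
    funext s; rw [real_inner_self_eq_norm_sq, radialExt, S2.norm_coe]; norm_num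
  rw [h3] at h2
  have h4 := congrArg (fun L : R3 →L[ℝ] ℝ => L w) (h2.unique (hasFDerivAt_const (1 : ℝ) (x : R3)))
  simp [fderivInnerCLM_apply, radialExt_coe] at h4
  rw [real_inner_comm (φ x : R3)] at h4
  linarith

theorem pushQuadrant_eq (x : S2) {Q : Set R3} (hQ : ∀ w ∈ Q, inner ℝ (x : R3) w = 0) :
    pushQuadrant φ x Q = fderiv ℝ (radialExt φ) x '' Q := by
  ext w
  constructor
  · rintro ⟨v, hv, rfl⟩
    exact ⟨_, hv, (dS_eq_fderiv (φ.contMDiffAt_one x) v).symm⟩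
  · rintro ⟨u, hu, rfl⟩
    obtain ⟨v, rfl⟩ := exists_dS_id_eq_iff.2 (hQ u hu)
    exact ⟨v, hu, dS_eq_fderiv (φ.contMDiffAt_one x) v⟩

theorem orientationPreserving_iff : OrientationPreserving φ ↔
    ∀ (x : S2) (v w : R3), inner ℝ (x : R3) v = 0 → inner ℝ (x : R3) w = 0 → 0 < det3 x v w →
      0 < det3 (φ x) (fderiv ℝ (radialExt φ) x v) (fderiv ℝ (radialExt φ) x w) := by
  constructor
  · intro h x v w hv hw hd
    obtain ⟨v, rfl⟩ := exists_dS_id_eq_iff.2 hv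
    obtain ⟨w, rfl⟩ := exists_dS_id_eq_iff.2 hw
    have := h x v w hd
    rwa [dS_eq_fderiv (φ.contMDiffAt_one x), dS_eq_fderiv (φ.contMDiffAt_one x)] at this
  · intro h x v w hd
    rw [dS_eq_fderiv (φ.contMDiffAt_one x), dS_eq_fderiv (φ.contMDiffAt_one x)]
    exact h x _ _ (dS_id_inner x v) (dS_id_inner x w) hd

end Diffeo

theorem image_cone (D : R3 →L[ℝ] R3) (a b : R3) : D '' cone a b = cone (D a) (D b) := by
  ext w
  constructor
  · rintro ⟨_, ⟨r, s, hr, hs, rfl⟩, rfl⟩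
    exact ⟨r, s, hr, hs, by simp⟩
  · rintro ⟨r, s, hr, hs, rfl⟩
    exact ⟨_, ⟨r, s, hr, hs, rfl⟩, by simp⟩

/-! ### The Cauchy–Pompeiu formula -/

/-- The Wirtinger derivative `∂a/∂z̄`. -/
def dbar (a : ℂ → ℂ) (y : ℂ) : ℂ := (fderiv ℝ a y 1 + Complex.I * fderiv ℝ a y Complex.I) / 2

theorem continuous_dbar {a : ℂ → ℂ} (ha : ContDiff ℝ 1 a) : Continuous (dbar a) := by
  have h := ha.continuous_fderiv one_ne_zero
  unfold dbar
  fun_prop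

theorem hasCompactSupport_dbar {a : ℂ → ℂ} (hs : HasCompactSupport a) :
    HasCompactSupport (dbar a) := by
  refine (hs.fderiv (𝕜 := ℝ)).mono' ?_
  intro y hy
  apply subset_tsupport
  intro h0
  apply hy
  simp [dbar, h0]

/-- The Wirtinger derivative in the rotated frame: a radial derivative plus `i` times an angular
derivative. In polar coordinates these two parts can be integrated separately. -/
theorem dbar_mul_exp (a : ℂ → ℂ) (y : ℂ) (θ : ℝ) :
    dbar a y * Complex.exp (-(θ * Complex.I)) =
      (fderiv ℝ a y (Complex.exp (θ * Complex.I)) +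
        Complex.I * fderiv ℝ a y (Complex.I * Complex.exp (θ * Complex.I))) / 2 := by
  have h1 : Complex.exp (θ * Complex.I) =
      Real.cos θ • (1 : ℂ) + Real.sin θ • Complex.I := by
    rw [Complex.exp_mul_I]; simp
  have h2 : Complex.I * Complex.exp (θ * Complex.I) =
      (-Real.sin θ) • (1 : ℂ) + Real.cos θ • Complex.I := by
    rw [Complex.exp_mul_I]; simp; ring_nf; simp; ring
  have h3 : Complex.exp (-(θ * Complex.I)) = (Real.cos θ : ℂ) - Real.sin θ * Complex.I := by
    rw [← neg_mul, Complex.exp_mul_I]; simp [sub_eq_add_neg]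
  rw [h2, h1, h3]
  simp only [map_add, map_smul]
  simp only [dbar, Complex.real_smul]
  push_cast
  ring_nf
  simp only [Complex.I_sq]
  ring

theorem integral_deriv_ray {a : ℂ → ℂ} (ha : ContDiff ℝ 1 a) (hs : HasCompactSupport a) (z : ℂ)
    {u : ℂ} (hu : ‖u‖ = 1) :
    ∫ r in Ioi (0 : ℝ), fderiv ℝ a (z + r * u) u = - a z := by
  have hd : ∀ r : ℝ, HasDerivAt (fun r : ℝ => a (z + r * u)) (fderiv ℝ a (z + r * u) u) r := by
    intro r
    have h1 := (ha.differentiable one_ne_zero (z + r * u)).hasFDerivAt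
    have h2 : HasDerivAt (fun r : ℝ => z + (r : ℂ) * u) u r := by
      simpa using ((Complex.ofRealCLM.hasDerivAt (x := r)).mul_const u).const_add z
    exact h1.comp_hasDerivAt r h2
  obtain ⟨R, hR⟩ := hs.isCompact.isBounded.subset_closedBall z
  have hz : ∀ r : ℝ, R < r → 0 < r → a (z + r * u) = 0 := by
    intro r hr h0
    by_contra h
    have := hR (subset_tsupport a h)
    rw [mem_closedBall_iff_norm] at this
    simp [hu, abs_of_pos h0] at this
    linarith
  have htends : Tendsto (fun r : ℝ => a (z + r * u)) atTop (𝓝 0) := by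
    refine tendsto_const_nhds.congr' ?_
    filter_upwards [eventually_gt_atTop R, eventually_gt_atTop 0] with r h1 h2
    exact (hz r h1 h2).symm
  have hcont : Continuous fun r : ℝ => fderiv ℝ a (z + r * u) u := by
    have := ha.continuous_fderiv one_ne_zero
    fun_prop
  have hcs : HasCompactSupport fun r : ℝ => fderiv ℝ a (z + r * u) u := by
    refine HasCompactSupport.intro (K := Icc (-|R|) |R|) isCompact_Icc ?_
    intro r hr
    by_contra h
    have h' : z + r * u ∈ tsupport a := by
      refine support_fderiv_subset ℝ (f := a) ?_
      intro h0
      apply h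
      simp [h0]
    have := hR h'
    rw [mem_closedBall_iff_norm] at this
    simp [hu] at this
    exact hr (abs_le.1 (this.trans (le_abs_self R)))
  have h3 := integral_Ioi_of_hasDerivAt_of_tendsto
    (a := (0 : ℝ)) (f := fun r : ℝ => a (z + r * u)) (hd 0).continuousAt.continuousWithinAt
    (fun r _ => hd r) (hcont.integrable_of_hasCompactSupport hcs).integrableOn htends
  rw [h3]; simp

theorem integral_deriv_circle {a : ℂ → ℂ} (ha : ContDiff ℝ 1 a) (z : ℂ) {r : ℝ} (hr : r ≠ 0) :
    ∫ θ in Ioo (-π) π, fderiv ℝ a (z + r * Complex.exp (θ * Complex.I))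
      (Complex.I * Complex.exp (θ * Complex.I)) = 0 := by
  have hd : ∀ θ : ℝ, HasDerivAt (fun θ : ℝ => a (z + r * Complex.exp (θ * Complex.I)))
      (r • fderiv ℝ a (z + r * Complex.exp (θ * Complex.I))
        (Complex.I * Complex.exp (θ * Complex.I))) θ := by
    intro θ
    have h1 := (ha.differentiable one_ne_zero
      (z + r * Complex.exp (θ * Complex.I))).hasFDerivAt
    have h2 : HasDerivAt (fun θ : ℝ => z + r * Complex.exp (θ * Complex.I))
        (r * (Complex.I * Complex.exp (θ * Complex.I))) θ := by
      have h3 : HasDerivAt (fun θ : ℝ => (θ : ℂ) * Complex.I) Complex.I θ := by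
        simpa using (Complex.ofRealCLM.hasDerivAt (x := θ)).mul_const Complex.I
      have h4 := (h3.cexp.const_mul (r : ℂ)).const_add z
      simpa [mul_comm, mul_left_comm] using h4
    have h5 := h1.comp_hasDerivAt θ h2
    have h6 : (r : ℂ) * (Complex.I * Complex.exp (θ * Complex.I)) =
      r • (Complex.I * Complex.exp (θ * Complex.I)) := by simp
    rw [h6, map_smul] at h5
    exact h5
  have hcont : Continuous fun θ : ℝ => r • fderiv ℝ a (z + r * Complex.exp (θ * Complex.I))
        (Complex.I * Complex.exp (θ * Complex.I)) := by
    have := ha.continuous_fderiv one_ne_zero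
    fun_prop
  have h1 := intervalIntegral.integral_eq_sub_of_hasDerivAt (a := -π) (b := π)
    (fun θ _ => hd θ) (hcont.intervalIntegrable _ _)
  have h2 : Complex.exp ((-π : ℝ) * Complex.I) = Complex.exp ((π : ℝ) * Complex.I) := by
    push_cast
    rw [neg_mul, Complex.exp_neg, Complex.exp_pi_mul_I]; norm_num
  rw [h2, sub_self, intervalIntegral.integral_smul,
    intervalIntegral.integral_of_le (by linarith [Real.pi_pos]), integral_Ioc_eq_integral_Ioo] at h1
  exact (smul_eq_zero.1 h1).resolve_left hr

/-- A continuous function that vanishes for `r > R` is integrable on the half strip. -/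
theorem integrableOn_halfStrip {F : ℝ × ℝ → ℂ} (hF : Continuous F) {R : ℝ}
    (hR : ∀ p : ℝ × ℝ, R < p.1 → 0 < p.1 → F p = 0) :
    Integrable F ((volume.restrict (Ioi (0 : ℝ))).prod (volume.restrict (Ioo (-π) π))) := by
  rw [Measure.prod_restrict]
  have h1 : IntegrableOn F (Icc (0 : ℝ) R ×ˢ Icc (-π) π) (volume.prod volume) :=
    hF.continuousOn.integrableOn_compact (isCompact_Icc.prod isCompact_Icc)
  have h2 : IntegrableOn F (Icc (0 : ℝ) R ×ˢ Icc (-π) π ∩ Ioi (0 : ℝ) ×ˢ Ioo (-π) π)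
    (volume.prod volume) := h1.mono_set inter_subset_left
  refine IntegrableOn.of_forall_sdiff_eq_zero h2 (measurableSet_Ioi.prod measurableSet_Ioo) ?_
  rintro ⟨r, θ⟩ ⟨⟨h3, h4⟩, h5⟩
  simp only [mem_Ioi, mem_Ioo, mem_inter_iff, mem_prod, mem_Icc] at h3 h4 h5
  by_contra h6
  by_cases h7 : R < r
  · exact h6 (hR (r, θ) h7 h3)
  · exact h5 ⟨⟨⟨h3.le, not_lt.1 h7⟩, h4.1.le, h4.2.le⟩, h3, h4⟩

/-- In polar coordinates around `z` the Jacobian cancels the singularity of the kernel. The angular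
part integrates to zero over every circle and the radial part to `-a z` over every ray. -/
theorem integral_dbar_div {a : ℂ → ℂ} (ha : ContDiff ℝ 1 a) (hs : HasCompactSupport a) (z : ℂ) :
    ∫ y, dbar a y / (z - y) = π * a z := by
  have hfd := ha.continuous_fderiv one_ne_zero
  have h1 : ∫ y, dbar a y / (z - y) = ∫ y, dbar a (z + y) / (-y) := by
    rw [← integral_add_left_eq_self (fun y => dbar a y / (z - y)) z]
    congr 1; funext y; congr 1; ring
  rw [h1, ← Complex.integral_comp_polarCoord_symm]
  obtain ⟨R, hR⟩ := hs.isCompact.isBounded.subset_closedBall z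
  have hzero : ∀ (r θ : ℝ), R < r → 0 < r →
      fderiv ℝ a (z + r * Complex.exp (θ * Complex.I)) = 0 := by
    intro r θ hr h0
    by_contra h
    have := hR (support_fderiv_subset ℝ h)
    rw [mem_closedBall_iff_norm] at this
    simp [Complex.norm_exp_ofReal_mul_I, abs_of_pos h0] at this
    linarith
  set F1 : ℝ × ℝ → ℂ := fun p => fderiv ℝ a (z + p.1 * Complex.exp (p.2 * Complex.I))
    (Complex.exp (p.2 * Complex.I)) with hF1
  set F2 : ℝ × ℝ → ℂ := fun p => fderiv ℝ a (z + p.1 * Complex.exp (p.2 * Complex.I))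
    (Complex.I * Complex.exp (p.2 * Complex.I)) with hF2
  have hc1 : Continuous F1 := by fun_prop
  have hc2 : Continuous F2 := by fun_prop
  have hi1 := integrableOn_halfStrip hc1 (R := R) (fun p h h' => by
    simp [hF1, hzero p.1 p.2 h h'])
  have hi2 := integrableOn_halfStrip hc2 (R := R) (fun p h h' => by
    simp [hF2, hzero p.1 p.2 h h'])
  have h2 : ∫ p in polarCoord.target, p.1 • (dbar a (z + Complex.polarCoord.symm p) /
      (-(Complex.polarCoord.symm p))) =
      ∫ p in polarCoord.target, (-(1 / 2 : ℂ)) * (F1 p + Complex.I * F2 p) := by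
    refine setIntegral_congr_fun polarCoord.open_target.measurableSet ?_
    rintro ⟨r, θ⟩ hp
    have hr : (0 : ℝ) < r := hp.1
    have hr' : (r : ℂ) ≠ 0 := by exact_mod_cast hr.ne'
    have h3 : Complex.polarCoord.symm (r, θ) = r * Complex.exp (θ * Complex.I) := by
      rw [Complex.polarCoord_symm_apply, Complex.exp_mul_I]; simp
    have h4 := dbar_mul_exp a (z + r * Complex.exp (θ * Complex.I)) θ
    simp only [h3]
    have h5 : F1 (r, θ) + Complex.I * F2 (r, θ) = 2 *
        (dbar a (z + r * Complex.exp (θ * Complex.I)) * Complex.exp (-(θ * Complex.I))) := by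
      rw [h4]; simp only [hF1, hF2]; ring
    rw [h5, Complex.exp_neg, Complex.real_smul]
    have := Complex.exp_ne_zero (θ * Complex.I)
    field_simp
  rw [h2]
  have h3 : polarCoord.target = Ioi (0 : ℝ) ×ˢ Ioo (-π) π := rfl
  rw [h3, Measure.volume_eq_prod, ← Measure.prod_restrict, integral_const_mul,
    integral_add hi1 (hi2.const_mul _), integral_const_mul]
  rw [integral_prod_symm _ hi1, integral_prod _ hi2]
  have h4 : ∀ θ : ℝ, ∫ r in Ioi (0 : ℝ), F1 (r, θ) = - a z := fun θ =>
    integral_deriv_ray ha hs z (Complex.norm_exp_ofReal_mul_I θ)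
  have h5 : ∫ r in Ioi (0 : ℝ), ∫ θ in Ioo (-π) π, F2 (r, θ) = 0 := by
    rw [setIntegral_congr_fun measurableSet_Ioi (g := fun _ => (0 : ℂ))]
    · simp
    · intro r hr
      exact integral_deriv_circle ha z (ne_of_gt hr)
  simp only [h4, h5]
  rw [setIntegral_const]
  simp [measureReal_def, Real.volume_Ioo]
  rw [ENNReal.toReal_ofReal (by linarith [Real.pi_pos])]
  push_cast
  ring

/-! ### Winding numbers of plane loops -/

/-- The integral of `dz / (z - y)` along the curve `c` over the interval from `s` to `t`. -/
def logIntegral (c : ℝ → ℂ) (s t : ℝ) (y : ℂ) : ℂ := ∫ τ in s..t, deriv c τ / (c τ - y)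

theorem continuous_logIntegrand {c : ℝ → ℂ} (hc : ContDiff ℝ 1 c) {y : ℂ} (hy : y ∉ range c) :
    Continuous fun τ => deriv c τ / (c τ - y) := by
  refine (hc.continuous_deriv le_rfl).div (hc.continuous.sub continuous_const) ?_
  intro t h
  exact hy ⟨t, sub_eq_zero.1 h⟩

/-- The product of `c τ - y` with the exponential of minus the logarithmic integral has derivative
zero. No branch of the logarithm is involved. -/
theorem exp_logIntegral {c : ℝ → ℂ} (hc : ContDiff ℝ 1 c) {y : ℂ} (hy : y ∉ range c) (s t : ℝ) :
    Complex.exp (logIntegral c s t y) = (c t - y) / (c s - y) := by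
  have hne : ∀ τ, c τ - y ≠ 0 := fun τ h => hy ⟨τ, sub_eq_zero.1 h⟩
  have hcont := continuous_logIntegrand hc hy
  have hd : ∀ τ, HasDerivAt (fun τ => Complex.exp (-logIntegral c s τ y) * (c τ - y)) 0 τ := by
    intro τ
    have h1 : HasDerivAt (fun τ => logIntegral c s τ y) (deriv c τ / (c τ - y)) τ :=
      intervalIntegral.integral_hasDerivAt_right (hcont.intervalIntegrable _ _)
        (hcont.stronglyMeasurableAtFilter _ _) hcont.continuousAt
    have h2 := h1.neg.cexp.mul (((hc.differentiable one_ne_zero τ).hasDerivAt).sub_const y)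
    convert! h2 using 1
    have := hne τ
    field_simp
    simp
  have h3 := is_const_of_deriv_eq_zero (fun τ => (hd τ).differentiableAt)
    (fun τ => (hd τ).deriv) t s
  simp only [logIntegral, intervalIntegral.integral_same, neg_zero, Complex.exp_zero,
    one_mul, Complex.exp_neg] at h3 ⊢
  have h4 := Complex.exp_ne_zero (∫ τ in s..t, deriv c τ / (c τ - y))
  have h5 := hne s
  field_simp at h3 ⊢
  rw [h3]

/-- The winding number around `y` of the loop `c` over the interval from `s` to `t`. -/
def winding (c : ℝ → ℂ) (s t : ℝ) (y : ℂ) : ℝ := (logIntegral c s t y / (2 * π * Complex.I)).re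

theorem exists_winding_eq {c : ℝ → ℂ} (hc : ContDiff ℝ 1 c) {s t : ℝ} (hst : c s = c t) {y : ℂ}
    (hy : y ∉ range c) :
    ∃ n : ℤ, winding c s t y = n ∧ logIntegral c s t y = n * (2 * π * Complex.I) := by
  have h := exp_logIntegral hc hy s t
  rw [hst, div_self (fun h => hy ⟨t, sub_eq_zero.1 h⟩), Complex.exp_eq_one_iff] at h
  obtain ⟨n, hn⟩ := h
  refine ⟨n, ?_, hn⟩
  rw [winding, hn, mul_div_assoc, div_self (by simp [Real.pi_ne_zero]), mul_one]
  simp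

theorem continuousAt_logIntegral {c : ℝ → ℂ} (hc : ContDiff ℝ 1 c) (hr : IsClosed (range c))
    (s t : ℝ) {y : ℂ} (hy : y ∉ range c) : ContinuousAt (logIntegral c s t) y := by
  obtain ⟨δ, hδ, hball⟩ := Metric.isOpen_iff.1 hr.isOpen_compl y hy
  have hdc := hc.continuous_deriv le_rfl
  refine intervalIntegral.continuousAt_of_dominated_interval
    (bound := fun τ => ‖deriv c τ‖ / (δ / 2)) ?_ ?_ ?_ ?_
  · refine Eventually.of_forall fun x => ?_
    exact (hdc.measurable.div (hc.continuous.sub continuous_const).measurable).aestronglyMeasurable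
  · filter_upwards [Metric.ball_mem_nhds y (half_pos hδ)] with x hx
    refine Eventually.of_forall fun τ _ => ?_
    rw [norm_div]
    refine div_le_div_of_nonneg_left (norm_nonneg _) (half_pos hδ) ?_
    have h1 : δ ≤ ‖c τ - y‖ := by
      by_contra h
      exact hball (mem_ball_iff_norm.2 (not_le.1 h)) ⟨τ, rfl⟩
    have h2 : ‖x - y‖ < δ / 2 := mem_ball_iff_norm.1 hx
    have h3 : ‖c τ - y‖ ≤ ‖c τ - x‖ + ‖x - y‖ := by
      rw [← sub_add_sub_cancel (c τ) x y]; exact norm_add_le _ _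
    linarith
  · exact (hdc.norm.div_const _).intervalIntegrable _ _
  · refine Eventually.of_forall fun τ _ => ?_
    refine continuousAt_const.div (continuousAt_const.sub continuousAt_id) ?_
    intro h
    exact hy ⟨τ, sub_eq_zero.1 h⟩

theorem continuousAt_winding {c : ℝ → ℂ} (hc : ContDiff ℝ 1 c) (hr : IsClosed (range c))
    (s t : ℝ) {y : ℂ} (hy : y ∉ range c) : ContinuousAt (winding c s t) y :=
  Complex.continuous_re.continuousAt.comp ((continuousAt_logIntegral hc hr s t hy).div_const _)

theorem exists_winding_eq_zero {c : ℝ → ℂ} (hc : ContDiff ℝ 1 c) (hr : IsCompact (range c))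
    {s t : ℝ} (hst : c s = c t) :
    ∃ R : ℝ, (∀ τ, ‖c τ‖ < R) ∧ ∀ y : ℂ, R ≤ ‖y‖ → winding c s t y = 0 := by
  have hdc := hc.continuous_deriv le_rfl
  obtain ⟨R₀, hR₀⟩ := hr.isBounded.subset_ball 0
  obtain ⟨M, hM⟩ := (isCompact_uIcc (a := s) (b := t)).exists_bound_of_continuousOn hdc.continuousOn
  have hM0 : 0 ≤ M := (norm_nonneg _).trans (hM s left_mem_uIcc)
  have hpi := Real.pi_pos
  -- At distance at least `M * |t - s| + 1` from the curve the logarithmic integral is smaller than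
  -- `1` in norm. Being an integral multiple of `2πi`, it vanishes.
  refine ⟨R₀ + (M * |t - s| + 1), fun τ => ?_, fun y hy => ?_⟩
  · have := hR₀ ⟨τ, rfl⟩
    rw [mem_ball_zero_iff] at this
    have h0 : 0 ≤ M * |t - s| := by positivity
    linarith
  · have hD : 0 < M * |t - s| + 1 := by positivity
    have hdist : ∀ τ, M * |t - s| + 1 ≤ ‖c τ - y‖ := by
      intro τ
      have h1 := hR₀ ⟨τ, rfl⟩
      rw [mem_ball_zero_iff] at h1
      have h2 := norm_sub_norm_le y (c τ)
      rw [norm_sub_rev] at h2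
      linarith
    have hy' : y ∉ range c := by
      rintro ⟨τ, rfl⟩
      have := hdist τ
      simp at this
      linarith
    obtain ⟨n, hn, hn'⟩ := exists_winding_eq hc hst hy'
    have h1 : ‖logIntegral c s t y‖ ≤ M / (M * |t - s| + 1) * |t - s| := by
      refine intervalIntegral.norm_integral_le_of_norm_le_const fun τ hτ => ?_
      rw [norm_div]
      exact div_le_div₀ hM0 (hM τ (uIoc_subset_uIcc hτ)) hD (hdist τ)
    have h2 : M / (M * |t - s| + 1) * |t - s| < 1 := by
      rw [div_mul_eq_mul_div, div_lt_one hD]; linarith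
    rw [hn'] at h1
    simp [abs_of_pos hpi] at h1
    have h3 : |(n : ℝ)| < 1 := by
      by_contra h
      have := Real.pi_gt_three
      nlinarith [not_lt.1 h]
    have h4 : n = 0 := by
      rw [← Int.abs_lt_one_iff]; exact_mod_cast h3
    rw [hn, h4]; simp

/-! ### Stokes' theorem with winding numbers -/

/-- In dimension two the Jacobian `r` of polar coordinates compensates for the pole. -/
theorem integrableOn_inv_norm : IntegrableOn (fun u : ℂ => ‖u‖⁻¹) (Metric.ball 0 1) := by
  have h := (integrableOn_fun_norm_addHaar (E := ℂ) (μ := volume) (f := fun r : ℝ => r⁻¹)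
    (r := 1)).2 ?_
  · exact h
  · simp only [Complex.finrank_real_complex]
    refine IntegrableOn.congr_fun (f := fun _ => (1 : ℝ)) ?_ ?_ measurableSet_Ioo
    · simp
    · intro r hr
      have : r ≠ 0 := hr.1.ne'
      simp [this]

/-- The bound is uniform in `z`, as Fubini's theorem requires below. Within distance `1` of `z` the
kernel is integrable and `g` is bounded; farther away the kernel is at most `1` and `g` is
integrable. -/
theorem exists_integral_dbar_div_bound {g : ℂ → ℂ} (hg : Continuous g) (hs : HasCompactSupport g) :
    ∃ C : ℝ, ∀ z : ℂ, Integrable (fun y => g y / (z - y)) ∧ ∫ y, ‖g y / (z - y)‖ ≤ C := by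
  obtain ⟨M, hM⟩ := hg.bounded_above_of_compact_support hs
  have hM0 : 0 ≤ M := (norm_nonneg _).trans (hM 0)
  have hk : Integrable ((Metric.ball (0 : ℂ) 1).indicator fun u : ℂ => ‖u‖⁻¹) :=
    integrableOn_inv_norm.integrable_indicator measurableSet_ball
  have hgi : Integrable fun y => ‖g y‖ := (hg.integrable_of_hasCompactSupport hs).norm
  have hb : ∀ z, Integrable fun y => M * (Metric.ball (0 : ℂ) 1).indicator (fun u : ℂ => ‖u‖⁻¹)
      (z - y) + ‖g y‖ := fun z => ((hk.comp_sub_left z).const_mul M).add hgi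
  have hle : ∀ z y, ‖g y / (z - y)‖ ≤
      M * (Metric.ball (0 : ℂ) 1).indicator (fun u : ℂ => ‖u‖⁻¹) (z - y) + ‖g y‖ := by
    intro z y
    rw [norm_div]
    by_cases h : z - y ∈ Metric.ball (0 : ℂ) 1
    · rw [indicator_of_mem h, div_eq_mul_inv]
      have := mul_le_mul_of_nonneg_right (hM y) (inv_nonneg.2 (norm_nonneg (z - y)))
      linarith [norm_nonneg (g y)]
    · rw [indicator_of_notMem h, mul_zero, zero_add]
      refine div_le_self (norm_nonneg _) ?_
      simpa using h
  have hmeas : ∀ z, AEStronglyMeasurable (fun y => g y / (z - y)) volume := fun z =>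
    (hg.measurable.div (continuous_const.sub continuous_id).measurable).aestronglyMeasurable
  refine ⟨(∫ y, M * (Metric.ball (0 : ℂ) 1).indicator (fun u : ℂ => ‖u‖⁻¹) y) + ∫ y, ‖g y‖,
    fun z => ⟨(hb z).mono' (hmeas z) (Eventually.of_forall (hle z)), ?_⟩⟩
  refine (integral_mono_of_nonneg (Eventually.of_forall fun y => norm_nonneg _) (hb z)
    (Eventually.of_forall (hle z))).trans (le_of_eq ?_)
  rw [integral_add ((hk.comp_sub_left z).const_mul M) hgi]
  congr 1
  exact integral_sub_left_eq_self
    (fun y => M * (Metric.ball (0 : ℂ) 1).indicator (fun u : ℂ => ‖u‖⁻¹) y) volume z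

/-- Expand `a (c τ)` by the Cauchy–Pompeiu formula and exchange the integrals; what remains inside
is the logarithmic integral. The curve need not be closed or embedded. -/
theorem integral_curve_eq_integral_dbar {a : ℂ → ℂ} (ha : ContDiff ℝ 1 a) (hs : HasCompactSupport a)
    {c : ℝ → ℂ} (hc : ContDiff ℝ 1 c) {s t : ℝ} (hst : s ≤ t) :
    Integrable (fun y => dbar a y * logIntegral c s t y) ∧
    π * ∫ τ in s..t, a (c τ) * deriv c τ = ∫ y, dbar a y * logIntegral c s t y := by
  have hdc := hc.continuous_deriv le_rfl
  have hg := continuous_dbar ha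
  obtain ⟨C, hC⟩ := exists_integral_dbar_div_bound hg (hasCompactSupport_dbar hs)
  obtain ⟨M, hM⟩ := (isCompact_Icc (a := s) (b := t)).exists_bound_of_continuousOn hdc.continuousOn
  have hint : Integrable (fun p : ℝ × ℂ => deriv c p.1 * (dbar a p.2 / (c p.1 - p.2)))
      ((volume.restrict (Ioc s t)).prod volume) := by
    have hmeas : AEStronglyMeasurable
        (fun p : ℝ × ℂ => deriv c p.1 * (dbar a p.2 / (c p.1 - p.2)))
        ((volume.restrict (Ioc s t)).prod volume) := by
      refine Measurable.aestronglyMeasurable ?_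
      refine (hdc.comp continuous_fst).measurable.mul
        (((hg.comp continuous_snd).measurable).div ?_)
      exact ((hc.continuous.comp continuous_fst).sub continuous_snd).measurable
    rw [integrable_prod_iff hmeas]
    refine ⟨Eventually.of_forall fun τ => (hC (c τ)).1.const_mul (deriv c τ), ?_⟩
    refine Integrable.mono' (g := fun _ => M * C) (integrable_const _)
      hmeas.norm.integral_prod_right' ?_
    filter_upwards [ae_restrict_mem measurableSet_Ioc] with τ hτ
    rw [Real.norm_of_nonneg (integral_nonneg fun _ => norm_nonneg _)]
    simp only [norm_mul]
    rw [integral_const_mul]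
    have h1 := hM τ (Ioc_subset_Icc_self hτ)
    have h2 : 0 ≤ ∫ y, ‖dbar a y / (c τ - y)‖ := integral_nonneg fun _ => norm_nonneg _
    exact mul_le_mul h1 (hC (c τ)).2 h2 ((norm_nonneg _).trans h1)
  have hslice : ∀ y, ∫ τ in Ioc s t, deriv c τ * (dbar a y / (c τ - y)) =
      dbar a y * logIntegral c s t y := by
    intro y
    rw [logIntegral, intervalIntegral.integral_of_le hst, ← integral_const_mul]
    congr 1; funext τ; ring
  constructor
  · have := hint.integral_prod_right
    simpa only [hslice] using this
  · rw [intervalIntegral.integral_of_le hst, ← integral_const_mul]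
    have h1 : ∀ τ, (π : ℂ) * (a (c τ) * deriv c τ) =
        ∫ y, deriv c τ * (dbar a y / (c τ - y)) := by
      intro τ
      rw [integral_const_mul, integral_dbar_div ha hs]; ring
    simp only [h1]
    rw [integral_integral_swap hint]
    simp only [hslice]

/-- The exterior derivative of `P dx + Q dy`. -/
def curl (P Q : ℂ → ℝ) (y : ℂ) : ℝ := fderiv ℝ Q y 1 - fderiv ℝ P y Complex.I

/-- The integral of `P dx + Q dy` along a curve. -/
def lineIntegral (P Q : ℂ → ℝ) (c : ℝ → ℂ) (s t : ℝ) : ℝ :=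
  ∫ τ in s..t, (P (c τ) * (deriv c τ).re + Q (c τ) * (deriv c τ).im)

/-- Take `a = P - iQ`, so that the real part of `a dz` is `P dx + Q dy` and the imaginary part of
`dbar a` is `-curl / 2`. Off the curve, which is a null set, the logarithmic integral is `2πi` times
the winding number, so the real part of the product is `π` times winding number times curl. -/
theorem lineIntegral_eq_of_hasCompactSupport {P Q : ℂ → ℝ} (hP : ContDiff ℝ 1 P)
    (hQ : ContDiff ℝ 1 Q) (hPs : HasCompactSupport P) (hQs : HasCompactSupport Q)
    {c : ℝ → ℂ} (hc : ContDiff ℝ 1 c) (hr : volume (range c) = 0)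
    {s t : ℝ} (hst : s ≤ t) (hcst : c s = c t) :
    lineIntegral P Q c s t = ∫ y, winding c s t y * curl P Q y := by
  set a : ℂ → ℂ := fun y => ((P y : ℂ) - Complex.I * Q y) with ha_def
  have ha : ContDiff ℝ 1 a :=
    (Complex.ofRealCLM.contDiff.comp hP).sub
      (contDiff_const.mul (Complex.ofRealCLM.contDiff.comp hQ))
  have has : HasCompactSupport a := by
    have h1 : HasCompactSupport fun y => (P y : ℂ) := hPs.comp_left (g := fun x : ℝ => (x : ℂ))
        (by simp)
    have h2 : HasCompactSupport fun y => (Complex.I * Q y : ℂ) :=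
      hQs.comp_left (g := fun x : ℝ => (Complex.I * x : ℂ)) (by simp)
    exact h1.sub h2
  obtain ⟨hi, h⟩ := integral_curve_eq_integral_dbar ha has hc hst
  have hfd : ∀ y v, fderiv ℝ a y v = (fderiv ℝ P y v : ℂ) - Complex.I * (fderiv ℝ Q y v : ℂ) := by
    intro y v
    have h1 : HasFDerivAt (fun y => (P y : ℂ)) (Complex.ofRealCLM.comp (fderiv ℝ P y)) y :=
      Complex.ofRealCLM.hasFDerivAt.comp y ((hP.differentiable one_ne_zero y).hasFDerivAt)
    have h2 : HasFDerivAt (fun y => (Q y : ℂ)) (Complex.ofRealCLM.comp (fderiv ℝ Q y)) y :=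
      Complex.ofRealCLM.hasFDerivAt.comp y ((hQ.differentiable one_ne_zero y).hasFDerivAt)
    have h3 := h1.sub (h2.const_mul Complex.I)
    have h4 : HasFDerivAt a _ y := h3
    rw [h4.fderiv]
    simp
  have h1 : ∀ᵐ y : ℂ, (dbar a y * logIntegral c s t y).re =
      π * (winding c s t y * curl P Q y) := by
    rw [ae_iff]
    refine measure_mono_null ?_ hr
    intro y hy
    by_contra hy'
    apply hy
    obtain ⟨n, hn, hn'⟩ := exists_winding_eq hc hcst hy'
    rw [hn, hn', dbar, hfd, hfd, curl]
    simp
    ring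
  have h2 := congrArg Complex.re h
  have h2' : ∫ y, (dbar a y * logIntegral c s t y).re = _ := integral_re hi
  rw [RCLike.re_eq_complex_re, ← h2, integral_congr_ae h1, integral_const_mul,
      Complex.re_ofReal_mul] at h2'
  have h3 := mul_left_cancel₀ Real.pi_ne_zero h2'
  rw [h3, lineIntegral]
  have hcont : Continuous fun τ => a (c τ) * deriv c τ :=
    (ha.continuous.comp hc.continuous).mul (hc.continuous_deriv le_rfl)
  have h4 := intervalIntegral.intervalIntegral_re (hcont.intervalIntegrable (μ := volume) s t)
  simp only [RCLike.re_eq_complex_re] at h4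
  rw [← h4]
  congr 1
  funext τ
  simp [ha_def]

/-- Cutting off `P` and `Q` outside a large ball affects neither side: the curve lies inside the
ball, and the winding number is zero outside. -/
theorem lineIntegral_eq {P Q : ℂ → ℝ} (hP : ContDiff ℝ 1 P) (hQ : ContDiff ℝ 1 Q)
    {c : ℝ → ℂ} (hc : ContDiff ℝ 1 c) (hrc : IsCompact (range c)) (hr : volume (range c) = 0)
    {s t : ℝ} (hst : s ≤ t) (hcst : c s = c t) :
    lineIntegral P Q c s t = ∫ y, winding c s t y * curl P Q y := by
  obtain ⟨R, hR, hw⟩ := exists_winding_eq_zero hc hrc hcst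
  have hR0 : 0 < R := (norm_nonneg _).trans_lt (hR 0)
  let χ : ContDiffBump (0 : ℂ) := ⟨R, R + 1, hR0, by linarith⟩
  have hχ : ContDiff ℝ 1 χ := χ.contDiff
  have hχ1 : ∀ y : ℂ, ‖y‖ < R → χ =ᶠ[𝓝 y] 1 := fun y hy =>
    χ.eventuallyEq_one_of_mem_ball (mem_ball_zero_iff.2 hy)
  have h := lineIntegral_eq_of_hasCompactSupport (hχ.mul hP) (hχ.mul hQ)
    (χ.hasCompactSupport.mul_right) (χ.hasCompactSupport.mul_right) hc hr hst hcst
  have hmul : ∀ (F : ℂ → ℝ) (y : ℂ), ‖y‖ < R → (fun y => χ y * F y) =ᶠ[𝓝 y] F := by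
    intro F y hy
    filter_upwards [hχ1 y hy] with x hx
    simp [hx]
  have h1 : lineIntegral (fun y => χ y * P y) (fun y => χ y * Q y) c s t =
      lineIntegral P Q c s t := by
    unfold lineIntegral
    congr 1; funext τ
    have h2 := (hmul P _ (hR τ)).eq_of_nhds
    have h3 := (hmul Q _ (hR τ)).eq_of_nhds
    simp only at h2 h3 ⊢
    rw [h2, h3]
  rw [← h1]
  refine h.trans (integral_congr_ae (Eventually.of_forall fun y => ?_))
  by_cases hy : R ≤ ‖y‖
  · simp [hw y hy]
  · have hy := not_le.1 hy
    simp only [curl]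
    rw [(hmul P y hy).fderiv_eq, (hmul Q y hy).fderiv_eq]

/-! ### Jumps of the winding number at a crossing -/

/-- Holds for all `s ≥ 0`, however large; this keeps a strand inside the domain of the logarithm
uniformly as the observer approaches the crossing. -/
theorem one_add_mul_mem_slitPlane {ζ : ℂ} (hζ : ζ ∈ Complex.slitPlane) {s : ℝ} (hs : 0 ≤ s) :
    1 + s * ζ ∈ Complex.slitPlane := by
  rw [Complex.mem_slitPlane_iff] at hζ ⊢
  rcases hζ with h | h
  · left
    simp
    positivity
  · rcases hs.eq_or_lt with rfl | hs
    · simp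
    · right
      simp [hs.ne', h]

theorem mem_slitPlane_of_im_ne_zero {z : ℂ} (h : z.im ≠ 0) : z ∈ Complex.slitPlane :=
  Complex.mem_slitPlane_iff.2 (Or.inr h)

theorem tendsto_slope_right {c : ℝ → ℂ} (hc : ContDiff ℝ 1 c) (τ₀ : ℝ) :
    Tendsto (fun h : ℝ => (c (τ₀ + h) - c τ₀) / h) (𝓝[>] 0) (𝓝 (deriv c τ₀)) := by
  have h1 := (hc.differentiable one_ne_zero τ₀).hasDerivAt.tendsto_slope_zero_right
  refine h1.congr fun h => ?_
  rw [Complex.real_smul, Complex.ofReal_inv, div_eq_inv_mul]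

theorem logIntegral_eq_log {c : ℝ → ℂ} (hc : ContDiff ℝ 1 c) {y : ℂ} {s t : ℝ}
    (h : ∀ τ ∈ uIcc s t, (c τ - y) / (c s - y) ∈ Complex.slitPlane) :
    logIntegral c s t y = Complex.log ((c t - y) / (c s - y)) := by
  have hs : c s - y ≠ 0 := by
    intro h0
    have := h s left_mem_uIcc
    simp [h0] at this
  have hne : ∀ τ ∈ uIcc s t, c τ - y ≠ 0 := by
    intro τ hτ h0
    have := h τ hτ
    simp [h0] at this
  have hd : ∀ τ ∈ uIcc s t, HasDerivAt (fun τ => Complex.log ((c τ - y) / (c s - y)))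
      (deriv c τ / (c τ - y)) τ := by
    intro τ hτ
    have h1 := (((hc.differentiable one_ne_zero τ).hasDerivAt).sub_const y).div_const (c s - y)
    have h2 := h1.clog_real (h τ hτ)
    convert! h2 using 1
    have := hne τ hτ
    field_simp
  have hcont : ContinuousOn (fun τ => deriv c τ / (c τ - y)) (uIcc s t) :=
    (hc.continuous_deriv le_rfl).continuousOn.div
      (hc.continuous.sub continuous_const).continuousOn hne
  rw [logIntegral, intervalIntegral.integral_eq_sub_of_hasDerivAt hd hcont.intervalIntegrable,
    div_self hs, Complex.log_one, sub_zero]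

/-- Seen from a point near the crossing, in a direction `α` not tangent to the strand, a short piece
of the strand sweeps an angle that is a difference of principal arguments. The piece, of length `δ`,
is fixed first; then the observer tends to the crossing and the angle converges by continuity of the
argument. -/
theorem tendsto_im_logIntegral_forward {c : ℝ → ℂ} (hc : ContDiff ℝ 1 c) {τ₀ : ℝ} {a : ℝ → ℂ}
    {α : ℂ} (ha : Tendsto a (𝓝[>] 0) (𝓝 α)) (hu : (deriv c τ₀ / α).im ≠ 0) :
    ∀ᶠ δ : ℝ in 𝓝[>] 0,
      Tendsto (fun r : ℝ => (logIntegral c τ₀ (τ₀ + δ) (c τ₀ + r * a r)).im) (𝓝[>] 0)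
        (𝓝 (Complex.arg (-(c (τ₀ + δ) - c τ₀) / α))) := by
  have hα : α ≠ 0 := by rintro rfl; simp at hu
  have hslope := tendsto_slope_right hc τ₀
  have hu' : -(deriv c τ₀) / α ∈ Complex.slitPlane := by
    apply mem_slitPlane_of_im_ne_zero
    rw [neg_div, Complex.neg_im]
    exact neg_ne_zero.2 hu
  have h1 : Tendsto (fun p : ℝ × ℝ => -((c (τ₀ + p.1) - c τ₀) / p.1) / a p.2)
      (𝓝[>] 0 ×ˢ 𝓝[>] 0) (𝓝 (-(deriv c τ₀) / α)) :=
    ((hslope.comp tendsto_fst).neg).div (ha.comp tendsto_snd) hα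
  have h2 : ∀ᶠ h : ℝ in 𝓝[>] 0, -((c (τ₀ + h) - c τ₀) / h) / α ∈ Complex.slitPlane :=
    (hslope.neg.div_const α) (Complex.isOpen_slitPlane.mem_nhds hu')
  -- A product neighbourhood decouples the two small parameters: the choice of `δ` does not depend
  -- on `r`.
  obtain ⟨s1, hs1, s2, hs2, hss⟩ := mem_prod_iff.1 (h1 (Complex.isOpen_slitPlane.mem_nhds hu'))
  obtain ⟨δ₀, hδ₀, hδs⟩ := mem_nhdsGT_iff_exists_Ioo_subset.1 hs1
  have hane : ∀ᶠ r : ℝ in 𝓝[>] 0, a r ≠ 0 := ha.eventually_ne hα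
  filter_upwards [Ioo_mem_nhdsGT hδ₀, h2] with δ hδ hδ2
  have hδ0 : 0 < δ := hδ.1
  have heq : ∀ᶠ r : ℝ in 𝓝[>] 0, (logIntegral c τ₀ (τ₀ + δ) (c τ₀ + r * a r)).im =
      Complex.arg (-(c (τ₀ + δ) - (c τ₀ + r * a r)) / a r) := by
    filter_upwards [hs2, hane, self_mem_nhdsWithin] with r hr2 har hr
    have hr : 0 < r := hr
    have hrc : (r : ℂ) ≠ 0 := by exact_mod_cast hr.ne'
    have hmem : ∀ τ ∈ uIcc τ₀ (τ₀ + δ),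
        (c τ - (c τ₀ + r * a r)) / (c τ₀ - (c τ₀ + r * a r)) ∈ Complex.slitPlane := by
      intro τ hτ
      rw [uIcc_of_le (by linarith)] at hτ
      rcases hτ.1.eq_or_lt with rfl | hlt
      · rw [div_self]
        · simp
        · simp [hrc, har]
      · have hh : τ - τ₀ ∈ s1 := hδs ⟨by linarith, by linarith [hτ.2, hδ.2]⟩
        have h3 : (τ - τ₀, r) ∈ s1 ×ˢ s2 := ⟨hh, hr2⟩
        have h4 := hss h3
        simp only [mem_preimage] at h4
        -- The quotient equals `1 + ((τ - τ₀) / r) ζ`, where `ζ` is minus the difference quotient of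
        -- the strand divided by `a r`.
        have h5 := one_add_mul_mem_slitPlane h4 (s := (τ - τ₀) / r)
          (div_nonneg (by linarith) hr.le)
        have h6 : ((τ - τ₀ : ℝ) : ℂ) ≠ 0 := by
          exact_mod_cast (sub_pos.2 hlt).ne'
        convert! h5 using 1
        rw [add_sub_cancel τ₀ τ]
        push_cast at h6 ⊢
        have h7 : c τ₀ - (c τ₀ + r * a r) = -(r * a r) := by ring
        rw [h7]
        field_simp
        ring
    rw [logIntegral_eq_log hc hmem, Complex.log_im]
    have h7 : (c (τ₀ + δ) - (c τ₀ + r * a r)) / (c τ₀ - (c τ₀ + r * a r)) =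
        ((r⁻¹ : ℝ) : ℂ) * (-(c (τ₀ + δ) - (c τ₀ + r * a r)) / a r) := by
      have h7 : c τ₀ - (c τ₀ + r * a r) = -(r * a r) := by ring
      rw [h7]; push_cast; field_simp
    rw [h7, Complex.arg_real_mul _ (inv_pos.2 hr)]
  refine Tendsto.congr' (heq.mono fun r hr => hr.symm) ?_
  have hm : -(c (τ₀ + δ) - c τ₀) / α ∈ Complex.slitPlane := by
    have := Complex.mem_slitPlane_iff.1 hδ2
    have h8 : -(c (τ₀ + δ) - c τ₀) / α = (δ : ℝ) * (-((c (τ₀ + δ) - c τ₀) / δ) / α) := by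
      have : (δ : ℂ) ≠ 0 := by exact_mod_cast hδ0.ne'
      field_simp
    rw [h8, Complex.mem_slitPlane_iff, Complex.re_ofReal_mul, Complex.im_ofReal_mul]
    rcases this with h | h
    · left; positivity
    · right; exact mul_ne_zero hδ0.ne' h
  refine (Complex.continuousAt_arg hm).tendsto.comp ?_
  have h9 : Tendsto (fun r : ℝ => (r : ℂ) * a r) (𝓝[>] 0) (𝓝 0) := by
    have h10 : Tendsto (fun r : ℝ => (r : ℂ)) (𝓝[>] 0) (𝓝 0) := by
      have := Complex.continuous_ofReal.tendsto 0
      simpa using this.mono_left (nhdsWithin_le_nhds (s := Ioi 0))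
    simpa using h10.mul ha
  have h11 : Tendsto (fun r : ℝ => -(c (τ₀ + δ) - (c τ₀ + r * a r))) (𝓝[>] 0)
      (𝓝 (-(c (τ₀ + δ) - (c τ₀ + 0)))) := (tendsto_const_nhds.sub (tendsto_const_nhds.add h9)).neg
  rw [add_zero] at h11
  exact h11.div ha hα

theorem tendsto_im_logIntegral_backward {c : ℝ → ℂ} (hc : ContDiff ℝ 1 c) {τ₀ : ℝ} {a : ℝ → ℂ}
    {α : ℂ} (ha : Tendsto a (𝓝[>] 0) (𝓝 α)) (hu : (deriv c τ₀ / α).im ≠ 0) :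
    ∀ᶠ δ : ℝ in 𝓝[>] 0,
      Tendsto (fun r : ℝ => (logIntegral c (τ₀ - δ) τ₀ (c τ₀ + r * a r)).im) (𝓝[>] 0)
        (𝓝 (-Complex.arg (-(c (τ₀ - δ) - c τ₀) / α))) := by
  have hd : ∀ τ, deriv (fun τ => c (-τ)) τ = - deriv c (-τ) := fun τ => deriv_comp_neg c τ
  have h := tendsto_im_logIntegral_forward (c := fun τ => c (-τ)) (τ₀ := -τ₀)
    (hc.comp contDiff_neg) ha (by
      rw [hd, neg_neg, neg_div, Complex.neg_im]; exact neg_ne_zero.2 hu)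
  filter_upwards [h] with δ hδ
  have h1 : ∀ y, logIntegral (fun τ => c (-τ)) (-τ₀) (-τ₀ + δ) y = -logIntegral c (τ₀ - δ) τ₀ y :=
      by
    intro y
    have h2 := intervalIntegral.integral_comp_neg (a := -τ₀) (b := -τ₀ + δ)
      (fun τ => - deriv c τ / (c τ - y))
    simp only [logIntegral, hd]
    rw [h2, ← intervalIntegral.integral_neg]
    simp only [neg_neg, neg_div]
    congr 1
    ring
  simp only [h1, Complex.neg_im, neg_neg, neg_add_rev] at hδ
  convert! hδ.neg using 3
  · ring
  · ring_nf

/-- The alternating sum over the values of `W` at four points. -/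
def crossDiff (W : ℂ → ℝ) (y₁ y₂ y₃ y₄ : ℂ) : ℝ := W y₁ + W y₂ - W y₃ - W y₄

/-- The contribution of a strand leaving a crossing in the direction `u`, in the limit at the
crossing, to the alternating sum over points in the directions `A`, `-A`, `B`, `-B`. -/
def crossArg (A B u : ℂ) : ℝ :=
  Complex.arg (-u / A) + Complex.arg (-u / -A) - Complex.arg (-u / B) - Complex.arg (-u / -B)

theorem crossArg_neg (A B u : ℂ) : crossArg A B (-u) = crossArg A B u := by
  simp only [crossArg, neg_neg, div_neg, neg_div]
  ring

theorem crossArg_real_mul (A B u : ℂ) {r : ℝ} (hr : 0 < r) :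
    crossArg A B (r * u) = crossArg A B u := by
  have h : ∀ z : ℂ, -((r : ℂ) * u) / z = (r : ℂ) * (-u / z) := fun z => by ring
  simp only [crossArg, h, Complex.arg_real_mul _ hr]

theorem continuousAt_crossArg {A B u : ℂ} (hA : (u / A).im ≠ 0) (hB : (u / B).im ≠ 0) :
    ContinuousAt (crossArg A B) u := by
  have h : ∀ {z : ℂ}, (u / z).im ≠ 0 → ContinuousAt (fun u => Complex.arg (-u / z)) u := by
    intro z hz
    refine ContinuousAt.comp (f := fun u => -u / z) (Complex.continuousAt_arg ?_)
      (continuousAt_id.neg.div_const z)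
    apply mem_slitPlane_of_im_ne_zero
    simp only [neg_div, Complex.neg_im, ne_eq, neg_eq_zero]
    exact hz
  have h' : ∀ {z : ℂ}, (u / z).im ≠ 0 → (u / -z).im ≠ 0 := by
    intro z hz
    rw [div_neg, Complex.neg_im]; exact neg_ne_zero.2 hz
  exact (((h hA).add (h (h' hA))).sub (h hB)).sub (h (h' hB))

/-- All arguments depend only on `ρ = V / U`. For `ρ` in the upper half plane the signs of the
imaginary parts of `1 / (1 ± ρ)` and `ρ / (1 ± ρ)` fix every branch, and all arguments cancel up to
`2π`. -/
theorem crossArg_sub_of_pos {U V : ℂ} (h : 0 < (V / U).im) :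
    crossArg (U + V) (U - V) U - crossArg (U + V) (U - V) V = 2 * π := by
  have hU : U ≠ 0 := by rintro rfl; simp at h
  set ρ := V / U with hρ
  have hV : V = ρ * U := by rw [hρ]; field_simp
  have h1 : 1 + ρ ≠ 0 := by
    intro h0; have := congrArg Complex.im h0; simp at this; linarith
  have h2 : 1 - ρ ≠ 0 := by
    intro h0; have := congrArg Complex.im h0; simp at this; linarith
  have hρ0 : ρ ≠ 0 := by intro h0; rw [h0] at h; simp at h
  have n1 : 0 < Complex.normSq (1 + ρ) := Complex.normSq_pos.2 h1
  have n2 : 0 < Complex.normSq (1 - ρ) := Complex.normSq_pos.2 h2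
  have e1 : U / (U + V) = 1 / (1 + ρ) := by
    rw [hV, show U + ρ * U = U * (1 + ρ) by ring]; field_simp
  have e2 : U / (U - V) = 1 / (1 - ρ) := by
    rw [hV, show U - ρ * U = U * (1 - ρ) by ring]; field_simp
  have e3 : V / (U + V) = ρ / (1 + ρ) := by
    rw [hV, show U + ρ * U = U * (1 + ρ) by ring]; field_simp
  have e4 : V / (U - V) = ρ / (1 - ρ) := by
    rw [hV, show U - ρ * U = U * (1 - ρ) by ring]; field_simp
  have i1 : (1 / (1 + ρ)).im < 0 := by
    rw [one_div, Complex.inv_im]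
    refine div_neg_of_neg_of_pos ?_ n1
    simpa using h
  have i2 : 0 < (1 / (1 - ρ)).im := by
    rw [one_div, Complex.inv_im]
    refine div_pos ?_ n2
    simpa using h
  have i3 : 0 < (ρ / (1 + ρ)).im := by
    rw [Complex.div_im, ← sub_div]
    refine div_pos ?_ n1
    simp; nlinarith
  have i4 : 0 < (ρ / (1 - ρ)).im := by
    rw [Complex.div_im, ← sub_div]
    refine div_pos ?_ n2
    simp; nlinarith
  have a1 := Complex.arg_neg_eq_arg_add_pi_of_im_neg i1
  have a2 := Complex.arg_neg_eq_arg_sub_pi_of_im_pos i2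
  have a3 := Complex.arg_neg_eq_arg_sub_pi_of_im_pos i3
  have a4 := Complex.arg_neg_eq_arg_sub_pi_of_im_pos i4
  have argpos : ∀ {z : ℂ}, 0 < z.im → 0 < z.arg ∧ z.arg < π := by
    intro z hz
    refine ⟨(Complex.arg_nonneg_iff.2 hz.le).lt_of_ne ?_, Complex.arg_lt_pi_iff.2 (Or.inr hz.ne')⟩
    intro h0
    have := (Complex.arg_eq_zero_iff.1 h0.symm).2
    exact hz.ne' this
  have p0 := argpos h
  have p3 := argpos i3
  have p4 := argpos i4
  have q1 : Complex.arg (1 / (1 + ρ)) = Complex.arg (ρ / (1 + ρ)) - Complex.arg ρ := by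
    have : (1 : ℂ) / (1 + ρ) = ρ / (1 + ρ) * ρ⁻¹ := by field_simp
    rw [this, Complex.arg_mul (div_ne_zero hρ0 h1) (inv_ne_zero hρ0)]
    · rw [Complex.arg_inv, if_neg p0.2.ne]; ring
    · rw [Complex.arg_inv, if_neg p0.2.ne]
      constructor <;> linarith
  have q2 : Complex.arg (1 / (1 - ρ)) = Complex.arg (ρ / (1 - ρ)) - Complex.arg ρ := by
    have : (1 : ℂ) / (1 - ρ) = ρ / (1 - ρ) * ρ⁻¹ := by field_simp
    rw [this, Complex.arg_mul (div_ne_zero hρ0 h2) (inv_ne_zero hρ0)]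
    · rw [Complex.arg_inv, if_neg p0.2.ne]; ring
    · rw [Complex.arg_inv, if_neg p0.2.ne]
      constructor <;> linarith
  simp only [crossArg, neg_div_neg_eq]
  simp only [neg_div, e1, e2, e3, e4, a1, a2, a3, a4]
  rw [q1, q2]; ring

theorem crossArg_sub_of_neg {U V : ℂ} (h : (V / U).im < 0) :
    crossArg (U + V) (U - V) U - crossArg (U + V) (U - V) V = -(2 * π) := by
  have hV : V ≠ 0 := by rintro rfl; simp at h
  have hU : U ≠ 0 := by rintro rfl; simp at h
  have h' : 0 < (U / V).im := by
    rw [← inv_div, Complex.inv_im]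
    have := Complex.normSq_pos.2 (div_ne_zero hV hU)
    exact div_pos (by linarith) this
  have h1 := crossArg_sub_of_pos h'
  have h2 : ∀ u, crossArg (V + U) (V - U) u = crossArg (U + V) (U - V) u := by
    intro u
    have e1 : V - U = -(U - V) := by ring
    simp only [crossArg, add_comm V U, e1, neg_neg]
    ring
  rw [h2, h2] at h1
  linarith

section Crossing

variable {c : ℝ → ℂ} {x A B : ℂ} {a₁ a₂ a₃ a₄ : ℝ → ℂ}

/-- The alternating sum of the imaginary parts of `∫ dz / (z - y)` tends to `ℓ` as `y` approaches
a crossing along four given directions. -/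
def TendsToCross (c : ℝ → ℂ) (x : ℂ) (a₁ a₂ a₃ a₄ : ℝ → ℂ) (s t ℓ : ℝ) : Prop :=
  Tendsto (fun r : ℝ => crossDiff (fun y => (logIntegral c s t y).im) (x + r * a₁ r) (x + r * a₂ r)
    (x + r * a₃ r) (x + r * a₄ r)) (𝓝[>] 0) (𝓝 ℓ)

theorem tendsToCross_forward (hc : ContDiff ℝ 1 c) {τ₀ : ℝ} (hx : c τ₀ = x)
    (h₁ : Tendsto a₁ (𝓝[>] 0) (𝓝 A)) (h₂ : Tendsto a₂ (𝓝[>] 0) (𝓝 (-A)))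
    (h₃ : Tendsto a₃ (𝓝[>] 0) (𝓝 B)) (h₄ : Tendsto a₄ (𝓝[>] 0) (𝓝 (-B)))
    (hA : (deriv c τ₀ / A).im ≠ 0) (hB : (deriv c τ₀ / B).im ≠ 0) :
    ∀ᶠ δ : ℝ in 𝓝[>] 0, TendsToCross c x a₁ a₂ a₃ a₄ τ₀ (τ₀ + δ)
      (crossArg A B (c (τ₀ + δ) - c τ₀)) := by
  have hn : ∀ {z : ℂ}, (deriv c τ₀ / z).im ≠ 0 → (deriv c τ₀ / -z).im ≠ 0 := fun h => by
    rw [div_neg, Complex.neg_im]; exact neg_ne_zero.2 h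
  filter_upwards [tendsto_im_logIntegral_forward hc h₁ hA,
    tendsto_im_logIntegral_forward hc h₂ (hn hA), tendsto_im_logIntegral_forward hc h₃ hB,
    tendsto_im_logIntegral_forward hc h₄ (hn hB)] with δ d1 d2 d3 d4
  rw [← hx]
  exact ((d1.add d2).sub d3).sub d4

theorem tendsToCross_backward (hc : ContDiff ℝ 1 c) {τ₀ : ℝ} (hx : c τ₀ = x)
    (h₁ : Tendsto a₁ (𝓝[>] 0) (𝓝 A)) (h₂ : Tendsto a₂ (𝓝[>] 0) (𝓝 (-A)))
    (h₃ : Tendsto a₃ (𝓝[>] 0) (𝓝 B)) (h₄ : Tendsto a₄ (𝓝[>] 0) (𝓝 (-B)))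
    (hA : (deriv c τ₀ / A).im ≠ 0) (hB : (deriv c τ₀ / B).im ≠ 0) :
    ∀ᶠ δ : ℝ in 𝓝[>] 0, TendsToCross c x a₁ a₂ a₃ a₄ (τ₀ - δ) τ₀
      (-crossArg A B (c (τ₀ - δ) - c τ₀)) := by
  have hn : ∀ {z : ℂ}, (deriv c τ₀ / z).im ≠ 0 → (deriv c τ₀ / -z).im ≠ 0 := fun h => by
    rw [div_neg, Complex.neg_im]; exact neg_ne_zero.2 h
  filter_upwards [tendsto_im_logIntegral_backward hc h₁ hA,
    tendsto_im_logIntegral_backward hc h₂ (hn hA), tendsto_im_logIntegral_backward hc h₃ hB,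
    tendsto_im_logIntegral_backward hc h₄ (hn hB)] with δ d1 d2 d3 d4
  rw [← hx]
  unfold TendsToCross crossDiff
  convert! ((d1.add d2).sub d3).sub d4 using 2
  simp only [crossArg]; ring

theorem tendsto_crossArg_forward (hc : ContDiff ℝ 1 c) {τ₀ : ℝ}
    (hA : (deriv c τ₀ / A).im ≠ 0) (hB : (deriv c τ₀ / B).im ≠ 0) :
    Tendsto (fun δ : ℝ => crossArg A B (c (τ₀ + δ) - c τ₀)) (𝓝[>] 0)
      (𝓝 (crossArg A B (deriv c τ₀))) := by
  refine ((continuousAt_crossArg hA hB).tendsto.comp (tendsto_slope_right hc τ₀)).congr' ?_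
  filter_upwards [self_mem_nhdsWithin] with δ hδ
  have hδ : 0 < δ := hδ
  have h : c (τ₀ + δ) - c τ₀ = (δ : ℝ) * ((c (τ₀ + δ) - c τ₀) / δ) := by
    have : (δ : ℂ) ≠ 0 := by exact_mod_cast hδ.ne'
    field_simp
  conv_rhs => rw [h, crossArg_real_mul _ _ _ hδ]
  rfl

theorem tendsto_crossArg_backward (hc : ContDiff ℝ 1 c) {τ₀ : ℝ}
    (hA : (deriv c τ₀ / A).im ≠ 0) (hB : (deriv c τ₀ / B).im ≠ 0) :
    Tendsto (fun δ : ℝ => crossArg A B (c (τ₀ - δ) - c τ₀)) (𝓝[>] 0)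
      (𝓝 (crossArg A B (deriv c τ₀))) := by
  have hd : deriv (fun τ => c (-τ)) (-τ₀) = - deriv c τ₀ := by
    rw [deriv_comp_neg, neg_neg]
  have hn : ∀ {z : ℂ}, (deriv c τ₀ / z).im ≠ 0 →
      (deriv (fun τ => c (-τ)) (-τ₀) / z).im ≠ 0 := fun h => by
    rw [hd, neg_div, Complex.neg_im]; exact neg_ne_zero.2 h
  have h := tendsto_crossArg_forward (c := fun τ => c (-τ)) (hc.comp contDiff_neg) (hn hA) (hn hB)
  rw [hd, crossArg_neg] at h
  refine h.congr fun δ => ?_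
  rw [neg_neg, neg_add, neg_neg, sub_eq_add_neg]
  rfl

/-- The logarithmic integral over a piece of the curve that avoids `x` is continuous at `x`, so the
four values have a common limit and cancel in pairs. -/
theorem tendsToCross_of_notMem (hc : ContDiff ℝ 1 c) {s t : ℝ} (hst : s ≤ t)
    (hx : ∀ τ ∈ Icc s t, c τ ≠ x) {α₁ α₂ α₃ α₄ : ℂ}
    (h₁ : Tendsto a₁ (𝓝[>] 0) (𝓝 α₁)) (h₂ : Tendsto a₂ (𝓝[>] 0) (𝓝 α₂))
    (h₃ : Tendsto a₃ (𝓝[>] 0) (𝓝 α₃)) (h₄ : Tendsto a₄ (𝓝[>] 0) (𝓝 α₄)) :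
    TendsToCross c x a₁ a₂ a₃ a₄ s t 0 := by
  have hcont : ContinuousAt (fun y => (logIntegral c s t y).im) x := by
    have hdc := hc.continuous_deriv le_rfl
    obtain ⟨δ, hδ, hball⟩ := Metric.isOpen_iff.1
      ((isCompact_Icc (a := s) (b := t)).image hc.continuous).isClosed.isOpen_compl x
      (by rintro ⟨τ, hτ, h⟩; exact hx τ hτ h)
    refine Complex.continuous_im.continuousAt.comp ?_
    refine intervalIntegral.continuousAt_of_dominated_interval
      (bound := fun τ => ‖deriv c τ‖ / (δ / 2)) ?_ ?_ ?_ ?_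
    · refine Eventually.of_forall fun x => ?_
      exact (hdc.measurable.div
        (hc.continuous.sub continuous_const).measurable).aestronglyMeasurable
    · filter_upwards [Metric.ball_mem_nhds x (half_pos hδ)] with y hy
      refine Eventually.of_forall fun τ hτ => ?_
      rw [uIoc_of_le hst] at hτ
      rw [norm_div]
      refine div_le_div_of_nonneg_left (norm_nonneg _) (half_pos hδ) ?_
      have h1 : δ ≤ ‖c τ - x‖ := by
        by_contra h
        exact hball (mem_ball_iff_norm.2 (not_le.1 h)) ⟨τ, Ioc_subset_Icc_self hτ, rfl⟩
      have h2 : ‖y - x‖ < δ / 2 := mem_ball_iff_norm.1 hy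
      have h3 : ‖c τ - x‖ ≤ ‖c τ - y‖ + ‖y - x‖ := by
        rw [← sub_add_sub_cancel (c τ) y x]; exact norm_add_le _ _
      linarith
    · exact (hdc.norm.div_const _).intervalIntegrable _ _
    · refine Eventually.of_forall fun τ hτ => ?_
      rw [uIoc_of_le hst] at hτ
      refine continuousAt_const.div (continuousAt_const.sub continuousAt_id) ?_
      intro h
      exact hx τ (Ioc_subset_Icc_self hτ) (sub_eq_zero.1 h)
  have h0 : ∀ {a : ℝ → ℂ} {α : ℂ}, Tendsto a (𝓝[>] 0) (𝓝 α) →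
      Tendsto (fun r : ℝ => (logIntegral c s t (x + r * a r)).im) (𝓝[>] 0)
        (𝓝 (logIntegral c s t x).im) := by
    intro a α ha
    refine hcont.tendsto.comp ?_
    have h10 : Tendsto (fun r : ℝ => (r : ℂ)) (𝓝[>] 0) (𝓝 0) := by
      have := Complex.continuous_ofReal.tendsto 0
      simpa using this.mono_left (nhdsWithin_le_nhds (s := Ioi 0))
    simpa using (h10.mul ha).const_add x
  have := (((h0 h₁).add (h0 h₂)).sub (h0 h₃)).sub (h0 h₄)
  unfold TendsToCross crossDiff
  convert! this using 2
  ring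

theorem TendsToCross.add (hc : ContDiff ℝ 1 c) {s t u ℓ ℓ' : ℝ}
    (hoff : ∀ᶠ r : ℝ in 𝓝[>] 0, x + r * a₁ r ∉ range c ∧ x + r * a₂ r ∉ range c ∧
      x + r * a₃ r ∉ range c ∧ x + r * a₄ r ∉ range c)
    (h : TendsToCross c x a₁ a₂ a₃ a₄ s t ℓ) (h' : TendsToCross c x a₁ a₂ a₃ a₄ t u ℓ') :
    TendsToCross c x a₁ a₂ a₃ a₄ s u (ℓ + ℓ') := by
  have hadd : ∀ y ∉ range c, (logIntegral c s u y).im =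
      (logIntegral c s t y).im + (logIntegral c t u y).im := by
    intro y hy
    rw [← Complex.add_im]
    congr 1
    have := continuous_logIntegrand hc hy
    exact (intervalIntegral.integral_add_adjacent_intervals (this.intervalIntegrable _ _)
      (this.intervalIntegrable _ _)).symm
  refine (Tendsto.add h h').congr' ?_
  filter_upwards [hoff] with r hr
  simp only [crossDiff, hadd _ hr.1, hadd _ hr.2.1, hadd _ hr.2.2.1, hadd _ hr.2.2.2]
  ring

/-- A strand running through the crossing does not contribute. -/
theorem tendsToCross_strand (hc : ContDiff ℝ 1 c)
    (hoff : ∀ᶠ r : ℝ in 𝓝[>] 0, x + r * a₁ r ∉ range c ∧ x + r * a₂ r ∉ range c ∧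
      x + r * a₃ r ∉ range c ∧ x + r * a₄ r ∉ range c)
    (h₁ : Tendsto a₁ (𝓝[>] 0) (𝓝 A)) (h₂ : Tendsto a₂ (𝓝[>] 0) (𝓝 (-A)))
    (h₃ : Tendsto a₃ (𝓝[>] 0) (𝓝 B)) (h₄ : Tendsto a₄ (𝓝[>] 0) (𝓝 (-B)))
    {s τ₀ t : ℝ} (hs : s < τ₀) (ht : τ₀ < t) (hx : c τ₀ = x)
    (hne : ∀ τ ∈ Icc s t, c τ = x → τ = τ₀)
    (hA : (deriv c τ₀ / A).im ≠ 0) (hB : (deriv c τ₀ / B).im ≠ 0) :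
    TendsToCross c x a₁ a₂ a₃ a₄ s t 0 := by
  -- Cut the interval at `τ₀ - δ`, `τ₀` and `τ₀ + δ`; the two outer pieces avoid the crossing.
  have hall : ∀ᶠ δ : ℝ in 𝓝[>] 0, TendsToCross c x a₁ a₂ a₃ a₄ s t
      (crossArg A B (c (τ₀ + δ) - c τ₀) - crossArg A B (c (τ₀ - δ) - c τ₀)) := by
    filter_upwards [tendsToCross_forward hc hx h₁ h₂ h₃ h₄ hA hB,
      tendsToCross_backward hc hx h₁ h₂ h₃ h₄ hA hB, Ioo_mem_nhdsGT (sub_pos.2 hs),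
      Ioo_mem_nhdsGT (sub_pos.2 ht)] with δ d1 d2 d3 d4
    have e1 : TendsToCross c x a₁ a₂ a₃ a₄ s (τ₀ - δ) 0 := by
      refine tendsToCross_of_notMem hc (by linarith [d3.2]) ?_ h₁ h₂ h₃ h₄
      intro τ hτ h
      have := hne τ ⟨hτ.1, by linarith [hτ.2, d3.1]⟩ h
      linarith [hτ.2, d3.1]
    have e2 : TendsToCross c x a₁ a₂ a₃ a₄ (τ₀ + δ) t 0 := by
      refine tendsToCross_of_notMem hc (by linarith [d4.2]) ?_ h₁ h₂ h₃ h₄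
      intro τ hτ h
      have := hne τ ⟨by linarith [hτ.1, d3.1], hτ.2⟩ h
      linarith [hτ.1, d3.1]
    have := ((e1.add hc hoff d2).add hc hoff d1).add hc hoff e2
    convert! this using 1
    ring
  have hlim : Tendsto (fun δ : ℝ => crossArg A B (c (τ₀ + δ) - c τ₀) -
      crossArg A B (c (τ₀ - δ) - c τ₀)) (𝓝[>] 0) (𝓝 0) := by
    simpa using (tendsto_crossArg_forward hc hA hB).sub (tendsto_crossArg_backward hc hA hB)
  obtain ⟨δ₀, hδ₀⟩ := hall.exists
  -- The same limit is found for every small `δ`, so by uniqueness the expression does not depend on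
  -- `δ` and can be evaluated by letting `δ` tend to zero.
  have hconst : Tendsto (fun δ : ℝ => crossArg A B (c (τ₀ + δ) - c τ₀) -
      crossArg A B (c (τ₀ - δ) - c τ₀)) (𝓝[>] 0)
      (𝓝 (crossArg A B (c (τ₀ + δ₀) - c τ₀) - crossArg A B (c (τ₀ - δ₀) - c τ₀))) := by
    refine tendsto_const_nhds.congr' ?_
    filter_upwards [hall] with δ hδ
    exact tendsto_nhds_unique hδ₀ hδ
  rw [tendsto_nhds_unique hlim hconst]
  exact hδ₀

/-- The contribution of a loop with a corner at the crossing. -/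
theorem tendsToCross_corner (hc : ContDiff ℝ 1 c)
    (hoff : ∀ᶠ r : ℝ in 𝓝[>] 0, x + r * a₁ r ∉ range c ∧ x + r * a₂ r ∉ range c ∧
      x + r * a₃ r ∉ range c ∧ x + r * a₄ r ∉ range c)
    (h₁ : Tendsto a₁ (𝓝[>] 0) (𝓝 A)) (h₂ : Tendsto a₂ (𝓝[>] 0) (𝓝 (-A)))
    (h₃ : Tendsto a₃ (𝓝[>] 0) (𝓝 B)) (h₄ : Tendsto a₄ (𝓝[>] 0) (𝓝 (-B)))
    {s t : ℝ} (hst : s < t) (hs : c s = x) (ht : c t = x)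
    (hne : ∀ τ ∈ Ioo s t, c τ ≠ x)
    (hsA : (deriv c s / A).im ≠ 0) (hsB : (deriv c s / B).im ≠ 0)
    (htA : (deriv c t / A).im ≠ 0) (htB : (deriv c t / B).im ≠ 0) :
    TendsToCross c x a₁ a₂ a₃ a₄ s t
      (crossArg A B (deriv c s) - crossArg A B (deriv c t)) := by
  have hall : ∀ᶠ δ : ℝ in 𝓝[>] 0, TendsToCross c x a₁ a₂ a₃ a₄ s t
      (crossArg A B (c (s + δ) - c s) - crossArg A B (c (t - δ) - c t)) := by
    filter_upwards [tendsToCross_forward hc hs h₁ h₂ h₃ h₄ hsA hsB,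
      tendsToCross_backward hc ht h₁ h₂ h₃ h₄ htA htB,
      Ioo_mem_nhdsGT (half_pos (sub_pos.2 hst))] with δ d1 d2 d3
    have e1 : TendsToCross c x a₁ a₂ a₃ a₄ (s + δ) (t - δ) 0 := by
      refine tendsToCross_of_notMem hc (by linarith [d3.2]) ?_ h₁ h₂ h₃ h₄
      intro τ hτ
      exact hne τ ⟨by linarith [hτ.1, d3.1], by linarith [hτ.2, d3.1]⟩
    have := (d1.add hc hoff e1).add hc hoff d2
    convert! this using 1
    ring
  have hlim := (tendsto_crossArg_forward hc hsA hsB).sub (tendsto_crossArg_backward hc htA htB)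
  obtain ⟨δ₀, hδ₀⟩ := hall.exists
  -- As for a strand, uniqueness of limits removes the dependence on `δ`.
  have hconst : Tendsto (fun δ : ℝ => crossArg A B (c (s + δ) - c s) -
      crossArg A B (c (t - δ) - c t)) (𝓝[>] 0)
      (𝓝 (crossArg A B (c (s + δ₀) - c s) - crossArg A B (c (t - δ₀) - c t))) := by
    refine tendsto_const_nhds.congr' ?_
    filter_upwards [hall] with δ hδ
    exact tendsto_nhds_unique hδ₀ hδ
  rw [tendsto_nhds_unique hlim hconst]
  exact hδ₀

end Crossing

/-! ### Determinants -/

theorem det3_apply (x v w : R3) : det3 x v w =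
    x 0 * (v 1 * w 2 - v 2 * w 1) - x 1 * (v 0 * w 2 - v 2 * w 0) +
      x 2 * (v 0 * w 1 - v 1 * w 0) := by
  simp [det3, Matrix.det_fin_three]; ring

/-- The determinant as a continuous linear map of its second argument. -/
def det3Mid (x w : R3) : R3 →L[ℝ] ℝ :=
  LinearMap.toContinuousLinearMap
    { toFun := fun v => det3 x v w
      map_add' := fun a b => by simp [det3_apply]; ring
      map_smul' := fun a b => by simp [det3_apply]; ring }

@[simp] theorem det3Mid_apply (x w v : R3) : det3Mid x w v = det3 x v w := rfl

theorem det3_swap (x v w : R3) : det3 x w v = -det3 x v w := by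
  simp [det3_apply]; ring

@[simp] theorem det3_self_left (x w : R3) : det3 x x w = 0 := by simp [det3_apply]; ring
@[simp] theorem det3_self_right (x w : R3) : det3 x w x = 0 := by simp [det3_apply]; ring
@[simp] theorem det3_self_mid (x w : R3) : det3 x w w = 0 := by simp [det3_apply]; ring

theorem det3_smul_mid (x v w : R3) (r : ℝ) : det3 x (r • v) w = r * det3 x v w := by
  simp [det3_apply]; ring
theorem det3_smul_right (x v w : R3) (r : ℝ) : det3 x v (r • w) = r * det3 x v w := by
  simp [det3_apply]; ring
theorem det3_neg_mid (x v w : R3) : det3 x (-v) w = -det3 x v w := by simp [det3_apply]; ring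
theorem det3_neg_right (x v w : R3) : det3 x v (-w) = -det3 x v w := by simp [det3_apply]; ring

theorem det3_cramer (x a b y : R3) :
    det3 x a b • y = det3 y a b • x + det3 x y b • a + det3 x a y • b := by
  ext i
  fin_cases i <;> simp [det3_apply] <;> ring

/-- Lagrange's identity: for vectors orthogonal to `x` the square of the determinant is the Gram
determinant of `v` and `w`, up to the factor `‖x‖ ^ 2`. -/
theorem det3_sq (x v w : R3) (hv : inner ℝ x v = 0) (hw : inner ℝ x w = 0) :
    det3 x v w ^ 2 = ‖x‖ ^ 2 * (‖v‖ ^ 2 * ‖w‖ ^ 2 - inner ℝ v w ^ 2) := by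
  rw [← real_inner_self_eq_norm_sq, ← real_inner_self_eq_norm_sq, ← real_inner_self_eq_norm_sq]
  have e : ∀ a b : R3, inner ℝ a b = a 0 * b 0 + a 1 * b 1 + a 2 * b 2 := by
    intro a b
    simp [PiLp.inner_apply, Fin.sum_univ_three]; ring
  rw [e] at hv hw
  simp only [e, det3_apply]
  have h1 : v 0 * x 0 = -(x 1 * v 1 + x 2 * v 2) := by linarith
  have h2 : w 0 * x 0 = -(x 1 * w 1 + x 2 * w 2) := by linarith
  linear_combination (-(x 0 * v 0 + x 1 * v 1 + x 2 * v 2) * (w 0 * w 0 + w 1 * w 1 + w 2 * w 2)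
    + 2 * (v 0 * w 0 + v 1 * w 1 + v 2 * w 2) * (x 0 * w 0 + x 1 * w 1 + x 2 * w 2)) * hv
    - (x 0 * w 0 + x 1 * w 1 + x 2 * w 2) * (v 0 * v 0 + v 1 * v 1 + v 2 * v 2) * hw

theorem det3_ne_zero {x : S2} {v w : R3} (hv : inner ℝ (x : R3) v = 0)
    (hw : inner ℝ (x : R3) w = 0) (h : LinearIndependent ℝ ![v, w]) : det3 x v w ≠ 0 := by
  intro h0
  have h1 := det3_sq x v w hv hw
  rw [h0, x.norm_coe] at h1
  have hw0 : w ≠ 0 := h.ne_zero 1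
  have h2 : ‖‖w‖ ^ 2 • v - inner ℝ v w • w‖ ^ 2 = 0 := by
    rw [← real_inner_self_eq_norm_sq, inner_sub_sub_self]
    simp only [inner_smul_left, inner_smul_right, real_inner_self_eq_norm_sq,
      real_inner_comm v w, RCLike.conj_to_real]
    linear_combination -(‖w‖ ^ 2) * h1
  have h3 : ‖w‖ ^ 2 • v + (-inner ℝ v w) • w = 0 := by
    rw [neg_smul, ← sub_eq_add_neg]
    exact norm_eq_zero.1 (pow_eq_zero_iff two_ne_zero |>.1 h2)
  have h4 := (LinearIndependent.pair_iff.1 h _ _ h3).1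
  exact hw0 (norm_eq_zero.1 (pow_eq_zero_iff two_ne_zero |>.1 h4))

theorem toS2_smul {r : ℝ} (hr : 0 < r) (v : R3) : toS2 (r • v) = toS2 v := by
  by_cases h : v = 0
  · simp [h]
  · apply Subtype.ext
    rw [coe_toS2 h, coe_toS2 (smul_ne_zero hr.ne' h), norm_smul, Real.norm_of_nonneg hr.le,
      mul_inv, smul_smul]
    congr 1
    field_simp

/-! ### Parameters of a closed curve -/

section Curve

variable {γ : ℝ → S2}

theorem Function.Periodic.eq_of_angle {X : Type*} {f : ℝ → X} (h : Function.Periodic f (2 * π))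
    {s t : ℝ} (hst : (s : Real.Angle) = t) : f s = f t := by
  obtain ⟨k, hk⟩ := Real.Angle.angle_eq_iff_two_pi_dvd_sub.1 hst
  have : s = t + k * (2 * π) := by linarith
  rw [this, h.int_mul k]

theorem range_eq_image_Icc (h : Function.Periodic γ (2 * π)) : range γ = γ '' Icc 0 (2 * π) := by
  have := h.image_Icc (by positivity) 0
  rw [zero_add] at this
  exact this.symm

theorem isCompact_range_curve (h : IsGenericCircle γ) : IsCompact (range γ) := by
  rw [range_eq_image_Icc h.periodic]
  exact isCompact_Icc.image h.smooth.continuous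

theorem isOpen_compl_range (h : IsGenericCircle γ) : IsOpen (range γ)ᶜ :=
  (isCompact_range_curve h).isClosed.isOpen_compl

/-- A property of the parameters close to those over `x` holds for the curve points close to `x`. -/
theorem eventually_curve (h : IsGenericCircle γ) {x : S2} {P : S2 → Prop}
    (hP : ∀ τ, γ τ = x → ∀ᶠ t in 𝓝 τ, P (γ t)) : ∀ᶠ y in 𝓝 x, y ∈ range γ → P y := by
  have h1 : ∀ᶠ y in 𝓝 x, ∀ t ∈ Icc (0 : ℝ) (2 * π), γ t = y → P y := by
    -- Compactness of a period of parameters reduces the claim to a neighbourhood of one parameter,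
    -- which either lies over `x` or stays away from it.
    refine isCompact_Icc.eventually_forall_of_forall_eventually fun τ _ => ?_
    by_cases hτ : γ τ = x
    · have h2 : ∀ᶠ z : S2 × ℝ in 𝓝 (x, τ), P (γ z.2) :=
        (continuous_snd.tendsto (x, τ)).eventually (hP τ hτ)
      filter_upwards [h2] with z hz hz'
      rwa [← hz']
    · have h2 : ∀ᶠ z : S2 × ℝ in 𝓝 (x, τ), γ z.2 ≠ z.1 :=
        (isOpen_ne_fun (h.smooth.continuous.comp continuous_snd) continuous_fst).mem_nhds hτ
      filter_upwards [h2] with z hz hz'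
      exact absurd hz' hz
  filter_upwards [h1] with y hy hr
  rw [range_eq_image_Icc h.periodic] at hr
  obtain ⟨t, ht, rfl⟩ := hr
  exact hy t ht rfl

theorem IsGenericCircle.angle_eq_or (h : IsGenericCircle γ) {x : S2} {s t τ : ℝ}
    (hst : (s : Real.Angle) ≠ t) (hs : γ s = x) (ht : γ t = x) (hτ : γ τ = x) :
    (τ : Real.Angle) = s ∨ (τ : Real.Angle) = t := by
  rcases h.no_triple s t τ (hs.trans ht.symm) (ht.trans hτ.symm) with h | h | h
  · exact absurd h hst
  · exact Or.inr h.symm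
  · exact Or.inl h.symm

/-! ### Cones and quadrants -/

theorem cone_comm (a b : R3) : cone a b = cone b a := by
  ext w
  constructor <;> rintro ⟨r, s, hr, hs, rfl⟩ <;> exact ⟨s, r, hs, hr, add_comm _ _⟩

theorem neg_mem_cone (a b : R3) : {w | -w ∈ cone a b} = cone (-a) (-b) := by
  ext w
  constructor
  · rintro ⟨r, s, hr, hs, h⟩
    refine ⟨r, s, hr, hs, ?_⟩
    rw [← neg_neg w, h]; simp; abel
  · rintro ⟨r, s, hr, hs, rfl⟩
    exact ⟨r, s, hr, hs, by simp; abel⟩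

theorem cone_smul {r s : ℝ} (hr : 0 < r) (hs : 0 < s) (a b : R3) :
    cone (r • a) (s • b) = cone a b := by
  ext w
  constructor
  · rintro ⟨p, q, hp, hq, rfl⟩
    exact ⟨p * r, q * s, by positivity, by positivity, by simp [smul_smul]⟩
  · rintro ⟨p, q, hp, hq, rfl⟩
    refine ⟨p / r, q / s, by positivity, by positivity, ?_⟩
    simp [smul_smul, hr.ne', hs.ne']

theorem add_mem_cone (a b : R3) : a + b ∈ cone a b := ⟨1, 1, one_pos, one_pos, by simp⟩

/-- The vector `a + b` lies in the first cone; comparing coordinates by means of the determinant, it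
lies in the cone on `σ a` and `τ b` only if both signs are positive. -/
theorem cone_ne_of_det {x a b : R3} (h : det3 x a b ≠ 0) :
    cone a b ≠ cone (-a) (-b) ∧ cone a b ≠ cone a (-b) ∧ cone a b ≠ cone (-a) b := by
  have key : ∀ σ τ : ℝ, cone a b = cone (σ • a) (τ • b) → 0 < σ ∧ 0 < τ := by
    intro σ τ hc
    have h1 := add_mem_cone a b
    rw [hc] at h1
    obtain ⟨r, s, hr, hs, hw⟩ := h1
    have e1 := congrArg (fun w => det3 x w b) hw
    have e2 := congrArg (fun w => det3 x a w) hw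
    have f1 : det3 x (a + b) b = det3 x a b := by simp [det3_apply]; ring
    have f2 : det3 x a (a + b) = det3 x a b := by simp [det3_apply]; ring
    have f3 : det3 x (r • σ • a + s • τ • b) b = (r * σ) * det3 x a b := by
      simp [det3_apply]; ring
    have f4 : det3 x a (r • σ • a + s • τ • b) = (s * τ) * det3 x a b := by
      simp [det3_apply]; ring
    simp only [f1, f2, f3, f4] at e1 e2
    have g1 : r * σ = 1 := by
      apply mul_right_cancel₀ h; linarith
    have g2 : s * τ = 1 := by
      apply mul_right_cancel₀ h; linarith
    constructor
    · by_contra h'; nlinarith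
    · by_contra h'; nlinarith
  refine ⟨fun hc => ?_, fun hc => ?_, fun hc => ?_⟩
  · have := (key (-1) (-1) (by simpa using hc)).1; linarith
  · have := (key 1 (-1) (by simpa using hc)).2; linarith
  · have := (key (-1) 1 (by simpa using hc)).1; linarith

/-- The vectors `a` and `b` span the two branches of the curve at the double point `x`. -/
structure IsCrossing (γ : ℝ → S2) (x : S2) (s t : ℝ) (a b : R3) : Prop where
  ne : (s : Real.Angle) ≠ t
  left : γ s = x
  right : γ t = x
  left_vel : a = velocity γ s ∨ a = -velocity γ s
  right_vel : b = velocity γ t ∨ b = -velocity γ t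

theorem exists_isCrossing {x : S2} (hx : x ∈ doublePoints γ) :
    ∃ s t, IsCrossing γ x s t (velocity γ s) (velocity γ t) := by
  obtain ⟨s, t, hst, hs, ht⟩ := hx
  exact ⟨s, t, hst, hs, ht, Or.inl rfl, Or.inl rfl⟩

namespace IsCrossing

variable {x : S2} {s t : ℝ} {a b : R3}

theorem swap (h : IsCrossing γ x s t a b) : IsCrossing γ x t s b a :=
  ⟨h.ne.symm, h.right, h.left, h.right_vel, h.left_vel⟩

theorem neg_left (h : IsCrossing γ x s t a b) : IsCrossing γ x s t (-a) b :=
  ⟨h.ne, h.left, h.right, by rcases h.left_vel with h | h <;> simp [h], h.right_vel⟩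

theorem neg_right (h : IsCrossing γ x s t a b) : IsCrossing γ x s t a (-b) := h.swap.neg_left.swap

theorem mem_doublePoints (h : IsCrossing γ x s t a b) : x ∈ doublePoints γ :=
  ⟨s, t, h.ne, h.left, h.right⟩

theorem inner_left (h : IsCrossing γ x s t a b) (hγ : IsGenericCircle γ) :
    inner ℝ (x : R3) a = 0 := by
  have := inner_velocity hγ.smooth s
  rw [h.left] at this
  rcases h.left_vel with h | h <;> simp [h, this]

theorem inner_right (h : IsCrossing γ x s t a b) (hγ : IsGenericCircle γ) :
    inner ℝ (x : R3) b = 0 := h.swap.inner_left hγ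

theorem det_ne (h : IsCrossing γ x s t a b) (hγ : IsGenericCircle γ) : det3 x a b ≠ 0 := by
  have h1 := hγ.transverse s t (h.left.trans h.right.symm) h.ne
  have i1 := inner_velocity hγ.smooth s
  have i2 := inner_velocity hγ.smooth t
  rw [h.left] at i1
  rw [h.right] at i2
  have h2 := det3_ne_zero i1 i2 h1
  rcases h.left_vel with h3 | h3 <;> rcases h.right_vel with h4 | h4 <;> rw [h3, h4] <;>
    simp [det3_neg_mid, det3_neg_right, h2]

theorem quadrants_eq (h : IsCrossing γ x s t a b) (hγ : IsGenericCircle γ) :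
    quadrants γ x = {cone a b, cone (-a) (-b), cone a (-b), cone (-a) b} := by
  have hv := velocity_periodic hγ.periodic
  ext Q
  simp only [mem_insert_iff, mem_singleton_iff]
  constructor
  · rintro ⟨s', t', hne, hs', ht', a', b', ha', hb', rfl⟩
    rcases hγ.angle_eq_or h.ne h.left h.right hs' with e1 | e1 <;>
    rcases hγ.angle_eq_or h.ne h.left h.right ht' with e2 | e2
    · exact absurd (e1.trans e2.symm) hne
    · rw [hv.eq_of_angle e1] at ha'
      rw [hv.eq_of_angle e2] at hb'
      rcases h.left_vel with h3 | h3 <;> rcases h.right_vel with h4 | h4 <;>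
      rcases ha' with h5 | h5 <;> rcases hb' with h6 | h6 <;> rw [h3, h4, h5, h6] <;> simp
    · rw [hv.eq_of_angle e1] at ha'
      rw [hv.eq_of_angle e2] at hb'
      rw [cone_comm a' b']
      rcases h.left_vel with h3 | h3 <;> rcases h.right_vel with h4 | h4 <;>
      rcases ha' with h5 | h5 <;> rcases hb' with h6 | h6 <;> rw [h3, h4, h5, h6] <;> simp
    · exact absurd (e1.trans e2.symm) hne
  · have key : ∀ {a b}, IsCrossing γ x s t a b → cone a b ∈ quadrants γ x := fun h =>
      ⟨s, t, h.ne, h.left, h.right, _, _, h.left_vel, h.right_vel, rfl⟩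
    rintro (rfl | rfl | rfl | rfl)
    · exact key h
    · exact key h.neg_left.neg_right
    · exact key h.neg_right
    · exact key h.neg_left

theorem cone_distinct (h : IsCrossing γ x s t a b) (hγ : IsGenericCircle γ) :
    cone a b ≠ cone (-a) (-b) ∧ cone a (-b) ≠ cone (-a) b ∧
      (cone a (-b) ∉ ({cone a b, cone (-a) (-b)} : Set (Set R3))) ∧
      (cone (-a) b ∉ ({cone a b, cone (-a) (-b)} : Set (Set R3))) := by
  have h1 := cone_ne_of_det (h.det_ne hγ)
  have h2 := cone_ne_of_det (h.neg_right.det_ne hγ)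
  have h3 := cone_ne_of_det (h.neg_left.det_ne hγ)
  simp only [neg_neg, mem_insert_iff, mem_singleton_iff, not_or] at *
  exact ⟨h1.1, h2.1, ⟨h2.2.1, h2.2.2⟩, ⟨h3.2.2, h3.2.1⟩⟩

/-- The two determinants are, up to a common factor, the `b`- and `a`-coordinates of the curve
point. A strand tangent to `a` has a `b`-coordinate of smaller order, so it stays in a thin wedge
around its tangent line. -/
theorem eventually_sector_strand (h : IsCrossing γ x s t a b) (hγ : IsGenericCircle γ) {ε : ℝ}
    (hε : 0 < ε) {τ : ℝ} (hτ : (τ : Real.Angle) = s) :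
    ∀ᶠ r in 𝓝 τ, |det3 x a (γ r)| ≤ ε * |det3 x (γ r) b| := by
  have hx : γ τ = x := (hγ.periodic.eq_of_angle hτ).trans h.left
  have hv : velocity γ τ = velocity γ s := (velocity_periodic hγ.periodic).eq_of_angle hτ
  have hd := hasDerivAt_coe_curve hγ.smooth τ
  have h1 : HasDerivAt (fun r => det3 x (γ r) b) (det3 x (velocity γ s) b) τ := by
    have := (det3Mid x b).hasFDerivAt.comp_hasDerivAt τ hd
    rw [hv] at this
    exact this
  have h2 : HasDerivAt (fun r => det3 x a (γ r)) 0 τ := by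
    have := ((det3Mid x a).hasFDerivAt.comp_hasDerivAt τ hd).neg
    rw [hv] at this
    convert! this using 1
    · funext r
      simp [det3_swap x a]
    · rw [det3Mid_apply]
      rcases h.left_vel with h3 | h3 <;> rw [h3] <;> simp [det3_neg_right]
  have hne : det3 x (velocity γ s) b ≠ 0 := by
    have := h.det_ne hγ
    rcases h.left_vel with h3 | h3
    · rwa [h3] at this
    · rw [h3, det3_neg_mid] at this
      exact neg_ne_zero.1 this
  have hk : Tendsto (fun r : ℝ => (r, τ)) (𝓝 τ) (𝓝 τ ×ˢ pure τ) :=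
    tendsto_id.prodMk tendsto_const_pure
  have h3 := (hasDerivAt_iff_isLittleO.1 h2).trans_isBigO ((h1.isTheta_sub hne).2.comp_tendsto hk)
  have h4 := h3.def hε
  filter_upwards [h4] with r hr
  simpa [hx] using hr

theorem eventually_sector (h : IsCrossing γ x s t a b) (hγ : IsGenericCircle γ) {ε : ℝ}
    (hε : 0 < ε) :
    ∀ᶠ y : S2 in 𝓝 x, y ∈ range γ →
      |det3 x a y| ≤ ε * |det3 x y b| ∨ |det3 x y b| ≤ ε * |det3 x a y| := by
  refine eventually_curve hγ fun τ hτ => ?_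
  rcases hγ.angle_eq_or h.ne h.left h.right hτ with e | e
  · filter_upwards [h.eventually_sector_strand hγ hε e] with r hr using Or.inl hr
  · filter_upwards [h.swap.eventually_sector_strand hγ hε e] with r hr
    right
    rw [det3_swap x (γ r : R3) b, det3_swap x a (γ r : R3), abs_neg, abs_neg] at hr
    exact hr

/-- The points with polar directions in a closed subsector of a quadrant. -/
def sector (x a b : R3) (ε δ : ℝ) : Set R3 :=
  {y | ∃ p q : ℝ, 0 < p ∧ p < δ ∧ 0 < q ∧ q < δ ∧ ε * p < q ∧ ε * q < p ∧ y = x + p • a + q • b}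

theorem convex_sector (x a b : R3) (ε δ : ℝ) : Convex ℝ (sector x a b ε δ) := by
  rintro _ ⟨p, q, h1, h2, h3, h4, h5, h6, rfl⟩ _ ⟨p', q', h1', h2', h3', h4', h5', h6', rfl⟩
    α β hα hβ hαβ
  rcases hα.eq_or_lt with rfl | hα
  · obtain rfl : β = 1 := by linarith
    exact ⟨p', q', h1', h2', h3', h4', h5', h6', by simp⟩
  refine ⟨α * p + β * p', α * q + β * q', by positivity, ?_, by positivity, ?_, ?_, ?_, ?_⟩
  · have := mul_lt_mul_of_pos_left h2 hα
    have := mul_le_mul_of_nonneg_left h2'.le hβ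
    have : α * δ + β * δ = δ := by rw [← add_mul, hαβ, one_mul]
    linarith
  · have := mul_lt_mul_of_pos_left h4 hα
    have := mul_le_mul_of_nonneg_left h4'.le hβ
    have : α * δ + β * δ = δ := by rw [← add_mul, hαβ, one_mul]
    linarith
  · have := mul_lt_mul_of_pos_left h5 hα
    have := mul_le_mul_of_nonneg_left h5'.le hβ
    linarith
  · have := mul_lt_mul_of_pos_left h6 hα
    have := mul_le_mul_of_nonneg_left h6'.le hβ
    linarith
  · have : (x : R3) = α • x + β • x := by rw [← add_smul, hαβ, one_smul]
    conv_rhs => rw [this]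
    simp only [smul_add, smul_smul, add_smul]
    abel

theorem det3_frame_ne {y : R3} {p q : ℝ} (hab : det3 x a b ≠ 0) (hy : y = x + p • a + q • b) :
    y ≠ 0 := by
  rintro rfl
  have := congrArg (fun w => det3 w a b) hy
  have e : det3 ((x : R3) + p • a + q • b) a b = det3 x a b := by simp [det3_apply]; ring
  simp only [e] at this
  apply hab
  rw [← this]; simp [det3_apply]

/-- Close to the double point the curve is confined to thin wedges around the two tangent lines, so
a closed subsector of a quadrant is free of it. The sector is convex, which later places it in a
single region. -/
theorem exists_sector_subset (h : IsCrossing γ x s t a b) (hγ : IsGenericCircle γ) {ε : ℝ}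
    (hε : 0 < ε) : ∃ δ > 0, (∀ y ∈ sector x a b ε δ, y ≠ 0) ∧
      toS2 '' sector x a b ε δ ⊆ (range γ)ᶜ := by
  have hdet := h.det_ne hγ
  have hcont : ContinuousAt (fun p : ℝ × ℝ => toS2 ((x : R3) + p.1 • a + p.2 • b)) (0, 0) := by
    have h1 : ContinuousAt toS2 (x : R3) :=
      (contMDiffAt_toS2 (m := 0) x.coe_ne_zero).continuousAt
    refine ContinuousAt.comp (g := toS2) ?_ (by fun_prop)
    simpa using h1
  have h2 : Tendsto (fun p : ℝ × ℝ => toS2 ((x : R3) + p.1 • a + p.2 • b)) (𝓝 (0, 0)) (𝓝 x) := by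
    have := hcont.tendsto
    simpa using this
  obtain ⟨δ, hδ, hball⟩ := Metric.eventually_nhds_iff.1
    (h2.eventually (h.eventually_sector hγ hε))
  refine ⟨δ, hδ, ?_, ?_⟩
  · rintro y ⟨p, q, -, -, -, -, -, -, hy⟩
    exact det3_frame_ne hdet hy
  · rintro _ ⟨y, ⟨p, q, h1, h2, h3, h4, h5, h6, rfl⟩, rfl⟩ hr
    have hy0 := det3_frame_ne hdet (rfl : (x : R3) + p • a + q • b = _)
    have h7 := hball (y := (p, q)) (by
      rw [Prod.dist_eq]; simp [abs_of_pos h1, abs_of_pos h3, h2, h4]) hr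
    simp only [coe_toS2 hy0, det3_smul_mid, det3_smul_right] at h7
    have e1 : det3 x ((x : R3) + p • a + q • b) b = p * det3 x a b := by
      simp [det3_apply]; ring
    have e2 : det3 x a ((x : R3) + p • a + q • b) = q * det3 x a b := by
      simp [det3_apply]; ring
    have hN : 0 < ‖(x : R3) + p • a + q • b‖ := norm_pos_iff.2 hy0
    rw [e1, e2] at h7
    simp only [abs_mul, abs_inv, abs_norm, abs_of_pos h1, abs_of_pos h3] at h7
    set N := ‖(x : R3) + p • a + q • b‖⁻¹
    have hN' : 0 < N * |det3 x a b| := mul_pos (inv_pos.2 hN) (abs_pos.2 hdet)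
    rcases h7 with h7 | h7
    · have : (N * |det3 x a b|) * q ≤ (N * |det3 x a b|) * (ε * p) := by linarith
      have := le_of_mul_le_mul_left this hN'
      linarith
    · have : (N * |det3 x a b|) * p ≤ (N * |det3 x a b|) * (ε * q) := by linarith
      have := le_of_mul_le_mul_left this hN'
      linarith

theorem isPreconnected_sector (h : IsCrossing γ x s t a b) (hγ : IsGenericCircle γ) (ε δ : ℝ) :
    IsPreconnected (toS2 '' sector x a b ε δ) := by
  refine (convex_sector x a b ε δ).isPreconnected.image _ ?_
  rintro y ⟨p, q, -, -, -, -, -, -, hy⟩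
  exact (contMDiffAt_toS2 (m := 0)
    (det3_frame_ne (h.det_ne hγ) hy)).continuousAt.continuousWithinAt

/-- The region at a quadrant contains the curves that start at the double point with a direction
in the quadrant. -/
theorem exists_region (h : IsCrossing γ x s t a b) (hγ : IsGenericCircle γ) :
    ∃ U ∈ regions γ, ∀ (w : R3) (y : ℝ → R3), w ∈ cone a b →
      Tendsto (fun r : ℝ => r⁻¹ • (y r - x)) (𝓝[>] 0) (𝓝 w) →
      ∀ᶠ r : ℝ in 𝓝[>] 0, toS2 (y r) ∈ U := by
  have hdet := h.det_ne hγ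
  obtain ⟨δ₁, hδ₁, hne₁, hsub₁⟩ := h.exists_sector_subset hγ (ε := 1 / 2) (by norm_num)
  have hdiag : ∀ {ε δ p : ℝ}, ε < 1 → 0 < p → p < δ →
      (x : R3) + p • a + p • b ∈ sector x a b ε δ := by
    intro ε δ p hε hp hpδ
    exact ⟨p, p, hp, hpδ, hp, hpδ, by nlinarith, by nlinarith, rfl⟩
  set z₀ := toS2 ((x : R3) + (δ₁ / 2) • a + (δ₁ / 2) • b) with hz₀
  have hz₀mem : z₀ ∈ toS2 '' sector x a b (1 / 2) δ₁ :=
    ⟨_, hdiag (by norm_num) (by linarith) (by linarith), rfl⟩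
  refine ⟨connectedComponentIn (range γ)ᶜ z₀, ⟨z₀, hsub₁ hz₀mem, rfl⟩, ?_⟩
  intro w y hw hy
  obtain ⟨p, q, hp, hq, rfl⟩ := hw
  -- Small enough for the direction `(p, q)` to lie strictly inside the subsector, and less than `1`
  -- so that the diagonal does too.
  set ε := min (1 / 2) (min (q / p) (p / q)) / 2 with hε_def
  have hε : 0 < ε := by positivity
  have hε1 : ε < 1 := by
    have := min_le_left (1 / 2) (min (q / p) (p / q)); linarith
  have hεq : ε * p < q := by
    have h1 : ε < q / p := by
      have h2 := (min_le_right (1 / 2) (min (q / p) (p / q))).trans (min_le_left _ _)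
      have : 0 < q / p := by positivity
      linarith
    rwa [lt_div_iff₀ hp] at h1
  have hεp : ε * q < p := by
    have h1 : ε < p / q := by
      have h2 := (min_le_right (1 / 2) (min (q / p) (p / q))).trans (min_le_right _ _)
      have : 0 < p / q := by positivity
      linarith
    rwa [lt_div_iff₀ hq] at h1
  obtain ⟨δ, hδ, hne, hsub⟩ := h.exists_sector_subset hγ hε
  -- Subsectors with different parameters share short diagonal vectors, so they lie in the same
  -- component. Thus the region depends on the quadrant only.
  have hsubU : toS2 '' sector x a b ε δ ⊆ connectedComponentIn (range γ)ᶜ z₀ := by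
    have hm : 0 < min δ δ₁ / 2 := by positivity
    have hm1 : min δ δ₁ / 2 < δ := by
      have := min_le_left δ δ₁; linarith
    have hm2 : min δ δ₁ / 2 < δ₁ := by
      have := min_le_right δ δ₁; linarith
    have e1 := (h.isPreconnected_sector hγ (1 / 2) δ₁).subset_connectedComponentIn hz₀mem hsub₁
    have e2 : toS2 ((x : R3) + (min δ δ₁ / 2) • a + (min δ δ₁ / 2) • b) ∈
        connectedComponentIn (range γ)ᶜ z₀ := e1 ⟨_, hdiag (by norm_num) hm hm2, rfl⟩
    rw [connectedComponentIn_eq e2]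
    exact (h.isPreconnected_sector hγ ε δ).subset_connectedComponentIn
      ⟨_, hdiag hε1 hm hm1, rfl⟩ hsub
  set Δ := det3 x a b with hΔ
  have hid : Tendsto (fun r : ℝ => r) (𝓝[>] 0) (𝓝 0) :=
    tendsto_id.mono_left nhdsWithin_le_nhds
  have hyx : Tendsto y (𝓝[>] 0) (𝓝 (x : R3)) := by
    have h1 := (hid.smul hy).add_const (x : R3)
    rw [zero_smul, zero_add] at h1
    refine h1.congr' ?_
    filter_upwards [self_mem_nhdsWithin] with r hr
    rw [smul_smul, mul_inv_cancel₀ (ne_of_gt hr), one_smul, sub_add_cancel]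
  have d0 : Tendsto (fun r => det3 (y r) a b) (𝓝[>] 0) (𝓝 Δ) := by
    have hc : Continuous fun y : R3 => det3 y a b := by
      simp only [det3_apply]; fun_prop
    exact (hc.tendsto _).comp hyx
  have d1 : Tendsto (fun r => r⁻¹ * det3 x (y r) b) (𝓝[>] 0) (𝓝 (p * Δ)) := by
    have h1 := ((det3Mid x b).continuous.tendsto _).comp hy
    have e : det3Mid (x : R3) b (p • a + q • b) = p * Δ := by
      rw [det3Mid_apply, hΔ]; simp [det3_apply]; ring
    rw [e] at h1
    refine h1.congr fun r => ?_
    simp [Function.comp]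
    left; simp [det3_apply]; ring
  have d2 : Tendsto (fun r => r⁻¹ * det3 x a (y r)) (𝓝[>] 0) (𝓝 (q * Δ)) := by
    have h1 := (((det3Mid x a).continuous.tendsto _).comp hy).neg
    have e : -det3Mid (x : R3) a (p • a + q • b) = q * Δ := by
      rw [det3Mid_apply, hΔ]; simp [det3_apply]; ring
    rw [e] at h1
    refine h1.congr fun r => ?_
    simp [Function.comp, det3_swap x a]
    left; simp [det3_apply]; ring
  have c1 : Tendsto (fun r => r⁻¹ * (det3 x (y r) b / det3 (y r) a b)) (𝓝[>] 0) (𝓝 p) := by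
    have := d1.div d0 hdet
    rw [mul_div_cancel_right₀ _ hdet] at this
    refine this.congr fun r => ?_
    simp [mul_div_assoc]
  have c2 : Tendsto (fun r => r⁻¹ * (det3 x a (y r) / det3 (y r) a b)) (𝓝[>] 0) (𝓝 q) := by
    have := d2.div d0 hdet
    rw [mul_div_cancel_right₀ _ hdet] at this
    refine this.congr fun r => ?_
    simp [mul_div_assoc]
  have hsmall : ∀ {f : ℝ → ℝ} {v : ℝ}, Tendsto (fun r => r⁻¹ * f r) (𝓝[>] 0) (𝓝 v) →
      ∀ᶠ r in 𝓝[>] 0, f r < δ := by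
    intro f v hf
    have h1 := hid.mul hf
    rw [zero_mul] at h1
    filter_upwards [h1.eventually_lt_const hδ, self_mem_nhdsWithin] with r hr hr0
    rwa [← mul_assoc, mul_inv_cancel₀ (ne_of_gt hr0), one_mul] at hr
  have hΔpos : ∀ᶠ r in 𝓝[>] 0, 0 < det3 (y r) a b / Δ := by
    have := d0.div_const Δ
    rw [div_self hdet] at this
    exact this.eventually_const_lt one_pos
  filter_upwards [hsmall c1, hsmall c2, c1.eventually_const_lt hp, c2.eventually_const_lt hq,
    (c1.const_mul ε).eventually_lt c2 hεq, (c2.const_mul ε).eventually_lt c1 hεp, hΔpos,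
    self_mem_nhdsWithin] with r g1 g2 g3 g4 g5 g6 g7 hr
  have hr : 0 < r := hr
  have hri : 0 < r⁻¹ := inv_pos.2 hr
  apply hsubU
  have hk0 : det3 (y r) a b ≠ 0 := by
    intro h0; rw [h0, zero_div] at g7; exact lt_irrefl _ g7
  refine ⟨(x : R3) + (det3 x (y r) b / det3 (y r) a b) • a +
    (det3 x a (y r) / det3 (y r) a b) • b, ⟨_, _, ?_, g1, ?_, g2, ?_, ?_, rfl⟩, ?_⟩
  · exact (mul_pos_iff_of_pos_left hri).1 g3
  · exact (mul_pos_iff_of_pos_left hri).1 g4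
  · rw [mul_left_comm] at g5
    exact lt_of_mul_lt_mul_left g5 hri.le
  · rw [mul_left_comm] at g6
    exact lt_of_mul_lt_mul_left g6 hri.le
  -- Cramer's rule gives the coordinates of `y r` in the frame `x, a, b`. Dividing by the
  -- coefficient of `x` is harmless since the retraction to the sphere ignores positive factors.
  · have h8 := det3_cramer x a b (y r)
    have h9 : y r = (det3 (y r) a b / Δ) • ((x : R3) + (det3 x (y r) b / det3 (y r) a b) • a +
        (det3 x a (y r) / det3 (y r) a b) • b) := by
      have h10 : y r = Δ⁻¹ • (det3 (y r) a b • (x : R3) + det3 x (y r) b • a +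
          det3 x a (y r) • b) := by
        rw [← h8, smul_smul, inv_mul_cancel₀ hdet, one_smul]
      conv_lhs => rw [h10]
      simp only [smul_add, smul_smul]
      congr 2
      · congr 1; field_simp
      · congr 1; field_simp
      · field_simp
    conv_rhs => rw [h9, toS2_smul g7]

end IsCrossing

end Curve

section Regions

variable {γ : ℝ → S2}

/-! ### Regions and quadrants -/

theorem regions_eq_of_mem {U U' : Set S2} (hU : U ∈ regions γ) (hU' : U' ∈ regions γ) {y : S2}
    (hy : y ∈ U) (hy' : y ∈ U') : U = U' := by
  obtain ⟨z, -, rfl⟩ := hU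
  obtain ⟨z', -, rfl⟩ := hU'
  rw [connectedComponentIn_eq hy, connectedComponentIn_eq hy']

theorem subset_of_mem_regions {U : Set S2} (hU : U ∈ regions γ) : U ⊆ (range γ)ᶜ := by
  obtain ⟨z, -, rfl⟩ := hU
  exact connectedComponentIn_subset _ _

theorem isOpen_of_mem_regions (h : IsGenericCircle γ) {U : Set S2} (hU : U ∈ regions γ) :
    IsOpen U := by
  have : LocallyConnectedSpace S2 := ChartedSpace.locallyConnectedSpace (EuclideanSpace ℝ (Fin 2))
      S2
  obtain ⟨z, -, rfl⟩ := hU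
  exact (isOpen_compl_range h).connectedComponentIn

theorem nonempty_of_mem_regions {U : Set S2} (hU : U ∈ regions γ) : U.Nonempty := by
  obtain ⟨z, hz, rfl⟩ := hU
  exact ⟨z, mem_connectedComponentIn hz⟩

theorem isPreconnected_of_mem_regions {U : Set S2} (hU : U ∈ regions γ) : IsPreconnected U := by
  obtain ⟨z, hz, rfl⟩ := hU
  exact isPreconnected_connectedComponentIn

theorem exists_mem_regions {y : S2} (hy : y ∉ range γ) : ∃ U ∈ regions γ, y ∈ U :=
  ⟨_, ⟨y, hy, rfl⟩, mem_connectedComponentIn hy⟩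

theorem coversQuadrant_iff {U : Set S2} {x : S2} {Q : Set R3} :
    CoversQuadrant U x Q ↔ ∀ w ∈ Q, ∀ᶠ r : ℝ in 𝓝[>] 0, toS2 ((x : R3) + r • w) ∈ U := by
  have key : ∀ w : R3, ∀ᶠ r : ℝ in 𝓝[>] 0, (x : R3) + r • w ≠ 0 := by
    intro w
    have h1 : ContinuousAt (fun r : ℝ => (x : R3) + r • w) 0 := by fun_prop
    have h2 : ∀ᶠ r : ℝ in 𝓝 0, (x : R3) + r • w ≠ 0 := by
      apply h1.eventually_ne
      simpa using x.coe_ne_zero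
    exact h2.filter_mono nhdsWithin_le_nhds
  refine forall₂_congr fun w _ => eventually_congr ?_
  filter_upwards [key w] with r hr
  constructor
  · rintro ⟨y, hy, hy'⟩
    have : toS2 ((x : R3) + r • w) = y := Subtype.ext (by rw [coe_toS2 hr, hy'])
    rwa [this]
  · intro h
    exact ⟨_, h, coe_toS2 hr⟩

theorem tendsto_slope_ray (x w : R3) :
    Tendsto (fun r : ℝ => r⁻¹ • (x + r • w - x)) (𝓝[>] 0) (𝓝 w) := by
  refine tendsto_const_nhds.congr' ?_
  filter_upwards [self_mem_nhdsWithin] with r hr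
  rw [add_sub_cancel_left, smul_smul, inv_mul_cancel₀ (ne_of_gt hr), one_smul]

/-- There is exactly one region covering a given quadrant. -/
theorem IsCrossing.exists_region_covers {x : S2} {s t : ℝ} {a b : R3} (h : IsCrossing γ x s t a b)
    (hγ : IsGenericCircle γ) :
    ∃ U ∈ regions γ, (∀ U' ∈ regions γ, CoversQuadrant U' x (cone a b) ↔ U' = U) ∧
      ∀ (w : R3) (y : ℝ → R3), w ∈ cone a b →
      Tendsto (fun r : ℝ => r⁻¹ • (y r - x)) (𝓝[>] 0) (𝓝 w) →
      ∀ᶠ r : ℝ in 𝓝[>] 0, toS2 (y r) ∈ U := by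
  obtain ⟨U, hU, hcov⟩ := h.exists_region hγ
  refine ⟨U, hU, fun U' hU' => ⟨fun hc => ?_, ?_⟩, hcov⟩
  · have h1 := coversQuadrant_iff.1 hc _ (add_mem_cone a b)
    have h2 := hcov _ _ (add_mem_cone a b) (tendsto_slope_ray x (a + b))
    obtain ⟨r, hr1, hr2⟩ := (h1.and h2).exists
    exact regions_eq_of_mem hU' hU hr1 hr2
  · rintro rfl
    exact coversQuadrant_iff.2 fun w hw => hcov _ _ hw (tendsto_slope_ray x w)

/-! ### Finiteness of the set of double points -/

/-- The component of the curve along its velocity at `σ` has a nonzero strict derivative, hence it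
is injective near `σ`. Both parameters may vary, which compactness arguments need. -/
theorem eventually_eq_of_curve_eq (h : IsGenericCircle γ) (σ : ℝ) :
    ∀ᶠ p : ℝ × ℝ in 𝓝 (σ, σ), γ p.1 = γ p.2 → p.1 = p.2 := by
  have h1 : HasStrictDerivAt (fun t => inner ℝ (velocity γ σ) (γ t : R3))
      (inner ℝ (velocity γ σ) (velocity γ σ)) σ := by
    have h2 : HasStrictDerivAt (fun t => (γ t : R3)) (velocity γ σ) σ :=
      (contDiff_coe_curve h.smooth).contDiffAt.hasStrictDerivAt (by simp)
    exact (innerSL ℝ (velocity γ σ)).hasStrictFDerivAt.comp_hasStrictDerivAt σ h2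
  have hne : inner ℝ (velocity γ σ) (velocity γ σ) ≠ 0 := by
    rw [Ne, inner_self_eq_zero]; exact h.immersive σ
  have h2 := (h1.isTheta_sub hne).2
  filter_upwards [h2.eq_zero_imp] with p hp hp'
  exact sub_eq_zero.1 (hp (by rw [hp']; simp))

theorem eventually_curve_ne (h : IsGenericCircle γ) (σ : ℝ) (x : S2) :
    ∀ᶠ t in 𝓝[≠] σ, γ t ≠ x := by
  by_cases hx : γ σ = x
  · have h1 := (hasDerivAt_coe_curve h.smooth σ).eventually_ne (h.immersive σ) (c := (x : R3))
    filter_upwards [h1] with t ht h2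
    exact ht (by rw [h2])
  · exact (h.smooth.continuous.continuousAt.eventually_ne hx).filter_mono nhdsWithin_le_nhds

/-- Double points are isolated. By compactness it suffices to look near one pair of parameters: if
both lie over `x` and represent the same angle, the curve is locally injective; if the angles
differ, the strands lie in thin wedges around different lines, which meet only in `x`; otherwise one
of the curve points stays away from `x`. -/
theorem eventually_notMem_doublePoints (h : IsGenericCircle γ) (x : S2) :
    ∀ᶠ y in 𝓝 x, y ∈ doublePoints γ → y = x := by
  have h1 : ∀ᶠ y in 𝓝 x, ∀ p ∈ Icc (0 : ℝ) (2 * π) ×ˢ Icc (0 : ℝ) (2 * π),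
      γ p.1 = y → γ p.2 = y → (p.1 : Real.Angle) ≠ p.2 → y = x := by
    refine (isCompact_Icc.prod isCompact_Icc).eventually_forall_of_forall_eventually ?_
    rintro ⟨σ, τ⟩ -
    have ht1 : Tendsto (fun z : S2 × ℝ × ℝ => z.2.1) (𝓝 (x, σ, τ)) (𝓝 σ) :=
      (continuous_fst.comp continuous_snd).tendsto (x, σ, τ)
    have ht2 : Tendsto (fun z : S2 × ℝ × ℝ => z.2.2) (𝓝 (x, σ, τ)) (𝓝 τ) :=
      (continuous_snd.comp continuous_snd).tendsto (x, σ, τ)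
    by_cases hσ : γ σ = x
    · by_cases hτ : γ τ = x
      · by_cases hστ : (σ : Real.Angle) = τ
        · obtain ⟨k, hk⟩ := Real.Angle.angle_eq_iff_two_pi_dvd_sub.1 hστ
          have h2 : Tendsto (fun z : S2 × ℝ × ℝ => (z.2.1, z.2.2 + k * (2 * π)))
              (𝓝 (x, σ, τ)) (𝓝 (σ, σ)) := by
            have h3 := ht2.add_const (k * (2 * π))
            have : τ + k * (2 * π) = σ := by linarith
            rw [this] at h3
            rw [nhds_prod_eq (x := σ) (y := σ)]
            exact ht1.prodMk h3
          filter_upwards [h2.eventually (eventually_eq_of_curve_eq h σ)] with z hz e1 e2 e3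
          exfalso
          apply e3
          have e4 := hz (by rw [h.periodic.int_mul k, e1, e2])
          rw [Real.Angle.angle_eq_iff_two_pi_dvd_sub]
          exact ⟨k, by linarith⟩
        · have hc : IsCrossing γ x σ τ (velocity γ σ) (velocity γ τ) :=
            ⟨hστ, hσ, hτ, Or.inl rfl, Or.inl rfl⟩
          have h3 := hc.eventually_sector_strand h (ε := 1 / 2) (by norm_num) rfl
          have h4 := hc.swap.eventually_sector_strand h (ε := 1 / 2) (by norm_num) rfl
          have h5 : ∀ᶠ r in 𝓝 σ, det3 x (γ r) (velocity γ τ) = 0 → r = σ := by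
            have hd : HasDerivAt (fun r => det3 x (γ r) (velocity γ τ))
                (det3 x (velocity γ σ) (velocity γ τ)) σ :=
              (det3Mid x (velocity γ τ)).hasFDerivAt.comp_hasDerivAt σ
                (hasDerivAt_coe_curve h.smooth σ)
            have h6 := hd.eventually_ne (hc.det_ne h) (c := 0)
            rw [eventually_nhdsWithin_iff] at h6
            filter_upwards [h6] with r hr h0
            by_contra hne
            exact hr hne h0
          filter_upwards [ht1.eventually h3, ht2.eventually h4, ht1.eventually h5] with z g3 g4 g5
            e1 e2 e3
          rw [e1] at g3 g5
          rw [e2] at g4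
          rw [det3_swap x z.1 (velocity γ σ), abs_neg] at g3
          rw [det3_swap x z.1 (velocity γ τ), abs_neg] at g4
          -- Each of the two determinants is at most half the other in absolute value, so both
          -- vanish.
          have h7 := g5 (by
            rw [← abs_eq_zero]
            have := abs_nonneg (det3 (x : R3) z.1 (velocity γ τ))
            linarith)
          rw [← e1, h7, hσ]
      · filter_upwards [(isOpen_ne_fun (h.smooth.continuous.comp (continuous_snd.comp
          continuous_snd)) continuous_fst).mem_nhds (show (x, σ, τ) ∈ _ from hτ)] with z hz e1 e2 e3
        exact absurd e2 hz
    · filter_upwards [(isOpen_ne_fun (h.smooth.continuous.comp (continuous_fst.comp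
          continuous_snd)) continuous_fst).mem_nhds (show (x, σ, τ) ∈ _ from hσ)] with z hz e1 e2 e3
      exact absurd e1 hz
  filter_upwards [h1] with y hy hyd
  obtain ⟨s, t, hst, hs, ht⟩ := hyd
  have key : ∀ {r : ℝ}, ∃ r' ∈ Icc (0 : ℝ) (2 * π), (r' : Real.Angle) = r := by
    intro r
    refine ⟨toIcoMod Real.two_pi_pos 0 r, ?_, ?_⟩
    · have := toIcoMod_mem_Ico Real.two_pi_pos 0 r
      rw [zero_add] at this
      exact Ico_subset_Icc_self this
    · exact Real.Angle.coe_toIcoMod r 0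
  obtain ⟨s', hs', e1⟩ := key (r := s)
  obtain ⟨t', ht', e2⟩ := key (r := t)
  refine hy (s', t') ⟨hs', ht'⟩ ?_ ?_ ?_
  · rw [← hs]; exact h.periodic.eq_of_angle e1
  · rw [← ht]; exact h.periodic.eq_of_angle e2
  · rw [e1, e2]; exact hst

theorem finite_doublePoints (h : IsGenericCircle γ) : (doublePoints γ).Finite := by
  have h1 : (univ ∩ doublePoints γ).Finite := by
    refine isCompact_univ.induction_on (p := fun s => (s ∩ doublePoints γ).Finite) ?_ ?_ ?_ ?_
    · simp
    · intro s t hst ht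
      exact ht.subset (inter_subset_inter_left _ hst)
    · intro s t hs ht
      rw [union_inter_distrib_right]
      exact hs.union ht
    · intro x _
      refine ⟨_, mem_nhdsWithin_of_mem_nhds (eventually_notMem_doublePoints h x), ?_⟩
      refine (finite_singleton x).subset ?_
      rintro y ⟨hy, hy'⟩
      exact hy hy'
  simpa using h1

/-! ### Curves with the same image -/

/-- Suppose that all strands of `γ₁` through the point are transverse to the velocity `u` of `γ₂`.
Points of these strands near `x` satisfy `‖y - x‖ ≤ C |det3 x u y|`, whereas points of `γ₂` leave
`x` tangentially to `u`, which makes this determinant of smaller order. So the image of `γ₂` near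
`x` is not contained in that of `γ₁`. -/
theorem exists_parallel_velocity {γ₁ γ₂ : ℝ → S2} (h₁ : IsGenericCircle γ₁)
    (h₂ : IsGenericCircle γ₂) (hr : range γ₂ ⊆ range γ₁) (t : ℝ) :
    ∃ s, γ₁ s = γ₂ t ∧ det3 (γ₂ t) (velocity γ₂ t) (velocity γ₁ s) = 0 := by
  by_contra! hcon
  set x := γ₂ t with hx
  set u := velocity γ₂ t with hu
  have hu0 : u ≠ 0 := h₂.immersive t
  have hd2 := hasDerivAt_coe_curve h₂.smooth t
  have hslow : ∀ ε > 0, ∀ᶠ r in 𝓝 t, |det3 x u (γ₂ r)| ≤ ε * ‖(γ₂ r : R3) - x‖ := by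
    intro ε hε
    have hd : HasDerivAt (fun r => det3 x u (γ₂ r)) 0 t := by
      have := ((det3Mid x u).hasFDerivAt.comp_hasDerivAt t hd2).neg
      convert! this using 1
      · funext r
        simp [det3_swap x u]
      · simp [← hu]
    have hk : Tendsto (fun r : ℝ => (r, t)) (𝓝 t) (𝓝 t ×ˢ pure t) :=
      tendsto_id.prodMk tendsto_const_pure
    have h3 := (hasDerivAt_iff_isLittleO.1 hd).trans_isBigO ((hd2.isTheta_sub hu0).2.comp_tendsto hk)
    filter_upwards [h3.def hε] with r hr
    simpa [← hx] using hr
  have hall : ∀ᶠ h in 𝓝 t, ∀ τ ∈ Icc (0 : ℝ) (2 * π), h ≠ t → γ₁ τ ≠ γ₂ h := by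
    refine isCompact_Icc.eventually_forall_of_forall_eventually fun τ _ => ?_
    have ht1 : Tendsto (fun z : ℝ × ℝ => z.1) (𝓝 (t, τ)) (𝓝 t) := continuous_fst.tendsto (t, τ)
    have ht2 : Tendsto (fun z : ℝ × ℝ => z.2) (𝓝 (t, τ)) (𝓝 τ) := continuous_snd.tendsto (t, τ)
    by_cases hτ : γ₁ τ = x
    · have hne := hcon τ hτ
      have hd1 := hasDerivAt_coe_curve h₁.smooth τ
      have hd : HasDerivAt (fun r => det3 x u (γ₁ r)) (det3 x u (velocity γ₁ τ)) τ := by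
        have := ((det3Mid x u).hasFDerivAt.comp_hasDerivAt τ hd1).neg
        convert! this using 1
        · funext r
          simp [det3_swap x u]
        · rw [det3Mid_apply, det3_swap x u, neg_neg]
      have hk : Tendsto (fun r : ℝ => (r, τ)) (𝓝 τ) (𝓝 τ ×ˢ pure τ) :=
        tendsto_id.prodMk tendsto_const_pure
      have h3 : (fun r => (γ₁ r : R3) - x) =O[𝓝 τ] fun r => det3 x u (γ₁ r) := by
        have h4 := hd1.differentiableAt.isBigO_sub.trans ((hd.isTheta_sub hne).2.comp_tendsto hk)
        refine h4.congr (fun r => by rw [hτ]) (fun r => ?_)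
        simp [hτ]
      obtain ⟨C, hC, hb⟩ := h3.exists_pos
      -- Together with the bound by `C` this gives `‖y - x‖ ≤ ‖y - x‖ / 2` at a common point other
      -- than `x`.
      have h5 := hslow (1 / (2 * C)) (by positivity)
      have h6 := eventually_curve_ne h₂ t x
      rw [eventually_nhdsWithin_iff] at h6
      filter_upwards [ht2.eventually hb.bound, ht1.eventually h5, ht1.eventually h6] with z b1 b2 b3
        hz heq
      rw [heq] at b1
      have h7 : 0 < ‖(γ₂ z.1 : R3) - x‖ := by
        rw [norm_pos_iff, sub_ne_zero]
        intro h0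
        exact b3 hz (Subtype.ext h0)
      rw [Real.norm_eq_abs] at b1
      have h8 := mul_le_mul_of_nonneg_left b2 hC.le
      have h9 : C * (1 / (2 * C) * ‖(γ₂ z.1 : R3) - x‖) = ‖(γ₂ z.1 : R3) - x‖ / 2 := by
        field_simp
      linarith
    · filter_upwards [(isOpen_ne_fun (h₁.smooth.continuous.comp continuous_snd)
        (h₂.smooth.continuous.comp continuous_fst)).mem_nhds
        (show (t, τ) ∈ _ from hτ)] with z hz _ using hz
  obtain ⟨h, hh, hne⟩ := ((hall.filter_mono nhdsWithin_le_nhds).and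
    (self_mem_nhdsWithin : {t}ᶜ ∈ 𝓝[≠] t)).exists
  have h1 : γ₂ h ∈ range γ₁ := hr ⟨h, rfl⟩
  rw [range_eq_image_Icc h₁.periodic] at h1
  obtain ⟨τ, hτ, e⟩ := h1
  exact hh τ hτ hne e

theorem exists_smul_of_det3_eq_zero {x : S2} {a v : R3} (ha : inner ℝ (x : R3) a = 0)
    (hv : inner ℝ (x : R3) v = 0) (ha0 : a ≠ 0) (hv0 : v ≠ 0) (h : det3 x a v = 0) :
    ∃ r : ℝ, r ≠ 0 ∧ v = r • a := by
  by_contra! hcon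
  apply det3_ne_zero ha hv _ h
  rw [LinearIndependent.pair_iff' ha0]
  intro r hr
  refine hcon r ?_ hr.symm
  rintro rfl
  exact hv0 (by rw [← hr, zero_smul])

/-- A diagram identifies only the images of two curves, not their parametrizations. Double points
and quadrants must therefore be recovered from the image, and parallel velocities suffice because
cones ignore positive factors. -/
theorem IsCrossing.of_range_subset {γ₁ γ₂ : ℝ → S2} (h₁ : IsGenericCircle γ₁)
    (h₂ : IsGenericCircle γ₂) (hr : range γ₂ ⊆ range γ₁) {x : S2} {s t : ℝ} {a b : R3}
    (h : IsCrossing γ₂ x s t a b) :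
    ∃ s' t' a' b', IsCrossing γ₁ x s' t' a' b' ∧
      ∃ p q : ℝ, 0 < p ∧ 0 < q ∧ a' = p • a ∧ b' = q • b := by
  have key : ∀ {s t a b}, IsCrossing γ₂ x s t a b →
      ∃ s' a', γ₁ s' = x ∧ (a' = velocity γ₁ s' ∨ a' = -velocity γ₁ s') ∧
        ∃ p : ℝ, 0 < p ∧ a' = p • a := by
    intro s t a b h
    obtain ⟨s', hs', hd⟩ := exists_parallel_velocity h₁ h₂ hr s
    rw [h.left] at hs' hd
    have ha0 : a ≠ 0 := by
      rintro rfl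
      have := h.det_ne h₂
      apply this; simp [det3_apply]
    have hd' : det3 x a (velocity γ₁ s') = 0 := by
      rcases h.left_vel with e | e <;> rw [e]
      · exact hd
      · rw [det3_neg_mid, hd, neg_zero]
    have hi : inner ℝ (x : R3) (velocity γ₁ s') = 0 := by
      have := inner_velocity h₁.smooth s'
      rwa [hs'] at this
    obtain ⟨r, hr0, hr⟩ := exists_smul_of_det3_eq_zero (h.inner_left h₂) hi ha0
      (h₁.immersive s') hd'
    rcases lt_or_gt_of_ne hr0 with hr1 | hr1
    · exact ⟨s', -velocity γ₁ s', hs', Or.inr rfl, -r, by linarith, by rw [hr, neg_smul]⟩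
    · exact ⟨s', velocity γ₁ s', hs', Or.inl rfl, r, hr1, hr⟩
  obtain ⟨s', a', hs', ha', p, hp, rfl⟩ := key h
  obtain ⟨t', b', ht', hb', q, hq, rfl⟩ := key h.swap
  refine ⟨s', t', _, _, ⟨?_, hs', ht', ha', hb'⟩, p, q, hp, hq, rfl, rfl⟩
  intro heq
  have hv := (velocity_periodic h₁.periodic).eq_of_angle heq
  apply h.det_ne h₂
  have e : det3 x (p • a) (q • b) = p * q * det3 x a b := by
    rw [det3_smul_mid, det3_smul_right]; ring
  have h0 : det3 x (p • a) (q • b) = 0 := by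
    rcases ha' with e1 | e1 <;> rcases hb' with e2 | e2 <;> rw [e1, e2, hv] <;>
      simp [det3_neg_mid, det3_neg_right]
  rw [e] at h0
  exact (mul_eq_zero.1 h0).resolve_left (by positivity)

theorem doublePoints_subset_of_range_subset {γ₁ γ₂ : ℝ → S2} (h₁ : IsGenericCircle γ₁)
    (h₂ : IsGenericCircle γ₂) (hr : range γ₂ ⊆ range γ₁) : doublePoints γ₂ ⊆ doublePoints γ₁ := by
  intro x hx
  obtain ⟨s, t, h⟩ := exists_isCrossing hx
  obtain ⟨s', t', a', b', h', -⟩ := h.of_range_subset h₁ h₂ hr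
  exact h'.mem_doublePoints

theorem quadrants_eq_of_range_subset {γ₁ γ₂ : ℝ → S2} (h₁ : IsGenericCircle γ₁)
    (h₂ : IsGenericCircle γ₂) (hr : range γ₂ ⊆ range γ₁) {x : S2} (hx : x ∈ doublePoints γ₂) :
    quadrants γ₂ x = quadrants γ₁ x := by
  obtain ⟨s, t, h⟩ := exists_isCrossing hx
  obtain ⟨s', t', a', b', h', p, q, hp, hq, rfl, rfl⟩ := h.of_range_subset h₁ h₂ hr
  rw [h.quadrants_eq h₂, h'.quadrants_eq h₁]
  simp only [← smul_neg, cone_smul hp hq]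

/-! ### The image of a curve under a diffeomorphism -/

section Push

variable (φ : Diffeomorph (𝓡 2) (𝓡 2) S2 S2 ∞)

theorem velocity_diffeo (h : IsGenericCircle γ) (t : ℝ) :
    velocity (fun s => φ (γ s)) t = fderiv ℝ (radialExt φ) (γ t) (velocity γ t) :=
  velocity_comp h.smooth (φ.contMDiffAt_one _)

theorem IsGenericCircle.diffeo (h : IsGenericCircle γ) :
    IsGenericCircle fun t => φ (γ t) where
  smooth := φ.contMDiff.comp h.smooth
  periodic := fun t => by show φ (γ (t + 2 * π)) = φ (γ t); rw [h.periodic t]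
  immersive := fun t h0 => by
    rw [velocity_diffeo φ h] at h0
    have := fderiv_radialExt_symm_apply φ (γ t) (inner_velocity h.smooth t)
    rw [h0, map_zero] at this
    exact h.immersive t this.symm
  transverse := fun s t hst hne => by
    have hst' : γ s = γ t := φ.injective hst
    have h1 := h.transverse s t hst' hne
    rw [LinearIndependent.pair_iff] at h1 ⊢
    intro p q hpq
    refine h1 p q ?_
    rw [velocity_diffeo φ h, velocity_diffeo φ h, hst', ← map_smul, ← map_smul, ← map_add] at hpq
    have hi : inner ℝ (γ t : R3) (p • velocity γ s + q • velocity γ t) = 0 := by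
      have i1 := inner_velocity h.smooth s
      have i2 := inner_velocity h.smooth t
      rw [hst'] at i1
      rw [inner_add_right, inner_smul_right, inner_smul_right, i1, i2]; simp
    have := fderiv_radialExt_symm_apply φ (γ t) hi
    rw [hpq, map_zero] at this
    exact this.symm
  no_triple := fun s t u hst htu => h.no_triple s t u (φ.injective hst) (φ.injective htu)

theorem IsCrossing.diffeo (h : IsGenericCircle γ) {x : S2} {s t : ℝ} {a b : R3}
    (hc : IsCrossing γ x s t a b) : IsCrossing (fun t => φ (γ t)) (φ x) s t
      (fderiv ℝ (radialExt φ) x a) (fderiv ℝ (radialExt φ) x b) where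
  ne := hc.ne
  left := by rw [hc.left]
  right := by rw [hc.right]
  left_vel := by
    rw [velocity_diffeo φ h, hc.left]
    rcases hc.left_vel with e | e <;> simp [e]
  right_vel := by
    rw [velocity_diffeo φ h, hc.right]
    rcases hc.right_vel with e | e <;> simp [e]

theorem IsCrossing.pushQuadrant_cone (h : IsGenericCircle γ) {x : S2} {s t : ℝ} {a b : R3}
    (hc : IsCrossing γ x s t a b) : pushQuadrant φ x (cone a b) =
      cone (fderiv ℝ (radialExt φ) x a) (fderiv ℝ (radialExt φ) x b) := by
  rw [pushQuadrant_eq, image_cone]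
  rintro w ⟨p, q, -, -, rfl⟩
  rw [inner_add_right, inner_smul_right, inner_smul_right, hc.inner_left h, hc.inner_right h]
  simp

theorem range_diffeo : range (fun t => φ (γ t)) = φ '' range γ := (range_comp φ γ)

theorem image_mem_regions {U : Set S2} (hU : U ∈ regions γ) :
    φ '' U ∈ regions fun t => φ (γ t) := by
  obtain ⟨z, hz, rfl⟩ := hU
  refine ⟨φ z, ?_, ?_⟩
  · rw [range_diffeo, mem_compl_iff]
    rintro ⟨y, hy, e⟩
    exact hz (φ.injective e ▸ hy)
  · rw [range_diffeo]
    have h1 := φ.toHomeomorph.image_connectedComponentIn hz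
    have h2 : φ '' (range γ)ᶜ = (φ '' range γ)ᶜ := image_compl_eq φ.bijective
    rw [← h2]
    exact h1

theorem exists_image_eq_of_mem_regions {U' : Set S2} (hU' : U' ∈ regions fun t => φ (γ t)) :
    ∃ U ∈ regions γ, φ '' U = U' := by
  obtain ⟨z, hz, rfl⟩ := hU'
  obtain ⟨y, rfl⟩ := φ.surjective z
  have hy : y ∉ range γ := by
    intro h; apply hz; rw [range_diffeo]; exact mem_image_of_mem _ h
  obtain ⟨U, hU, hyU⟩ := exists_mem_regions hy
  exact ⟨U, hU, regions_eq_of_mem (image_mem_regions φ hU) ⟨_, hz, rfl⟩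
    (mem_image_of_mem _ hyU) (mem_connectedComponentIn hz)⟩

/-- A region covers a quadrant if and only if its image covers the image of the quadrant. -/
theorem IsCrossing.covers_image_iff (h : IsGenericCircle γ) {x : S2} {s t : ℝ} {a b : R3}
    (hc : IsCrossing γ x s t a b) {U : Set S2} (hU : U ∈ regions γ) :
    CoversQuadrant (φ '' U) (φ x) (cone (fderiv ℝ (radialExt φ) x a) (fderiv ℝ (radialExt φ) x b)) ↔
      CoversQuadrant U x (cone a b) := by
  obtain ⟨V, hV, hVi, hVc⟩ := hc.exists_region_covers h
  obtain ⟨W, hW, hWi, hWc⟩ := (hc.diffeo φ h).exists_region_covers (h.diffeo φ)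
  rw [hVi U hU, hWi _ (image_mem_regions φ hU)]
  -- The ray in the direction `a + b` is mapped to a curve leaving `φ x` in a direction of the image
  -- quadrant, so its points lie both in the image of `V` and in `W`.
  have hVW : φ '' V = W := by
    have hd : HasFDerivAt (radialExt φ) (fderiv ℝ (radialExt φ) x) x :=
      ((contDiffAt_radialExt (φ.contMDiffAt_one x)).differentiableAt one_ne_zero).hasFDerivAt
    have h1 : Tendsto (fun r : ℝ => r⁻¹ • (radialExt φ ((x : R3) + r • (a + b)) - φ x)) (𝓝[>] 0)
        (𝓝 (fderiv ℝ (radialExt φ) x (a + b))) := by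
      have h2 := (hd.hasLineDerivAt (a + b)).tendsto_slope_zero_right
      rw [radialExt_coe] at h2
      exact h2
    have h3 := hWc _ _ (by rw [map_add]; exact add_mem_cone _ _) h1
    have h4 := hVc _ _ (add_mem_cone a b) (tendsto_slope_ray x (a + b))
    obtain ⟨r, hr1, hr2⟩ := (h3.and h4).exists
    rw [radialExt, toS2_coe] at hr1
    exact regions_eq_of_mem (image_mem_regions φ hV) hW (mem_image_of_mem _ hr2) hr1
  rw [← hVW]
  exact φ.injective.image_injective.eq_iff

end Push

end Regions

/-! ### Signed counts of covered quadrants -/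

section CoverSum

variable {γ : ℝ → S2}

open Classical in
/-- `1` if `U` covers the quadrant `A` at `x` and `0` otherwise. -/
def coverCount (U : Set S2) (x : S2) (A : Set R3) : ℝ := if CoversQuadrant U x A then 1 else 0

theorem coverCount_congr {U U' : Set S2} {x x' : S2} {A A' : Set R3}
    (h : CoversQuadrant U x A ↔ CoversQuadrant U' x' A') :
    coverCount U x A = coverCount U' x' A' := by
  unfold coverCount; split_ifs <;> tauto

/-- The number of quadrants in `{±cone a b}` covered by `U` minus the number of quadrants in
`{±cone a (-b)}` covered by `U`. -/
def coverSum (U : Set S2) (x : S2) (a b : R3) : ℝ :=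
  coverCount U x (cone a b) + coverCount U x (cone (-a) (-b)) - coverCount U x (cone a (-b)) -
    coverCount U x (cone (-a) b)

theorem pair_ne_of_cone {a b : R3} {S : Set (Set R3)} (hS : S = {cone a b, cone (-a) (-b)}) :
    cone a b ∈ S ∧ cone (-a) (-b) ∈ S := by simp [hS]

theorem IsCrossing.quadrants_diff (hγ : IsGenericCircle γ) {x : S2} {s t : ℝ} {a b : R3}
    (h : IsCrossing γ x s t a b) :
    quadrants γ x \ {cone a b, cone (-a) (-b)} = {cone a (-b), cone (-a) b} := by
  obtain ⟨h1, h2, h3, h4⟩ := h.cone_distinct hγ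
  rw [h.quadrants_eq hγ]
  ext A
  constructor
  · rintro ⟨h5 | h5 | h5 | h5, h6⟩
    · exact absurd (Or.inl h5) h6
    · exact absurd (Or.inr h5) h6
    · exact Or.inl h5
    · exact Or.inr h5
  · rintro (rfl | rfl)
    · exact ⟨by simp, h3⟩
    · exact ⟨by simp, h4⟩

/-- Brings the contribution of a vertex to the defect into the shape in which it appears in `Psi`;
this uses that the four quadrants are distinct. -/
theorem IsCrossing.finsum_signed_length (hγ : IsGenericCircle γ) {x : S2} {s t : ℝ} {a b : R3}
    (h : IsCrossing γ x s t a b) (U : Set S2) {S : Set (Set R3)} [DecidablePred (· ∈ S)]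
    (hS : S = {cone a b, cone (-a) (-b)}) (ℓ : ℝ) :
    ∑ᶠ A ∈ {A | A ∈ quadrants γ x ∧ CoversQuadrant U x A}, (if A ∈ S then 1 else -1) * ℓ =
      ℓ * coverSum U x a b := by
  classical
  have e1 : ∑ᶠ A ∈ {A | A ∈ quadrants γ x ∧ CoversQuadrant U x A},
      (if A ∈ S then (1 : ℝ) else -1) * ℓ = ∑ᶠ A ∈ quadrants γ x,
        (coverCount U x A) * ((if A ∈ S then (1 : ℝ) else -1) * ℓ) := by
    apply finsum_congr
    intro A
    by_cases h1 : A ∈ quadrants γ x <;> by_cases h2 : CoversQuadrant U x A <;>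
      simp [h1, h2, coverCount]
  obtain ⟨h1, h2, h3, h4⟩ := h.cone_distinct hγ
  obtain ⟨m1, m2⟩ := pair_ne_of_cone hS
  rw [← hS] at h3 h4
  rw [e1, h.quadrants_eq hγ]
  have n1 : cone a b ≠ cone a (-b) := fun e => h3 (e ▸ m1)
  have n2 : cone a b ≠ cone (-a) b := fun e => h4 (e ▸ m1)
  have n3 : cone (-a) (-b) ≠ cone a (-b) := fun e => h3 (e ▸ m2)
  have n4 : cone (-a) (-b) ≠ cone (-a) b := fun e => h4 (e ▸ m2)
  rw [finsum_mem_insert _ (by simp [h1, n1, n2]) (by simp),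
    finsum_mem_insert _ (by simp [n3, n4]) (by simp),
    finsum_mem_insert _ (by simp [h2]) (by simp), finsum_mem_singleton]
  simp only [m1, m2, h3, h4, if_true, if_false, coverSum]
  ring

end CoverSum

namespace DecoratedCircle

variable (Γ : DecoratedCircle)

theorem exists_isCrossing_plus (p : Γ.Vertex) : ∃ s t a b, IsCrossing Γ.curve p s t a b ∧
    Γ.plus p = {cone a b, cone (-a) (-b)} := by
  obtain ⟨A, ⟨s, t, hst, hs, ht, a, b, ha, hb, rfl⟩, h⟩ := Γ.plus_spec p
  exact ⟨s, t, a, b, ⟨hst, hs, ht, ha, hb⟩, by rw [h, neg_mem_cone]⟩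

/-- Exactly one region covers a quadrant, so the choice made in `regionOf` is harmless and its
default value never occurs here. -/
theorem regionOf_apply {p : Γ.Vertex} {A : Set R3} (hA : A ∈ quadrants Γ.curve (p : S2))
    (U : Γ.Region) : Γ.regionOf p A U = coverCount U p A := by
  classical
  obtain ⟨s, t, hst, hs, ht, a, b, ha, hb, rfl⟩ := hA
  obtain ⟨V, hV, hVi, -⟩ :=
    (⟨hst, hs, ht, ha, hb⟩ : IsCrossing Γ.curve p s t a b).exists_region_covers Γ.generic
  have hex : ∃ U : Γ.Region, CoversQuadrant (U : Set S2) p (cone a b) :=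
    ⟨⟨V, hV⟩, (hVi V hV).2 rfl⟩
  have h1 : ∀ W : Γ.Region, CoversQuadrant (W : Set S2) p (cone a b) ↔ W = ⟨V, hV⟩ := by
    intro W
    rw [hVi W W.2, Subtype.ext_iff]
  rw [regionOf, dif_pos hex, (h1 _).1 hex.choose_spec, coverCount, Finsupp.single_apply]
  simp only [h1, eq_comm]

theorem Psi_single_apply {p : Γ.Vertex} {s t : ℝ} {a b : R3} (h : IsCrossing Γ.curve p s t a b)
    (hp : Γ.plus p = {cone a b, cone (-a) (-b)}) (r : ℝ) (U : Γ.Region) :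
    Γ.Psi (Finsupp.single p r) U = r * coverSum U p a b := by
  obtain ⟨h1, h2, -, -⟩ := h.cone_distinct Γ.generic
  rw [Psi, Finsupp.linearCombination_single, hp, h.quadrants_diff Γ.generic, finsum_mem_pair h1,
    finsum_mem_pair h2]
  have hq := h.quadrants_eq Γ.generic
  simp only [Finsupp.smul_apply, Finsupp.sub_apply, Finsupp.add_apply, smul_eq_mul]
  rw [Γ.regionOf_apply (by simp [hq]), Γ.regionOf_apply (by simp [hq]),
    Γ.regionOf_apply (by simp [hq]), Γ.regionOf_apply (by simp [hq]), coverSum]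
  ring

instance : Finite Γ.Vertex := (finite_doublePoints Γ.generic).to_subtype

theorem Psi_apply (q : Γ.Q) (U : Γ.Region) :
    Γ.Psi q U = ∑ᶠ p : Γ.Vertex, Γ.Psi (Finsupp.single p (q p)) U := by
  have := Fintype.ofFinite Γ.Vertex
  rw [finsum_eq_sum_of_fintype, ← Finsupp.finsetSum_apply, ← map_sum]
  congr 2
  rw [← Finsupp.sum_fintype q (fun p r => Finsupp.single p r) (by simp), Finsupp.sum_single]

end DecoratedCircle

/-! ### Defects -/

theorem IsCrossing.coverSum_image {γ : ℝ → S2} (φ : Diffeomorph (𝓡 2) (𝓡 2) S2 S2 ∞)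
    (h : IsGenericCircle γ) {x : S2} {s t : ℝ} {a b : R3}
    (hc : IsCrossing γ x s t a b) {U : Set S2} (hU : U ∈ regions γ) :
    coverSum (φ '' U) (φ x) (fderiv ℝ (radialExt φ) x a) (fderiv ℝ (radialExt φ) x b) =
      coverSum U x a b := by
  have h1 := hc.covers_image_iff φ h hU
  have h2 := hc.neg_left.covers_image_iff φ h hU
  have h3 := hc.neg_right.covers_image_iff φ h hU
  have h4 := hc.neg_left.neg_right.covers_image_iff φ h hU
  simp only [map_neg] at h1 h2 h3 h4
  rw [coverSum, coverSum, coverCount_congr h1, coverCount_congr h2, coverCount_congr h3,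
    coverCount_congr h4]

namespace ContactCircleBundle

variable {E : Type*} [TopologicalSpace E] [ChartedSpace R3 E] [IsManifold (𝓡 3) ∞ E]
  [MulAction Circle E]
  {B : ContactCircleBundle E}

namespace LegendrianKnot

variable {L : B.LegendrianKnot}

/-- Of the four choices of signs for the two rays, exactly the two that differ by a common sign have
a positive determinant. One decorated quadrant thus determines the decoration. -/
theorem ShortChord.plusQuadrants_eq {y : doublePoints L.projection} (c : L.ShortChord y)
    {A : Set R3} (hA : A ∈ c.plusQuadrants) : ∃ a b : R3,
      IsCrossing L.projection y c.terminal c.initial a b ∧ A = cone a b ∧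
      c.plusQuadrants = {cone a b, cone (-a) (-b)} := by
  obtain ⟨a, b, ha, hb, hd, rfl⟩ := hA
  refine ⟨a, b, ⟨c.distinct.symm, c.terminal_over, c.initial_over, ha, hb⟩, rfl, ?_⟩
  have key : ∀ {u v w : R3}, (u = w ∨ u = -w) → (v = w ∨ v = -w) → (v = u ∨ v = -u) := by
    rintro u v w (rfl | rfl) (rfl | rfl) <;> simp
  ext A
  constructor
  · rintro ⟨a', b', ha', hb', hd', rfl⟩
    rcases key ha ha' with rfl | rfl <;> rcases key hb hb' with rfl | rfl
    · simp
    · rw [det3_neg_right] at hd'; linarith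
    · rw [det3_neg_mid] at hd'; linarith
    · simp
  · rintro (rfl | rfl)
    · exact ⟨a, b, ha, hb, hd, rfl⟩
    · refine ⟨-a, -b, ?_, ?_, by rwa [det3_neg_mid, det3_neg_right, neg_neg], rfl⟩
      · rcases ha with rfl | rfl <;> simp
      · rcases hb with rfl | rfl <;> simp

variable (L) in
/-- The defect of the image of a region under a diffeomorphism compatible with the decorations. -/
theorem two_pi_mul_defect (c : ∀ y : doublePoints L.projection, L.ShortChord y)
    (Γ : DecoratedCircle) (φ : Diffeomorph (𝓡 2) (𝓡 2) S2 S2 ∞)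
    (hr : φ '' range Γ.curve = range L.projection) (q : Γ.Q)
    (hq : ∀ p : Γ.Vertex, ∃ y : doublePoints L.projection, (y : S2) = φ p ∧ q p = (c y).length ∧
      ∀ A ∈ Γ.plus p, pushQuadrant φ p A ∈ (c y).plusQuadrants) (U : Γ.Region) :
    2 * π * L.defect c (φ '' (U : Set S2)) =
      surfaceIntegral (φ '' (U : Set S2)) B.curvature + Γ.Psi q U := by
  classical
  have hL : IsGenericCircle L.projection := L.generic_projection
  have hφ := Γ.generic.diffeo φ
  have hrange : range (fun t => φ (Γ.curve t)) = range L.projection := by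
    rw [range_diffeo, hr]
  choose f hf1 hf2 hf3 using hq
  -- Surjectivity rests on the equality of images: a double point of the projection is a double
  -- point of the moved curve.
  have hbij : Function.Bijective f := by
    constructor
    · intro p p' hp
      apply Subtype.ext
      exact φ.injective ((hf1 p).symm.trans ((congrArg Subtype.val hp).trans (hf1 p')))
    · intro y
      have hy : (y : S2) ∈ doublePoints fun t => φ (Γ.curve t) :=
        doublePoints_subset_of_range_subset hφ hL hrange.ge y.2
      obtain ⟨s, t, hst, hs, ht⟩ := hy
      refine ⟨⟨Γ.curve s, s, t, hst, rfl, φ.injective (ht.trans hs.symm)⟩, ?_⟩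
      apply Subtype.ext
      exact (hf1 _).trans hs
  unfold defect
  rw [← mul_assoc, mul_one_div_cancel (by positivity), one_mul]
  congr 1
  rw [Γ.Psi_apply]
  symm
  refine finsum_eq_of_bijective f hbij fun p => ?_
  obtain ⟨s, t, a, b, hc, hp⟩ := Γ.exists_isCrossing_plus p
  have hquad : quadrants L.projection (f p) = quadrants (fun t => φ (Γ.curve t)) (f p) :=
    quadrants_eq_of_range_subset hφ hL hrange.ge (f p).2
  have hmem := hf3 p (cone a b) (by simp [hp])
  obtain ⟨a', b', hc', he, hplus⟩ := (c (f p)).plusQuadrants_eq hmem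
  rw [hc.pushQuadrant_cone φ Γ.generic] at he
  have hplus' : (c (f p)).plusQuadrants =
      {cone (fderiv ℝ (radialExt φ) p a) (fderiv ℝ (radialExt φ) p b),
        cone (-fderiv ℝ (radialExt φ) p a) (-fderiv ℝ (radialExt φ) p b)} := by
    rw [hplus, ← neg_mem_cone, ← neg_mem_cone, he]
  have hcd := hc.diffeo φ Γ.generic
  rw [hquad, Γ.Psi_single_apply hc hp, hf2]
  have e := hf1 p
  rw [e, hcd.finsum_signed_length hφ _ hplus', hc.coverSum_image φ Γ.generic U.2]

end LegendrianKnot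

end ContactCircleBundle

/-! ### Volumes in three-space -/

section Volume

/-- The splitting of three-space into a line and a plane. -/
def splitR3 : R3 ≃ᵐ ℝ × ℂ :=
  ((MeasurableEquiv.toLp 2 (Fin 3 → ℝ)).symm.trans
    (MeasurableEquiv.piFinSuccAbove (fun _ : Fin 3 => ℝ) 0)).trans
    ((MeasurableEquiv.refl ℝ).prodCongr Complex.measurableEquivPi.symm)

theorem splitR3_apply (y : R3) : splitR3 y = (y 0, ⟨y 1, y 2⟩) := by
  refine Prod.ext rfl ?_
  apply Complex.measurableEquivPi.injective
  simp [splitR3, MeasurableEquiv.piFinSuccAbove, MeasurableEquiv.prodCongr,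
      Complex.measurableEquivPi]
  exact ⟨rfl, rfl⟩

theorem measurePreserving_splitR3 : MeasurePreserving splitR3 :=
  (((MeasurePreserving.id volume).prod (Complex.volume_preserving_equiv_pi.symm _)).comp
    (volume_preserving_piFinSuccAbove (fun _ : Fin 3 => ℝ) 0)).comp
      (PiLp.volume_preserving_ofLp (Fin 3))

theorem det_continuousLinearMap_R3 (D : R3 →L[ℝ] R3) :
    D.det = det3 (D (EuclideanSpace.single 0 1)) (D (EuclideanSpace.single 1 1))
      (D (EuclideanSpace.single 2 1)) := by
  rw [ContinuousLinearMap.det, ← LinearMap.det_toMatrix (EuclideanSpace.basisFun (Fin 3) ℝ).toBasis,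
    ← Matrix.det_transpose, det3]
  congr 1
  ext i j
  fin_cases i <;> simp [LinearMap.toMatrix_apply]

end Volume


/-! ### Area in parametrized pieces of the sphere -/

section Area

open scoped Pointwise

/-- The Jacobian of a parametrization of a piece of the sphere. -/
def areaJac (Ψ : ℂ → S2) (ζ : ℂ) : ℝ :=
  det3 (Ψ ζ) (fderiv ℝ (fun z => (Ψ z : R3)) ζ 1) (fderiv ℝ (fun z => (Ψ z : R3)) ζ Complex.I)

/-- The cone over a parametrized piece of the sphere. -/
def coneMap (Ψ : ℂ → S2) (y : R3) : R3 := y 0 • (Ψ (splitR3 y).2 : R3)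

/-- The second component of the splitting of three-space. -/
def planePart : R3 →L[ℝ] ℂ :=
  (EuclideanSpace.proj 1 : R3 →L[ℝ] ℝ).smulRight 1 +
    (EuclideanSpace.proj 2 : R3 →L[ℝ] ℝ).smulRight Complex.I

theorem splitR3_snd (y : R3) : (splitR3 y).2 = planePart y := by
  rw [splitR3_apply]
  apply Complex.ext <;> simp [planePart]

variable {Ψ : ℂ → S2}

theorem hasFDerivAt_coneMap (hΨ : ContDiff ℝ 1 fun ζ => (Ψ ζ : R3)) (y : R3) :
    HasFDerivAt (coneMap Ψ) (y 0 • (fderiv ℝ (fun z => (Ψ z : R3)) (splitR3 y).2).comp planePart +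
      (EuclideanSpace.proj 0 : R3 →L[ℝ] ℝ).smulRight (Ψ (splitR3 y).2 : R3)) y := by
  have h1 : HasFDerivAt (fun y : R3 => y 0) (EuclideanSpace.proj 0 : R3 →L[ℝ] ℝ) y :=
    (EuclideanSpace.proj 0 : R3 →L[ℝ] ℝ).hasFDerivAt
  have h2 : HasFDerivAt (fun y : R3 => (Ψ (splitR3 y).2 : R3))
      ((fderiv ℝ (fun z => (Ψ z : R3)) (splitR3 y).2).comp planePart) y := by
    have h3 := (hΨ.differentiable one_ne_zero (planePart y)).hasFDerivAt.comp y planePart.hasFDerivAt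
    simp only [splitR3_snd]
    exact h3
  exact h1.smul h2

theorem det_fderiv_coneMap (y : R3) :
    (y 0 • (fderiv ℝ (fun z => (Ψ z : R3)) (splitR3 y).2).comp planePart +
      (EuclideanSpace.proj 0 : R3 →L[ℝ] ℝ).smulRight (Ψ (splitR3 y).2 : R3)).det =
      y 0 ^ 2 * areaJac Ψ (splitR3 y).2 := by
  rw [det_continuousLinearMap_R3]
  simp only [planePart, add_apply, smul_apply,
    ContinuousLinearMap.comp_apply, ContinuousLinearMap.smulRight_apply]
  simp [det3_smul_mid, det3_smul_right, areaJac]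
  ring

theorem image_coneMap (A : Set ℂ) :
    coneMap Ψ '' (splitR3 ⁻¹' (Ioo 0 1 ×ˢ A)) = Ioo (0 : ℝ) 1 • ((↑) '' (Ψ '' A) : Set R3) := by
  ext z
  simp only [Set.mem_smul, mem_image, mem_preimage, mem_prod]
  constructor
  · rintro ⟨y, ⟨h1, h2⟩, rfl⟩
    rw [splitR3_apply] at h1
    exact ⟨y 0, h1, _, ⟨_, ⟨_, h2, rfl⟩, rfl⟩, rfl⟩
  · rintro ⟨r, hr, _, ⟨_, ⟨ζ, hζ, rfl⟩, rfl⟩, rfl⟩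
    have h := splitR3.apply_symm_apply (r, ζ)
    refine ⟨splitR3.symm (r, ζ), ⟨by rw [h]; exact hr, by rw [h]; exact hζ⟩, ?_⟩
    rw [coneMap, h]
    rw [splitR3_apply] at h
    have h0 := congrArg Prod.fst h
    simp only at h0
    rw [h0]

theorem injOn_coneMap (hinj : Function.Injective Ψ) (A : Set ℂ) :
    InjOn (coneMap Ψ) (splitR3 ⁻¹' (Ioo 0 1 ×ˢ A)) := by
  rintro y ⟨⟨h1, -⟩, -⟩ y' ⟨⟨h1', -⟩, -⟩ h
  rw [splitR3_apply] at h1 h1'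
  simp only at h1 h1'
  have h2 := congrArg norm h
  simp only [coneMap, norm_smul, S2.norm_coe, mul_one, Real.norm_of_nonneg h1.le,
    Real.norm_of_nonneg h1'.le] at h2
  simp only [coneMap, h2] at h
  have h3 := hinj (Subtype.ext (smul_right_injective R3 h1'.ne' h))
  apply splitR3.injective
  refine Prod.ext ?_ h3
  rw [splitR3_apply, splitR3_apply]
  exact h2

/-- The measure on the sphere is defined as three times the volume of the cone over a set. The cone
is parametrized by radius and plane coordinate with Jacobian `r ^ 2 * areaJac`, and the radial
integral separates. -/
theorem toSphere_image (hΨ : ContDiff ℝ 1 fun ζ => (Ψ ζ : R3)) (hinj : Function.Injective Ψ)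
    {A : Set ℂ} (hA : MeasurableSet A) :
    (volume : Measure R3).toSphere (Ψ '' A) = ∫⁻ ζ in A, ENNReal.ofReal |areaJac Ψ ζ| := by
  have hcont : Continuous Ψ := continuous_induced_rng.2 hΨ.continuous
  have hS : MeasurableSet (splitR3 ⁻¹' (Ioo 0 1 ×ˢ A)) :=
    splitR3.measurable (measurableSet_Ioo.prod hA)
  have hJ : Continuous (areaJac Ψ) := by
    have := hΨ.continuous_fderiv one_ne_zero
    have h1 : Continuous fun ζ => fderiv ℝ (fun z => (Ψ z : R3)) ζ 1 := by fun_prop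
    have h2 : Continuous fun ζ => fderiv ℝ (fun z => (Ψ z : R3)) ζ Complex.I := by fun_prop
    have h0 := hΨ.continuous
    unfold areaJac
    simp only [det3_apply]
    fun_prop
  rw [Measure.toSphere_apply' _ ((hcont.measurableEmbedding hinj).measurableSet_image.2 hA),
    ← image_coneMap, ← setLIntegral_one,
    lintegral_image_eq_lintegral_abs_det_fderiv_mul volume hS
      (fun y _ => (hasFDerivAt_coneMap hΨ y).hasFDerivWithinAt) (injOn_coneMap hinj A)]
  simp only [mul_one, det_fderiv_coneMap]
  have h1 : ∀ y : R3, ENNReal.ofReal |y 0 ^ 2 * areaJac Ψ (splitR3 y).2| =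
      (fun p : ℝ × ℂ => ENNReal.ofReal (p.1 ^ 2) * ENNReal.ofReal |areaJac Ψ p.2|)
        (splitR3 y) := by
    intro y
    have e : (splitR3 y).1 = y 0 := by rw [splitR3_apply]
    simp only [e]
    rw [abs_mul, abs_of_nonneg (sq_nonneg _), ENNReal.ofReal_mul (sq_nonneg _)]
  simp only [h1]
  rw [measurePreserving_splitR3.setLIntegral_comp_preimage_emb splitR3.measurableEmbedding
    (fun p : ℝ × ℂ => ENNReal.ofReal (p.1 ^ 2) * ENNReal.ofReal |areaJac Ψ p.2|),
    Measure.volume_eq_prod, ← Measure.prod_restrict,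
    lintegral_prod_mul (f := fun r : ℝ => ENNReal.ofReal (r ^ 2))
      (g := fun ζ => ENNReal.ofReal |areaJac Ψ ζ|) (by fun_prop) (by fun_prop),
    ← ofReal_integral_eq_lintegral_ofReal _ (Eventually.of_forall fun r => sq_nonneg r)]
  · rw [← integral_Ioc_eq_integral_Ioo, ← intervalIntegral.integral_of_le zero_le_one]
    rw [← mul_assoc]
    -- The dimension factor `3` cancels the radial integral `1 / 3`.
    have : ((Module.finrank ℝ R3 : ℕ) : ENNReal) * ENNReal.ofReal (∫ r in (0 : ℝ)..1, r ^ 2) = 1 :=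
        by
      rw [integral_pow]
      simp
      rw [ENNReal.ofReal_inv_of_pos (by norm_num)]
      norm_num
      exact ENNReal.mul_inv_cancel (by simp) (by simp)
    rw [this, one_mul]
  · exact ((continuous_pow 2).integrableOn_Icc (μ := volume) (a := (0 : ℝ)) (b := 1)).mono_set
      Ioo_subset_Icc_self

theorem continuous_areaJac (hΨ : ContDiff ℝ 1 fun ζ => (Ψ ζ : R3)) : Continuous (areaJac Ψ) := by
  have := hΨ.continuous_fderiv one_ne_zero
  have h1 : Continuous fun ζ => fderiv ℝ (fun z => (Ψ z : R3)) ζ 1 := by fun_prop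
  have h2 : Continuous fun ζ => fderiv ℝ (fun z => (Ψ z : R3)) ζ Complex.I := by fun_prop
  have h0 := hΨ.continuous
  unfold areaJac
  simp only [det3_apply]
  fun_prop

/-- Surface integrals in a parametrization. -/
theorem surfaceIntegral_image (hΨ : ContDiff ℝ 1 fun ζ => (Ψ ζ : R3))
    (hinj : Function.Injective Ψ) {A : Set ℂ} (hA : MeasurableSet A) (f : S2 → ℝ) :
    surfaceIntegral (Ψ '' A) f = ∫ ζ in A, |areaJac Ψ ζ| * f (Ψ ζ) := by
  have hcont : Continuous Ψ := continuous_induced_rng.2 hΨ.continuous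
  have he := hcont.measurableEmbedding hinj
  have hJ := continuous_areaJac hΨ
  have h1 : ((volume : Measure R3).toSphere).restrict (Ψ '' A) =
      Measure.map Ψ ((volume.restrict A).withDensity fun ζ => ENNReal.ofReal |areaJac Ψ ζ|) := by
    ext T hT
    have e : T ∩ Ψ '' A = Ψ '' (Ψ ⁻¹' T ∩ A) := by
      rw [image_preimage_inter]
    have hT' := hcont.measurable hT
    rw [Measure.restrict_apply hT, e, toSphere_image hΨ hinj (hT'.inter hA),
      Measure.map_apply hcont.measurable hT, withDensity_apply _ hT',
      Measure.restrict_restrict hT']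
  rw [surfaceIntegral, h1, he.integral_map,
    integral_withDensity_eq_integral_toReal_smul (by fun_prop) (by simp)]
  simp

/-- A curve in the sphere has area zero. -/
theorem toSphere_range_curve {γ : ℝ → S2} (hγ : ContDiff ℝ 1 fun t => (γ t : R3)) :
    (volume : Measure R3).toSphere (range γ) = 0 := by
  have hcont : Continuous γ := continuous_induced_rng.2 hγ.continuous
  have hmeas : MeasurableSet (range γ) := by
    have : range γ = ⋃ n : ℕ, γ '' Icc (-n : ℝ) n := by
      rw [← image_iUnion, ← image_univ]
      congr 1
      symm
      rw [eq_univ_iff_forall]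
      intro t
      obtain ⟨n, hn⟩ := exists_nat_ge |t|
      exact mem_iUnion.2 ⟨n, by rw [mem_Icc]; exact abs_le.1 hn⟩
    rw [this]
    exact MeasurableSet.iUnion fun n => (isCompact_Icc.image hcont).measurableSet
  rw [Measure.toSphere_apply' _ hmeas]
  -- The cone over the curve is covered by a map of `R3` that ignores one coordinate, so its
  -- derivative is singular everywhere and its image is a null set.
  have hsub : (Ioo (0 : ℝ) 1 • ((↑) '' range γ : Set R3)) ⊆
      (fun y : R3 => y 0 • (γ (y 1) : R3)) '' univ := by
    rintro _ ⟨r, hr, _, ⟨_, ⟨t, rfl⟩, rfl⟩, rfl⟩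
    exact ⟨!₂[r, t, 0], mem_univ _, by simp⟩
  have hd : ∀ y : R3, HasFDerivAt (fun y : R3 => y 0 • (γ (y 1) : R3))
      (y 0 • (fderiv ℝ (fun t => (γ t : R3)) (y 1)).comp (EuclideanSpace.proj 1 : R3 →L[ℝ] ℝ) +
        (EuclideanSpace.proj 0 : R3 →L[ℝ] ℝ).smulRight (γ (y 1) : R3)) y := by
    intro y
    have h1 : HasFDerivAt (fun y : R3 => y 0) (EuclideanSpace.proj 0 : R3 →L[ℝ] ℝ) y :=
      (EuclideanSpace.proj 0 : R3 →L[ℝ] ℝ).hasFDerivAt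
    have h2 : HasFDerivAt (fun y : R3 => y 1) (EuclideanSpace.proj 1 : R3 →L[ℝ] ℝ) y :=
      (EuclideanSpace.proj 1 : R3 →L[ℝ] ℝ).hasFDerivAt
    exact h1.smul ((hγ.differentiable one_ne_zero (y 1)).hasFDerivAt.comp
      (f := fun y : R3 => y 1) y h2)
  have := addHaar_image_eq_zero_of_det_fderivWithin_eq_zero (volume : Measure R3)
    (s := univ) (fun (y : R3) _ => (hd y).hasFDerivWithinAt) (fun y _ => by
      rw [det_continuousLinearMap_R3]
      simp [det3_apply])
  rw [measure_mono_null hsub this, mul_zero]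

/-- A curve in the plane has area zero. -/
theorem volume_range_curve {c : ℝ → ℂ} (hc : ContDiff ℝ 1 c) : volume (range c) = 0 := by
  -- The curve is extended to the plane as a function of the real part, with `I` in the kernel of
  -- every derivative.
  have h := addHaar_image_eq_zero_of_det_fderivWithin_eq_zero (volume : Measure ℂ) (s := univ)
    (f := fun z => c z.re) (f' := fun z => (fderiv ℝ c z.re).comp Complex.reCLM)
    (fun z _ => ((hc.differentiable one_ne_zero z.re).hasFDerivAt.comp z
      Complex.reCLM.hasFDerivAt).hasFDerivWithinAt) (fun z _ => by
      refine LinearMap.det_eq_zero_iff_ker_ne_bot.2 fun h => ?_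
      have h1 : Complex.I ∈ LinearMap.ker
        (((fderiv ℝ c z.re).comp Complex.reCLM : ℂ →L[ℝ] ℂ) : ℂ →ₗ[ℝ] ℂ) := by simp
      rw [h] at h1
      exact Complex.I_ne_zero h1)
  refine measure_mono_null ?_ h
  rintro _ ⟨t, rfl⟩
  exact ⟨t, mem_univ _, by simp⟩

end Area

/-! ### Stereographic coordinates -/

section Stereo

/-- Twice the product of `1 + |ζ|²` and the inverse stereographic projection. -/
def stereoNum (ζ : ℂ) : R3 :=
  (2 * ζ.re) • EuclideanSpace.single 0 1 + (2 * ζ.im) • EuclideanSpace.single 1 1 +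
    (1 - (ζ.re ^ 2 + ζ.im ^ 2)) • EuclideanSpace.single 2 1

/-- The denominator of the inverse stereographic projection. -/
def stereoDen (ζ : ℂ) : ℝ := 1 + (ζ.re ^ 2 + ζ.im ^ 2)

theorem stereoDen_pos (ζ : ℂ) : 0 < stereoDen ζ := by unfold stereoDen; positivity

theorem stereoNum_zero (ζ : ℂ) : stereoNum ζ 0 = 2 * ζ.re := by simp [stereoNum]
theorem stereoNum_one (ζ : ℂ) : stereoNum ζ 1 = 2 * ζ.im := by simp [stereoNum]
theorem stereoNum_two (ζ : ℂ) : stereoNum ζ 2 = 1 - (ζ.re ^ 2 + ζ.im ^ 2) := by simp [stereoNum]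

theorem norm_eq_one_iff_R3 (v : R3) : ‖v‖ = 1 ↔ v 0 ^ 2 + v 1 ^ 2 + v 2 ^ 2 = 1 := by
  rw [EuclideanSpace.norm_eq, Real.sqrt_eq_one, Fin.sum_univ_three]
  simp

/-- The inverse of the stereographic projection from the south pole. -/
def stereo (ζ : ℂ) : S2 :=
  ⟨(stereoDen ζ)⁻¹ • stereoNum ζ, by
    rw [mem_sphere_zero_iff_norm, norm_eq_one_iff_R3]
    have := (stereoDen_pos ζ).ne'
    simp only [PiLp.smul_apply, smul_eq_mul, stereoNum_zero, stereoNum_one, stereoNum_two]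
    field_simp
    unfold stereoDen
    ring⟩

/-- The stereographic projection from the south pole. -/
def stereoProj (x : R3) : ℂ := ⟨x 0 / (1 + x 2), x 1 / (1 + x 2)⟩

theorem coe_stereo (ζ : ℂ) : (stereo ζ : R3) = (stereoDen ζ)⁻¹ • stereoNum ζ := rfl

theorem stereo_two (ζ : ℂ) : (stereo ζ : R3) 2 = 2 / stereoDen ζ - 1 := by
  have := (stereoDen_pos ζ).ne'
  rw [coe_stereo, PiLp.smul_apply, stereoNum_two, smul_eq_mul]
  field_simp
  unfold stereoDen
  ring

theorem stereo_two_ne (ζ : ℂ) : (stereo ζ : R3) 2 ≠ -1 := by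
  rw [stereo_two]
  have := div_pos two_pos (stereoDen_pos ζ)
  linarith

@[simp] theorem stereoProj_stereo (ζ : ℂ) : stereoProj (stereo ζ) = ζ := by
  have := (stereoDen_pos ζ).ne'
  have e : (1 : ℝ) + (stereo ζ : R3) 2 = 2 / stereoDen ζ := by rw [stereo_two]; ring
  apply Complex.ext
  · show (stereo ζ : R3) 0 / (1 + (stereo ζ : R3) 2) = ζ.re
    rw [e, coe_stereo, PiLp.smul_apply, stereoNum_zero, smul_eq_mul]
    field_simp
  · show (stereo ζ : R3) 1 / (1 + (stereo ζ : R3) 2) = ζ.im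
    rw [e, coe_stereo, PiLp.smul_apply, stereoNum_one, smul_eq_mul]
    field_simp

theorem stereo_injective : Function.Injective stereo := fun a b h => by
  rw [← stereoProj_stereo a, h, stereoProj_stereo]

theorem S2.sum_sq (x : S2) : (x : R3) 0 ^ 2 + (x : R3) 1 ^ 2 + (x : R3) 2 ^ 2 = 1 :=
  (norm_eq_one_iff_R3 _).1 x.norm_coe

theorem one_add_ne_zero {x : S2} (hx : (x : R3) 2 ≠ -1) : 1 + (x : R3) 2 ≠ 0 := fun h =>
  hx (by linarith)

theorem stereo_stereoProj {x : S2} (hx : (x : R3) 2 ≠ -1) : stereo (stereoProj x) = x := by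
  have h1 := one_add_ne_zero hx
  have h2 := x.sum_sq
  have h3 : stereoDen (stereoProj x) = 2 / (1 + (x : R3) 2) := by
    rw [stereoDen, stereoProj]
    field_simp
    linear_combination h2
  apply Subtype.ext
  ext i
  rw [coe_stereo, PiLp.smul_apply, h3]
  fin_cases i
  · simp [stereoNum_zero, stereoProj]; field_simp
  · simp [stereoNum_one, stereoProj]; field_simp
  · simp [stereoNum_two, stereoProj]; field_simp; linear_combination -h2

theorem range_stereo : range stereo = {x : S2 | (x : R3) 2 ≠ -1} := by
  ext x
  constructor
  · rintro ⟨ζ, rfl⟩; exact stereo_two_ne ζ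
  · intro hx; exact ⟨_, stereo_stereoProj hx⟩

theorem eq_southPole_iff (x : S2) : (x : R3) 2 = -1 ↔ x = southPole := by
  constructor
  · intro h
    have := x.sum_sq
    rw [h] at this
    have h0 : (x : R3) 0 = 0 := by nlinarith [sq_nonneg ((x : R3) 0), sq_nonneg ((x : R3) 1)]
    have h1 : (x : R3) 1 = 0 := by nlinarith [sq_nonneg ((x : R3) 0), sq_nonneg ((x : R3) 1)]
    apply Subtype.ext
    ext i
    fin_cases i <;> simp [southPole, h, h0, h1]
  · rintro rfl; simp [southPole]

/-- The derivative of the numerator of the inverse stereographic projection. -/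
def stereoNumDeriv (ζ : ℂ) : ℂ →L[ℝ] R3 :=
  ((2 : ℝ) • Complex.reCLM).smulRight (EuclideanSpace.single 0 1) +
    ((2 : ℝ) • Complex.imCLM).smulRight (EuclideanSpace.single 1 1) +
    (-((2 * ζ.re) • Complex.reCLM + (2 * ζ.im) • Complex.imCLM)).smulRight
      (EuclideanSpace.single 2 1)

theorem hasFDerivAt_stereoNum (ζ : ℂ) : HasFDerivAt stereoNum (stereoNumDeriv ζ) ζ := by
  have hre : HasFDerivAt (fun z : ℂ => z.re) Complex.reCLM ζ := Complex.reCLM.hasFDerivAt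
  have him : HasFDerivAt (fun z : ℂ => z.im) Complex.imCLM ζ := Complex.imCLM.hasFDerivAt
  have h3 := ((hre.pow 2).add (him.pow 2)).const_sub 1
  convert! (((hre.const_mul 2).smul_const (EuclideanSpace.single 0 1 : R3)).add
    ((him.const_mul 2).smul_const (EuclideanSpace.single 1 1 : R3))).add
    (h3.smul_const (EuclideanSpace.single 2 1 : R3)) using 1
  simp [stereoNumDeriv]

theorem contDiff_stereoNum : ContDiff ℝ ∞ stereoNum := by
  have hre : ContDiff ℝ ∞ fun z : ℂ => z.re := Complex.reCLM.contDiff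
  have him : ContDiff ℝ ∞ fun z : ℂ => z.im := Complex.imCLM.contDiff
  unfold stereoNum
  fun_prop

theorem contDiff_stereoDen : ContDiff ℝ ∞ stereoDen := by
  have hre : ContDiff ℝ ∞ fun z : ℂ => z.re := Complex.reCLM.contDiff
  have him : ContDiff ℝ ∞ fun z : ℂ => z.im := Complex.imCLM.contDiff
  unfold stereoDen
  fun_prop

theorem contDiff_coe_stereo : ContDiff ℝ ∞ fun ζ => (stereo ζ : R3) :=
  (contDiff_stereoDen.inv fun ζ => (stereoDen_pos ζ).ne').smul contDiff_stereoNum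

theorem contMDiff_stereo : ContMDiff 𝓘(ℝ, ℂ) (𝓡 2) ∞ stereo := fun _ =>
  contMDiffAt_sphere_of_coe contDiff_coe_stereo.contMDiff.contMDiffAt

theorem areaJac_stereo (ζ : ℂ) : areaJac stereo ζ = 4 / stereoDen ζ ^ 2 := by
  have hd : HasFDerivAt (fun ζ => (stereo ζ : R3)) _ ζ :=
    (((contDiff_stereoDen.inv fun ζ => (stereoDen_pos ζ).ne').differentiable
      (by simp) ζ).hasFDerivAt).smul (hasFDerivAt_stereoNum ζ)
  rw [areaJac, hd.fderiv]
  generalize fderiv ℝ stereoDen⁻¹ ζ = D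
  have hn := (stereoDen_pos ζ).ne'
  rw [coe_stereo]
  simp only [add_apply, smul_apply, ContinuousLinearMap.smulRight_apply, Pi.inv_apply]
  generalize D 1 = d₁
  generalize D Complex.I = d₂
  -- Differentiating the scalar factor only adds multiples of the position vector, which the
  -- determinant does not see.
  have e : ∀ (r d₁ d₂ : ℝ) (g g₁ g₂ : R3), det3 (r • g) (r • g₁ + d₁ • g) (r • g₂ + d₂ • g) =
      r ^ 3 * det3 g g₁ g₂ := by
    intro r d₁ d₂ g g₁ g₂
    simp [det3_apply]; ring
  rw [e]
  have e2 : det3 (stereoNum ζ) (stereoNumDeriv ζ 1) (stereoNumDeriv ζ Complex.I) =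
      4 * stereoDen ζ := by
    simp [det3_apply, stereoNum, stereoNumDeriv, stereoDen]; ring
  rw [e2]
  field_simp

theorem areaJac_stereo_pos (ζ : ℂ) : 0 < areaJac stereo ζ := by
  rw [areaJac_stereo]
  have := stereoDen_pos ζ
  positivity

theorem contDiffAt_stereoProj {x : R3} (hx : 1 + x 2 ≠ 0) : ContDiffAt ℝ ∞ stereoProj x := by
  have e : stereoProj = fun x => ((x 0 / (1 + x 2) : ℝ) : ℂ) +
      ((x 1 / (1 + x 2) : ℝ) : ℂ) * Complex.I := by
    funext x
    apply Complex.ext <;> simp only [stereoProj, Complex.add_re, Complex.add_im, Complex.mul_re,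
      Complex.mul_im, Complex.ofReal_re, Complex.ofReal_im, Complex.I_re, Complex.I_im] <;> ring
  rw [e]
  have h : ∀ i : Fin 3, ContDiffAt ℝ ∞ (fun x : R3 => x i) x := fun i =>
    (EuclideanSpace.proj i : R3 →L[ℝ] ℝ).contDiff.contDiffAt
  have h2 : ContDiffAt ℝ ∞ (fun x : R3 => 1 + x 2) x := contDiffAt_const.add (h 2)
  exact (Complex.ofRealCLM.contDiff.contDiffAt.comp x ((h 0).div h2 hx)).add
    ((Complex.ofRealCLM.contDiff.contDiffAt.comp x ((h 1).div h2 hx)).mul contDiffAt_const)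

/-- The half turn of the sphere around the first coordinate axis. -/
def halfTurn (x : S2) : S2 := ⟨!₂[(x : R3) 0, -(x : R3) 1, -(x : R3) 2], by
  rw [mem_sphere_zero_iff_norm, norm_eq_one_iff_R3]
  have := x.sum_sq
  simpa using this⟩

theorem coe_halfTurn (x : S2) : (halfTurn x : R3) = !₂[(x : R3) 0, -(x : R3) 1, -(x : R3) 2] := rfl

/-- The half turn of three-space around the first coordinate axis. -/
def halfTurnCLM : R3 →L[ℝ] R3 :=
  (EuclideanSpace.proj 0 : R3 →L[ℝ] ℝ).smulRight (EuclideanSpace.single 0 1) -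
    (EuclideanSpace.proj 1 : R3 →L[ℝ] ℝ).smulRight (EuclideanSpace.single 1 1) -
    (EuclideanSpace.proj 2 : R3 →L[ℝ] ℝ).smulRight (EuclideanSpace.single 2 1)

theorem coe_halfTurn_eq (x : S2) : (halfTurn x : R3) = halfTurnCLM x := by
  rw [coe_halfTurn]
  ext i
  fin_cases i <;> simp [halfTurnCLM]

@[simp] theorem halfTurn_halfTurn (x : S2) : halfTurn (halfTurn x) = x := by
  apply Subtype.ext
  rw [coe_halfTurn, coe_halfTurn]
  ext i
  fin_cases i <;> simp

/-- The inverse of the stereographic projection from the north pole. -/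
def stereoS (ζ : ℂ) : S2 := halfTurn (stereo ζ)

theorem contDiff_coe_stereoS : ContDiff ℝ ∞ fun ζ => (stereoS ζ : R3) := by
  have : (fun ζ => (stereoS ζ : R3)) = fun ζ => halfTurnCLM (stereo ζ) := by
    funext ζ; exact coe_halfTurn_eq _
  rw [this]
  exact halfTurnCLM.contDiff.comp contDiff_coe_stereo

theorem contMDiff_stereoS : ContMDiff 𝓘(ℝ, ℂ) (𝓡 2) ∞ stereoS := fun _ =>
  contMDiffAt_sphere_of_coe contDiff_coe_stereoS.contMDiff.contMDiffAt

/-- A half turn preserves the determinant, unlike a reflection; so the chart at the other pole is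
positively oriented as well. -/
theorem areaJac_stereoS (ζ : ℂ) : areaJac stereoS ζ = areaJac stereo ζ := by
  have h : (fun ζ => (stereoS ζ : R3)) = halfTurnCLM ∘ fun ζ => (stereo ζ : R3) := by
    funext ζ; exact coe_halfTurn_eq _
  have hd := halfTurnCLM.hasFDerivAt.comp ζ
    ((contDiff_coe_stereo.differentiable (by simp) ζ).hasFDerivAt)
  rw [areaJac, areaJac, h, hd.fderiv, stereoS, coe_halfTurn_eq]
  simp [det3_apply, halfTurnCLM]
  ring

theorem stereoS_injective : Function.Injective stereoS := fun a b h => stereo_injective (by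
  rw [← halfTurn_halfTurn (stereo a), ← halfTurn_halfTurn (stereo b)]; exact congrArg halfTurn h)

theorem stereoS_two (ζ : ℂ) : (stereoS ζ : R3) 2 = 1 - 2 / stereoDen ζ := by
  rw [stereoS, coe_halfTurn]
  have := stereo_two ζ
  simp [this]

theorem stereoS_two_ne (ζ : ℂ) : (stereoS ζ : R3) 2 ≠ 1 := by
  rw [stereoS_two]
  have := div_pos two_pos (stereoDen_pos ζ)
  linarith

end Stereo

/-! ### Pullbacks of the connection form -/

namespace CircleBundleWithConnection

variable {E : Type*} [TopologicalSpace E] [ChartedSpace R3 E] [IsManifold (𝓡 3) ∞ E]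
  [MulAction Circle E]
  (B : CircleBundleWithConnection E)

section Pull

variable {F : Type*} [NormedAddCommGroup F] [NormedSpace ℝ F]

/-- The pullback of the connection form under a map from a normed space. -/
def pullForm (s : F → E) (y : F) : F →L[ℝ] ℝ :=
  (B.form (s y)).comp (mfderiv 𝓘(ℝ, F) (𝓡 3) s y)

theorem contDiffOn_pullForm {s : F → E} {T : Set F} (hT : IsOpen T)
    (hs : ContMDiffOn 𝓘(ℝ, F) (𝓡 3) ∞ s T) (v : F) :
    ContDiffOn ℝ ∞ (fun y => B.pullForm s y v) T := by
  have hM : IsManifold (𝓡 3) 1 E := IsManifold.of_le (n := ∞) (by simp)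
  have h1 : ContMDiffOn 𝓘(ℝ, F) 𝓘(ℝ, F).tangent ∞
      (fun x : F => (⟨x, v⟩ : TangentBundle 𝓘(ℝ, F) F)) T :=
    contMDiffOn_vectorSpace_iff_contDiffOn.2 contDiffOn_const
  have h2 : ContMDiffOn 𝓘(ℝ, F).tangent (𝓡 3).tangent ∞ (tangentMapWithin 𝓘(ℝ, F) (𝓡 3) s T)
      (Bundle.TotalSpace.proj ⁻¹' T) :=
    hs.contMDiffOn_tangentMapWithin (by simp) hT.uniqueMDiffOn
  have h3 := B.smooth_form.comp_contMDiffOn (h2.comp h1 fun x hx => hx)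
  rw [contMDiffOn_iff_contDiffOn] at h3
  refine h3.congr fun y hy => ?_
  show _ = B.form (s y) (mfderivWithin 𝓘(ℝ, F) (𝓡 3) s T y v)
  rw [mfderivWithin_of_isOpen hT hy]
  rfl

theorem contDiffAt_pullForm [FiniteDimensional ℝ F] {s : F → E} {T : Set F} (hT : IsOpen T)
    (hs : ContMDiffOn 𝓘(ℝ, F) (𝓡 3) ∞ s T) {y : F} (hy : y ∈ T) :
    ContDiffAt ℝ ∞ (B.pullForm s) y :=
  (contDiffOn_clm_apply.2 fun v => B.contDiffOn_pullForm hT hs v).contDiffAt (hT.mem_nhds hy)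

end Pull

/-- The exterior derivative commutes with pullback along `χ ∘ s`, where `χ` is the chart at `s ζ`
used in the definition. This reduces curvature to the curl of a form on the plane. -/
theorem extDerivOneForm_eq {s : ℂ → E} (hs : ContMDiff 𝓘(ℝ, ℂ) (𝓡 3) ∞ s) (ζ : ℂ) :
    extDerivOneForm B.form (s ζ) (mfderiv 𝓘(ℝ, ℂ) (𝓡 3) s ζ (1 : ℂ))
      (mfderiv 𝓘(ℝ, ℂ) (𝓡 3) s ζ Complex.I) =
      curl (fun z => B.pullForm s z 1) (fun z => B.pullForm s z Complex.I) ζ := by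
  set p := s ζ with hp
  set χ := extChartAt (𝓡 3) p with hχ
  set w : R3 → R3 [⋀^Fin 1]→L[ℝ] ℝ :=
    fun y => ContinuousAlternatingMap.ofSubsingleton ℝ R3 ℝ (0 : Fin 1) (B.pullForm χ.symm y)
    with hw
  set u : ℂ → R3 := fun z => χ (s z) with hu
  have hχs : ContMDiffOn 𝓘(ℝ, R3) (𝓡 3) ∞ χ.symm χ.target := contMDiffOn_extChartAt_symm p
  have hTo : IsOpen χ.target := isOpen_extChartAt_target p
  have hpt : χ p ∈ χ.target := mem_extChartAt_target p
  have hsd : ∀ z, MDifferentiableAt 𝓘(ℝ, ℂ) (𝓡 3) s z := fun z => (hs z).mdifferentiableAt (by simp)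
  have hwd : DifferentiableAt ℝ w (u ζ) := by
    have h1 := (B.contDiffAt_pullForm hTo hχs hpt).differentiableAt (by simp)
    exact ((ContinuousAlternatingMap.ofSubsingletonLIE (𝕜 := ℝ) (E := R3) (F := ℝ)
      (0 : Fin 1)).toContinuousLinearEquiv.toContinuousLinearMap.differentiableAt).comp (u ζ) h1
  have hsrc : ∀ᶠ z in 𝓝 ζ, s z ∈ χ.source :=
    hs.continuous.continuousAt.preimage_mem_nhds (extChartAt_source_mem_nhds p)
  have hχm : ∀ q ∈ χ.source, ContMDiffAt (𝓡 3) 𝓘(ℝ, R3) ∞ χ q := fun q hq =>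
    contMDiffAt_extChartAt' (by simpa [hχ] using hq)
  have hum : ContDiffAt ℝ ∞ u ζ := by
    rw [← contMDiffAt_iff_contDiffAt]
    exact (hχm p (mem_extChartAt_source p)).comp ζ (hs ζ)
  have hev : (fun z => (w (u z)).compContinuousLinearMap (fderiv ℝ u z)) =ᶠ[𝓝 ζ]
      fun z => ContinuousAlternatingMap.ofSubsingleton ℝ ℂ ℝ (0 : Fin 1) (B.pullForm s z) := by
    have hsrc' : ∀ᶠ z in 𝓝 ζ, ∀ᶠ z' in 𝓝 z, s z' ∈ χ.source := eventually_eventually_nhds.2 hsrc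
    filter_upwards [hsrc, hsrc'] with z hz hz'
    have hut : u z ∈ χ.target := χ.map_source hz
    have e1 : s =ᶠ[𝓝 z] χ.symm ∘ u := by
      filter_upwards [hz'] with z' h
      exact (χ.left_inv h).symm
    have hud : MDifferentiableAt 𝓘(ℝ, ℂ) 𝓘(ℝ, R3) u z :=
      ((hχm _ hz).mdifferentiableAt (by simp)).comp z (hsd z)
    have hsy : MDifferentiableAt 𝓘(ℝ, R3) (𝓡 3) χ.symm (u z) :=
      ((hχs (u z) hut).contMDiffAt (hTo.mem_nhds hut)).mdifferentiableAt (by simp)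
    have e2 : mfderiv 𝓘(ℝ, ℂ) (𝓡 3) s z =
        (mfderiv 𝓘(ℝ, R3) (𝓡 3) χ.symm (u z)).comp (mfderiv 𝓘(ℝ, ℂ) 𝓘(ℝ, R3) u z) := by
      rw [e1.mfderiv_eq, mfderiv_comp z hsy hud]
    have e3 : χ.symm (u z) = s z := χ.left_inv hz
    ext v
    show B.form (χ.symm (u z)) (mfderiv 𝓘(ℝ, R3) (𝓡 3) χ.symm (u z) (fderiv ℝ u z (v 0))) =
      B.form (s z) (mfderiv 𝓘(ℝ, ℂ) (𝓡 3) s z (v 0))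
    rw [e2, e3, mfderiv_eq_fderiv]
    rfl
  have hpull := extDeriv_pullback hwd hum
    (by rw [minSmoothness_of_isRCLikeNormedField]; exact WithTop.coe_le_coe.2 (le_top : (2 : ℕ∞) ≤ ⊤))
  rw [hev.extDeriv_eq] at hpull
  have hw'd : DifferentiableAt ℝ (fun z => ContinuousAlternatingMap.ofSubsingleton ℝ ℂ ℝ (0 : Fin 1)
      (B.pullForm s z)) ζ :=
    ((ContinuousAlternatingMap.ofSubsingletonLIE (𝕜 := ℝ) (E := ℂ) (F := ℝ)
      (0 : Fin 1)).toContinuousLinearEquiv.toContinuousLinearMap.differentiableAt).comp ζ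
      ((B.contDiffAt_pullForm isOpen_univ hs.contMDiffOn (mem_univ ζ)).differentiableAt (by simp))
  have h1 := extDeriv_apply hw'd ![1, Complex.I]
  have h2 : curl (fun z => B.pullForm s z 1) (fun z => B.pullForm s z Complex.I) ζ =
      (extDeriv (fun z => ContinuousAlternatingMap.ofSubsingleton ℝ ℂ ℝ (0 : Fin 1)
      (B.pullForm s z)) ζ) ![1, Complex.I] := by
    rw [h1, Fin.sum_univ_two, curl]
    simp
    rfl
  rw [h2, hpull]
  have h3 : ∀ v : ℂ, mvfderiv (𝓡 3) χ p (mfderiv 𝓘(ℝ, ℂ) (𝓡 3) s ζ v) = fderiv ℝ u ζ v := by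
    intro v
    have := mfderiv_comp ζ ((hχm p (mem_extChartAt_source p)).mdifferentiableAt (by simp)) (hsd ζ)
    rw [← mfderiv_eq_fderiv]
    show _ = mfderiv 𝓘(ℝ, ℂ) 𝓘(ℝ, R3) (χ ∘ s) ζ v
    rw [this]
    rfl
  show (extDeriv w (χ p)) ![mvfderiv (𝓡 3) χ p _, mvfderiv (𝓡 3) χ p _] = _
  rw [h3, h3, ContinuousAlternatingMap.compContinuousLinearMap_apply]
  congr 1
  ext i
  fin_cases i <;> rfl

/-- The exterior derivative of a local connection form is minus the curvature. -/
theorem curl_pullForm {s : ℂ → E} (hs : ContMDiff 𝓘(ℝ, ℂ) (𝓡 3) ∞ s) {ζ : ℂ} {k : ℝ}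
    (hk : B.IsCurvatureAt (B.proj (s ζ)) k) :
    curl (fun z => B.pullForm s z 1) (fun z => B.pullForm s z Complex.I) ζ =
      -(k * areaJac (fun z => B.proj (s z)) ζ) := by
  rw [← B.extDerivOneForm_eq hs, hk (s ζ) rfl, areaJac]
  have h3 : ∀ v : ℂ, dS (𝓡 3) B.proj (s ζ) (mfderiv 𝓘(ℝ, ℂ) (𝓡 3) s ζ v) =
      fderiv ℝ (fun z => (B.proj (s z) : R3)) ζ v := by
    intro v
    have hp : MDifferentiableAt (𝓡 3) 𝓘(ℝ, R3) (fun q => (B.proj q : R3)) (s ζ) :=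
      (contMDiff_coe_S2.comp B.smooth_proj (s ζ)).mdifferentiableAt (n := ∞) (by simp)
    have := mfderiv_comp ζ hp ((hs ζ).mdifferentiableAt (by simp))
    rw [← mfderiv_eq_fderiv]
    show _ = mfderiv 𝓘(ℝ, ℂ) 𝓘(ℝ, R3) ((fun q => (B.proj q : R3)) ∘ s) ζ v
    rw [this]
    rfl
  rw [h3, h3]

end CircleBundleWithConnection

/-! ### Rotated sections -/

namespace CircleBundleWithConnection

variable {E : Type*} [TopologicalSpace E] [ChartedSpace R3 E] [IsManifold (𝓡 3) ∞ E]
  [MulAction Circle E]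
  (B : CircleBundleWithConnection E)

section Pull

variable {F G : Type*} [NormedAddCommGroup F] [NormedSpace ℝ F] [NormedAddCommGroup G]
  [NormedSpace ℝ G]

theorem pullForm_comp {s : F → E} {g : G → F} {y : G}
    (hs : MDifferentiableAt 𝓘(ℝ, F) (𝓡 3) s (g y)) (hg : DifferentiableAt ℝ g y) (v : G) :
    B.pullForm (fun x => s (g x)) y v = B.pullForm s (g y) (fderiv ℝ g y v) := by
  have h := mfderiv_comp y hs hg.mdifferentiableAt
  show B.form (s (g y)) (mfderiv 𝓘(ℝ, G) (𝓡 3) (s ∘ g) y v) = _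
  rw [h, mfderiv_eq_fderiv]
  rfl

theorem contMDiff_const_smul (B : CircleBundleWithConnection E) (z : Circle) : ContMDiff (𝓡 3) (𝓡 3)
    ∞ fun q : E => z • q := by
  have := B.smooth_smul
  exact (contMDiff_const (I := 𝓡 3) (I' := 𝓡 1) (c := z)).smul contMDiff_id

theorem contMDiff_exp_smul (B : CircleBundleWithConnection E) {u : F → ℝ} {s : F → E} (hu :
    ContDiff ℝ ∞ u)
    (hs : ContMDiff 𝓘(ℝ, F) (𝓡 3) ∞ s) :
    ContMDiff 𝓘(ℝ, F) (𝓡 3) ∞ fun y => Circle.exp (u y) • s y := by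
  have := B.smooth_smul
  exact (contMDiff_circleExp.comp hu.contMDiff).smul hs

theorem pullForm_smul (z : Circle) {s : F → E} {y : F}
    (hs : MDifferentiableAt 𝓘(ℝ, F) (𝓡 3) s y) (v : F) :
    B.pullForm (fun x => z • s x) y v = B.pullForm s y v := by
  have h := mfderiv_comp y ((B.contMDiff_const_smul z).mdifferentiableAt (by simp) (x := s y)) hs
  show B.form (z • s y) (mfderiv 𝓘(ℝ, F) (𝓡 3) ((fun q : E => z • q) ∘ s) y v) = _
  rw [h]
  exact B.form_invariant z (s y) _

/-- Verticality is normalised at time zero only; invariance under the circle action carries it to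
every time. -/
theorem pullForm_exp (p : E) (u a : ℝ) :
    B.pullForm (fun w : ℝ => Circle.exp w • p) u a = a := by
  have hsm : ContMDiff 𝓘(ℝ, ℝ) (𝓡 3) ∞ fun w : ℝ => Circle.exp w • p :=
    B.contMDiff_exp_smul contDiff_id contMDiff_const
  have e : (fun w : ℝ => Circle.exp w • p) =
      fun w : ℝ => Circle.exp u • (Circle.exp (w - u) • p) := by
    funext w
    rw [← mul_smul, ← Circle.exp_add, add_sub_cancel]
  have hsm' : ContMDiff 𝓘(ℝ, ℝ) (𝓡 3) ∞ fun w : ℝ => Circle.exp (w - u) • p :=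
    B.contMDiff_exp_smul (contDiff_id.sub contDiff_const) contMDiff_const
  rw [e, B.pullForm_smul _ (hsm'.mdifferentiableAt (by simp)),
    B.pullForm_comp (s := fun w : ℝ => Circle.exp w • p) (g := fun w => w - u)
      (hsm.mdifferentiableAt (by simp)) (by fun_prop), sub_self]
  have h1 : fderiv ℝ (fun w : ℝ => w - u) u a = a • 1 := by
    rw [fderiv_sub_const]; simp
  rw [h1, map_smul]
  have h2 : B.pullForm (fun w : ℝ => Circle.exp w • p) 0 1 = 1 := B.form_vertical p
  rw [h2]; simp

/-- A section rotated by a variable angle. -/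
def rotMap (s : F → E) (p : ℝ × F) : E := Circle.exp p.1 • s p.2

theorem contMDiff_rotMap (B : CircleBundleWithConnection E) {s : F → E}
    (hs : ContMDiff 𝓘(ℝ, F) (𝓡 3) ∞ s) :
    ContMDiff 𝓘(ℝ, ℝ × F) (𝓡 3) ∞ (rotMap s) :=
  B.contMDiff_exp_smul contDiff_fst (hs.comp contDiff_snd.contMDiff)

/-- The familiar local formula for a connection: the differential of the fibre angle plus the
pullback under the section. -/
theorem pullForm_rotMap {s : F → E} (hs : ContMDiff 𝓘(ℝ, F) (𝓡 3) ∞ s) (u a : ℝ) (ζ v : F) :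
    B.pullForm (rotMap s) (u, ζ) (a, v) = a + B.pullForm s ζ v := by
  have hd := (B.contMDiff_rotMap hs).mdifferentiableAt (by simp) (x := (u, ζ))
  have e : (a, v) = (a, (0 : F)) + ((0 : ℝ), v) := by simp
  rw [e, map_add]
  congr 1
  · have h := B.pullForm_comp (s := rotMap s) (g := fun w : ℝ => (w, ζ)) (y := u) hd
      (by fun_prop) a
    have h1 : fderiv ℝ (fun w : ℝ => (w, ζ)) u a = (a, 0) := by
      have : HasFDerivAt (fun w : ℝ => (w, ζ)) ((ContinuousLinearMap.id ℝ ℝ).prod 0) u :=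
        (hasFDerivAt_id u).prodMk (hasFDerivAt_const ζ u)
      rw [this.fderiv]; simp
    rw [h1] at h
    exact h.symm.trans (B.pullForm_exp (s ζ) u a)
  · have h := B.pullForm_comp (s := rotMap s) (g := fun w : F => (u, w)) (y := ζ) hd
      (by fun_prop) v
    have h1 : fderiv ℝ (fun w : F => (u, w)) ζ v = (0, v) := by
      have : HasFDerivAt (fun w : F => (u, w)) ((0 : F →L[ℝ] ℝ).prod (ContinuousLinearMap.id ℝ F))
          ζ :=
        (hasFDerivAt_const u ζ).prodMk (hasFDerivAt_id ζ)
      rw [this.fderiv]; simp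
    rw [h1] at h
    rw [← h]
    exact B.pullForm_smul (Circle.exp u) (hs.mdifferentiableAt (by simp)) v

/-- The connection form on a rotated lift of a curve. -/
theorem pullForm_lift {s : F → E} (hs : ContMDiff 𝓘(ℝ, F) (𝓡 3) ∞ s) {θ : ℝ → ℝ} {c : ℝ → F}
    {t : ℝ} (hθ : DifferentiableAt ℝ θ t) (hc : DifferentiableAt ℝ c t) :
    B.pullForm (fun t => Circle.exp (θ t) • s (c t)) t 1 =
      deriv θ t + B.pullForm s (c t) (deriv c t) := by
  have hd := (B.contMDiff_rotMap hs).mdifferentiableAt (by simp) (x := (θ t, c t))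
  have h := B.pullForm_comp (s := rotMap s) (g := fun t : ℝ => (θ t, c t)) (y := t) hd
    (hθ.prodMk hc) 1
  rw [(hθ.hasFDerivAt.prodMk hc.hasFDerivAt).fderiv] at h
  rw [← B.pullForm_rotMap hs (θ t) _ (c t)]
  exact h

end Pull

/-- A continuous angle is differentiable if the rotated lift is. -/
theorem differentiableAt_angle {s : ℂ → E} (hs : ContMDiff 𝓘(ℝ, ℂ) (𝓡 3) ∞ s)
    (himm : ∀ ζ, Function.Injective (fderiv ℝ (fun z => (B.proj (s z) : R3)) ζ)) {θ : ℝ → ℝ}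
    {c : ℝ → ℂ} {t : ℝ} (hθ : ContinuousAt θ t) (hc : ContinuousAt c t)
    (hL : MDifferentiableAt 𝓘(ℝ, ℝ) (𝓡 3) (fun t => Circle.exp (θ t) • s (c t)) t) :
    DifferentiableAt ℝ θ t := by
  set p := Circle.exp (θ t) • s (c t) with hp
  set χ := extChartAt (𝓡 3) p with hχ
  have hχd : ContMDiffAt (𝓡 3) 𝓘(ℝ, R3) ∞ χ p := contMDiffAt_extChartAt
  have hrot := B.contMDiff_rotMap hs
  have hcomp : ContMDiffAt 𝓘(ℝ, ℝ × ℂ) 𝓘(ℝ, R3) ∞ (χ ∘ rotMap s) (θ t, c t) :=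
    hχd.comp (θ t, c t) (hrot (θ t, c t))
  have hF : ContDiffAt ℝ ∞ (χ ∘ rotMap s) (θ t, c t) := contMDiffAt_iff_contDiffAt.1 hcomp
  -- The local trivialization is immersive: projecting a kernel vector to the base kills `v`, and
  -- then the connection form kills `a`.
  have hinj : Function.Injective (fderiv ℝ (χ ∘ rotMap s) (θ t, c t)) := by
    rw [injective_iff_map_eq_zero]
    rintro ⟨a, v⟩ h0
    have hrd := hrot.mdifferentiableAt (by simp) (x := (θ t, c t))
    have h1 : mfderiv 𝓘(ℝ, ℝ × ℂ) (𝓡 3) (rotMap s) (θ t, c t) (a, v) = 0 := by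
      rw [← mfderiv_eq_fderiv, mfderiv_comp (θ t, c t) (hχd.mdifferentiableAt (by simp)) hrd] at h0
      have h2 := isInvertible_mfderiv_extChartAt (I := 𝓡 3) (mem_extChartAt_source (I := 𝓡 3) p)
      exact h2.injective (h0.trans (map_zero _).symm)
    have hv : v = 0 := by
      apply himm (c t)
      rw [map_zero]
      have h3 : (fun z : ℝ × ℂ => (B.proj (s z.2) : R3)) = (fun q : E => (B.proj q : R3)) ∘ rotMap s
          := by
        funext z
        have : B.proj (s z.2) = B.proj (rotMap s z) := (B.fibre _ _).2 ⟨_, rfl⟩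
        simp only [Function.comp, this]
      have hps : Differentiable ℝ fun z => (B.proj (s z) : R3) := by
        have : ContMDiff 𝓘(ℝ, ℂ) 𝓘(ℝ, R3) ∞ fun z => (B.proj (s z) : R3) :=
          contMDiff_coe_S2.comp (B.smooth_proj.comp hs)
        exact this.contDiff.differentiable (by simp)
      have h4 := ((hps (c t)).hasFDerivAt.comp (θ t, c t) (hasFDerivAt_snd (𝕜 := ℝ))).fderiv
      have h5 : fderiv ℝ (fun z : ℝ × ℂ => (B.proj (s z.2) : R3)) (θ t, c t) (a, v) =
          fderiv ℝ (fun z => (B.proj (s z) : R3)) (c t) v := by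
        change fderiv ℝ (fun z : ℝ × ℂ => (B.proj (s z.2) : R3)) (θ t, c t) = _ at h4
        rw [h4]; rfl
      have hpd : ContMDiff (𝓡 3) 𝓘(ℝ, R3) ∞ fun q : E => (B.proj q : R3) :=
        contMDiff_coe_S2.comp B.smooth_proj
      have h6 := mfderiv_comp (θ t, c t) (g := fun q : E => (B.proj q : R3)) (f := rotMap s)
        (hpd.mdifferentiableAt (by simp)) hrd
      rw [← h5, h3, ← mfderiv_eq_fderiv, h6]
      show mfderiv (𝓡 3) 𝓘(ℝ, R3) _ _ (mfderiv 𝓘(ℝ, ℝ × ℂ) (𝓡 3) (rotMap s) (θ t, c t) (a, v)) = 0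
      rw [h1, map_zero]
    have ha : a = 0 := by
      have h6 := B.pullForm_rotMap hs (θ t) a (c t) v
      have h7 : B.pullForm (rotMap s) (θ t, c t) (a, v) = 0 := by
        show B.form _ (mfderiv 𝓘(ℝ, ℝ × ℂ) (𝓡 3) (rotMap s) (θ t, c t) (a, v)) = 0
        rw [h1, map_zero]
      rw [h7, hv, map_zero, add_zero] at h6
      exact h6.symm
    rw [ha, hv]; rfl
  set A : (ℝ × ℂ) ≃L[ℝ] R3 := (LinearMap.linearEquivOfInjective
    (fderiv ℝ (χ ∘ rotMap s) (θ t, c t) : (ℝ × ℂ) →ₗ[ℝ] R3) hinj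
    (by simp [Complex.finrank_real_complex])).toContinuousLinearEquiv with hA
  have hst : HasStrictFDerivAt (χ ∘ rotMap s) (A : (ℝ × ℂ) →L[ℝ] R3) (θ t, c t) := by
    have hAe : (A : (ℝ × ℂ) →L[ℝ] R3) = fderiv ℝ (χ ∘ rotMap s) (θ t, c t) :=
      ContinuousLinearMap.ext fun v => rfl
    rw [hAe]
    exact hF.hasStrictFDerivAt (by simp)
  -- Continuity of the angle keeps `(θ r, c r)` in the domain where the local inverse recovers it
  -- from the differentiable lift.
  have h8 : ∀ᶠ r in 𝓝 t, hst.localInverse _ _ _ ((χ ∘ rotMap s) (θ r, c r)) = (θ r, c r) :=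
    (hθ.prodMk hc).eventually hst.eventually_left_inverse
  have h9 : DifferentiableAt ℝ (fun r => (χ ∘ rotMap s) (θ r, c r)) t := by
    rw [← mdifferentiableAt_iff_differentiableAt]
    exact (hχd.mdifferentiableAt (by simp)).comp t hL
  have h10 : DifferentiableAt ℝ
      (fun r => hst.localInverse _ _ _ ((χ ∘ rotMap s) (θ r, c r))) t :=
    DifferentiableAt.comp t hst.to_localInverse.differentiableAt h9
  have h11 : DifferentiableAt ℝ (fun r => (θ r, c r)) t := h10.congr_of_eventuallyEq
    (h8.mono fun r hr => hr.symm)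
  exact h11.fst

end CircleBundleWithConnection

/-! ### The curvature of a contact circle bundle -/

theorem contDiff_areaJac {Ψ : ℂ → S2} (hΨ : ContDiff ℝ ∞ fun ζ => (Ψ ζ : R3)) :
    ContDiff ℝ ∞ (areaJac Ψ) := by
  have := hΨ.fderiv_right (m := ∞) (by simp)
  have h1 : ContDiff ℝ ∞ fun ζ => fderiv ℝ (fun z => (Ψ z : R3)) ζ 1 := by fun_prop
  have h2 : ContDiff ℝ ∞ fun ζ => fderiv ℝ (fun z => (Ψ z : R3)) ζ Complex.I := by fun_prop
  unfold areaJac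
  simp only [det3_apply]
  fun_prop

theorem contDiff_curl {P Q : ℂ → ℝ} (hP : ContDiff ℝ ∞ P) (hQ : ContDiff ℝ ∞ Q) :
    ContDiff ℝ ∞ (curl P Q) := by
  have := hP.fderiv_right (m := ∞) (by simp)
  have := hQ.fderiv_right (m := ∞) (by simp)
  unfold curl
  fun_prop

theorem fderiv_injective_of_areaJac_ne {Ψ : ℂ → S2} {ζ : ℂ} (h : areaJac Ψ ζ ≠ 0) :
    Function.Injective (fderiv ℝ (fun z => (Ψ z : R3)) ζ) := by
  rw [injective_iff_map_eq_zero]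
  intro v hv
  have hv' : v = v.re • (1 : ℂ) + v.im • Complex.I := by
    apply Complex.ext <;> simp
  rw [hv', map_add, map_smul, map_smul] at hv
  have k1 : ∀ (x a b : R3) (p q : ℝ), det3 x (p • a + q • b) b = p * det3 x a b := by
    intro x a b p q
    simp [det3_apply]; ring
  have k2 : ∀ (x a b : R3) (p q : ℝ), det3 x a (p • a + q • b) = q * det3 x a b := by
    intro x a b p q
    simp [det3_apply]; ring
  have h1 := k1 (Ψ ζ) (fderiv ℝ (fun z => (Ψ z : R3)) ζ 1)
    (fderiv ℝ (fun z => (Ψ z : R3)) ζ Complex.I) v.re v.im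
  have h2 := k2 (Ψ ζ) (fderiv ℝ (fun z => (Ψ z : R3)) ζ 1)
    (fderiv ℝ (fun z => (Ψ z : R3)) ζ Complex.I) v.re v.im
  rw [hv] at h1 h2
  have z1 : ∀ x b : R3, det3 x 0 b = 0 := by intro x b; simp [det3_apply]
  have z2 : ∀ x b : R3, det3 x b 0 = 0 := by intro x b; simp [det3_apply]
  rw [z1] at h1
  rw [z2] at h2
  apply Complex.ext
  · exact (mul_eq_zero.1 h1.symm).resolve_right h
  · exact (mul_eq_zero.1 h2.symm).resolve_right h

/-! ### The unit circle -/

/-- The unit circle, run through with speed `σ`. -/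
def unitCircle (σ t : ℝ) : ℂ := Complex.exp ((σ * t : ℝ) * Complex.I)

theorem contDiff_unitCircle (σ : ℝ) : ContDiff ℝ ∞ (unitCircle σ) := by
  unfold unitCircle
  exact Complex.contDiff_exp.comp ((Complex.ofRealCLM.contDiff.comp
    (contDiff_const.mul contDiff_id)).mul contDiff_const)

theorem deriv_unitCircle (σ t : ℝ) : deriv (unitCircle σ) t = unitCircle σ t * (σ * Complex.I) := by
  have h1 : HasDerivAt (fun t : ℝ => ((σ * t : ℝ) : ℂ) * Complex.I) (((σ * 1 : ℝ) : ℂ) * Complex.I)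
      t :=
    (((hasDerivAt_id t).const_mul σ).ofReal_comp).mul_const _
  have h2 : HasDerivAt (unitCircle σ) _ t := h1.cexp
  rw [h2.deriv, unitCircle, mul_one]

theorem norm_unitCircle (σ t : ℝ) : ‖unitCircle σ t‖ = 1 := Complex.norm_exp_ofReal_mul_I _

theorem unitCircle_closed {σ : ℝ} (hσ : σ = 1 ∨ σ = -1) :
    unitCircle σ 0 = unitCircle σ (2 * π) := by
  rcases hσ with rfl | rfl
  · simp [unitCircle]
  · simp only [unitCircle, mul_zero, Complex.ofReal_zero, zero_mul, Complex.exp_zero]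
    symm
    rw [Complex.exp_eq_one_iff]
    exact ⟨-1, by push_cast; ring⟩

theorem periodic_unitCircle {σ : ℝ} (hσ : σ = 1 ∨ σ = -1) :
    Function.Periodic (unitCircle σ) (2 * π) := by
  intro t
  have : Complex.exp ((σ * (2 * π) : ℝ) * Complex.I) = 1 := by
    have h0 := (unitCircle_closed hσ).symm
    simpa [unitCircle] using h0
  simp only [unitCircle, mul_add, Complex.ofReal_add, add_mul, Complex.exp_add, this, mul_one]

theorem isCompact_range_unitCircle {σ : ℝ} (hσ : σ = 1 ∨ σ = -1) :
    IsCompact (range (unitCircle σ)) := by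
  have h1 := (periodic_unitCircle hσ).image_Icc (by positivity) 0
  rw [zero_add] at h1
  rw [← h1]
  exact isCompact_Icc.image (contDiff_unitCircle σ).continuous

theorem isDiscrete_range_intCast : IsDiscrete (range ((↑) : ℤ → ℝ)) :=
  ⟨Int.isClosedEmbedding_coe_real.isEmbedding.toHomeomorph.symm.isEmbedding.discreteTopology⟩

/-- The winding number is constant on connected sets that avoid the curve. -/
theorem winding_eq_of_isPreconnected {c : ℝ → ℂ} (hc : ContDiff ℝ 1 c) (hr : IsClosed (range c))
    {s t : ℝ} (hst : c s = c t) {S : Set ℂ} (hS : IsPreconnected S) (hS1 : S ⊆ (range c)ᶜ) {a b : ℂ}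
    (ha : a ∈ S) (hb : b ∈ S) : winding c s t a = winding c s t b := by
  refine hS.constant_of_mapsTo isDiscrete_range_intCast (fun z hz =>
    (continuousAt_winding hc hr s t (hS1 hz)).continuousWithinAt) (fun z hz => ?_) ha hb
  obtain ⟨n, hn, -⟩ := exists_winding_eq hc hst (hS1 hz)
  exact ⟨n, hn.symm⟩

/-- The winding number is constant on connected sets off the circle. Inside the disc it is evaluated
at the centre; outside, the point is moved along a ray to where the winding number is known to
vanish. -/
theorem winding_unitCircle {σ : ℝ} (hσ : σ = 1 ∨ σ = -1) {y : ℂ} :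
    (‖y‖ < 1 → winding (unitCircle σ) 0 (2 * π) y = σ) ∧
      (1 < ‖y‖ → winding (unitCircle σ) 0 (2 * π) y = 0) := by
  have hc : ContDiff ℝ 1 (unitCircle σ) := (contDiff_unitCircle σ).of_le (by simp)
  have hcl := unitCircle_closed hσ
  have hrc := isCompact_range_unitCircle hσ
  have hoff : ∀ z : ℂ, ‖z‖ ≠ 1 → z ∉ range (unitCircle σ) := by
    rintro z hz ⟨t, rfl⟩
    exact hz (norm_unitCircle σ t)
  have hconst : ∀ S : Set ℂ, IsPreconnected S → (∀ z ∈ S, ‖z‖ ≠ 1) → ∀ {a b : ℂ}, a ∈ S → b ∈ S →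
      winding (unitCircle σ) 0 (2 * π) a = winding (unitCircle σ) 0 (2 * π) b := by
    intro S hS hS1 a b ha hb
    exact winding_eq_of_isPreconnected hc hrc.isClosed hcl hS (fun z hz => hoff z (hS1 z hz)) ha hb
  constructor
  · intro hy
    rw [hconst (Metric.ball 0 1) (convex_ball 0 1).isPreconnected
      (fun z hz => (by simpa using hz : ‖z‖ < 1).ne) (by simpa using hy) (Metric.mem_ball_self one_pos)]
    have h1 : logIntegral (unitCircle σ) 0 (2 * π) 0 = σ * (2 * π * Complex.I) := by
      have h2 : ∀ t, deriv (unitCircle σ) t / (unitCircle σ t - 0) = σ * Complex.I := by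
        intro t
        have h3 : unitCircle σ t ≠ 0 := Complex.exp_ne_zero _
        rw [deriv_unitCircle, sub_zero, mul_div_cancel_left₀ _ h3]
      simp only [logIntegral, h2]
      rw [intervalIntegral.integral_const, Complex.real_smul]
      push_cast
      ring
    rw [winding, h1, mul_div_assoc, div_self (by simp [Real.pi_ne_zero]), mul_one,
      Complex.ofReal_re]
  · intro hy
    obtain ⟨R, -, hR⟩ := exists_winding_eq_zero hc hrc hcl
    set S : Set ℂ := (fun r : ℝ => r • y) '' Ici 1
    have hS : IsPreconnected S := isPreconnected_Ici.image _ (by fun_prop)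
    have hn : ∀ r : ℝ, 1 ≤ r → ‖r • y‖ = r * ‖y‖ := fun r hr => by
      rw [norm_smul, Real.norm_of_nonneg (by linarith)]
    rw [hconst S hS (b := (max 1 (R / ‖y‖)) • y) _ ⟨1, mem_Ici.2 le_rfl, one_smul _ _⟩
      ⟨_, mem_Ici.2 (le_max_left _ _), rfl⟩]
    · apply hR
      rw [hn _ (le_max_left _ _)]
      have h2 := le_max_right 1 (R / ‖y‖)
      rw [div_le_iff₀ (by linarith)] at h2
      exact h2
    · rintro _ ⟨r, hr, rfl⟩
      simp only
      rw [hn r hr]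
      have : (1 : ℝ) ≤ r := hr
      nlinarith

theorem lineIntegral_unitCircle {P Q : ℂ → ℝ} (hP : ContDiff ℝ ∞ P) (hQ : ContDiff ℝ ∞ Q) {σ : ℝ}
    (hσ : σ = 1 ∨ σ = -1) :
    lineIntegral P Q (unitCircle σ) 0 (2 * π) = σ * ∫ y in Metric.ball (0 : ℂ) 1, curl P Q y := by
  have hc : ContDiff ℝ 1 (unitCircle σ) := (contDiff_unitCircle σ).of_le (by simp)
  have hcl := unitCircle_closed hσ
  have hrc := isCompact_range_unitCircle hσ
  rw [lineIntegral_eq (hP.of_le (by simp)) (hQ.of_le (by simp)) hc hrc (volume_range_curve hc)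
    (by positivity) hcl, ← integral_const_mul, ← integral_indicator Metric.isOpen_ball.measurableSet]
  apply integral_congr_ae
  have h0 : ∀ᵐ y : ℂ, y ∉ Metric.sphere (0 : ℂ) 1 :=
    measure_eq_zero_iff_ae_notMem.1 (Measure.addHaar_sphere volume 0 1)
  filter_upwards [h0] with y hy
  rw [mem_sphere_zero_iff_norm] at hy
  rcases lt_or_gt_of_ne hy with h | h
  · rw [indicator_of_mem (by simpa using h), (winding_unitCircle hσ).1 h]
  · rw [indicator_of_notMem (by simpa using h.le), (winding_unitCircle hσ).2 h, zero_mul]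

/-! ### The total curvature -/

theorem stereo_unitCircle (t : ℝ) : stereo (unitCircle 1 t) = equator t := by
  have hre : (unitCircle 1 t).re = Real.cos t := by
    rw [unitCircle, Complex.exp_ofReal_mul_I_re, one_mul]
  have him : (unitCircle 1 t).im = Real.sin t := by
    rw [unitCircle, Complex.exp_ofReal_mul_I_im, one_mul]
  have h := Real.cos_sq_add_sin_sq t
  apply Subtype.ext
  ext i
  rw [coe_stereo, PiLp.smul_apply, stereoDen, hre, him, h]
  fin_cases i <;> simp [stereoNum, hre, him, h, equator] <;> ring

theorem stereoS_unitCircle (t : ℝ) : stereoS (unitCircle (-1) t) = equator t := by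
  have hre : (unitCircle (-1) t).re = Real.cos t := by
    rw [unitCircle, Complex.exp_ofReal_mul_I_re]; simp
  have him : (unitCircle (-1) t).im = -Real.sin t := by
    rw [unitCircle, Complex.exp_ofReal_mul_I_im]; simp
  have h := Real.cos_sq_add_sin_sq t
  apply Subtype.ext
  ext i
  rw [stereoS, coe_halfTurn, coe_stereo]
  fin_cases i <;> simp [stereoDen, stereoNum, hre, him, h, equator] <;> ring

theorem stereo_image_ball : stereo '' Metric.ball 0 1 = {x : S2 | 0 < (x : R3) 2} := by
  have key : ∀ ζ : ℂ, ζ ∈ Metric.ball (0 : ℂ) 1 ↔ 0 < (stereo ζ : R3) 2 := by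
    intro ζ
    rw [stereo_two, mem_ball_zero_iff, sub_pos, lt_div_iff₀ (stereoDen_pos ζ), one_mul, stereoDen,
      ← Real.sqrt_one, Complex.norm_eq_sqrt_sq_add_sq,
      Real.sqrt_lt_sqrt_iff (by positivity)]
    rw [Real.sqrt_one]
    constructor <;> intro h <;> linarith
  ext x
  constructor
  · rintro ⟨ζ, hζ, rfl⟩; exact (key ζ).1 hζ
  · intro hx
    have hx' : 0 < (x : R3) 2 := hx
    have h := stereo_stereoProj (x := x) (by linarith)
    exact ⟨stereoProj x, (key _).2 (by rw [h]; exact hx'), h⟩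

theorem stereoS_image_ball : stereoS '' Metric.ball 0 1 = {x : S2 | (x : R3) 2 < 0} := by
  have : stereoS '' Metric.ball 0 1 = halfTurn '' (stereo '' Metric.ball 0 1) := by
    rw [image_image]; rfl
  rw [this, stereo_image_ball]
  ext x
  constructor
  · rintro ⟨y, hy, rfl⟩
    have hy' : 0 < (y : R3) 2 := hy
    show (halfTurn y : R3) 2 < 0
    rw [coe_halfTurn]
    simpa using hy'
  · intro hx
    refine ⟨halfTurn x, ?_, halfTurn_halfTurn x⟩
    have hx' : (x : R3) 2 < 0 := hx
    show 0 < (halfTurn x : R3) 2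
    rw [coe_halfTurn]
    simpa using hx'

theorem range_equator : range equator = {x : S2 | (x : R3) 2 = 0} := by
  ext x
  constructor
  · rintro ⟨t, rfl⟩; simp [equator]
  · intro hx
    have hx' : (x : R3) 2 = 0 := hx
    have h := x.sum_sq
    rw [hx'] at h
    set z : ℂ := ⟨(x : R3) 0, (x : R3) 1⟩ with hz
    have hn : ‖z‖ = 1 := by
      rw [Complex.norm_eq_sqrt_sq_add_sq, Real.sqrt_eq_one]
      linarith
    have hz0 : z ≠ 0 := by
      intro h0
      rw [h0] at hn
      simp at hn
    refine ⟨Complex.arg z, Subtype.ext ?_⟩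
    ext i
    fin_cases i
    · show Real.cos (Complex.arg z) = _
      rw [Complex.cos_arg hz0, hn, div_one]; rfl
    · show Real.sin (Complex.arg z) = _
      rw [Complex.sin_arg, hn, div_one]; rfl
    · simp [equator, hx']

theorem contDiff_coe_equator : ContDiff ℝ 1 fun t => (equator t : R3) := by
  have : (fun t => (equator t : R3)) = fun t => (stereo (unitCircle 1 t) : R3) := by
    funext t; rw [stereo_unitCircle]
  rw [this]
  exact (contDiff_coe_stereo.comp (contDiff_unitCircle 1)).of_le (by simp)

namespace ContactCircleBundle

variable {E : Type*} [TopologicalSpace E] [ChartedSpace R3 E] [IsManifold (𝓡 3) ∞ E]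
  [MulAction Circle E]
  (B : ContactCircleBundle E)

/-- The default value `0` of `curvature` is excluded by strict negativity, so the curvature exists
at every point. -/
theorem isCurvatureAt_curvature (x : S2) : B.IsCurvatureAt x (B.curvature x) := by
  have h := B.curvature_neg x
  unfold CircleBundleWithConnection.curvature at h ⊢
  split_ifs at h ⊢ with h0
  · exact h0.choose_spec
  · exact absurd h (lt_irrefl 0)

theorem curl_pullForm {s : ℂ → E} (hs : ContMDiff 𝓘(ℝ, ℂ) (𝓡 3) ∞ s) {Ψ : ℂ → S2}
    (hp : ∀ ζ, B.proj (s ζ) = Ψ ζ) (ζ : ℂ) :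
    curl (fun z => B.pullForm s z 1) (fun z => B.pullForm s z Complex.I) ζ =
      -(B.curvature (Ψ ζ) * areaJac Ψ ζ) := by
  have hp' : (fun z => B.proj (s z)) = Ψ := funext hp
  rw [B.toCircleBundleWithConnection.curl_pullForm hs
    (B.isCurvatureAt_curvature (B.proj (s ζ))), hp']
  simp only [hp]

theorem contDiff_pullForm_apply {s : ℂ → E} (hs : ContMDiff 𝓘(ℝ, ℂ) (𝓡 3) ∞ s) (v : ℂ) :
    ContDiff ℝ ∞ fun z => B.pullForm s z v :=
  contDiffOn_univ.1 (B.contDiffOn_pullForm isOpen_univ hs.contMDiffOn v)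

/-- The curvature was chosen pointwise; its smoothness comes from writing it as a quotient of the
curl of the local connection form and the Jacobian. -/
theorem contDiff_curvature_comp {s : ℂ → E} (hs : ContMDiff 𝓘(ℝ, ℂ) (𝓡 3) ∞ s) {Ψ : ℂ → S2}
    (hp : ∀ ζ, B.proj (s ζ) = Ψ ζ) (hΨ : ContDiff ℝ ∞ fun ζ => (Ψ ζ : R3))
    (hJ : ∀ ζ, areaJac Ψ ζ ≠ 0) : ContDiff ℝ ∞ fun ζ => B.curvature (Ψ ζ) := by
  have h1 := (contDiff_curl (B.contDiff_pullForm_apply hs 1)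
    (B.contDiff_pullForm_apply hs Complex.I)).neg.div (contDiff_areaJac hΨ) hJ
  have e : (fun ζ => B.curvature (Ψ ζ)) =
      ((fun x => -curl (fun z => B.pullForm s z 1) (fun z => B.pullForm s z Complex.I) x) /
        areaJac Ψ) := by
    funext ζ
    rw [Pi.div_apply, B.curl_pullForm hs hp ζ, neg_neg]
    exact (mul_div_cancel_right₀ _ (hJ ζ)).symm
  rw [e]
  exact h1

/-- Sections over the complements of the poles in stereographic coordinates. -/
theorem exists_sections {B : ContactCircleBundle E} {e : ℤ} (he : B.IsEulerNumber e) :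
    ∃ sN sS : ℂ → E, ContMDiff 𝓘(ℝ, ℂ) (𝓡 3) ∞ sN ∧ ContMDiff 𝓘(ℝ, ℂ) (𝓡 3) ∞ sS ∧
      (∀ ζ, B.proj (sN ζ) = stereo ζ) ∧ (∀ ζ, B.proj (sS ζ) = stereoS ζ) ∧
      ∃ θ : ℝ → ℝ, Continuous θ ∧ (∀ t, θ (t + 2 * π) = θ t + 2 * π * e) ∧
        ∀ t, sS (unitCircle (-1) t) = Circle.exp (θ t) • sN (unitCircle 1 t) := by
  obtain ⟨σN, σS, h1, h2, h3, h4, θ, h5, h6, h7⟩ := he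
  refine ⟨fun ζ => σN (stereo ζ), fun ζ => σS (stereoS ζ), ?_, ?_, fun ζ => h3 _ (stereo_two_ne ζ),
    fun ζ => h4 _ (stereoS_two_ne ζ), θ, h5, h6, fun t => ?_⟩
  · exact h1.comp_contMDiff contMDiff_stereo fun ζ => stereo_two_ne ζ
  · exact h2.comp_contMDiff contMDiff_stereoS fun ζ => stereoS_two_ne ζ
  · simp only [stereo_unitCircle, stereoS_unitCircle, h7]

theorem continuous_curvature {e : ℤ} (he : B.IsEulerNumber e) : Continuous B.curvature := by
  obtain ⟨sN, sS, hN, hS, pN, pS, -⟩ := exists_sections he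
  have cN := (B.contDiff_curvature_comp hN pN contDiff_coe_stereo
    fun ζ => (areaJac_stereo_pos ζ).ne').continuous
  have cS := (B.contDiff_curvature_comp hS pS contDiff_coe_stereoS
    fun ζ => by rw [areaJac_stereoS]; exact (areaJac_stereo_pos ζ).ne').continuous
  have hcoord : Continuous fun x : S2 => (x : R3) 2 :=
    (EuclideanSpace.proj 2 : R3 →L[ℝ] ℝ).continuous.comp continuous_subtype_val
  have hproj : ∀ x : S2, (x : R3) 2 ≠ -1 → ContinuousAt (fun y : S2 => stereoProj y) x :=
    fun x hx => (contDiffAt_stereoProj (one_add_ne_zero hx)).continuousAt.comp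
      continuous_subtype_val.continuousAt
  rw [continuous_iff_continuousAt]
  intro x
  by_cases hx : (x : R3) 2 = -1
  · have hx1 : (x : R3) 2 ≠ 1 := by rw [hx]; norm_num
    have hht : Continuous halfTurn := by
      refine continuous_induced_rng.2 ?_
      have : (fun x : S2 => (halfTurn x : R3)) = fun x : S2 => halfTurnCLM x := by
        funext x; exact coe_halfTurn_eq x
      show Continuous fun x : S2 => (halfTurn x : R3)
      rw [this]
      exact halfTurnCLM.continuous.comp continuous_subtype_val
    have h2 : ∀ y : S2, (y : R3) 2 ≠ 1 → (halfTurn y : R3) 2 ≠ -1 := by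
      intro y hy
      rw [coe_halfTurn]
      simpa using hy
    have h1 : ContinuousAt (fun y : S2 => B.curvature (stereoS (stereoProj (halfTurn y)))) x :=
      cS.continuousAt.comp ((hproj _ (h2 x hx1)).comp hht.continuousAt)
    refine h1.congr ?_
    filter_upwards [hcoord.isOpen_preimage {1}ᶜ isOpen_compl_singleton |>.mem_nhds hx1] with y hy
    rw [stereoS, stereo_stereoProj (h2 y hy), halfTurn_halfTurn]
  · have h1 : ContinuousAt (fun y : S2 => B.curvature (stereo (stereoProj y))) x :=
      cN.continuousAt.comp (hproj x hx)
    refine h1.congr ?_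
    filter_upwards [hcoord.isOpen_preimage {-1}ᶜ isOpen_compl_singleton |>.mem_nhds hx] with y hy
    rw [stereo_stereoProj hy]

theorem integrable_curvature {e : ℤ} (he : B.IsEulerNumber e) :
    Integrable B.curvature (volume : Measure R3).toSphere :=
  (B.continuous_curvature he).integrable_of_hasCompactSupport
    (HasCompactSupport.of_compactSpace _)

theorem lineIntegral_pullForm {s : ℂ → E} (hs : ContMDiff 𝓘(ℝ, ℂ) (𝓡 3) ∞ s) {Ψ : ℂ → S2}
    (hp : ∀ ζ, B.proj (s ζ) = Ψ ζ) (hΨ : ContDiff ℝ ∞ fun ζ => (Ψ ζ : R3))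
    (hinj : Function.Injective Ψ) (hJ : ∀ ζ, 0 < areaJac Ψ ζ) {σ : ℝ} (hσ : σ = 1 ∨ σ = -1) :
    lineIntegral (fun z => B.pullForm s z 1) (fun z => B.pullForm s z Complex.I) (unitCircle σ) 0
      (2 * π) = -(σ * surfaceIntegral (Ψ '' Metric.ball 0 1) B.curvature) := by
  rw [lineIntegral_unitCircle (B.contDiff_pullForm_apply hs 1)
    (B.contDiff_pullForm_apply hs Complex.I) hσ, surfaceIntegral_image (hΨ.of_le (by simp)) hinj
    Metric.isOpen_ball.measurableSet, ← mul_neg, ← integral_neg]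
  congr 2
  funext ζ
  rw [B.curl_pullForm hs hp ζ, abs_of_pos (hJ ζ), mul_comm]

theorem pullForm_eq {s : ℂ → E} (z v : ℂ) :
    B.pullForm s z v = B.pullForm s z 1 * v.re + B.pullForm s z Complex.I * v.im := by
  have hv : v = v.re • (1 : ℂ) + v.im • Complex.I := by
    apply Complex.ext <;> simp
  conv_lhs => rw [hv, map_add, map_smul, map_smul]
  simp only [smul_eq_mul]
  ring

/-- The total curvature is `2π` times the Euler number. -/
theorem surfaceIntegral_univ_curvature {e : ℤ} (he : B.IsEulerNumber e) :
    surfaceIntegral univ B.curvature = 2 * π * e := by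
  obtain ⟨sN, sS, hN, hS, pN, pS, θ, hθ, hθp, hθs⟩ := exists_sections he
  have hu : ∀ σ t, DifferentiableAt ℝ (unitCircle σ) t := fun σ t =>
    (contDiff_unitCircle σ).differentiable (by simp) t
  have hSm : ContMDiff 𝓘(ℝ, ℝ) (𝓡 3) ∞ fun t => sS (unitCircle (-1) t) :=
    hS.comp (contDiff_unitCircle (-1)).contMDiff
  have hSe : (fun t => sS (unitCircle (-1) t)) = fun t => Circle.exp (θ t) • sN (unitCircle 1 t) :=
    funext hθs
  have hpN : (fun z => B.proj (sN z)) = stereo := funext pN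
  -- The definition of the Euler number supplies a merely continuous angle.
  have hθd : Differentiable ℝ θ := by
    intro t
    refine B.differentiableAt_angle hN ?_ hθ.continuousAt (hu 1 t).continuousAt ?_
    · intro ζ
      have := fderiv_injective_of_areaJac_ne (Ψ := stereo) (areaJac_stereo_pos ζ).ne'
      simpa only [pN] using this
    · rw [← hSe]
      exact hSm.mdifferentiableAt (by simp)
  -- The derivative of the angle is the difference of the two local connection forms along the
  -- equator.
  have hd : ∀ t, deriv θ t = B.pullForm sS (unitCircle (-1) t) (deriv (unitCircle (-1)) t) -
      B.pullForm sN (unitCircle 1 t) (deriv (unitCircle 1) t) := by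
    intro t
    have h1 := B.pullForm_lift hN (hθd t) (hu 1 t)
    rw [← hSe, B.pullForm_comp (s := sS) (g := unitCircle (-1)) (hS.mdifferentiableAt (by simp))
      (hu (-1) t), fderiv_apply_one_eq_deriv] at h1
    rw [h1]; ring
  have hc : ∀ (s : ℂ → E) (σ : ℝ), ContMDiff 𝓘(ℝ, ℂ) (𝓡 3) ∞ s →
      Continuous fun t => B.pullForm s (unitCircle σ t) (deriv (unitCircle σ) t) := by
    intro s σ hs
    have c1 := (B.contDiff_pullForm_apply hs 1).continuous.comp (contDiff_unitCircle σ).continuous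
    have c2 := (B.contDiff_pullForm_apply hs Complex.I).continuous.comp
      (contDiff_unitCircle σ).continuous
    have c3 := (contDiff_unitCircle σ).continuous_deriv (by simp)
    have := (c1.mul (Complex.continuous_re.comp c3)).add (c2.mul (Complex.continuous_im.comp c3))
    refine this.congr fun t => ?_
    rw [B.pullForm_eq]; rfl
  have hFTC : ∫ t in (0 : ℝ)..(2 * π), deriv θ t = 2 * π * e := by
    rw [intervalIntegral.integral_deriv_eq_sub (fun t _ => hθd t)]
    · have := hθp 0
      rw [zero_add] at this
      rw [this]; ring
    · have e1 : deriv θ = _ := funext hd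
      rw [e1]
      exact ((hc sS (-1) hS).sub (hc sN 1 hN)).intervalIntegrable _ _
  have hsplit : ∫ t in (0 : ℝ)..(2 * π), deriv θ t =
      lineIntegral (fun z => B.pullForm sS z 1) (fun z => B.pullForm sS z Complex.I)
        (unitCircle (-1)) 0 (2 * π) -
      lineIntegral (fun z => B.pullForm sN z 1) (fun z => B.pullForm sN z Complex.I)
        (unitCircle 1) 0 (2 * π) := by
    simp only [hd]
    rw [intervalIntegral.integral_sub ((hc sS (-1) hS).intervalIntegrable _ _)
      ((hc sN 1 hN).intervalIntegrable _ _), lineIntegral, lineIntegral]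
    congr 1 <;> refine intervalIntegral.integral_congr fun t _ => ?_ <;> exact B.pullForm_eq _ _
  -- The equator runs clockwise in the southern chart, so Stokes' theorem produces the curvatures of
  -- the two hemispheres with the same sign.
  rw [B.lineIntegral_pullForm hS pS contDiff_coe_stereoS stereoS_injective
      (fun ζ => by rw [areaJac_stereoS]; exact areaJac_stereo_pos ζ) (Or.inr rfl),
    B.lineIntegral_pullForm hN pN contDiff_coe_stereo stereo_injective areaJac_stereo_pos
      (Or.inl rfl), hFTC, stereo_image_ball, stereoS_image_ball] at hsplit
  have hcoord : Measurable fun x : S2 => (x : R3) 2 :=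
    ((EuclideanSpace.proj 2 : R3 →L[ℝ] ℝ).continuous.comp continuous_subtype_val).measurable
  have hmN : MeasurableSet {x : S2 | 0 < (x : R3) 2} := hcoord measurableSet_Ioi
  have hmS : MeasurableSet {x : S2 | (x : R3) 2 < 0} := hcoord measurableSet_Iio
  have hint := B.integrable_curvature he
  have hdis : Disjoint {x : S2 | 0 < (x : R3) 2} {x : S2 | (x : R3) 2 < 0} := by
    rw [Set.disjoint_left]
    intro x h1 h2
    exact lt_asymm (show 0 < (x : R3) 2 from h1) h2
  have hae : (univ : Set S2) =ᵐ[(volume : Measure R3).toSphere]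
      ({x : S2 | 0 < (x : R3) 2} ∪ {x : S2 | (x : R3) 2 < 0} : Set S2) := by
    have h0 := measure_eq_zero_iff_ae_notMem.1 (toSphere_range_curve contDiff_coe_equator)
    rw [range_equator] at h0
    filter_upwards [h0] with x hx
    have hx' : (x : R3) 2 ≠ 0 := hx
    apply propext
    constructor
    · intro _
      rcases lt_or_gt_of_ne hx' with h | h
      · exact Or.inr h
      · exact Or.inl h
    · intro _; trivial
  have hfin : surfaceIntegral univ B.curvature =
      surfaceIntegral {x : S2 | 0 < (x : R3) 2} B.curvature +
        surfaceIntegral {x : S2 | (x : R3) 2 < 0} B.curvature := by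
    unfold surfaceIntegral
    rw [setIntegral_congr_set hae, setIntegral_union hdis hmS hint.integrableOn hint.integrableOn]
  rw [hfin]
  linarith

end ContactCircleBundle

/-! ### Regions and curvature -/

theorem isOpen_image_region {γ : ℝ → S2} (h : IsGenericCircle γ)
    (φ : Diffeomorph (𝓡 2) (𝓡 2) S2 S2 ∞) {U : Set S2} (hU : U ∈ regions γ) : IsOpen (φ '' U) :=
  isOpen_of_mem_regions (h.diffeo φ) (image_mem_regions φ hU)

namespace ContactCircleBundle

variable {E : Type*} [TopologicalSpace E] [ChartedSpace R3 E] [IsManifold (𝓡 3) ∞ E]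
  [MulAction Circle E]
  (B : ContactCircleBundle E)

theorem surfaceIntegral_curvature_neg {e : ℤ} (he : B.IsEulerNumber e) {U : Set S2}
    (hU : IsOpen U) (hne : U.Nonempty) : surfaceIntegral U B.curvature < 0 := by
  have hint := (B.integrable_curvature he).integrableOn (s := U)
  have h1 : 0 < ∫ x in U, -B.curvature x ∂(volume : Measure R3).toSphere := by
    rw [setIntegral_pos_iff_support_of_nonneg_ae
      (Eventually.of_forall fun x => neg_nonneg.2 (B.curvature_neg x).le) hint.neg]
    have : (Function.support fun x => -B.curvature x) = univ := by
      rw [eq_univ_iff_forall]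
      exact fun x => (neg_pos.2 (B.curvature_neg x)).ne'
    rw [this, univ_inter]
    exact hU.measure_pos _ hne
  rw [integral_neg] at h1
  exact neg_pos.1 h1

/-- The curvatures of the regions of a curve add up to the total curvature. -/
theorem sum_surfaceIntegral_regions {e : ℤ} (he : B.IsEulerNumber e) {γ : ℝ → S2}
    (h : IsGenericCircle γ) (φ : Diffeomorph (𝓡 2) (𝓡 2) S2 S2 ∞) [Fintype (regions γ)] :
    ∑ U : regions γ, surfaceIntegral (φ '' (U : Set S2)) B.curvature = 2 * π * e := by
  rw [← B.surfaceIntegral_univ_curvature he]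
  have hint := B.integrable_curvature he
  unfold surfaceIntegral
  rw [← integral_iUnion_fintype (fun U => (isOpen_image_region h φ U.2).measurableSet)
    _ (fun U => hint.integrableOn)]
  · apply setIntegral_congr_set
    have h0 := measure_eq_zero_iff_ae_notMem.1
      (toSphere_range_curve ((contDiff_coe_curve (h.diffeo φ).smooth).of_le (by simp)))
    filter_upwards [h0] with x hx
    apply propext
    constructor
    · intro _; trivial
    · intro _
      obtain ⟨y, rfl⟩ := φ.surjective x
      have hy : y ∉ range γ := fun hy => hx (by rw [range_diffeo]; exact mem_image_of_mem _ hy)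
      obtain ⟨U, hU, hyU⟩ := exists_mem_regions hy
      exact mem_iUnion.2 ⟨⟨U, hU⟩, mem_image_of_mem _ hyU⟩
  · intro U V hUV
    refine Set.disjoint_left.2 ?_
    rintro _ ⟨y, hy, rfl⟩ ⟨z, hz, e1⟩
    obtain rfl := φ.injective e1
    exact hUV (Subtype.ext (regions_eq_of_mem U.2 V.2 hy hz))

/-- The necessity of the condition: the witnesses are the vector of chord lengths and the vector of
curvatures of the moved regions. -/
theorem LegendrianKnot.exists_chordVector {B : ContactCircleBundle E} {e : ℤ}
    (he : B.IsEulerNumber e) {Γ : DecoratedCircle} {n : Γ.Region →₀ ℤ} {L : B.LegendrianKnot}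
    {c : ∀ y : doublePoints L.projection, L.ShortChord y} (hd : L.IsDiagram c Γ n) :
    (Γ.Psi '' Γ.chordVectors ∩
      {w | ∃ v ∈ Γ.negHyperplane e, w = (2 * Real.pi) • Γ.toV n - v}).Nonempty := by
  obtain ⟨φ, -, hr, hplus, hn⟩ := hd
  choose y hy1 hy2 using hplus
  set q : Γ.Q := Finsupp.equivFunOnFinite.symm fun p => (c (y p)).length with hq
  have hq' : ∀ p, q p = (c (y p)).length := fun p => rfl
  have key : ∀ U : Γ.Region, 2 * π * (n U : ℝ) =
      surfaceIntegral (φ '' (U : Set S2)) B.curvature + Γ.Psi q U := fun U => by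
    rw [hn U]
    exact L.two_pi_mul_defect c Γ φ hr q (fun p => ⟨y p, hy1 p, hq' p, hy2 p⟩) U
  have hneg : ∀ U : Γ.Region, surfaceIntegral (φ '' (U : Set S2)) B.curvature < 0 := fun U =>
    B.surfaceIntegral_curvature_neg he (isOpen_image_region Γ.generic φ U.2)
      ((nonempty_of_mem_regions U.2).image φ)
  -- The vectors `n` and `Psi q` are finitely supported. A region outside both supports would have
  -- zero curvature by `key`, contradicting strict negativity.
  have hfin : Finite Γ.Region := by
    classical
    refine Finite.of_finite_univ ((n.support ∪ (Γ.Psi q).support).finite_toSet.subset ?_)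
    intro U _
    by_contra hU
    simp only [Finset.coe_union, mem_union, Finset.mem_coe, Finsupp.mem_support_iff, not_or,
      not_not] at hU
    have h1 := key U
    rw [hU.1, hU.2] at h1
    have h2 := hneg U
    simp at h1
    linarith
  have := Fintype.ofFinite Γ.Region
  set v : Γ.V := Finsupp.equivFunOnFinite.symm fun U : Γ.Region =>
    surfaceIntegral (φ '' (U : Set S2)) B.curvature with hv
  have hv' : ∀ U, v U = surfaceIntegral (φ '' (U : Set S2)) B.curvature := fun U => rfl
  refine ⟨Γ.Psi q, ⟨q, fun p => ?_, rfl⟩, v, ⟨?_, fun U => by rw [hv']; exact hneg U⟩, ?_⟩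
  · rw [hq']
    exact ⟨(c (y p)).length_pos, (c (y p)).length_lt⟩
  · show (v.sum fun _ c => c) = 2 * π * e
    rw [Finsupp.sum_fintype _ _ (fun _ => rfl)]
    exact B.sum_surfaceIntegral_regions he Γ.generic φ
  · ext U
    have h1 := key U
    rw [← hv'] at h1
    simp only [DecoratedCircle.toV, Finsupp.sub_apply, Finsupp.smul_apply,
      Finsupp.mapRange_apply, smul_eq_mul]
    linarith

end ContactCircleBundle

/-! ### Curves avoiding the south pole -/

/-- The curve in stereographic coordinates. -/
def planeCurve (γ : ℝ → S2) (t : ℝ) : ℂ := stereoProj (γ t)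

section PlaneCurve

variable {γ : ℝ → S2}

theorem two_ne_of_southPole_notMem (hs : southPole ∉ range γ) (t : ℝ) : (γ t : R3) 2 ≠ -1 := by
  rw [Ne, eq_southPole_iff]
  exact fun h => hs ⟨t, h⟩

theorem stereo_planeCurve (hs : southPole ∉ range γ) (t : ℝ) : stereo (planeCurve γ t) = γ t :=
  stereo_stereoProj (two_ne_of_southPole_notMem hs t)

theorem contDiff_planeCurve (h : IsGenericCircle γ) (hs : southPole ∉ range γ) :
    ContDiff ℝ ∞ (planeCurve γ) := by
  rw [contDiff_iff_contDiffAt]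
  intro t
  exact (contDiffAt_stereoProj (one_add_ne_zero (two_ne_of_southPole_notMem hs t))).comp t
    (contDiff_coe_curve h.smooth).contDiffAt

theorem periodic_planeCurve (h : IsGenericCircle γ) : Function.Periodic (planeCurve γ) (2 * π) :=
  fun t => by rw [planeCurve, h.periodic t, planeCurve]

theorem isCompact_range_planeCurve (h : IsGenericCircle γ) (hs : southPole ∉ range γ) :
    IsCompact (range (planeCurve γ)) := by
  have h1 := (periodic_planeCurve h).image_Icc (by positivity) 0
  rw [zero_add] at h1
  rw [← h1]
  exact isCompact_Icc.image (contDiff_planeCurve h hs).continuous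

theorem planeCurve_eq_iff (hs : southPole ∉ range γ) {s t : ℝ} :
    planeCurve γ s = planeCurve γ t ↔ γ s = γ t := by
  constructor
  · intro h
    rw [← stereo_planeCurve hs s, h, stereo_planeCurve hs]
  · intro h; rw [planeCurve, h, planeCurve]

theorem notMem_range_planeCurve (hs : southPole ∉ range γ) {ζ : ℂ} :
    ζ ∉ range (planeCurve γ) ↔ stereo ζ ∉ range γ := by
  refine not_congr ⟨?_, ?_⟩
  · rintro ⟨t, rfl⟩; exact ⟨t, (stereo_planeCurve hs t).symm⟩
  · rintro ⟨t, ht⟩; exact ⟨t, by rw [planeCurve, ht, stereoProj_stereo]⟩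

theorem velocity_eq_fderiv_stereo (h : IsGenericCircle γ) (hs : southPole ∉ range γ) (t : ℝ) :
    velocity γ t = fderiv ℝ (fun z => (stereo z : R3)) (planeCurve γ t)
      (deriv (planeCurve γ) t) := by
  have h1 := ((contDiff_coe_stereo.differentiable (by simp) (planeCurve γ t)).hasFDerivAt).comp_hasDerivAt t
    ((contDiff_planeCurve h hs).differentiable (by simp) t).hasDerivAt
  have h2 : ((fun z => (stereo z : R3)) ∘ planeCurve γ) = fun t => (γ t : R3) := by
    funext t; simp only [Function.comp, stereo_planeCurve hs]
  rw [h2] at h1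
  exact h1.deriv

open Classical in
/-- The winding number of a loop around points of the sphere, normalised to vanish at the south
pole. -/
def sphereWinding (γ : ℝ → S2) (s t : ℝ) (y : S2) : ℝ :=
  if (y : R3) 2 = -1 then 0 else winding (planeCurve γ) s t (stereoProj y)

theorem sphereWinding_stereo (s t : ℝ) (ζ : ℂ) :
    sphereWinding γ s t (stereo ζ) = winding (planeCurve γ) s t ζ := by
  rw [sphereWinding, if_neg (stereo_two_ne ζ), stereoProj_stereo]

/-- At the south pole the stereographic coordinate tends to infinity, where the winding number
vanishes; hence the normalisation to zero is the continuous one. -/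
theorem continuousAt_sphereWinding (h : IsGenericCircle γ) (hs : southPole ∉ range γ) {s t : ℝ}
    (hst : γ s = γ t) {y : S2} (hy : y ∉ range γ) : ContinuousAt (sphereWinding γ s t) y := by
  have hc : ContDiff ℝ 1 (planeCurve γ) := (contDiff_planeCurve h hs).of_le (by simp)
  have hrc := isCompact_range_planeCurve h hs
  by_cases hy2 : (y : R3) 2 = -1
  · obtain ⟨R, -, hR⟩ := exists_winding_eq_zero hc hrc ((planeCurve_eq_iff hs).2 hst)
    have hcl : IsClosed (stereo '' Metric.closedBall 0 R) :=
      ((isCompact_closedBall 0 R).image contMDiff_stereo.continuous).isClosed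
    have hmem : y ∉ stereo '' Metric.closedBall 0 R := by
      rintro ⟨ζ, -, rfl⟩
      exact stereo_two_ne ζ hy2
    have hev : sphereWinding γ s t =ᶠ[𝓝 y] fun _ => 0 := by
      filter_upwards [hcl.isOpen_compl.mem_nhds hmem] with z hz
      rw [sphereWinding]
      split_ifs with hz2
      · rfl
      · apply hR
        by_contra! hlt
        exact hz ⟨stereoProj z, by simpa using hlt.le, stereo_stereoProj hz2⟩
    exact continuousAt_const.congr hev.symm
  · have h1 : ContinuousAt (fun z : S2 => stereoProj z) y :=
      (contDiffAt_stereoProj (one_add_ne_zero hy2)).continuousAt.comp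
        continuous_subtype_val.continuousAt
    have h2 : stereoProj y ∉ range (planeCurve γ) := by
      rw [notMem_range_planeCurve hs, stereo_stereoProj hy2]
      exact hy
    have h3 : ContinuousAt (fun z : S2 => winding (planeCurve γ) s t (stereoProj z)) y :=
      ContinuousAt.comp (f := fun z : S2 => stereoProj z)
        (continuousAt_winding hc hrc.isClosed s t h2) h1
    refine h3.congr ?_
    have hcoord : Continuous fun x : S2 => (x : R3) 2 :=
      (EuclideanSpace.proj 2 : R3 →L[ℝ] ℝ).continuous.comp continuous_subtype_val
    filter_upwards [hcoord.isOpen_preimage {-1}ᶜ isOpen_compl_singleton |>.mem_nhds hy2] with z hz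
    have hz' : (z : R3) 2 ≠ -1 := hz
    rw [sphereWinding, if_neg hz']

/-- A continuous function with integer values is constant on a connected region, including the
region that contains the south pole. -/
theorem exists_sphereWinding_eq (h : IsGenericCircle γ) (hs : southPole ∉ range γ) {s t : ℝ}
    (hst : γ s = γ t) : ∃ W : Set S2 → ℤ, ∀ U ∈ regions γ, ∀ y ∈ U,
      sphereWinding γ s t y = W U := by
  have hc : ContDiff ℝ 1 (planeCurve γ) := (contDiff_planeCurve h hs).of_le (by simp)
  have key : ∀ U ∈ regions γ, ∃ m : ℤ, ∀ y ∈ U, sphereWinding γ s t y = m := by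
    intro U hU
    have hint : ∀ z ∈ U, ∃ m : ℤ, sphereWinding γ s t z = m := by
      intro z hz
      rw [sphereWinding]
      split_ifs with hz2
      · exact ⟨0, by simp⟩
      · have h2 : stereoProj z ∉ range (planeCurve γ) := by
          rw [notMem_range_planeCurve hs, stereo_stereoProj hz2]
          exact subset_of_mem_regions hU hz
        obtain ⟨n, hn, -⟩ := exists_winding_eq hc ((planeCurve_eq_iff hs).2 hst) h2
        exact ⟨n, hn⟩
    obtain ⟨y₀, hy₀⟩ := nonempty_of_mem_regions hU
    obtain ⟨m, hm⟩ := hint y₀ hy₀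
    refine ⟨m, fun y hy => ?_⟩
    rw [← hm]
    refine (isPreconnected_of_mem_regions hU).constant_of_mapsTo isDiscrete_range_intCast
      (fun z hz => (continuousAt_sphereWinding h hs hst
        (subset_of_mem_regions hU hz)).continuousWithinAt) (fun z hz => ?_) hy hy₀
    obtain ⟨n, hn⟩ := hint z hz
    exact ⟨n, hn.symm⟩
  choose! W hW using key
  exact ⟨W, hW⟩

end PlaneCurve

/-! ### Surface integrals and loop integrals in stereographic coordinates -/

theorem integrable_areaJac_mul {f : S2 → ℝ} (hf : Continuous f) :
    Integrable fun ζ => f (stereo ζ) * areaJac stereo ζ := by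
  have h0 : ContDiff ℝ 1 fun ζ => (stereo ζ : R3) := contDiff_coe_stereo.of_le (by simp)
  have h1 := toSphere_image h0 stereo_injective MeasurableSet.univ
  have h2 : Integrable (areaJac stereo) := by
    refine ⟨(continuous_areaJac h0).aestronglyMeasurable, ?_⟩
    rw [hasFiniteIntegral_iff_norm]
    simp only [Real.norm_eq_abs]
    rw [setLIntegral_univ] at h1
    rw [← h1]
    exact measure_lt_top _ _
  obtain ⟨C, hC⟩ := isCompact_univ.exists_bound_of_continuousOn hf.continuousOn
  exact h2.bdd_mul (c := C) (hf.comp contMDiff_stereo.continuous).aestronglyMeasurable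
    (Eventually.of_forall fun ζ => hC _ (mem_univ _))

theorem toSphere_singleton (x : S2) : (volume : Measure R3).toSphere {x} = 0 := by
  have := toSphere_range_curve (γ := fun _ => x) contDiff_const
  rwa [range_const] at this

theorem surfaceIntegral_eq_preimage {U : Set S2} (hU : IsOpen U) (f : S2 → ℝ) :
    surfaceIntegral U f = ∫ ζ in stereo ⁻¹' U, f (stereo ζ) * areaJac stereo ζ := by
  have h0 : ContDiff ℝ 1 fun ζ => (stereo ζ : R3) := contDiff_coe_stereo.of_le (by simp)
  have hm : MeasurableSet (stereo ⁻¹' U) := (hU.preimage contMDiff_stereo.continuous).measurableSet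
  have h1 := surfaceIntegral_image h0 stereo_injective hm f
  have h2 : surfaceIntegral U f = surfaceIntegral (stereo '' (stereo ⁻¹' U)) f := by
    apply setIntegral_congr_set
    have h3 := measure_eq_zero_iff_ae_notMem.1 (toSphere_singleton southPole)
    filter_upwards [h3] with x hx
    apply propext
    have hx2 : (x : R3) 2 ≠ -1 := by rw [Ne, eq_southPole_iff]; exact hx
    constructor
    · intro h
      refine ⟨stereoProj x, ?_, stereo_stereoProj hx2⟩
      rw [mem_preimage, stereo_stereoProj hx2]
      exact h
    · rintro ⟨ζ, hζ, rfl⟩; exact hζ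
  rw [h2, h1]
  refine setIntegral_congr_fun hm fun ζ _ => ?_
  simp only [abs_of_pos (areaJac_stereo_pos ζ), mul_comm]

/-- Line integrals around loops in terms of winding numbers. -/
theorem lineIntegral_planeCurve {γ : ℝ → S2} (h : IsGenericCircle γ) (hs : southPole ∉ range γ)
    [Fintype (regions γ)] {P Q : ℂ → ℝ} (hP : ContDiff ℝ ∞ P) (hQ : ContDiff ℝ ∞ Q) {f : S2 → ℝ}
    (hf : Continuous f) (hcurl : ∀ ζ, curl P Q ζ = -(f (stereo ζ) * areaJac stereo ζ)) {s t : ℝ}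
    (hle : s ≤ t) (hst : γ s = γ t) {W : Set S2 → ℤ}
    (hW : ∀ U ∈ regions γ, ∀ y ∈ U, sphereWinding γ s t y = W U) :
    lineIntegral P Q (planeCurve γ) s t =
      -∑ U : regions γ, (W U : ℝ) * surfaceIntegral (U : Set S2) f := by
  have hc : ContDiff ℝ 1 (planeCurve γ) := (contDiff_planeCurve h hs).of_le (by simp)
  have hrc := isCompact_range_planeCurve h hs
  have hnull := volume_range_curve hc
  have hcont : Continuous stereo := contMDiff_stereo.continuous
  have hmeas : ∀ U : regions γ, MeasurableSet (stereo ⁻¹' (U : Set S2)) := fun U =>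
    ((isOpen_of_mem_regions h U.2).preimage hcont).measurableSet
  have hint := integrable_areaJac_mul hf
  have hWint : ∀ U : regions γ, ∀ ζ ∈ stereo ⁻¹' (U : Set S2),
      (W U : ℝ) * -(f (stereo ζ) * areaJac stereo ζ) =
        winding (planeCurve γ) s t ζ * curl P Q ζ := by
    intro U ζ hζ
    rw [hcurl, ← sphereWinding_stereo, hW U U.2 _ hζ]
  rw [lineIntegral_eq (hP.of_le (by simp)) (hQ.of_le (by simp)) hc hrc hnull hle
    ((planeCurve_eq_iff hs).2 hst)]
  have hae : (univ : Set ℂ) =ᵐ[volume] ⋃ U : regions γ, stereo ⁻¹' (U : Set S2) := by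
    filter_upwards [measure_eq_zero_iff_ae_notMem.1 hnull] with ζ hζ
    apply propext
    constructor
    · intro _
      obtain ⟨U, hU, hyU⟩ := exists_mem_regions ((notMem_range_planeCurve hs).1 hζ)
      exact mem_iUnion.2 ⟨⟨U, hU⟩, hyU⟩
    · intro _; trivial
  rw [← setIntegral_univ, setIntegral_congr_set hae, integral_iUnion_fintype hmeas,
      ← Finset.sum_neg_distrib]
  · refine Finset.sum_congr rfl fun U _ => ?_
    rw [surfaceIntegral_eq_preimage (isOpen_of_mem_regions h U.2), ← setIntegral_congr_fun (hmeas U)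
        (hWint U),
      integral_const_mul, integral_neg, mul_neg]
  · intro U V hUV
    refine Set.disjoint_left.2 fun ζ hU hV => hUV (Subtype.ext ?_)
    exact regions_eq_of_mem U.2 V.2 hU hV
  · intro U
    exact ((hint.neg.const_mul (W U : ℝ)).integrableOn).congr_fun (hWint U) (hmeas U)

/-! ### Winding numbers near a double point -/

section Vertex

variable {γ : ℝ → S2}

theorem angle_eq_of_abs_lt {s t : ℝ} (h : (s : Real.Angle) = t) (hlt : |s - t| < 2 * π) : s = t :=
    by
  obtain ⟨k, hk⟩ := Real.Angle.angle_eq_iff_two_pi_dvd_sub.1 h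
  have hk0 : k = 0 := by
    by_contra hne
    have h1 : (1 : ℝ) ≤ |(k : ℝ)| := by exact_mod_cast Int.one_le_abs hne
    rw [hk, abs_mul, abs_of_pos Real.two_pi_pos] at hlt
    nlinarith [Real.two_pi_pos]
  rw [hk0] at hk
  simp at hk
  linarith

/-- The determinant of two plane vectors. -/
def planeDet (U V : ℂ) : ℝ := U.re * V.im - U.im * V.re

theorem div_im_eq (z w : ℂ) : (z / w).im = planeDet w z / Complex.normSq w := by
  rw [Complex.div_im, planeDet]
  ring

theorem div_im_ne_zero {z w : ℂ} (h : planeDet w z ≠ 0) : (z / w).im ≠ 0 := by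
  rw [div_im_eq]
  refine div_ne_zero h ?_
  rw [Ne, Complex.normSq_eq_zero]
  rintro rfl
  simp [planeDet] at h

theorem det3_fderiv (Ψ : ℂ → S2) (ζ U V : ℂ) :
    det3 (Ψ ζ) (fderiv ℝ (fun z => (Ψ z : R3)) ζ U) (fderiv ℝ (fun z => (Ψ z : R3)) ζ V) =
      planeDet U V * areaJac Ψ ζ := by
  have hv : ∀ v : ℂ, v = v.re • (1 : ℂ) + v.im • Complex.I := fun v => by
    apply Complex.ext <;> simp
  conv_lhs => rw [hv U, hv V]
  simp only [map_add, map_smul, areaJac, planeDet, det3_apply, PiLp.add_apply, PiLp.smul_apply,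
    smul_eq_mul]
  ring

theorem coverSum_neg_left (U : Set S2) (x : S2) (a b : R3) :
    coverSum U x (-a) b = -coverSum U x a b := by
  simp only [coverSum, neg_neg]; ring

theorem coverSum_neg_right (U : Set S2) (x : S2) (a b : R3) :
    coverSum U x a (-b) = -coverSum U x a b := by
  simp only [coverSum, neg_neg]; ring

theorem IsCrossing.det_eq {x : S2} {s₀ t₀ : ℝ} {ζ : ℂ} (h : IsGenericCircle γ) (hs :
    southPole ∉ range γ)
    (hx : IsCrossing γ x s₀ t₀ (velocity γ s₀) (velocity γ t₀)) (hζ : stereo ζ = x) :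
    det3 x (velocity γ s₀) (velocity γ t₀) =
      planeDet (deriv (planeCurve γ) s₀) (deriv (planeCurve γ) t₀) * areaJac stereo ζ := by
  have e1 : planeCurve γ s₀ = ζ := by rw [planeCurve, hx.left, ← hζ, stereoProj_stereo]
  have e2 : planeCurve γ t₀ = ζ := by rw [planeCurve, hx.right, ← hζ, stereoProj_stereo]
  rw [velocity_eq_fderiv_stereo h hs, velocity_eq_fderiv_stereo h hs, e1, e2, ← hζ, det3_fderiv]

variable [Fintype (regions γ)]

/-- A point leaving the crossing into a quadrant is in the one region that covers the quadrant.
Writing its winding number as a sum over all regions lets the four quadrants combine into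
`coverSum`. -/
theorem IsCrossing.eventually_winding (h : IsGenericCircle γ) (hs : southPole ∉ range γ)
    {x : S2} {s₀ t₀ : ℝ} {a b : R3} (hx : IsCrossing γ x s₀ t₀ a b) {ζ : ℂ} (hζ : stereo ζ = x)
    {α : ℂ} (hα : fderiv ℝ (fun z => (stereo z : R3)) ζ α ∈ cone a b) {s t : ℝ}
    {W : Set S2 → ℤ} (hW : ∀ U ∈ regions γ, ∀ y ∈ U, sphereWinding γ s t y = W U) :
    ∀ᶠ r : ℝ in 𝓝[>] 0, ζ + r * α ∉ range (planeCurve γ) ∧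
      winding (planeCurve γ) s t (ζ + r * α) =
        ∑ U : regions γ, (W U : ℝ) * coverCount (U : Set S2) x (cone a b) := by
  obtain ⟨V, hV, hVi, hVc⟩ := hx.exists_region_covers h
  have h1 : Tendsto (fun r : ℝ => r⁻¹ • ((stereo (ζ + r • α) : R3) - x)) (𝓝[>] 0)
      (𝓝 (fderiv ℝ (fun z => (stereo z : R3)) ζ α)) := by
    have h2 := ((contDiff_coe_stereo.differentiable
      (by simp) ζ).hasFDerivAt.hasLineDerivAt α).tendsto_slope_zero_right
    rw [hζ] at h2
    exact h2
  filter_upwards [hVc _ _ hα h1] with r hr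
  rw [toS2_coe] at hr
  have hr' : stereo (ζ + r * α) ∈ V := by rwa [← Complex.real_smul]
  refine ⟨(notMem_range_planeCurve hs).2 (subset_of_mem_regions hV hr'), ?_⟩
  rw [← sphereWinding_stereo, hW V hV _ hr', Finset.sum_eq_single (⟨V, hV⟩ : regions γ)]
  · rw [coverCount, if_pos ((hVi V hV).2 rfl), mul_one]
  · intro U _ hne
    rw [coverCount, if_neg, mul_zero]
    intro hc
    exact hne (Subtype.ext ((hVi U U.2).1 hc))
  · intro hn; exact absurd (Finset.mem_univ _) hn

section Frame

variable {x : S2} {s₀ t₀ : ℝ} {ζ : ℂ}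

/-- The alternating sum of the winding numbers of the regions at a double point as a limit. -/
theorem IsCrossing.sum_winding_eq (h : IsGenericCircle γ) (hs : southPole ∉ range γ)
    (hx : IsCrossing γ x s₀ t₀ (velocity γ s₀) (velocity γ t₀)) (hζ : stereo ζ = x) {s t : ℝ}
    (hst : γ s = γ t)
    {W : Set S2 → ℤ} (hW : ∀ U ∈ regions γ, ∀ y ∈ U, sphereWinding γ s t y = W U) :
    let A := deriv (planeCurve γ) s₀ + deriv (planeCurve γ) t₀
    let B := deriv (planeCurve γ) s₀ - deriv (planeCurve γ) t₀
    (∀ᶠ r : ℝ in 𝓝[>] 0, ζ + r * A ∉ range (planeCurve γ) ∧ ζ + r * -A ∉ range (planeCurve γ) ∧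
      ζ + r * B ∉ range (planeCurve γ) ∧ ζ + r * -B ∉ range (planeCurve γ)) ∧
    ∀ ℓ, TendsToCross (planeCurve γ) ζ (fun _ => A) (fun _ => -A) (fun _ => B) (fun _ => -B) s t ℓ →
      2 * π * ∑ U : regions γ, (W U : ℝ) *
        coverSum (U : Set S2) x (velocity γ s₀) (velocity γ t₀) = ℓ := by
  intro A B
  have e1 : planeCurve γ s₀ = ζ := by rw [planeCurve, hx.left, ← hζ, stereoProj_stereo]
  have e2 : planeCurve γ t₀ = ζ := by rw [planeCurve, hx.right, ← hζ, stereoProj_stereo]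
  have v1 := velocity_eq_fderiv_stereo h hs s₀
  have v2 := velocity_eq_fderiv_stereo h hs t₀
  rw [e1] at v1
  rw [e2] at v2
  have w1 := hx.eventually_winding h hs hζ (α := A)
    (by rw [map_add, ← v1, ← v2]; exact add_mem_cone _ _) hW
  have w2 := hx.neg_left.neg_right.eventually_winding h hs hζ (α := -A)
    (by rw [neg_add, map_add, map_neg, map_neg, ← v1, ← v2]; exact add_mem_cone _ _) hW
  have w3 := hx.neg_right.eventually_winding h hs hζ (α := B)
    (by rw [show B = deriv (planeCurve γ) s₀ + -deriv (planeCurve γ) t₀ from sub_eq_add_neg _ _,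
          map_add, map_neg, ← v1, ← v2]
        exact add_mem_cone _ _) hW
  have w4 := hx.neg_left.eventually_winding h hs hζ (α := -B)
    (by rw [show -B = -deriv (planeCurve γ) s₀ + deriv (planeCurve γ) t₀ from by
            rw [neg_add_eq_sub]; exact neg_sub _ _,
          map_add, map_neg, ← v1, ← v2]
        exact add_mem_cone _ _) hW
  have hc : ContDiff ℝ 1 (planeCurve γ) := (contDiff_planeCurve h hs).of_le (by simp)
  have him : ∀ y ∉ range (planeCurve γ), (logIntegral (planeCurve γ) s t y).im =
      2 * π * winding (planeCurve γ) s t y := by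
    intro y hy
    obtain ⟨n, hn, hl⟩ := exists_winding_eq hc ((planeCurve_eq_iff hs).2 hst) hy
    rw [hn, hl]
    simp
    ring
  refine ⟨?_, fun ℓ hℓ => ?_⟩
  · filter_upwards [w1, w2, w3, w4] with r r1 r2 r3 r4 using ⟨r1.1, r2.1, r3.1, r4.1⟩
  · refine tendsto_nhds_unique (tendsto_const_nhds.congr' ?_) hℓ
    filter_upwards [w1, w2, w3, w4] with r r1 r2 r3 r4
    simp only [crossDiff]
    rw [him _ r1.1, him _ r2.1, him _ r3.1, him _ r4.1, r1.2, r2.2, r3.2, r4.2]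
    simp only [coverSum, mul_sub, mul_add, Finset.sum_sub_distrib, Finset.sum_add_distrib]

/-- The alternating sum of winding numbers at the base point of a loop. -/
theorem IsCrossing.sum_winding_corner_velocity (h : IsGenericCircle γ) (hs : southPole ∉ range γ)
    {s t : ℝ} (hx : IsCrossing γ x s t (velocity γ s) (velocity γ t)) (hlt : s < t)
    (hlt' : t < s + 2 * π)
    {W : Set S2 → ℤ} (hW : ∀ U ∈ regions γ, ∀ y ∈ U, sphereWinding γ s t y = W U) :
    ∑ U : regions γ, (W U : ℝ) * coverSum (U : Set S2) x (velocity γ s) (velocity γ t) =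
      SignType.sign (det3 x (velocity γ s) (velocity γ t)) := by
  have hc : ContDiff ℝ 1 (planeCurve γ) := (contDiff_planeCurve h hs).of_le (by simp)
  set ζ := planeCurve γ s with hζ'
  have hζ : stereo ζ = x := by rw [hζ', stereo_planeCurve hs, hx.left]
  have e2 : planeCurve γ t = ζ := by rw [planeCurve, hx.right, ← hζ, stereoProj_stereo]
  obtain ⟨hoff, hsum⟩ := hx.sum_winding_eq h hs hζ (hx.left.trans hx.right.symm) hW
  have hdet := hx.det_eq h hs hζ
  have hJ := areaJac_stereo_pos ζ
  have hne := hx.det_ne h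
  set U := deriv (planeCurve γ) s with hU
  set V := deriv (planeCurve γ) t with hV
  have hne' : planeDet U V ≠ 0 := by
    intro h0; apply hne; rw [hdet, h0, zero_mul]
  -- The crossing is approached along the diagonals `±(U + V)` and `±(U - V)`, one in each quadrant
  -- and none tangent to a strand.
  have p1 : planeDet (U + V) U = -planeDet U V := by simp [planeDet]; ring
  have p2 : planeDet (U - V) U = planeDet U V := by simp [planeDet]; ring
  have p3 : planeDet (U + V) V = planeDet U V := by simp [planeDet]; ring
  have p4 : planeDet (U - V) V = planeDet U V := by simp [planeDet]; ring
  -- Since the interval is shorter than a period, the loop meets the double point only at its ends.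
  have hcorner := tendsToCross_corner hc hoff tendsto_const_nhds tendsto_const_nhds
    tendsto_const_nhds tendsto_const_nhds hlt rfl e2 (fun τ hτ h0 => by
      have hτx : γ τ = x := by
        rw [← hx.left]
        exact (planeCurve_eq_iff hs).1 h0
      rcases h.angle_eq_or hx.ne hx.left hx.right hτx with e | e
      · have := angle_eq_of_abs_lt e (by rw [abs_lt]; constructor <;> linarith [hτ.1, hτ.2])
        exact hτ.1.ne' this
      · have := angle_eq_of_abs_lt e (by rw [abs_lt]; constructor <;> linarith [hτ.1, hτ.2])
        exact hτ.2.ne this)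
    (div_im_ne_zero (by rw [p1]; exact neg_ne_zero.2 hne'))
    (div_im_ne_zero (by rw [p2]; exact hne')) (div_im_ne_zero (by rw [p3]; exact hne'))
    (div_im_ne_zero (by rw [p4]; exact hne'))
  have hval := hsum _ hcorner
  have hpi := Real.two_pi_pos
  rcases lt_or_gt_of_ne hne' with hneg | hpos
  · have him : (V / U).im < 0 := by
      rw [div_im_eq]
      refine div_neg_of_neg_of_pos hneg (Complex.normSq_pos.2 ?_)
      rintro h0
      rw [h0] at hne'
      simp [planeDet] at hne'
    rw [crossArg_sub_of_neg him] at hval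
    rw [hdet, sign_neg (mul_neg_of_neg_of_pos hneg hJ)]
    simp only [SignType.coe_neg_one]
    have : 2 * π * (∑ U : regions γ, (W U : ℝ) * coverSum (U : Set S2) x (velocity γ s)
        (velocity γ t)) =
        2 * π * -1 := by rw [hval]; ring
    exact mul_left_cancel₀ hpi.ne' this
  · have him : 0 < (V / U).im := by
      rw [div_im_eq]
      refine div_pos hpos (Complex.normSq_pos.2 ?_)
      rintro h0
      rw [h0] at hne'
      simp [planeDet] at hne'
    rw [crossArg_sub_of_pos him] at hval
    rw [hdet, sign_pos (mul_pos hpos hJ)]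
    simp only [SignType.coe_one]
    exact mul_left_cancel₀ hpi.ne' (hval.trans (mul_one _).symm)

/-- The alternating sum of winding numbers at the base point of a loop. -/
theorem IsCrossing.sum_winding_corner (h : IsGenericCircle γ) (hs : southPole ∉ range γ)
    {s t : ℝ} {a b : R3} (hx : IsCrossing γ x s t a b) (hlt : s < t) (hlt' : t < s + 2 * π)
    {W : Set S2 → ℤ} (hW : ∀ U ∈ regions γ, ∀ y ∈ U, sphereWinding γ s t y = W U) :
    ∑ U : regions γ, (W U : ℝ) * coverSum (U : Set S2) x a b = SignType.sign (det3 x a b) := by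
  have hx' : IsCrossing γ x s t (velocity γ s) (velocity γ t) :=
    ⟨hx.ne, hx.left, hx.right, Or.inl rfl, Or.inl rfl⟩
  have key := hx'.sum_winding_corner_velocity h hs hlt hlt' hW
  rcases hx.left_vel with rfl | rfl <;> rcases hx.right_vel with rfl | rfl
  · exact key
  · simp only [coverSum_neg_right, mul_neg, Finset.sum_neg_distrib, key, det3_neg_right,
      Left.sign_neg, SignType.coe_neg]
  · simp only [coverSum_neg_left, mul_neg, Finset.sum_neg_distrib, key, det3_neg_mid,
      Left.sign_neg, SignType.coe_neg]
  · simp only [coverSum_neg_left, coverSum_neg_right, neg_neg, key, det3_neg_mid, det3_neg_right]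

/-- Away from its base point the loop runs through `x` not at all, once or twice, and every complete
passage contributes zero. -/
theorem IsCrossing.sum_winding_strand_velocity (h : IsGenericCircle γ) (hs : southPole ∉ range γ)
    {s t : ℝ} (hx : IsCrossing γ x s₀ t₀ (velocity γ s₀) (velocity γ t₀)) (hlt : s < t)
    (hlt' : t ≤ s + 2 * π) (hst : γ s = γ t) (hsx : γ s ≠ x)
    {W : Set S2 → ℤ} (hW : ∀ U ∈ regions γ, ∀ y ∈ U, sphereWinding γ s t y = W U) :
    ∑ U : regions γ, (W U : ℝ) * coverSum (U : Set S2) x (velocity γ s₀) (velocity γ t₀) = 0 := by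
  have hc : ContDiff ℝ 1 (planeCurve γ) := (contDiff_planeCurve h hs).of_le (by simp)
  set ζ := planeCurve γ s₀ with hζ'
  have hζ : stereo ζ = x := by rw [hζ', stereo_planeCurve hs, hx.left]
  obtain ⟨hoff, hsum⟩ := hx.sum_winding_eq h hs hζ hst hW
  have hdet := hx.det_eq h hs hζ
  have hne := hx.det_ne h
  have hdper : Function.Periodic (deriv (planeCurve γ)) (2 * π) := by
    intro τ
    have : planeCurve γ = fun r => planeCurve γ (r + 2 * π) := by
      funext r; rw [periodic_planeCurve h r]
    conv_rhs => rw [this]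
    rw [deriv_comp_add_const]
  set U := deriv (planeCurve γ) s₀ with hU
  set V := deriv (planeCurve γ) t₀ with hV
  have hne' : planeDet U V ≠ 0 := by
    intro h0; apply hne; rw [hdet, h0, zero_mul]
  have p1 : planeDet (U + V) U = -planeDet U V := by simp [planeDet]; ring
  have p2 : planeDet (U - V) U = planeDet U V := by simp [planeDet]; ring
  have p3 : planeDet (U + V) V = planeDet U V := by simp [planeDet]; ring
  have p4 : planeDet (U - V) V = planeDet U V := by simp [planeDet]; ring
  have hζx : ∀ τ, planeCurve γ τ = ζ ↔ γ τ = x := by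
    intro τ
    rw [hζ', planeCurve_eq_iff hs, hx.left]
  have hs' : γ t ≠ x := hst ▸ hsx
  have hang : ∀ τ ∈ Icc s t, γ τ = x → τ ∈ Ioo s t := by
    rintro τ ⟨h1, h2⟩ h3
    refine ⟨lt_of_le_of_ne h1 ?_, lt_of_le_of_ne h2 ?_⟩
    · rintro rfl; exact hsx h3
    · rintro rfl; exact hs' h3
  have hstrand : ∀ {σ τ τ₀ : ℝ}, σ < τ₀ → τ₀ < τ → γ τ₀ = x →
      (∀ r ∈ Icc σ τ, γ r = x → r = τ₀) →
      TendsToCross (planeCurve γ) ζ (fun _ => U + V) (fun _ => -(U + V)) (fun _ => U - V)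
        (fun _ => -(U - V)) σ τ 0 := by
    intro σ τ τ₀ h1 h2 h3 h4
    have hd : (deriv (planeCurve γ) τ₀ / (U + V)).im ≠ 0 ∧
        (deriv (planeCurve γ) τ₀ / (U - V)).im ≠ 0 := by
      rcases h.angle_eq_or hx.ne hx.left hx.right h3 with e | e
      · rw [hdper.eq_of_angle e]
        exact ⟨div_im_ne_zero (by rw [p1]; exact neg_ne_zero.2 hne'),
          div_im_ne_zero (by rw [p2]; exact hne')⟩
      · rw [hdper.eq_of_angle e]
        exact ⟨div_im_ne_zero (by rw [p3]; exact hne'), div_im_ne_zero (by rw [p4]; exact hne')⟩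
    exact tendsToCross_strand hc hoff tendsto_const_nhds tendsto_const_nhds tendsto_const_nhds
      tendsto_const_nhds h1 h2 ((hζx _).2 h3) (fun r hr hr' => h4 r hr ((hζx _).1 hr')) hd.1 hd.2
  have hzero : TendsToCross (planeCurve γ) ζ (fun _ => U + V) (fun _ => -(U + V)) (fun _ => U - V)
      (fun _ => -(U - V)) s t 0 := by
    by_cases h0 : ∃ τ₁ ∈ Icc s t, γ τ₁ = x
    · obtain ⟨τ₁, hτ₁, e₁⟩ := h0
      have hi₁ := hang _ hτ₁ e₁
      by_cases h1 : ∃ τ₂ ∈ Icc s t, γ τ₂ = x ∧ τ₂ ≠ τ₁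
      · have two : ∀ {σ₁ σ₂ : ℝ}, σ₁ ∈ Icc s t → σ₂ ∈ Icc s t → γ σ₁ = x → γ σ₂ = x → σ₁ < σ₂ →
            TendsToCross (planeCurve γ) ζ (fun _ => U + V) (fun _ => -(U + V)) (fun _ => U - V)
              (fun _ => -(U - V)) s t 0 := by
          intro σ₁ σ₂ m₁ m₂ f₁ f₂ hσ
          have i₁ := hang _ m₁ f₁
          have i₂ := hang _ m₂ f₂
          have hσne : (σ₁ : Real.Angle) ≠ σ₂ := by
            intro e
            have := angle_eq_of_abs_lt e (by
              rw [abs_lt]; constructor <;> linarith [i₁.1, i₁.2, i₂.1, i₂.2])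
            exact hσ.ne this
          have honly : ∀ r ∈ Icc s t, γ r = x → r = σ₁ ∨ r = σ₂ := by
            intro r hr hrx
            have ir := hang _ hr hrx
            rcases h.angle_eq_or hσne f₁ f₂ hrx with e | e
            · exact Or.inl (angle_eq_of_abs_lt e (by
                rw [abs_lt]; constructor <;> linarith [i₁.1, i₁.2, ir.1, ir.2]))
            · exact Or.inr (angle_eq_of_abs_lt e (by
                rw [abs_lt]; constructor <;> linarith [i₂.1, i₂.2, ir.1, ir.2]))
          -- Two passages are separated at the midpoint of their parameters.
          have a1 := hstrand (σ := s) (τ := (σ₁ + σ₂) / 2) i₁.1 (by linarith) f₁ (by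
            intro r hr hrx
            rcases honly r ⟨hr.1, by linarith [hr.2, i₂.2]⟩ hrx with e | e
            · exact e
            · exfalso; linarith [hr.2])
          have a2 := hstrand (σ := (σ₁ + σ₂) / 2) (τ := t) (by linarith) i₂.2 f₂ (by
            intro r hr hrx
            rcases honly r ⟨by linarith [hr.1, i₁.1], hr.2⟩ hrx with e | e
            · exfalso; linarith [hr.1]
            · exact e)
          have := a1.add hc hoff a2
          rwa [add_zero] at this
        obtain ⟨τ₂, hτ₂, e₂, hne₂⟩ := h1
        rcases lt_or_gt_of_ne hne₂ with hl | hl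
        · exact two hτ₂ hτ₁ e₂ e₁ hl
        · exact two hτ₁ hτ₂ e₁ e₂ hl
      · push Not at h1
        exact hstrand hi₁.1 hi₁.2 e₁ h1
    · push Not at h0
      exact tendsToCross_of_notMem hc hlt.le (fun τ hτ h2 => h0 τ hτ ((hζx τ).1 h2))
        tendsto_const_nhds tendsto_const_nhds tendsto_const_nhds tendsto_const_nhds
  have := hsum 0 hzero
  exact (mul_eq_zero.1 this).resolve_left Real.two_pi_pos.ne'

/-- The alternating sum of winding numbers at a double point that is not the base point. -/
theorem IsCrossing.sum_winding_strand (h : IsGenericCircle γ) (hs : southPole ∉ range γ)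
    {s t : ℝ} {a b : R3} (hx : IsCrossing γ x s₀ t₀ a b) (hlt : s < t)
    (hlt' : t ≤ s + 2 * π) (hst : γ s = γ t) (hsx : γ s ≠ x)
    {W : Set S2 → ℤ} (hW : ∀ U ∈ regions γ, ∀ y ∈ U, sphereWinding γ s t y = W U) :
    ∑ U : regions γ, (W U : ℝ) * coverSum (U : Set S2) x a b = 0 := by
  have hx' : IsCrossing γ x s₀ t₀ (velocity γ s₀) (velocity γ t₀) :=
    ⟨hx.ne, hx.left, hx.right, Or.inl rfl, Or.inl rfl⟩
  have key := hx'.sum_winding_strand_velocity h hs hlt hlt' hst hsx hW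
  rcases hx.left_vel with rfl | rfl <;> rcases hx.right_vel with rfl | rfl <;>
    simp only [coverSum_neg_left, coverSum_neg_right, mul_neg, Finset.sum_neg_distrib, key,
        neg_zero]

end Frame

end Vertex

/-! ### Legendrian lifts -/

namespace ContactCircleBundle

variable {E : Type*} [TopologicalSpace E] [ChartedSpace R3 E] [IsManifold (𝓡 3) ∞ E]
  [MulAction Circle E] {B : ContactCircleBundle E} {γ : ℝ → S2}

/-- The negative primitive of the connection form along the lift of a curve by a section. -/
def liftAngle (B : ContactCircleBundle E) (s : ℂ → E) (c : ℝ → ℂ) (t : ℝ) : ℝ :=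
  -∫ τ in (0 : ℝ)..t, B.pullForm s (c τ) (deriv c τ)

theorem contDiff_pullForm_curve {s : ℂ → E} (hs : ContMDiff 𝓘(ℝ, ℂ) (𝓡 3) ∞ s) {c : ℝ → ℂ}
    (hc : ContDiff ℝ ∞ c) : ContDiff ℝ ∞ fun τ => B.pullForm s (c τ) (deriv c τ) := by
  have h1 : ContDiff ℝ ∞ (deriv c) := (contDiff_infty_iff_deriv.1 hc).2
  have e : (fun τ => B.pullForm s (c τ) (deriv c τ)) =
      fun τ => B.pullForm s (c τ) 1 * (deriv c τ).re + B.pullForm s (c τ) Complex.I * (deriv c τ).im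
          := by
    funext τ; rw [B.pullForm_eq]
  rw [e]
  exact (((B.contDiff_pullForm_apply hs 1).comp hc).mul (Complex.reCLM.contDiff.comp h1)).add
    (((B.contDiff_pullForm_apply hs Complex.I).comp hc).mul (Complex.imCLM.contDiff.comp h1))

theorem hasDerivAt_liftAngle {s : ℂ → E} (hs : ContMDiff 𝓘(ℝ, ℂ) (𝓡 3) ∞ s) {c : ℝ → ℂ}
    (hc : ContDiff ℝ ∞ c) (t : ℝ) :
    HasDerivAt (liftAngle B s c) (-B.pullForm s (c t) (deriv c t)) t := by
  have hcont := (contDiff_pullForm_curve (B := B) hs hc).continuous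
  exact (hcont.integral_hasStrictDerivAt 0 t).hasDerivAt.neg

theorem contDiff_liftAngle {s : ℂ → E} (hs : ContMDiff 𝓘(ℝ, ℂ) (𝓡 3) ∞ s) {c : ℝ → ℂ}
    (hc : ContDiff ℝ ∞ c) : ContDiff ℝ ∞ (liftAngle B s c) := by
  rw [contDiff_infty_iff_deriv]
  refine ⟨fun t => (hasDerivAt_liftAngle hs hc t).differentiableAt, ?_⟩
  have e : deriv (liftAngle B s c) = fun t => -B.pullForm s (c t) (deriv c t) :=
    funext fun t => (hasDerivAt_liftAngle hs hc t).deriv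
  rw [e]
  exact (contDiff_pullForm_curve hs hc).neg

theorem liftAngle_sub {s : ℂ → E} (hs : ContMDiff 𝓘(ℝ, ℂ) (𝓡 3) ∞ s) {c : ℝ → ℂ}
    (hc : ContDiff ℝ ∞ c) (σ τ : ℝ) : liftAngle B s c τ - liftAngle B s c σ =
      -lineIntegral (fun z => B.pullForm s z 1) (fun z => B.pullForm s z Complex.I) c σ τ := by
  have hcont := (contDiff_pullForm_curve (B := B) hs hc).continuous
  have e : lineIntegral (fun z => B.pullForm s z 1) (fun z => B.pullForm s z Complex.I) c σ τ =
      ∫ r in σ..τ, B.pullForm s (c r) (deriv c r) := by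
    rw [lineIntegral]
    exact intervalIntegral.integral_congr fun r _ => (B.pullForm_eq _ _).symm
  rw [e, ← intervalIntegral.integral_interval_sub_left (hcont.intervalIntegrable 0 τ)
    (hcont.intervalIntegrable 0 σ), liftAngle, liftAngle]
  ring

variable {e : ℤ} [Fintype (regions γ)]

/-- The change of the angle along a loop of the curve, if the areas of the regions are given by
integers and chord lengths. -/
theorem liftAngle_loop (he : B.IsEulerNumber e) (h : IsGenericCircle γ) (hsp : southPole ∉ range γ)
    {s : ℂ → E} (hs : ContMDiff 𝓘(ℝ, ℂ) (𝓡 3) ∞ s) (hp : ∀ ζ, B.proj (s ζ) = stereo ζ)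
    {a b : doublePoints γ → R3} {q : doublePoints γ → ℝ} {n : regions γ → ℤ}
    (hn : ∀ U : regions γ, surfaceIntegral (U : Set S2) B.curvature =
      2 * π * n U - ∑ᶠ p : doublePoints γ, q p * coverSum (U : Set S2) p (a p) (b p))
    {σ τ : ℝ} (hle : σ ≤ τ) (hστ : γ σ = γ τ) {W : Set S2 → ℤ}
    (hW : ∀ U ∈ regions γ, ∀ y ∈ U, sphereWinding γ σ τ y = W U) :
    liftAngle B s (planeCurve γ) τ - liftAngle B s (planeCurve γ) σ =
      2 * π * ((∑ U : regions γ, W U * n U : ℤ) : ℝ) - ∑ᶠ p : doublePoints γ, q p *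
        ∑ U : regions γ, (W U : ℝ) * coverSum (U : Set S2) p (a p) (b p) := by
  have : Finite (doublePoints γ) := (finite_doublePoints h).to_subtype
  have : Fintype (doublePoints γ) := Fintype.ofFinite _
  rw [liftAngle_sub hs (contDiff_planeCurve h hsp), lineIntegral_planeCurve h hsp
    (B.contDiff_pullForm_apply hs 1) (B.contDiff_pullForm_apply hs Complex.I)
    (B.continuous_curvature he) (B.curl_pullForm hs hp) hle hστ hW, neg_neg]
  simp only [hn, finsum_eq_sum_of_fintype]
  push_cast
  simp only [mul_sub, Finset.sum_sub_distrib, Finset.mul_sum]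
  congr 1
  · exact Finset.sum_congr rfl fun U _ => by ring
  · rw [Finset.sum_comm]
    exact Finset.sum_congr rfl fun U _ => Finset.sum_congr rfl fun p _ => by ring

/-- A generic circle whose regions have suitable areas lifts to a closed Legendrian curve with
given chord lengths over the double points. -/
theorem exists_lift (he : B.IsEulerNumber e) (h : IsGenericCircle γ) (hsp : southPole ∉ range γ)
    {S T : doublePoints γ → ℝ} {a b : doublePoints γ → R3}
    (hx : ∀ p : doublePoints γ, IsCrossing γ p (S p) (T p) (a p) (b p)) (hlt : ∀ p, S p < T p)
    (hlt' : ∀ p, T p < S p + 2 * π) {q : doublePoints γ → ℝ} {n : regions γ → ℤ}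
    (hn : ∀ U : regions γ, surfaceIntegral (U : Set S2) B.curvature =
      2 * π * n U - ∑ᶠ p : doublePoints γ, q p * coverSum (U : Set S2) p (a p) (b p)) :
    ∃ L : ℝ → E, ContMDiff 𝓘(ℝ, ℝ) (𝓡 3) ∞ L ∧ Function.Periodic L (2 * π) ∧
      (∀ t, B.proj (L t) = γ t) ∧
      (∀ t, B.form (L t) (mfderiv 𝓘(ℝ, ℝ) (𝓡 3) L t (1 : ℝ)) = 0) ∧
      ∀ p : doublePoints γ, (0 < det3 p (a p) (b p) → Circle.exp (q p) • L (T p) = L (S p)) ∧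
        (det3 p (a p) (b p) < 0 → Circle.exp (q p) • L (S p) = L (T p)) := by
  obtain ⟨s, -, hs, -, hps, -⟩ := exists_sections he
  have hc := contDiff_planeCurve h hsp
  set c := planeCurve γ with hcdef
  set θ := liftAngle B s c with hθ
  have hθs : ContDiff ℝ ∞ θ := contDiff_liftAngle hs hc
  have hcp : Function.Periodic c (2 * π) := periodic_planeCurve h
  have hproj : ∀ t, B.proj (Circle.exp (θ t) • s (c t)) = γ t := fun t => by
    rw [← (B.fibre (s (c t)) _).2 ⟨_, rfl⟩, hps, hcdef, stereo_planeCurve hsp]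
  have hperiod : ∃ m : ℤ, ∀ t, θ (t + 2 * π) = θ t + 2 * π * m := by
    -- Starting the full loop away from all double points makes every vertex a passage, so no chord
    -- length enters and only a multiple of `2π` remains.
    obtain ⟨σ, hσ⟩ : ∃ σ, γ σ ∉ doublePoints γ := by
      have h1 : ∀ᶠ τ in 𝓝[≠] (0 : ℝ), ∀ x ∈ doublePoints γ, γ τ ≠ x :=
        (finite_doublePoints h).eventually_all.2 fun x _ => eventually_curve_ne h 0 x
      obtain ⟨τ, hτ⟩ := h1.exists
      exact ⟨τ, fun hm => hτ _ hm rfl⟩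
    have hγσ : γ σ = γ (σ + 2 * π) := (h.periodic σ).symm
    have hlts : σ < σ + 2 * π := by linarith [Real.two_pi_pos]
    obtain ⟨W, hW⟩ := exists_sphereWinding_eq h hsp hγσ
    have key := liftAngle_loop he h hsp hs hps hn hlts.le hγσ hW
    have hz : ∀ p : doublePoints γ, q p *
        ∑ U : regions γ, (W U : ℝ) * coverSum (U : Set S2) p (a p) (b p) = 0 := fun p => by
      rw [(hx p).sum_winding_strand h hsp hlts le_rfl hγσ (fun e => hσ (e ▸ p.2)) hW, mul_zero]
    rw [finsum_congr hz, finsum_zero, sub_zero] at key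
    refine ⟨∑ U : regions γ, W U * n U, fun t => ?_⟩
    -- The increment over a period does not depend on the starting point, so knowing it at `σ` is
    -- enough.
    have hd : ∀ t, HasDerivAt (fun t => θ (t + 2 * π) - θ t) 0 t := by
      intro t
      have h1 := ((hasDerivAt_liftAngle (B := B) hs hc (t + 2 * π)).comp_add_const t (2 * π)).sub
        (hasDerivAt_liftAngle (B := B) hs hc t)
      have h2 : deriv c (t + 2 * π) = deriv c t := by
        have : c = fun r => c (r + 2 * π) := by funext r; rw [hcp r]
        conv_rhs => rw [this]
        rw [deriv_comp_add_const]
      rw [hcp t, h2, sub_self] at h1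
      exact h1
    have h3 := is_const_of_deriv_eq_zero (fun t => (hd t).differentiableAt)
      (fun t => (hd t).deriv) t σ
    rw [key] at h3
    linarith
  obtain ⟨m, hm⟩ := hperiod
  have hexp : ∀ k : ℤ, Circle.exp (2 * π * k) = 1 := fun k => by
    rw [Circle.exp_eq_one]; exact ⟨k, by ring⟩
  -- For the loop from one strand to the other at `p`, only the corner at `p` contributes; the sign
  -- of the determinant decides which strand the chord starts from.
  have hloop : ∀ p : doublePoints γ, ∃ k : ℤ, θ (T p) = θ (S p) + 2 * π * k -
      q p * SignType.sign (det3 p (a p) (b p)) := by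
    intro p
    have hγ : γ (S p) = γ (T p) := (hx p).left.trans (hx p).right.symm
    obtain ⟨W, hW⟩ := exists_sphereWinding_eq h hsp hγ
    have key := liftAngle_loop he h hsp hs hps hn (hlt p).le hγ hW
    rw [finsum_eq_single _ p, (hx p).sum_winding_corner h hsp (hlt p) (hlt' p) hW] at key
    · exact ⟨_, by linarith⟩
    · intro p' hne
      rw [(hx p').sum_winding_strand h hsp (hlt p) (hlt' p).le hγ (fun e => hne ?_) hW, mul_zero]
      exact Subtype.ext (e.symm.trans (hx p).left)
  have hcST : ∀ p, c (S p) = c (T p) := fun p =>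
    (planeCurve_eq_iff hsp).2 ((hx p).left.trans (hx p).right.symm)
  refine ⟨fun t => Circle.exp (θ t) • s (c t), ?_, ?_, hproj, ?_, fun p => ⟨fun hd => ?_,
      fun hd => ?_⟩⟩
  · exact B.contMDiff_exp_smul hθs (hs.comp hc.contMDiff)
  · intro t
    simp only
    rw [hm, hcp t, Circle.exp_add, hexp, mul_one]
  · intro t
    have h1 := B.pullForm_lift hs (hθs.differentiable (by simp) t) (hc.differentiable (by simp) t)
    rw [(hasDerivAt_liftAngle hs hc t).deriv, neg_add_cancel] at h1
    exact h1
  · obtain ⟨k, hk⟩ := hloop p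
    simp only
    rw [sign_pos hd] at hk
    rw [hk, hcST, smul_smul, ← Circle.exp_add]
    congr 1
    rw [show q p + (θ (S p) + 2 * π * k - q p * ((1 : SignType) : ℝ)) = θ (S p) + 2 * π * k by
      simp, Circle.exp_add, hexp, mul_one]
  · obtain ⟨k, hk⟩ := hloop p
    simp only
    rw [sign_neg hd] at hk
    rw [hk, hcST, smul_smul, ← Circle.exp_add]
    congr 1
    rw [show θ (S p) + 2 * π * k - q p * ((-1 : SignType) : ℝ) = q p + θ (S p) + 2 * π * k by
      simp; ring, Circle.exp_add _ (2 * π * k), hexp, mul_one]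

end ContactCircleBundle

/-! ### Smooth maps of the plane -/

section PlaneMaps

theorem det_eq_planeDet (A : ℂ →L[ℝ] ℂ) : A.det = planeDet (A 1) (A Complex.I) := by
  rw [ContinuousLinearMap.det, ← LinearMap.det_toMatrix Complex.basisOneI, Matrix.det_fin_two,
    planeDet]
  simp [LinearMap.toMatrix_apply]
  ring

theorem ContinuousLinearMap.det_comp_apply (A B : ℂ →L[ℝ] ℂ) : (A.comp B).det = A.det * B.det :=
  LinearMap.det_comp _ _

theorem planeDet_apply (A : ℂ →L[ℝ] ℂ) (U V : ℂ) :
    planeDet (A U) (A V) = A.det * planeDet U V := by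
  have hv : ∀ v : ℂ, v = v.re • (1 : ℂ) + v.im • Complex.I := fun v => by
    apply Complex.ext <;> simp
  rw [det_eq_planeDet]
  conv_lhs => rw [hv U, hv V, map_add, map_add, map_smul, map_smul, map_smul, map_smul]
  simp only [planeDet, Complex.add_re, Complex.add_im, Complex.real_smul,
    Complex.re_ofReal_mul, Complex.im_ofReal_mul]
  ring

theorem det_fderiv_comp {f g : ℂ → ℂ} {z : ℂ} (hf : DifferentiableAt ℝ f (g z))
    (hg : DifferentiableAt ℝ g z) :
    (fderiv ℝ (fun w => f (g w)) z).det = (fderiv ℝ f (g z)).det * (fderiv ℝ g z).det := by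
  have h : fderiv ℝ (fun w => f (g w)) z = (fderiv ℝ f (g z)).comp (fderiv ℝ g z) :=
    fderiv_comp z hf hg
  rw [h, ContinuousLinearMap.det_comp_apply]

/-- By the inverse function theorem an injective local diffeomorphism is an open embedding with
smooth inverse, and `K` is this inverse composed with `S`. No continuity of `K` is assumed. -/
theorem contDiff_of_comp_eq {T S K : ℂ → ℂ} (hT : ContDiff ℝ ∞ T) (hinj : Function.Injective T)
    (hdet : ∀ w, (fderiv ℝ T w).det ≠ 0) (hS : ContDiff ℝ ∞ S) (h : ∀ w, T (K w) = S w) :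
    ContDiff ℝ ∞ K := by
  have hstrict : ∀ w, HasStrictFDerivAt T
      ((fderiv ℝ T w).toContinuousLinearEquivOfDetNeZero (hdet w) : ℂ →L[ℝ] ℂ) w := fun w => by
    rw [ContinuousLinearMap.coe_toContinuousLinearEquivOfDetNeZero]
    exact hT.contDiffAt.hasStrictFDerivAt (by simp)
  have hopen : IsOpenMap T := isOpenMap_of_hasStrictFDerivAt_equiv hstrict
  have hemb : IsOpenEmbedding T :=
    IsOpenEmbedding.of_continuous_injective_isOpenMap hT.continuous hinj hopen
  set e := hemb.toOpenPartialHomeomorph T with he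
  have hcoe : ∀ w, e w = T w := fun w => rfl
  have hsymm : ∀ w, e.symm (T w) = w := fun w => e.left_inv (by simp [he])
  have hK : K = fun w => e.symm (S w) := by
    funext w; rw [← h, hsymm]
  rw [hK, contDiff_iff_contDiffAt]
  intro w
  refine ContDiffAt.comp w ?_ hS.contDiffAt
  have hmem : S w ∈ e.target := by
    rw [← h]; exact e.map_source (by simp [he])
  refine e.contDiffAt_symm hmem (f₀' :=
      (fderiv ℝ T (e.symm (S w))).toContinuousLinearEquivOfDetNeZero
    (hdet _)) (hstrict _).hasFDerivAt hT.contDiffAt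

/-- Smoothness can be checked in logarithmic coordinates. -/
theorem contDiffAt_of_comp_exp {F : Type*} [NormedAddCommGroup F] [NormedSpace ℝ F] {f : ℂ → F}
    {w : ℂ} (h : ContDiffAt ℝ ∞ (fun z => f (Complex.exp z)) w) :
    ContDiffAt ℝ ∞ f (Complex.exp w) := by
  have hne := Complex.exp_ne_zero w
  have h1 : Complex.exp w / Complex.exp w = 1 := div_self hne
  have hl : ContDiffAt ℝ ∞ (fun z => w + Complex.log (z / Complex.exp w)) (Complex.exp w) := by
    have h2 : ContDiffAt ℝ ∞ Complex.log (Complex.exp w / Complex.exp w) := by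
      rw [h1]
      exact (Complex.contDiffAt_log Complex.one_mem_slitPlane).restrict_scalars ℝ
    have h5 : ContDiffAt ℝ ∞ (fun z : ℂ => z / Complex.exp w) (Complex.exp w) :=
      contDiffAt_id.div_const _
    exact contDiffAt_const.add (ContDiffAt.comp (Complex.exp w) (f := fun z => z / Complex.exp w)
        h2 h5)
  have h3 : w + Complex.log (Complex.exp w / Complex.exp w) = w :=
      by rw [h1, Complex.log_one, add_zero]
  have h4 : ContDiffAt ℝ ∞ (fun z => f (Complex.exp (w + Complex.log (z / Complex.exp w))))
      (Complex.exp w) := by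
    refine ContDiffAt.comp (Complex.exp w) (g := fun z => f (Complex.exp z)) ?_ hl
    rw [h3]; exact h
  refine h4.congr_of_eventuallyEq ?_
  filter_upwards [isOpen_ne.mem_nhds hne] with z hz
  rw [Complex.exp_add, Complex.exp_log (div_ne_zero hz hne), mul_div_cancel₀ _ hne]

/-! ### Maps of the plane in logarithmic coordinates -/

theorem hasFDerivAt_complexExp (w : ℂ) :
    HasFDerivAt Complex.exp ((ContinuousLinearMap.mul ℝ ℂ (Complex.exp w))) w := by
  have h := ((Complex.hasDerivAt_exp w).hasFDerivAt).restrictScalars ℝ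
  have e : ContinuousLinearMap.mul ℝ ℂ (Complex.exp w) = ((ContinuousLinearMap.toSpanSingleton ℂ
      (Complex.exp w) : ℂ →L[ℂ] ℂ)).restrictScalars ℝ :=
    ContinuousLinearMap.ext fun v => by simp [mul_comm]
  rw [e]
  exact h

theorem det_fderiv_exp (w : ℂ) : (fderiv ℝ Complex.exp w).det = Real.exp (2 * w.re) := by
  rw [(hasFDerivAt_complexExp w).fderiv, det_eq_planeDet]
  have : Real.exp (2 * w.re) = Real.exp w.re * Real.exp w.re := by rw [← Real.exp_add]; ring_nf
  simp [planeDet, Complex.exp_re, Complex.exp_im, this]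
  linear_combination (Real.exp w.re * Real.exp w.re) * Real.cos_sq_add_sin_sq w.im

theorem norm_exp_le_iff {w : ℂ} {r : ℝ} (hr : 0 < r) : ‖Complex.exp w‖ ≤ r ↔ w.re ≤ Real.log r := by
  rw [Complex.norm_exp, Real.le_log_iff_exp_le hr]

theorem le_norm_exp_iff {w : ℂ} {r : ℝ} (hr : 0 < r) : r ≤ ‖Complex.exp w‖ ↔ Real.log r ≤ w.re := by
  rw [Complex.norm_exp, Real.log_le_iff_le_exp hr]

/-- The map of the plane that is given by `K` in logarithmic coordinates. -/
def expConj (K : ℂ → ℂ) (z : ℂ) : ℂ := if z = 0 then 0 else Complex.exp (K (Complex.log z))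

theorem exp_eq_of_periodic {K : ℂ → ℂ} (hper : ∀ w, K (w + 2 * π * Complex.I) = K w + 2 * π *
    Complex.I)
    {w w' : ℂ} (h : Complex.exp w = Complex.exp w') : Complex.exp (K w) = Complex.exp (K w') := by
  have hp : Function.Periodic (fun w => K w - w) (2 * π * Complex.I) := fun w => by
    simp only [hper]; ring
  obtain ⟨n, hn⟩ := Complex.exp_eq_exp_iff_exists_int.1 h
  have h1 := hp.int_mul n w'
  rw [Complex.exp_eq_exp_iff_exists_int]
  refine ⟨n, ?_⟩
  rw [hn]
  linear_combination h1

theorem expConj_exp {K : ℂ → ℂ} (hper : ∀ w, K (w + 2 * π * Complex.I) = K w + 2 * π * Complex.I)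
    (w : ℂ) : expConj K (Complex.exp w) = Complex.exp (K w) := by
  rw [expConj, if_neg (Complex.exp_ne_zero w)]
  exact exp_eq_of_periodic hper (Complex.exp_log (Complex.exp_ne_zero w))

theorem expConj_eq_self {K : ℂ → ℂ} {z : ℂ} (hK : K (Complex.log z) = Complex.log z) :
    expConj K z = z := by
  rw [expConj]
  split_ifs with h
  · exact h.symm
  · rw [hK, Complex.exp_log h]

/-- Equivariance under `2πi` makes the cut of the logarithm invisible, so away from the origin
smoothness is tested in logarithmic coordinates. Near the origin the map is the identity because `K`
is the identity far to the left. -/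
theorem contDiff_expConj {K : ℂ → ℂ} (hK : ContDiff ℝ ∞ K)
    (hper : ∀ w, K (w + 2 * π * Complex.I) = K w + 2 * π * Complex.I) {a : ℝ}
    (ha : ∀ w : ℂ, w.re ≤ a → K w = w) : ContDiff ℝ ∞ (expConj K) := by
  rw [contDiff_iff_contDiffAt]
  intro z
  by_cases hz : z = 0
  · refine contDiffAt_id.congr_of_eventuallyEq ?_
    have h1 : ∀ᶠ y in 𝓝 z, ‖y‖ < Real.exp a :=
      continuous_norm.continuousAt.eventually_lt continuousAt_const (by
        rw [hz, norm_zero]; exact Real.exp_pos a)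
    filter_upwards [h1] with y hy
    rw [expConj]
    split_ifs with h
    · exact h.symm
    · rw [ha, Complex.exp_log h]; rfl
      rw [Complex.log_re]
      exact ((Real.log_lt_iff_lt_exp (norm_pos_iff.2 h)).2 hy).le
  · rw [← Complex.exp_log hz]
    refine contDiffAt_of_comp_exp ?_
    have : (fun w => expConj K (Complex.exp w)) = fun w => Complex.exp (K w) :=
      funext (expConj_exp hper)
    rw [this]
    exact (Complex.contDiff_exp.comp hK).contDiffAt

theorem det_fderiv_expConj {K : ℂ → ℂ} (hK : ContDiff ℝ ∞ K)
    (hper : ∀ w, K (w + 2 * π * Complex.I) = K w + 2 * π * Complex.I) {a : ℝ}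
    (ha : ∀ w : ℂ, w.re ≤ a → K w = w) (w : ℂ) :
    (fderiv ℝ (expConj K) (Complex.exp w)).det * Real.exp (2 * w.re) =
      Real.exp (2 * (K w).re) * (fderiv ℝ K w).det := by
  have h1 := det_fderiv_comp (f := expConj K) (g := Complex.exp) (z := w)
    ((contDiff_expConj hK hper ha).differentiable (by simp) _) (hasFDerivAt_complexExp w).differentiableAt
  have h2 := det_fderiv_comp (f := Complex.exp) (g := K) (z := w)
    (hasFDerivAt_complexExp _).differentiableAt (hK.differentiable (by simp) _)
  rw [det_fderiv_exp] at h1 h2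
  rw [← h1, ← h2]
  simp only [expConj_exp hper]

end PlaneMaps

/-! ### Parametric integrals -/

/-- The integral is the value at `0` of the convolution of the indicator of `(0, 1]` with a
parameter dependent kernel. The bump function gives the kernel compact support and equals `1` where
the indicator sees it. -/
theorem contDiff_parametric_intervalIntegral {F : Type*} [NormedAddCommGroup F] [NormedSpace ℝ F]
    {h : F × ℝ → ℝ} (hh : ContDiff ℝ ∞ h) : ContDiff ℝ ∞ fun p => ∫ s in (0 : ℝ)..1, h (p, s) := by
  let φ : ContDiffBump (0 : ℝ) := ⟨1, 2, one_pos, by norm_num⟩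
  let g : F → ℝ → ℝ := fun p x => φ x * h (p, -x)
  let f : ℝ → ℝ := (Ioc (0 : ℝ) 1).indicator fun _ => 1
  have hf : LocallyIntegrable f volume :=
    ((integrableOn_const (by simp)).integrable_indicator measurableSet_Ioc).locallyIntegrable
  have key : ContDiffOn ℝ ∞ (fun p => (convolution f (g p) (ContinuousLinearMap.mul ℝ ℝ) volume)
      ((fun _ => 0) p))
      univ := by
    refine contDiffOn_convolution_right_with_param_comp (n := ⊤) (k := Metric.closedBall (0 : ℝ) 2)
      (ContinuousLinearMap.mul ℝ ℝ) (v := fun _ => (0 : ℝ)) contDiffOn_const isOpen_univ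
      (isCompact_closedBall 0 2) (fun p x _ hx => ?_) hf ?_
    · have : φ x = 0 := φ.zero_of_le_dist (by
        rw [Metric.mem_closedBall, not_le] at hx; exact hx.le)
      simp [g, this]
    · refine ContDiff.contDiffOn ?_
      exact (φ.contDiff.comp contDiff_snd).mul (hh.comp (contDiff_fst.prodMk contDiff_snd.neg))
  rw [contDiffOn_univ] at key
  convert key using 2 with p
  rw [convolution_def, intervalIntegral.integral_of_le zero_le_one,
    ← integral_indicator measurableSet_Ioc]
  refine integral_congr_ae (Eventually.of_forall fun t => ?_)
  simp only [f, g, indicator]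
  split_ifs with ht
  · have : φ (-t) = 1 := φ.one_of_mem_closedBall (by
      rw [Metric.mem_closedBall, dist_zero_right, norm_neg, Real.norm_eq_abs,
        abs_of_pos ht.1]
      exact ht.2)
    simp [this]
  · simp

/-! ### Transport of densities on the cylinder -/

section Cylinder

/-- A smooth positive density on the cylinder `ℂ / 2πiℤ`. -/
structure IsCylinderDensity (g : ℂ → ℝ) : Prop where
  smooth : ContDiff ℝ ∞ g
  pos : ∀ w, 0 < g w
  periodic : Function.Periodic g (2 * π * Complex.I)

/-- The integral of a density over the arc `[0, y]` of a circle of the cylinder. -/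
def arcMass (g : ℂ → ℝ) (u y : ℝ) : ℝ := ∫ t in (0 : ℝ)..y, g (u + t * Complex.I)

/-- The integral of a density over a circle of the cylinder. -/
def circleMass (g : ℂ → ℝ) (u : ℝ) : ℝ := arcMass g u (2 * π)

/-- Coordinates on the cylinder in which a given density is constant. -/
def flatten (g : ℂ → ℝ) (a : ℝ) (w : ℂ) : ℂ :=
  ⟨∫ u in a..w.re, circleMass g u, 2 * π * (arcMass g w.re w.im / circleMass g w.re)⟩

variable {f g : ℂ → ℝ} {a b : ℝ}

namespace IsCylinderDensity

theorem continuous_arc (hg : IsCylinderDensity g) (u : ℝ) :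
    Continuous fun t : ℝ => g (u + t * Complex.I) :=
  hg.smooth.continuous.comp (by fun_prop)

theorem contDiff_arcMass (hg : IsCylinderDensity g) : ContDiff ℝ ∞ fun p :
    ℝ × ℝ => arcMass g p.1 p.2 := by
  -- Rescaling the arc to the unit interval moves the variable endpoint into the integrand.
  have e : (fun p : ℝ × ℝ => arcMass g p.1 p.2) =
      fun p => p.2 * ∫ s in (0 : ℝ)..1, g (p.1 + (p.2 * s : ℝ) * Complex.I) := by
    funext p
    have := intervalIntegral.mul_integral_comp_mul_left (a := 0) (b := 1)
      (f := fun t : ℝ => g (p.1 + t * Complex.I)) p.2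
    rw [mul_zero, mul_one] at this
    rw [arcMass, ← this]
  rw [e]
  refine contDiff_snd.mul ?_
  refine contDiff_parametric_intervalIntegral (h := fun r : (ℝ × ℝ) × ℝ =>
    g (r.1.1 + (r.1.2 * r.2 : ℝ) * Complex.I)) (hg.smooth.comp ?_)
  have h1 : ContDiff ℝ ∞ fun r : (ℝ × ℝ) × ℝ => (r.1.1 : ℂ) :=
    Complex.ofRealCLM.contDiff.comp (contDiff_fst.comp contDiff_fst)
  have h2 : ContDiff ℝ ∞ fun r : (ℝ × ℝ) × ℝ => ((r.1.2 * r.2 : ℝ) : ℂ) :=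
    Complex.ofRealCLM.contDiff.comp ((contDiff_snd.comp contDiff_fst).mul contDiff_snd)
  exact h1.add (h2.mul contDiff_const)

theorem contDiff_circleMass (hg : IsCylinderDensity g) : ContDiff ℝ ∞ (circleMass g) :=
  hg.contDiff_arcMass.comp (contDiff_id.prodMk contDiff_const)

theorem hasDerivAt_arcMass (hg : IsCylinderDensity g) (u y : ℝ) :
    HasDerivAt (arcMass g u) (g (u + y * Complex.I)) y :=
  ((hg.continuous_arc u).integral_hasStrictDerivAt 0 y).hasDerivAt

theorem strictMono_arcMass (hg : IsCylinderDensity g) (u : ℝ) : StrictMono (arcMass g u) :=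
  strictMono_of_deriv_pos fun y => by
    rw [(hg.hasDerivAt_arcMass u y).deriv]; exact hg.pos _

theorem circleMass_pos (hg : IsCylinderDensity g) (u : ℝ) : 0 < circleMass g u := by
  have h := hg.strictMono_arcMass u Real.two_pi_pos
  rwa [arcMass, intervalIntegral.integral_same] at h

theorem arcMass_add (hg : IsCylinderDensity g) (u y : ℝ) :
    arcMass g u (y + 2 * π) = arcMass g u y + circleMass g u := by
  have hp : Function.Periodic (fun t : ℝ => g (u + t * Complex.I)) (2 * π) := fun t => by
    have := hg.periodic (u + t * Complex.I)
    refine Eq.trans ?_ this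
    show g _ = g _
    congr 1
    push_cast
    ring
  have hi : ∀ x y : ℝ, IntervalIntegrable (fun t : ℝ => g (u + t * Complex.I)) volume x y :=
    fun x y => (hg.continuous_arc u).intervalIntegrable x y
  rw [arcMass, ← intervalIntegral.integral_add_adjacent_intervals (hi 0 y) (hi y (y + 2 * π)),
    hp.intervalIntegral_add_eq y 0, zero_add]
  rfl

theorem hasDerivAt_mass (hg : IsCylinderDensity g) (a u : ℝ) :
    HasDerivAt (fun u => ∫ r in a..u, circleMass g r) (circleMass g u) u :=
  (hg.contDiff_circleMass.continuous.integral_hasStrictDerivAt a u).hasDerivAt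

theorem contDiff_flatten (hg : IsCylinderDensity g) (a : ℝ) : ContDiff ℝ ∞ (flatten g a) := by
  have h1 : ContDiff ℝ ∞ fun u => ∫ r in a..u, circleMass g r := by
    rw [contDiff_infty_iff_deriv]
    refine ⟨fun u => (hg.hasDerivAt_mass a u).differentiableAt, ?_⟩
    have e : deriv (fun u => ∫ r in a..u, circleMass g r) = circleMass g :=
      funext fun u => (hg.hasDerivAt_mass a u).deriv
    rw [e]
    exact hg.contDiff_circleMass
  have h2 : ContDiff ℝ ∞ fun w : ℂ => 2 * π * (arcMass g w.re w.im / circleMass g w.re) :=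
    contDiff_const.mul ((hg.contDiff_arcMass.comp
      (Complex.reCLM.contDiff.prodMk Complex.imCLM.contDiff)).div
      (hg.contDiff_circleMass.comp Complex.reCLM.contDiff) fun w => (hg.circleMass_pos _).ne')
  exact Complex.equivRealProdCLM.symm.contDiff.comp ((h1.comp Complex.reCLM.contDiff).prodMk h2)

/-- The derivative is triangular: the new real part depends on the old one only, with derivative
`circleMass`, and this factor cancels the normalisation of the angular coordinate. -/
theorem det_fderiv_flatten (hg : IsCylinderDensity g) (a : ℝ) (w : ℂ) :
    (fderiv ℝ (flatten g a) w).det = 2 * π * g w := by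
  have hd := (hg.contDiff_flatten a).differentiable (by simp) w
  have hre : ∀ v : ℂ, (fderiv ℝ (flatten g a) w v).re = circleMass g w.re * v.re := by
    intro v
    have h1 := Complex.reCLM.hasFDerivAt.comp w hd.hasFDerivAt
    have h2 := (hg.hasDerivAt_mass a w.re).hasFDerivAt.comp w Complex.reCLM.hasFDerivAt
    have h3 := congrArg (fun A : ℂ →L[ℝ] ℝ => A v) (h1.unique h2)
    rw [mul_comm]
    exact h3
  have him : (fderiv ℝ (flatten g a) w Complex.I).im = 2 * π * (g w / circleMass g w.re) := by
    have h0 : HasDerivAt (fun t : ℝ => w + t * Complex.I) Complex.I 0 := by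
      simpa using ((Complex.ofRealCLM.hasDerivAt (x := 0)).mul_const Complex.I).const_add w
    have h0' : w + ((0 : ℝ) : ℂ) * Complex.I = w := by simp
    have h1 : HasDerivAt (fun t : ℝ => flatten g a (w + t * Complex.I))
        (fderiv ℝ (flatten g a) w Complex.I) 0 := by
      refine HasFDerivAt.comp_hasDerivAt (0 : ℝ) (l := flatten g a) ?_ h0
      rw [h0']; exact hd.hasFDerivAt
    have h2 := Complex.imCLM.hasFDerivAt.comp_hasDerivAt (0 : ℝ) h1
    have h3 : HasDerivAt (fun t : ℝ => 2 * π * (arcMass g w.re (w.im + t) / circleMass g w.re))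
        (2 * π * (g w / circleMass g w.re)) 0 := by
      have h4 := hg.hasDerivAt_arcMass w.re (w.im + 0)
      have h5 := h4.comp_const_add w.im 0
      have h6 : (w.re : ℂ) + ((w.im + 0 : ℝ) : ℂ) * Complex.I = w := by
        rw [add_zero, Complex.re_add_im]
      rw [h6] at h5
      exact (h5.div_const _).const_mul _
    have e : (Complex.imCLM ∘ fun t : ℝ => flatten g a (w + t * Complex.I)) =
        fun t : ℝ => 2 * π * (arcMass g w.re (w.im + t) / circleMass g w.re) := by
      funext t
      simp [flatten]
    rw [e] at h2
    exact h2.unique h3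
  rw [det_eq_planeDet, planeDet, hre, hre, him]
  have := (hg.circleMass_pos w.re).ne'
  simp
  field_simp

theorem strictMono_mass (hg : IsCylinderDensity g) (a : ℝ) :
    StrictMono fun u => ∫ r in a..u, circleMass g r :=
  strictMono_of_deriv_pos fun u => by
    rw [(hg.hasDerivAt_mass a u).deriv]; exact hg.circleMass_pos u

theorem flatten_injective (hg : IsCylinderDensity g) (a : ℝ) : Function.Injective (flatten g a) :=
    by
  intro w w' h
  have h1 : w.re = w'.re := (hg.strictMono_mass a).injective (congrArg Complex.re h)
  have h2 := congrArg Complex.im h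
  simp only [flatten, h1] at h2
  have h3 := mul_left_cancel₀ Real.two_pi_pos.ne' h2
  rw [div_left_inj' (hg.circleMass_pos _).ne'] at h3
  exact Complex.ext h1 ((hg.strictMono_arcMass _).injective h3)

theorem flatten_add (hg : IsCylinderDensity g) (a : ℝ) (w : ℂ) :
    flatten g a (w + 2 * π * Complex.I) = flatten g a w + 2 * π * Complex.I := by
  have h1 : (w + 2 * π * Complex.I).re = w.re := by simp
  have h2 : (w + 2 * π * Complex.I).im = w.im + 2 * π := by simp
  have := (hg.circleMass_pos w.re).ne'
  apply Complex.ext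
  · simp [flatten, h1]
  · simp only [flatten, h1, h2, hg.arcMass_add, Complex.add_im]
    simp
    field_simp

/-- The normalised arc mass fixes all multiples of `2π`; the intermediate value theorem between two
consecutive multiples does the rest. -/
theorem exists_arcMass_eq (hg : IsCylinderDensity g) (u v : ℝ) :
    ∃ y, 2 * π * (arcMass g u y / circleMass g u) = v := by
  set D : ℝ → ℝ := fun y => 2 * π * (arcMass g u y / circleMass g u) with hD
  have hm := (hg.circleMass_pos u).ne'
  have hp : Function.Periodic (fun y => D y - y) (2 * π) := fun y => by
    simp only [hD, hg.arcMass_add]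
    field_simp
    ring
  have hz : ∀ n : ℤ, D (n * (2 * π)) = n * (2 * π) := fun n => by
    have h1 : D (0 + n * (2 * π)) - (0 + n * (2 * π)) = D 0 - 0 := hp.int_mul n 0
    rw [zero_add] at h1
    have h2 : D 0 = 0 := by simp [hD, arcMass]
    rw [h2] at h1
    linarith
  have hc : Continuous D := by
    have : Continuous (arcMass g u) :=
      continuous_iff_continuousAt.2 fun y => (hg.hasDerivAt_arcMass u y).continuousAt
    exact continuous_const.mul (this.div_const _)
  have h3 := Int.floor_le (v / (2 * π))
  have h4 := (Int.lt_floor_add_one (v / (2 * π))).le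
  rw [le_div_iff₀ Real.two_pi_pos] at h3
  rw [div_le_iff₀ Real.two_pi_pos] at h4
  have h5 := intermediate_value_Icc (f := D)
    (show (⌊v / (2 * π)⌋ : ℝ) * (2 * π) ≤ ((⌊v / (2 * π)⌋ + 1 : ℤ) : ℝ) * (2 * π) by
      push_cast; nlinarith [Real.two_pi_pos]) hc.continuousOn
  obtain ⟨y, -, hy⟩ := h5 (show v ∈ _ by rw [hz, hz]; push_cast; exact ⟨h3, h4⟩)
  exact ⟨y, hy⟩

theorem arcMass_congr (hfg : ∀ w : ℂ, w.re ≤ a ∨ b ≤ w.re → f w = g w) {u : ℝ} (hu : u ≤ a ∨ b ≤ u)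
    (y : ℝ) : arcMass f u y = arcMass g u y :=
  intervalIntegral.integral_congr fun t _ => hfg _ (by simpa using hu)

/-- The flat coordinates of two densities agree where the densities agree. -/
theorem mass_eq (hf : IsCylinderDensity f) (hg : IsCylinderDensity g)
    (hfg : ∀ w : ℂ, w.re ≤ a ∨ b ≤ w.re → f w = g w)
    (hmass : ∫ u in a..b, circleMass f u = ∫ u in a..b, circleMass g u) {u : ℝ}
    (hu : u ≤ a ∨ b ≤ u) : ∫ r in a..u, circleMass f r = ∫ r in a..u, circleMass g r := by
  rcases hu with hu | hu
  · refine intervalIntegral.integral_congr fun r hr => ?_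
    rw [uIcc_of_ge hu] at hr
    exact arcMass_congr hfg (Or.inl hr.2) _
  · rw [← intervalIntegral.integral_add_adjacent_intervals
      (hf.contDiff_circleMass.continuous.intervalIntegrable a b)
      (hf.contDiff_circleMass.continuous.intervalIntegrable b u),
      ← intervalIntegral.integral_add_adjacent_intervals
      (hg.contDiff_circleMass.continuous.intervalIntegrable a b)
      (hg.contDiff_circleMass.continuous.intervalIntegrable b u), hmass]
    congr 1
    refine intervalIntegral.integral_congr fun r hr => ?_
    rw [uIcc_of_le hu] at hr
    exact arcMass_congr hfg (Or.inr hr.1) _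

theorem flatten_eq (hf : IsCylinderDensity f) (hg : IsCylinderDensity g)
    (hfg : ∀ w : ℂ, w.re ≤ a ∨ b ≤ w.re → f w = g w)
    (hmass : ∫ u in a..b, circleMass f u = ∫ u in a..b, circleMass g u) {w : ℂ}
    (hw : w.re ≤ a ∨ b ≤ w.re) : flatten f a w = flatten g a w := by
  apply Complex.ext
  · exact hf.mass_eq hg hfg hmass hw
  · simp only [flatten, circleMass]
    rw [arcMass_congr hfg hw, arcMass_congr hfg hw]

/-- Equality of the total masses makes the two axial mass functions agree outside `(a, b)`. In
between, the intermediate value theorem yields the real part. -/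
theorem exists_flatten_eq (hf : IsCylinderDensity f) (hg : IsCylinderDensity g) (hab : a ≤ b)
    (hfg : ∀ w : ℂ, w.re ≤ a ∨ b ≤ w.re → f w = g w)
    (hmass : ∫ u in a..b, circleMass f u = ∫ u in a..b, circleMass g u) (w : ℂ) :
    ∃ z, flatten g a z = flatten f a w := by
  set F : ℝ → ℝ := fun u => ∫ r in a..u, circleMass f r with hF
  set G : ℝ → ℝ := fun u => ∫ r in a..u, circleMass g r with hG
  obtain ⟨u, hu⟩ : ∃ u, G u = F w.re := by
    have hout : ∀ u, u ≤ a ∨ b ≤ u → F u = G u := fun u hu => hf.mass_eq hg hfg hmass hu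
    rcases le_total w.re a with h1 | h1
    · exact ⟨w.re, (hout _ (Or.inl h1)).symm⟩
    rcases le_total b w.re with h2 | h2
    · exact ⟨w.re, (hout _ (Or.inr h2)).symm⟩
    have h3 := intermediate_value_Icc (f := G) hab
      (continuous_iff_continuousAt.2 fun u => (hg.hasDerivAt_mass a u).continuousAt).continuousOn
    obtain ⟨u, -, hu⟩ := h3 (show F w.re ∈ _ by
      rw [← hout a (Or.inl le_rfl), ← hout b (Or.inr le_rfl)]
      exact ⟨(hf.strictMono_mass a).monotone h1, (hf.strictMono_mass a).monotone h2⟩)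
    exact ⟨u, hu⟩
  obtain ⟨y, hy⟩ := hg.exists_arcMass_eq u (flatten f a w).im
  exact ⟨⟨u, y⟩, Complex.ext hu hy⟩

/-- Two densities of the same mass that agree near the ends of the cylinder are related by a
diffeomorphism. -/
theorem exists_transport (hf : IsCylinderDensity f) (hg : IsCylinderDensity g) (hab : a ≤ b)
    (hfg : ∀ w : ℂ, w.re ≤ a ∨ b ≤ w.re → f w = g w)
    (hmass : ∫ u in a..b, circleMass f u = ∫ u in a..b, circleMass g u) :
    ∃ K : ℂ → ℂ, ContDiff ℝ ∞ K ∧ (∀ w, K (w + 2 * π * Complex.I) = K w + 2 * π * Complex.I) ∧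
      (∀ w : ℂ, w.re ≤ a ∨ b ≤ w.re → K w = w) ∧
      (∀ w, g (K w) * (fderiv ℝ K w).det = f w) ∧ ∀ w, flatten g a (K w) = flatten f a w := by
  -- The transport map is the flattening of `f` followed by the inverse of the flattening of `g`.
  choose K hK using hf.exists_flatten_eq hg hab hfg hmass
  have hinj := hg.flatten_injective a
  have hsm : ContDiff ℝ ∞ K := contDiff_of_comp_eq (hg.contDiff_flatten a) hinj
    (fun w => by
      rw [hg.det_fderiv_flatten]; exact (mul_pos Real.two_pi_pos (hg.pos w)).ne')
    (hf.contDiff_flatten a) hK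
  refine ⟨K, hsm, fun w => hinj ?_, fun w hw => hinj ?_, fun w => ?_, hK⟩
  · rw [hK, hf.flatten_add, hg.flatten_add, hK]
  · rw [hK, hf.flatten_eq hg hfg hmass hw]
  -- Both flattenings have Jacobian `2π` times their density, so the chain rule is the transport
  -- equation.
  · have h1 := det_fderiv_comp (f := flatten g a) (g := K) (z := w)
      ((hg.contDiff_flatten a).differentiable (by simp) _) (hsm.differentiable (by simp) _)
    simp only [hK] at h1
    have h2 := hf.det_fderiv_flatten a w
    have h3 : fderiv ℝ (fun w => flatten f a w) w = fderiv ℝ (flatten f a) w := rfl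
    rw [h3, h2, hg.det_fderiv_flatten] at h1
    have h4 := Real.two_pi_pos.ne'
    have : 2 * π * (g (K w) * (fderiv ℝ K w).det) = 2 * π * f w := by rw [h1]; ring
    exact mul_left_cancel₀ h4 this

end IsCylinderDensity

end Cylinder

/-! ### Transport of densities in the plane -/

section PlaneTransport

/-- Integration over an annulus in logarithmic coordinates. -/
theorem integral_eq_of_annulus {h : ℂ → ℝ} (hc : Continuous h) {r₀ r₁ : ℝ} (h0 : 0 < r₀)
    (h01 : r₀ ≤ r₁) (hz : ∀ z, ‖z‖ ≤ r₀ ∨ r₁ ≤ ‖z‖ → h z = 0) :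
    ∫ z, h z = ∫ u in Real.log r₀..Real.log r₁, circleMass (fun w => h (Complex.exp w) *
      Real.exp (2 * w.re)) u := by
  have h1 : 0 < r₁ := h0.trans_le h01
  set a := Real.log r₀ with ha
  set b := Real.log r₁ with hb
  have hab : a ≤ b := Real.log_le_log h0 h01
  set H : ℂ → ℝ := fun w => h (Complex.exp w) * Real.exp (2 * w.re) with hH
  have hHc : Continuous H := (hc.comp Complex.continuous_exp).mul (by fun_prop)
  set A : Set ℂ := Icc a b ×ℂ Ioc (-π) π with hA
  have hAm : MeasurableSet A := Complex.measurableEquivRealProd.measurable (measurableSet_Icc.prod measurableSet_Ioc)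
  have hinj : InjOn Complex.exp A := by
    intro w hw w' hw' e
    rw [hA, Complex.mem_reProdIm] at hw hw'
    exact Complex.exp_inj_of_neg_pi_lt_of_le_pi hw.2.1 hw.2.2 hw'.2.1 hw'.2.2 e
  have hsupport : ∫ z, h z = ∫ z in Complex.exp '' A, h z := by
    refine (setIntegral_eq_integral_of_forall_compl_eq_zero fun z hzA => hz z ?_).symm
    by_contra hcon
    push Not at hcon
    have hz0 : z ≠ 0 := norm_pos_iff.1 (h0.trans hcon.1)
    refine hzA ⟨Complex.log z, ?_, Complex.exp_log hz0⟩
    rw [hA, Complex.mem_reProdIm, Complex.log_re, Complex.log_im]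
    exact ⟨⟨Real.log_le_log h0 hcon.1.le, Real.log_le_log (h0.trans hcon.1) hcon.2.le⟩,
      Complex.neg_pi_lt_arg z, Complex.arg_le_pi z⟩
  have hchange : ∫ z in Complex.exp '' A, h z = ∫ w in A, H w := by
    rw [integral_image_eq_integral_abs_det_fderiv_smul volume hAm
      (fun w _ => (hasFDerivAt_complexExp w).differentiableAt.hasFDerivAt.hasFDerivWithinAt) hinj]
    refine integral_congr_ae (Eventually.of_forall fun w => ?_)
    simp only [det_fderiv_exp, hH, smul_eq_mul]
    rw [abs_of_pos (Real.exp_pos _), mul_comm]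
  have hprod : ∫ w in A, H w = ∫ p in Icc a b ×ˢ Ioc (-π) π, H (p.1 + p.2 * Complex.I) := by
    have hmp := Complex.volume_preserving_equiv_real_prod
    have e := hmp.setIntegral_preimage_emb Complex.measurableEquivRealProd.measurableEmbedding
      (fun p : ℝ × ℝ => H (p.1 + p.2 * Complex.I)) (Icc a b ×ˢ Ioc (-π) π)
    rw [← e]
    have e2 : Complex.measurableEquivRealProd ⁻¹' (Icc a b ×ˢ Ioc (-π) π) = A := rfl
    rw [e2]
    refine setIntegral_congr_fun hAm fun w _ => ?_
    simp [Complex.measurableEquivRealProd]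
  have hpc : Continuous fun p : ℝ × ℝ => H (p.1 + p.2 * Complex.I) := hHc.comp (by fun_prop)
  have hint : IntegrableOn (fun p : ℝ × ℝ => H (p.1 + p.2 * Complex.I)) (Icc a b ×ˢ Ioc (-π) π) :=
    (hpc.continuousOn.integrableOn_compact (isCompact_Icc.prod isCompact_Icc)).mono_set
      (prod_mono le_rfl Ioc_subset_Icc_self)
  rw [hsupport, hchange, hprod, Measure.volume_eq_prod, setIntegral_prod _ hint,
    intervalIntegral.integral_of_le hab, integral_Icc_eq_integral_Ioc]
  refine integral_congr_ae (Eventually.of_forall fun u => ?_)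
  have hp : Function.Periodic (fun t : ℝ => H (u + t * Complex.I)) (2 * π) := fun t => by
    have e : (u : ℂ) + ((t + 2 * π : ℝ) : ℂ) * Complex.I = u + t * Complex.I + 2 * π * Complex.I :=
        by
      push_cast; ring
    simp only [hH, e, Complex.exp_periodic _]
    congr 2
    simp
  -- Periodicity shifts the range of the principal argument to the interval used in `circleMass`.
  have h5 := hp.intervalIntegral_add_eq (-π) 0
  rw [zero_add, show -π + 2 * π = π by ring] at h5
  simp only [circleMass, arcMass]
  rw [← h5, intervalIntegral.integral_of_le (by linarith [Real.pi_pos])]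

/-- The exponential factor is the Jacobian of `exp`, so this is the pullback of the area density `P`
to the cylinder. -/
theorem isCylinderDensity_exp {P : ℂ → ℝ} (hP : ContDiff ℝ ∞ P) (hpos : ∀ z, 0 < P z) :
    IsCylinderDensity fun w => P (Complex.exp w) * Real.exp (2 * w.re) where
  smooth := (hP.comp Complex.contDiff_exp).mul
    (Real.contDiff_exp.comp (contDiff_const.mul Complex.reCLM.contDiff))
  pos w := mul_pos (hpos _) (Real.exp_pos _)
  periodic w := by
    simp only [Complex.exp_periodic w]
    simp

/-- Two positive densities of the plane of equal total mass that agree near the origin and near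
infinity are related by a diffeomorphism. -/
theorem exists_plane_transport {p P : ℂ → ℝ} (hp : ContDiff ℝ ∞ p) (hP : ContDiff ℝ ∞ P)
    (hp0 : ∀ z, 0 < p z) (hP0 : ∀ z, 0 < P z) {r₀ r₁ : ℝ} (h0 : 0 < r₀) (h01 : r₀ ≤ r₁)
    (heq : ∀ z, ‖z‖ ≤ r₀ ∨ r₁ ≤ ‖z‖ → p z = P z) (hint : ∫ z, (p z - P z) = 0) :
    ∃ κ κ' : ℂ → ℂ, ContDiff ℝ ∞ κ ∧ ContDiff ℝ ∞ κ' ∧ Function.LeftInverse κ' κ ∧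
      Function.RightInverse κ' κ ∧ (∀ z, r₁ ≤ ‖z‖ → κ z = z) ∧ (∀ z, r₁ ≤ ‖z‖ → κ' z = z) ∧
      (∀ z, 0 < (fderiv ℝ κ z).det) ∧ ∀ z, P (κ z) * (fderiv ℝ κ z).det = p z := by
  have h1 : 0 < r₁ := h0.trans_le h01
  set a := Real.log r₀ with ha
  set b := Real.log r₁ with hb
  have hab : a ≤ b := Real.log_le_log h0 h01
  have hf := isCylinderDensity_exp hp hp0
  have hg := isCylinderDensity_exp hP hP0
  set f : ℂ → ℝ := fun w => p (Complex.exp w) * Real.exp (2 * w.re) with hfdef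
  set g : ℂ → ℝ := fun w => P (Complex.exp w) * Real.exp (2 * w.re) with hgdef
  have hfg : ∀ w : ℂ, w.re ≤ a ∨ b ≤ w.re → f w = g w := fun w hw => by
    simp only [hfdef, hgdef]
    rw [heq]
    rwa [norm_exp_le_iff h0, le_norm_exp_iff h1]
  have hmass : ∫ u in a..b, circleMass f u = ∫ u in a..b, circleMass g u := by
    have h2 := integral_eq_of_annulus (h := fun z => p z - P z) (hp.sub hP).continuous h0 h01
      (fun z hz => sub_eq_zero.2 (heq z hz))
    rw [hint] at h2
    have h3 : ∀ u, circleMass (fun w => (p (Complex.exp w) - P (Complex.exp w)) *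
        Real.exp (2 * w.re)) u = circleMass f u - circleMass g u := fun u => by
      simp only [circleMass, arcMass]
      rw [← intervalIntegral.integral_sub ((hf.continuous_arc u).intervalIntegrable _ _)
        ((hg.continuous_arc u).intervalIntegrable _ _)]
      simp only [hfdef, hgdef, sub_mul]
    simp only [h3] at h2
    rw [intervalIntegral.integral_sub
      (hf.contDiff_circleMass.continuous.intervalIntegrable _ _)
      (hg.contDiff_circleMass.continuous.intervalIntegrable _ _)] at h2
    linarith
  obtain ⟨K, hK, hper, hout, hdet, hflat⟩ := hf.exists_transport hg hab hfg hmass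
  obtain ⟨K', hK', hper', hout', -, hflat'⟩ := hg.exists_transport hf hab
    (fun w hw => (hfg w hw).symm) hmass.symm
  -- The transports in the two directions are mutually inverse because both are characterised by the
  -- injective flattenings.
  have hl : ∀ w, K' (K w) = w := fun w => hf.flatten_injective a (by rw [hflat', hflat])
  have hr : ∀ w, K (K' w) = w := fun w => hg.flatten_injective a (by rw [hflat, hflat'])
  have hexp : ∀ {z : ℂ}, z ≠ 0 → ∃ w, Complex.exp w = z := fun hz => ⟨_, Complex.exp_log hz⟩
  have hin : ∀ w : ℂ, w.re ≤ a → K w = w := fun w hw => hout w (Or.inl hw)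
  have hzero : ∀ K : ℂ → ℂ, expConj K 0 = 0 := fun K => if_pos rfl
  have hκ : ∀ z, P (expConj K z) * (fderiv ℝ (expConj K) z).det = p z := by
    intro z
    by_cases hz : z = 0
    -- The origin is not seen by logarithmic coordinates, but the map is the identity around it and
    -- the densities agree there.
    · have h2 : ∀ᶠ y in 𝓝 z, expConj K y = y := by
        have h3 : ∀ᶠ y in 𝓝 z, ‖y‖ < r₀ :=
          continuous_norm.continuousAt.eventually_lt continuousAt_const (by rwa [hz, norm_zero])
        filter_upwards [h3] with y hy
        by_cases hy0 : y = 0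
        · rw [hy0, hzero]
        · refine expConj_eq_self (hin _ ?_)
          rw [Complex.log_re]
          exact Real.log_le_log (norm_pos_iff.2 hy0) hy.le
      have h4 : fderiv ℝ (expConj K) z = ContinuousLinearMap.id ℝ ℂ := by
        rw [Filter.EventuallyEq.fderiv_eq (f := fun y => y) h2]; exact fderiv_id
      rw [h4, h2.self_of_nhds, det_eq_planeDet, heq z (Or.inl (by rw [hz, norm_zero]; exact h0.le))]
      simp [planeDet]
    · obtain ⟨w, rfl⟩ := hexp hz
      have h2 := det_fderiv_expConj hK hper hin w
      have h3 := hdet w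
      simp only [hfdef, hgdef] at h3
      rw [expConj_exp hper]
      refine mul_right_cancel₀ (Real.exp_pos (2 * w.re)).ne' ?_
      rw [mul_assoc, h2, ← h3]
      ring
  refine ⟨expConj K, expConj K', contDiff_expConj hK hper hin,
    contDiff_expConj hK' hper' fun w hw => hout' w (Or.inl hw), fun z => ?_, fun z => ?_,
    fun z hz => ?_, fun z hz => ?_, fun z => ?_, hκ⟩
  · by_cases hz : z = 0
    · rw [hz, hzero, hzero]
    · obtain ⟨w, rfl⟩ := hexp hz
      rw [expConj_exp hper, expConj_exp hper', hl]
  · by_cases hz : z = 0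
    · rw [hz, hzero, hzero]
    · obtain ⟨w, rfl⟩ := hexp hz
      rw [expConj_exp hper', expConj_exp hper, hr]
  · refine expConj_eq_self (hout _ (Or.inr ?_))
    rw [Complex.log_re]
    exact Real.log_le_log h1 hz
  · refine expConj_eq_self (hout' _ (Or.inr ?_))
    rw [Complex.log_re]
    exact Real.log_le_log h1 hz
  · exact pos_of_mul_pos_right ((hκ z).symm ▸ hp0 z) (hP0 _).le

end PlaneTransport

/-! ### Densities with prescribed masses -/

section Density

/-- A smooth cut-off function that vanishes near the origin and near infinity. -/
def annularCutoff (N : ℝ) (z : ℂ) : ℝ :=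
  Real.smoothTransition (N ^ 2 * Complex.normSq z - 1) *
    Real.smoothTransition (2 - Complex.normSq z / N ^ 2)

theorem contDiff_annularCutoff (N : ℝ) : ContDiff ℝ ∞ (annularCutoff N) := by
  have h : ContDiff ℝ ∞ fun z : ℂ => Complex.normSq z := by
    have e : (fun z : ℂ => Complex.normSq z) = fun z => z.re * z.re + z.im * z.im :=
      funext Complex.normSq_apply
    rw [e]
    exact (Complex.reCLM.contDiff.mul Complex.reCLM.contDiff).add
      (Complex.imCLM.contDiff.mul Complex.imCLM.contDiff)
  exact (Real.smoothTransition.contDiff.comp ((contDiff_const.mul h).sub contDiff_const)).mul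
    (Real.smoothTransition.contDiff.comp (contDiff_const.sub (h.div_const _)))

theorem annularCutoff_mem (N : ℝ) (z : ℂ) : annularCutoff N z ∈ Icc (0 : ℝ) 1 :=
  ⟨mul_nonneg (Real.smoothTransition.nonneg _) (Real.smoothTransition.nonneg _),
    mul_le_one₀ (Real.smoothTransition.le_one _) (Real.smoothTransition.nonneg _)
      (Real.smoothTransition.le_one _)⟩

theorem annularCutoff_eq_zero {N : ℝ} (hN : 0 < N) {z : ℂ} (hz : ‖z‖ ≤ 1 / N ∨ 2 * N ≤ ‖z‖) :
    annularCutoff N z = 0 := by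
  rw [annularCutoff, Complex.normSq_eq_norm_sq]
  rcases hz with hz | hz
  · rw [Real.smoothTransition.zero_of_nonpos, zero_mul]
    rw [le_div_iff₀ hN] at hz
    have : (‖z‖ * N) ^ 2 ≤ 1 ^ 2 := pow_le_pow_left₀ (by positivity) hz 2
    nlinarith
  · rw [Real.smoothTransition.zero_of_nonpos (x := 2 - _), mul_zero]
    rw [sub_nonpos, le_div_iff₀ (by positivity)]
    nlinarith

theorem eventually_annularCutoff_eq_one {z : ℂ} (hz : z ≠ 0) :
    ∀ᶠ n : ℕ in atTop, annularCutoff (n + 1) z = 1 := by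
  obtain ⟨m, hm⟩ := exists_nat_gt (‖z‖ + 2 / ‖z‖)
  have hz0 := norm_pos_iff.2 hz
  filter_upwards [eventually_ge_atTop m] with n hn
  have h1 : ‖z‖ + 2 / ‖z‖ < (n : ℝ) + 1 := by
    have : (m : ℝ) ≤ n := by exact_mod_cast hn
    linarith
  have h2 : 0 < 2 / ‖z‖ := by positivity
  have h3 : 2 < ((n : ℝ) + 1) * ‖z‖ := by
    rw [← div_lt_iff₀ hz0]; linarith
  rw [annularCutoff, Complex.normSq_eq_norm_sq, Real.smoothTransition.one_of_one_le,
    Real.smoothTransition.one_of_one_le, one_mul]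
  · have : ‖z‖ ^ 2 / ((n : ℝ) + 1) ^ 2 ≤ 1 := by
      rw [div_le_one (by positivity)]
      exact pow_le_pow_left₀ hz0.le (by linarith) 2
    linarith
  · nlinarith

/-- The density is shrunk to a small multiple on an annulus that exhausts the punctured plane; by
dominated convergence the remaining mass tends to zero. This makes room for arbitrary prescribed
masses. -/
theorem tendsto_integral_cutoff {P : ℂ → ℝ} (hP : Continuous P) (hPi : Integrable P) :
    Tendsto (fun n : ℕ => ∫ z, P z * (1 - (1 - 1 / ((n : ℝ) + 1)) * annularCutoff (n + 1) z)) atTop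
      (𝓝 0) := by
  have h := tendsto_integral_of_dominated_convergence (μ := (volume : Measure ℂ))
    (F := fun (n : ℕ) z => P z * (1 - (1 - 1 / ((n : ℝ) + 1)) * annularCutoff (n + 1) z))
    (f := fun _ => 0) (fun z => ‖P z‖) (fun n => ?_) hPi.norm (fun n => ?_) ?_
  · simpa using h
  · exact (hP.mul (continuous_const.sub (continuous_const.mul
      (contDiff_annularCutoff _).continuous))).aestronglyMeasurable
  · refine Eventually.of_forall fun z => ?_
    rw [norm_mul]
    refine mul_le_of_le_one_right (norm_nonneg _) ?_
    have h1 := annularCutoff_mem ((n : ℝ) + 1) z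
    have h2 : 1 / ((n : ℝ) + 1) ≤ 1 := by
      rw [div_le_one (by positivity)]; linarith [Nat.cast_nonneg (α := ℝ) n]
    have h3 : 0 < 1 / ((n : ℝ) + 1) := by positivity
    rw [Real.norm_eq_abs, abs_le]
    constructor <;> nlinarith [h1.1, h1.2, mul_nonneg (sub_nonneg.2 h2) h1.1]
  · have h0 : ∀ᵐ z : ℂ, z ≠ 0 := by simp [ae_iff]
    filter_upwards [h0] with z hz
    have h1 : Tendsto (fun n : ℕ => P z * (1 / ((n : ℝ) + 1))) atTop (𝓝 (P z * 0)) :=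
      tendsto_const_nhds.mul tendsto_one_div_add_atTop_nhds_zero_nat
    rw [mul_zero] at h1
    refine h1.congr' ?_
    filter_upwards [eventually_annularCutoff_eq_one hz] with n hn
    rw [hn]; ring

/-- A nonempty open set contains a point other than the origin. A bump around it with compact
support in the punctured plane lies in every sufficiently large annulus. -/
theorem exists_bump {A : Set ℂ} (hA : IsOpen A) (hne : A.Nonempty) : ∃ b : ℂ → ℝ,
    ContDiff ℝ ∞ b ∧ HasCompactSupport b ∧ (∀ z, 0 ≤ b z) ∧ 0 < ∫ z, b z ∧
      (∀ z ∉ A, b z = 0) ∧ ∃ m : ℝ, ∀ N, m < N → ∀ z, ‖z‖ ≤ 1 / N ∨ 2 * N ≤ ‖z‖ → b z = 0 := by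
  obtain ⟨z₀, hz₀, hz₀'⟩ := (dense_compl_singleton (0 : ℂ)).inter_open_nonempty A hA hne
  obtain ⟨b, hb1, hb2, hb3, hb4, hb5⟩ := exists_contDiff_tsupport_subset (n := ⊤)
    ((hA.inter isOpen_compl_singleton).mem_nhds ⟨hz₀, hz₀'⟩)
  have hb0 : ∀ z, 0 ≤ b z := fun z => (hb4 ⟨z, rfl⟩).1
  have hoff : ∀ z ∉ tsupport b, b z = 0 := fun z hz => image_eq_zero_of_notMem_tsupport hz
  refine ⟨b, hb3, hb2, hb0, ?_, fun z hz => hoff z fun h => hz (hb1 h).1, ?_⟩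
  · exact hb3.continuous.integral_pos_of_hasCompactSupport_nonneg_nonzero hb2 hb0
      (x := z₀) (by rw [hb5]; exact one_ne_zero)
  -- One bound for this sum controls the support near the origin and near infinity at once.
  · have hc1 : ContinuousOn (fun z : ℂ => ‖z‖ + 1 / ‖z‖) (tsupport b) :=
      continuous_norm.continuousOn.add (continuousOn_const.div continuous_norm.continuousOn
        fun z hz => norm_ne_zero_iff.2 (hb1 hz).2)
    obtain ⟨m, hm⟩ := (IsCompact.bddAbove_image hb2 hc1)
    refine ⟨max m 0, fun N hN z hz => hoff z fun hzt => ?_⟩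
    have h1 : ‖z‖ + 1 / ‖z‖ ≤ m := hm ⟨z, hzt, rfl⟩
    have h2 : 0 < ‖z‖ := norm_pos_iff.2 (hb1 hzt).2
    have h3 : 0 < 1 / ‖z‖ := by positivity
    have hN0 : 0 < N := (le_max_right _ _).trans_lt hN
    have hNm : m < N := (le_max_left _ _).trans_lt hN
    rcases hz with hz | hz
    · rw [le_div_iff₀ hN0, mul_comm, ← le_div_iff₀ h2] at hz
      linarith
    · linarith

/-- A positive density can be changed in an annulus so as to give prescribed masses to the sets of
a partition. -/
theorem exists_density {ι : Type*} [Fintype ι] {P : ℂ → ℝ} (hP : ContDiff ℝ ∞ P)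
    (hP0 : ∀ z, 0 < P z) (hPi : Integrable P) {A : ι → Set ℂ} (hA : ∀ i, IsOpen (A i))
    (hne : ∀ i, (A i).Nonempty) (hdisj : Pairwise fun i j => Disjoint (A i) (A j))
    (hcover : ∀ᵐ z, z ∈ ⋃ i, A i) {w : ι → ℝ} (hw : ∀ i, 0 < w i) (hsum : ∑ i, w i = ∫ z, P z) :
    ∃ p : ℂ → ℝ, ContDiff ℝ ∞ p ∧ (∀ z, 0 < p z) ∧ (∃ r₀ r₁ : ℝ, 0 < r₀ ∧ r₀ ≤ r₁ ∧
      ∀ z, ‖z‖ ≤ r₀ ∨ r₁ ≤ ‖z‖ → p z = P z) ∧ ∫ z, (p z - P z) = 0 ∧ ∀ i, ∫ z in A i, p z = w i :=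
          by
  choose b hb hbc hb0 hbi hbA m hm using fun i => exists_bump (hA i) (hne i)
  have hbint : ∀ i, Integrable (b i) := fun i =>
    (hb i).continuous.integrable_of_hasCompactSupport (hbc i)
  have hlim := tendsto_integral_cutoff hP.continuous hPi
  -- Even the whole shrunken mass is below each of the finitely many prescribed masses, so every set
  -- of the partition lacks mass.
  have hev : ∀ᶠ n : ℕ in atTop, ∀ i,
      ∫ z, P z * (1 - (1 - 1 / ((n : ℝ) + 1)) * annularCutoff (n + 1) z) < w i ∧ m i < (n : ℝ) + 1
          := by
    rw [eventually_all]
    intro i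
    refine (hlim.eventually_lt_const (hw i)).and ?_
    obtain ⟨k, hk⟩ := exists_nat_gt (m i)
    filter_upwards [eventually_ge_atTop k] with n hn
    have : (k : ℝ) ≤ n := by exact_mod_cast hn
    linarith
  obtain ⟨n, hn⟩ := hev.exists
  set N : ℝ := (n : ℝ) + 1 with hN
  have hN1 : 1 ≤ N := by rw [hN]; linarith [Nat.cast_nonneg (α := ℝ) n]
  have hN0 : 0 < N := one_pos.trans_le hN1
  set p₀ : ℂ → ℝ := fun z => P z * (1 - (1 - 1 / N) * annularCutoff N z) with hp₀
  have hp₀c : ContDiff ℝ ∞ p₀ :=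
    hP.mul (contDiff_const.sub (contDiff_const.mul (contDiff_annularCutoff N)))
  have hfac : ∀ z, 0 < 1 - (1 - 1 / N) * annularCutoff N z ∧
      1 - (1 - 1 / N) * annularCutoff N z ≤ 1 := fun z => by
    have h1 := annularCutoff_mem N z
    have h2 : 1 / N ≤ 1 := by rw [div_le_one hN0]; exact hN1
    have h3 : 0 < 1 / N := by positivity
    constructor <;> nlinarith [h1.1, h1.2, mul_nonneg (sub_nonneg.2 h2) h1.1,
      mul_nonneg (sub_nonneg.2 h2) (sub_nonneg.2 h1.2)]
  have hp₀pos : ∀ z, 0 < p₀ z := fun z => mul_pos (hP0 z) (hfac z).1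
  have hp₀i : Integrable p₀ := by
    refine hPi.mono' hp₀c.continuous.aestronglyMeasurable (Eventually.of_forall fun z => ?_)
    rw [Real.norm_eq_abs, abs_of_pos (hp₀pos z)]
    exact mul_le_of_le_one_right (hP0 z).le (hfac z).2
  -- The positive coefficient for which the bump makes up exactly the missing mass of `A i`.
  set c : ι → ℝ := fun i => (w i - ∫ z in A i, p₀ z) / ∫ z, b i z with hc
  have hc0 : ∀ i, 0 < c i := fun i => by
    refine div_pos (sub_pos.2 (lt_of_le_of_lt ?_ (hn i).1)) (hbi i)
    exact setIntegral_le_integral hp₀i (Eventually.of_forall fun z => (hp₀pos z).le)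
  set p : ℂ → ℝ := fun z => p₀ z + ∑ i, c i * b i z with hp
  have hpi : Integrable p := hp₀i.add (integrable_finsetSum _ fun i _ => (hbint i).const_mul _)
  have hmass : ∀ j, ∫ z in A j, p z = w j := by
    intro j
    have h1 : ∫ z in A j, p z = ∫ z in A j, (p₀ z + c j * b j z) := by
      refine setIntegral_congr_fun (hA j).measurableSet fun z hz => ?_
      simp only [hp]
      rw [Finset.sum_eq_single j]
      · intro i _ hij
        rw [hbA i z fun hzi => (disjoint_left.1 (hdisj hij)) hzi hz, mul_zero]
      · intro h; exact absurd (Finset.mem_univ _) h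
    rw [h1, integral_add hp₀i.integrableOn ((hbint j).const_mul _).integrableOn, integral_const_mul,
      setIntegral_eq_integral_of_forall_compl_eq_zero (hbA j), hc]
    simp only
    rw [div_mul_cancel₀ _ (hbi j).ne']
    ring
  refine ⟨p, hp₀c.add (ContDiff.sum fun i _ => contDiff_const.mul (hb i)), fun z => ?_,
    ⟨1 / N, 2 * N, by positivity, ?_, fun z hz => ?_⟩, ?_, hmass⟩
  · exact add_pos_of_pos_of_nonneg (hp₀pos z)
      (Finset.sum_nonneg fun i _ => mul_nonneg (hc0 i).le (hb0 i z))
  · rw [div_le_iff₀ hN0]; nlinarith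
  · simp only [hp, hp₀]
    rw [annularCutoff_eq_zero hN0 hz, Finset.sum_eq_zero fun i _ => by
      rw [hm i N (hn i).2 z hz, mul_zero]]
    ring
  · rw [integral_sub hpi hPi, ← hsum, sub_eq_zero, ← Measure.restrict_eq_self_of_ae_mem hcover,
      integral_iUnion_fintype (fun i => (hA i).measurableSet) hdisj fun i => hpi.integrableOn]
    exact Finset.sum_congr rfl fun i _ => hmass i

end Density

/-! ### Diffeomorphisms of the sphere that are given in stereographic coordinates -/

section SphereMap

/-- The self-map of the sphere that fixes the south pole and is given by `κ` in stereographic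
coordinates. -/
def sphereMap (κ : ℂ → ℂ) (x : S2) : S2 :=
  if (x : R3) 2 = -1 then x else stereo (κ (stereoProj x))

variable {κ κ' : ℂ → ℂ} {r : ℝ}

theorem sphereMap_stereo (κ : ℂ → ℂ) (ζ : ℂ) : sphereMap κ (stereo ζ) = stereo (κ ζ) := by
  rw [sphereMap, if_neg (stereo_two_ne ζ), stereoProj_stereo]

theorem southPole_two : (southPole : R3) 2 = -1 := by simp [southPole]

theorem sphereMap_southPole (κ : ℂ → ℂ) : sphereMap κ southPole = southPole :=
  if_pos southPole_two

theorem continuous_two : Continuous fun x : S2 => (x : R3) 2 :=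
  (EuclideanSpace.proj 2 : R3 →L[ℝ] ℝ).continuous.comp continuous_subtype_val

theorem eventually_sphereMap_eq {x : S2} (hx : (x : R3) 2 ≠ -1) (κ : ℂ → ℂ) :
    ∀ᶠ y in 𝓝 x, sphereMap κ y = stereo (κ (stereoProj y)) := by
  filter_upwards [continuous_two.continuousAt.eventually_ne hx] with y hy
  exact if_neg hy

/-- Small heights above the south pole correspond to large stereographic coordinates, where `κ` is
the identity. This gives smoothness at the pole. -/
theorem eventually_sphereMap_eq_self (hr : ∀ z, r ≤ ‖z‖ → κ z = z) :
    ∀ᶠ y in 𝓝 southPole, sphereMap κ y = y := by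
  have h1 : ∀ᶠ y : S2 in 𝓝 southPole, (y : R3) 2 < 2 / (1 + r ^ 2) - 1 := by
    refine continuous_two.continuousAt.eventually_lt continuousAt_const ?_
    rw [southPole_two]
    have : 0 < 2 / (1 + r ^ 2) := by positivity
    linarith
  filter_upwards [h1] with y hy
  by_cases hy2 : (y : R3) 2 = -1
  · exact if_pos hy2
  · obtain ⟨ζ, rfl⟩ : y ∈ range stereo := by rw [range_stereo]; exact hy2
    rw [sphereMap_stereo, hr]
    rw [stereo_two, sub_lt_sub_iff_right, div_lt_div_iff_of_pos_left two_pos (stereoDen_pos ζ)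
      (by positivity), stereoDen] at hy
    refine le_of_lt (lt_of_pow_lt_pow_left₀ 2 (norm_nonneg ζ) ?_)
    rw [← Complex.normSq_eq_norm_sq, Complex.normSq_apply]
    nlinarith

theorem contMDiff_sphereMap (hκ : ContDiff ℝ ∞ κ) (hr : ∀ z, r ≤ ‖z‖ → κ z = z) :
    ContMDiff (𝓡 2) (𝓡 2) ∞ (sphereMap κ) := by
  intro x
  by_cases hx : (x : R3) 2 = -1
  · rw [eq_southPole_iff] at hx
    subst hx
    exact contMDiffAt_id.congr_of_eventuallyEq (eventually_sphereMap_eq_self hr)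
  · have h1 : ContDiffAt ℝ ∞ (fun y : R3 => stereo (κ (stereoProj y)) : R3 → R3) x :=
      (contDiff_coe_stereo.comp hκ).contDiffAt.comp (x : R3)
        (contDiffAt_stereoProj (one_add_ne_zero hx))
    have h2 : ContMDiffAt (𝓡 2) (𝓡 2) ∞ (fun y : S2 => stereo (κ (stereoProj y))) x :=
      contMDiffAt_sphere_of_coe (h1.contMDiffAt.comp x contMDiff_coe_S2.contMDiffAt)
    exact h2.congr_of_eventuallyEq (eventually_sphereMap_eq hx κ)

theorem sphereMap_leftInverse (h : Function.LeftInverse κ' κ) :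
    Function.LeftInverse (sphereMap κ') (sphereMap κ) := by
  intro x
  by_cases hx : (x : R3) 2 = -1
  · rw [eq_southPole_iff] at hx
    rw [hx, sphereMap_southPole, sphereMap_southPole]
  · obtain ⟨ζ, rfl⟩ : x ∈ range stereo := by rw [range_stereo]; exact hx
    rw [sphereMap_stereo, sphereMap_stereo, h]

/-- The diffeomorphism of the sphere that is given by a diffeomorphism of the plane that is the
identity near infinity. -/
def sphereDiffeo (hκ : ContDiff ℝ ∞ κ) (hκ' : ContDiff ℝ ∞ κ') (hl : Function.LeftInverse κ' κ)
    (hrt : Function.RightInverse κ' κ) (hr : ∀ z, r ≤ ‖z‖ → κ z = z)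
    (hr' : ∀ z, r ≤ ‖z‖ → κ' z = z) : Diffeomorph (𝓡 2) (𝓡 2) S2 S2 ∞ where
  toFun := sphereMap κ
  invFun := sphereMap κ'
  left_inv := sphereMap_leftInverse hl
  right_inv := sphereMap_leftInverse hrt
  contMDiff_toFun := contMDiff_sphereMap hκ hr
  contMDiff_invFun := contMDiff_sphereMap hκ' hr'

theorem fderiv_radialExt_id {x : S2} {v : R3} (hv : inner ℝ (x : R3) v = 0) :
    fderiv ℝ (radialExt id) x v = v := by
  obtain ⟨v', rfl⟩ := exists_dS_id_eq_iff.2 hv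
  exact (dS_eq_fderiv contMDiffAt_id v').symm

theorem radialExt_eventuallyEq {f g : S2 → S2} {x : S2} (h : f =ᶠ[𝓝 x] g) :
    radialExt f =ᶠ[𝓝 (x : R3)] radialExt g := by
  have h1 : ContinuousAt toS2 (x : R3) :=
    (contMDiffAt_toS2 x.coe_ne_zero (m := 1)).continuousAt
  have h2 : ∀ᶠ y in 𝓝 (toS2 (x : R3)), f y = g y := by rw [toS2_coe]; exact h
  filter_upwards [h1.eventually h2] with y hy
  simp only [radialExt, hy]

/-- The differential of a map of the sphere in stereographic coordinates. -/
theorem fderiv_radialExt_stereo {f : S2 → S2} {x : S2} (hx : (x : R3) 2 ≠ -1)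
    (hκ : DifferentiableAt ℝ κ (stereoProj x))
    (hf : ∀ᶠ y in 𝓝 x, f y = stereo (κ (stereoProj y))) (v : R3) :
    fderiv ℝ (radialExt f) x v = fderiv ℝ (fun z => (stereo z : R3)) (κ (stereoProj x))
      (fderiv ℝ κ (stereoProj x) (fderiv ℝ (fun y : R3 => stereoProj (toS2 y)) x v)) := by
  have h1 : DifferentiableAt ℝ (fun y : R3 => stereoProj (toS2 y)) x := by
    refine DifferentiableAt.comp (x : R3) (g := stereoProj) (f := fun y : R3 => (toS2 y : R3)) ?_
      ((contDiffAt_coe_toS2 x.coe_ne_zero (m := 1)).differentiableAt one_ne_zero)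
    rw [toS2_coe]
    exact (contDiffAt_stereoProj (one_add_ne_zero hx)).differentiableAt (by simp)
  have h2 : HasFDerivAt (fun y : R3 => κ (stereoProj (toS2 y))) ((fderiv ℝ κ (stereoProj x)).comp
      (fderiv ℝ (fun y : R3 => stereoProj (toS2 y)) x)) x := by
    refine HasFDerivAt.comp (x : R3) (g := κ) ?_ h1.hasFDerivAt
    rw [toS2_coe]; exact hκ.hasFDerivAt
  have h3 : HasFDerivAt (fun y : R3 => (stereo (κ (stereoProj (toS2 y))) : R3))
      ((fderiv ℝ (fun z => (stereo z : R3)) (κ (stereoProj x))).comp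
        ((fderiv ℝ κ (stereoProj x)).comp (fderiv ℝ (fun y : R3 => stereoProj (toS2 y)) x))) x := by
    refine HasFDerivAt.comp (x : R3) (g := fun z => (stereo z : R3)) ?_ h2
    rw [toS2_coe]
    exact (contDiff_coe_stereo.differentiable (by simp) _).hasFDerivAt
  have h4 : radialExt f =ᶠ[𝓝 (x : R3)] fun y => (stereo (κ (stereoProj (toS2 y))) : R3) :=
    radialExt_eventuallyEq hf
  rw [h4.fderiv_eq, h3.fderiv]
  rfl

theorem orientationPreserving_sphereDiffeo (hκ : ContDiff ℝ ∞ κ) (hκ' : ContDiff ℝ ∞ κ')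
    (hl : Function.LeftInverse κ' κ) (hrt : Function.RightInverse κ' κ)
    (hr : ∀ z, r ≤ ‖z‖ → κ z = z) (hr' : ∀ z, r ≤ ‖z‖ → κ' z = z)
    (hdet : ∀ z, 0 < (fderiv ℝ κ z).det) :
    OrientationPreserving (sphereDiffeo hκ hκ' hl hrt hr hr') := by
  rw [orientationPreserving_iff]
  intro x v w hv hw hpos
  show 0 < det3 (sphereMap κ x) (fderiv ℝ (radialExt (sphereMap κ)) x v)
    (fderiv ℝ (radialExt (sphereMap κ)) x w)
  by_cases hx : (x : R3) 2 = -1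
  · rw [eq_southPole_iff] at hx
    subst hx
    have h1 : radialExt (sphereMap κ) =ᶠ[𝓝 (southPole : R3)] radialExt id :=
      radialExt_eventuallyEq (eventually_sphereMap_eq_self hr)
    rw [h1.fderiv_eq, fderiv_radialExt_id hv, fderiv_radialExt_id hw, sphereMap_southPole]
    exact hpos
  -- The coordinate formula for the identity map expresses the tangent vectors themselves through
  -- the chart, so the two determinants differ by the determinant of `κ` and positive factors.
  · have hid : ∀ᶠ y : S2 in 𝓝 x, id y = stereo (id (stereoProj y)) := by
      filter_upwards [continuous_two.continuousAt.eventually_ne hx] with y hy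
      exact (stereo_stereoProj hy).symm
    have e1 := fderiv_radialExt_stereo hx differentiableAt_id hid v
    have e2 := fderiv_radialExt_stereo hx differentiableAt_id hid w
    rw [fderiv_radialExt_id hv, fderiv_id, ContinuousLinearMap.id_apply] at e1
    rw [fderiv_radialExt_id hw, fderiv_id, ContinuousLinearMap.id_apply] at e2
    have hd : DifferentiableAt ℝ κ (stereoProj x) := hκ.differentiable (by simp) _
    rw [fderiv_radialExt_stereo hx hd (eventually_sphereMap_eq hx κ),
      fderiv_radialExt_stereo hx hd (eventually_sphereMap_eq hx κ), sphereMap, if_neg hx,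
      det3_fderiv, planeDet_apply]
    rw [e1, e2, ← stereo_stereoProj hx] at hpos
    simp only [id, stereoProj_stereo] at hpos
    rw [det3_fderiv, stereo_stereoProj hx] at hpos
    exact mul_pos (mul_pos (hdet _) (pos_of_mul_pos_left hpos (areaJac_stereo_pos _).le))
      (areaJac_stereo_pos _)

theorem surfaceIntegral_sphereDiffeo (hκ : ContDiff ℝ ∞ κ) (hκ' : ContDiff ℝ ∞ κ')
    (hl : Function.LeftInverse κ' κ) (hrt : Function.RightInverse κ' κ)
    (hr : ∀ z, r ≤ ‖z‖ → κ z = z) (hr' : ∀ z, r ≤ ‖z‖ → κ' z = z)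
    (hdet : ∀ z, 0 < (fderiv ℝ κ z).det) {U : Set S2} (hU : IsOpen U) (f : S2 → ℝ) :
    surfaceIntegral (sphereDiffeo hκ hκ' hl hrt hr hr' '' U) f =
      ∫ ζ in stereo ⁻¹' U, f (stereo (κ ζ)) * areaJac stereo (κ ζ) * (fderiv ℝ κ ζ).det := by
  have hopen : IsOpen (sphereDiffeo hκ hκ' hl hrt hr hr' '' U) :=
    (sphereDiffeo hκ hκ' hl hrt hr hr').toHomeomorph.isOpenMap U hU
  have hpre : stereo ⁻¹' (sphereDiffeo hκ hκ' hl hrt hr hr' '' U) = κ '' (stereo ⁻¹' U) := by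
    ext ζ
    constructor
    · rintro ⟨y, hy, e⟩
      change sphereMap κ y = stereo ζ at e
      refine ⟨κ' ζ, ?_, hrt ζ⟩
      rw [mem_preimage, ← sphereMap_stereo, ← e, sphereMap_leftInverse hl]
      exact hy
    · rintro ⟨z, hz, rfl⟩
      exact ⟨stereo z, hz, sphereMap_stereo κ z⟩
  rw [surfaceIntegral_eq_preimage hopen, hpre, integral_image_eq_integral_abs_det_fderiv_smul volume
    (hU.preimage contMDiff_stereo.continuous).measurableSet
    (fun z _ => (hκ.differentiable (by simp) z).hasFDerivAt.hasFDerivWithinAt) hl.injective.injOn]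
  refine integral_congr_ae (Eventually.of_forall fun z => ?_)
  simp only [smul_eq_mul]
  rw [abs_of_pos (hdet z), mul_comm]

end SphereMap

/-! ### Half turns of the sphere -/

section HalfTurn

/-- The half turn about the axis through a point of the sphere, as a linear map. -/
def axisTurnCLM (m : S2) : R3 →L[ℝ] R3 :=
  (2 : ℝ) • (innerSL ℝ (m : R3)).smulRight (m : R3) - ContinuousLinearMap.id ℝ R3

theorem axisTurnCLM_apply (m : S2) (v : R3) :
    axisTurnCLM m v = (2 * inner ℝ (m : R3) v) • (m : R3) - v := by
  simp [axisTurnCLM, smul_smul]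

theorem inner_axisTurnCLM (m : S2) (v : R3) :
    inner ℝ (m : R3) (axisTurnCLM m v) = inner ℝ (m : R3) v := by
  rw [axisTurnCLM_apply, inner_sub_right, inner_smul_right, real_inner_self_eq_norm_sq, m.norm_coe]
  ring

theorem axisTurnCLM_axisTurnCLM (m : S2) (v : R3) : axisTurnCLM m (axisTurnCLM m v) = v := by
  rw [axisTurnCLM_apply, inner_axisTurnCLM, axisTurnCLM_apply, sub_sub_cancel]

theorem norm_axisTurnCLM (m : S2) (v : R3) : ‖axisTurnCLM m v‖ = ‖v‖ := by
  rw [← sq_eq_sq₀ (norm_nonneg _) (norm_nonneg _), axisTurnCLM_apply, norm_sub_sq_real, norm_smul,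
    m.norm_coe, inner_smul_left, Real.norm_eq_abs, mul_one, sq_abs]
  simp
  ring

theorem det3_axisTurnCLM (m : S2) (x v w : R3) :
    det3 (axisTurnCLM m x) (axisTurnCLM m v) (axisTurnCLM m w) = det3 x v w := by
  have hm := m.sum_sq
  simp only [det3_apply, axisTurnCLM_apply, PiLp.sub_apply, PiLp.smul_apply, smul_eq_mul,
    PiLp.inner_apply, Fin.sum_univ_three, RCLike.inner_apply, conj_trivial]
  linear_combination 2 * (x 0 * (v 1 * w 2 - v 2 * w 1) - x 1 * (v 0 * w 2 - v 2 * w 0) +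
    x 2 * (v 0 * w 1 - v 1 * w 0)) * hm

/-- The half turn about the axis through a point of the sphere. -/
def axisTurn (m : S2) : Diffeomorph (𝓡 2) (𝓡 2) S2 S2 ∞ where
  toFun x := ⟨axisTurnCLM m x, by rw [mem_sphere_zero_iff_norm, norm_axisTurnCLM, x.norm_coe]⟩
  invFun x := ⟨axisTurnCLM m x, by rw [mem_sphere_zero_iff_norm, norm_axisTurnCLM, x.norm_coe]⟩
  left_inv x := Subtype.ext (axisTurnCLM_axisTurnCLM m x)
  right_inv x := Subtype.ext (axisTurnCLM_axisTurnCLM m x)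
  contMDiff_toFun _ := contMDiffAt_sphere_of_coe
    ((axisTurnCLM m).contDiff.contMDiff.comp contMDiff_coe_S2).contMDiffAt
  contMDiff_invFun _ := contMDiffAt_sphere_of_coe
    ((axisTurnCLM m).contDiff.contMDiff.comp contMDiff_coe_S2).contMDiffAt

theorem coe_axisTurn (m x : S2) : (axisTurn m x : R3) = axisTurnCLM m x := rfl

theorem orientationPreserving_axisTurn (m : S2) : OrientationPreserving (axisTurn m) := by
  rw [orientationPreserving_iff]
  intro x v w hv hw hpos
  have h1 : ∀ v : R3, inner ℝ (x : R3) v = 0 →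
      fderiv ℝ (radialExt (axisTurn m)) x v = axisTurnCLM m v := by
    intro v hv
    have h2 : DifferentiableAt ℝ (radialExt id) (x : R3) :=
      (contDiffAt_radialExt (contMDiffAt_id (n := 1))).differentiableAt one_ne_zero
    have h3 := ((axisTurnCLM m).hasFDerivAt.comp (x : R3) h2.hasFDerivAt).fderiv
    have h4 : radialExt (axisTurn m) = axisTurnCLM m ∘ radialExt id := rfl
    rw [h4, h3, ContinuousLinearMap.comp_apply, fderiv_radialExt_id hv]
  rw [h1 v hv, h1 w hw, coe_axisTurn, det3_axisTurnCLM]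
  exact hpos

/-- The axis is the bisector of the two points, which is undefined exactly for antipodal points. -/
theorem exists_axisTurn_eq {x y : S2} (h : (x : R3) + y ≠ 0) : ∃ m, axisTurn m x = y := by
  refine ⟨toS2 ((x : R3) + y), Subtype.ext ?_⟩
  have h1 : ‖(x : R3) + y‖ ^ 2 = 2 * inner ℝ ((x : R3) + y) (x : R3) := by
    rw [norm_add_sq_real, x.norm_coe, y.norm_coe, inner_add_left, real_inner_self_eq_norm_sq,
      x.norm_coe, real_inner_comm]
    ring
  have h2 : ‖(x : R3) + y‖ ≠ 0 := norm_ne_zero_iff.2 h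
  rw [coe_axisTurn, axisTurnCLM_apply, coe_toS2 h, inner_smul_left, smul_smul]
  have h3 : 2 * ((starRingEnd ℝ) ‖(x : R3) + y‖⁻¹ * inner ℝ ((x : R3) + y) (x : R3)) *
      ‖(x : R3) + y‖⁻¹ = 1 := by
    rw [conj_trivial]
    field_simp
    rw [h1]
  rw [h3, one_smul, add_sub_cancel_left]

end HalfTurn

/-! ### Diffeomorphisms with prescribed curvatures of the regions -/

theorem OrientationPreserving.trans {φ ψ : Diffeomorph (𝓡 2) (𝓡 2) S2 S2 ∞}
    (hφ : OrientationPreserving φ) (hψ : OrientationPreserving ψ) :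
    OrientationPreserving (φ.trans ψ) := by
  rw [orientationPreserving_iff] at *
  intro x v w hv hw hpos
  have h1 : DifferentiableAt ℝ (radialExt φ) x :=
    (contDiffAt_radialExt (φ.contMDiffAt_one x)).differentiableAt one_ne_zero
  have h2 : DifferentiableAt ℝ (radialExt ψ) (radialExt φ x) := by
    rw [radialExt_coe]
    exact (contDiffAt_radialExt (ψ.contMDiffAt_one (φ x))).differentiableAt one_ne_zero
  have h3 : radialExt (φ.trans ψ) = radialExt ψ ∘ radialExt φ := by
    funext y
    simp [radialExt, Function.comp]
  have h4 := fderiv_comp (x : R3) h2 h1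
  rw [← h3, radialExt_coe] at h4
  rw [h4]
  exact hψ (φ x) _ _ (fderiv_radialExt_inner φ x v) (fderiv_radialExt_inner φ x w)
    (hφ x v w hv hw hpos)

namespace ContactCircleBundle

variable {E : Type*} [TopologicalSpace E] [ChartedSpace R3 E] [IsManifold (𝓡 3) ∞ E]
  [MulAction Circle E] {B : ContactCircleBundle E} {e : ℤ} {γ : ℝ → S2}

theorem contDiff_curvature_stereo (he : B.IsEulerNumber e) :
    ContDiff ℝ ∞ fun ζ => B.curvature (stereo ζ) := by
  obtain ⟨s, -, hs, -, hp, -⟩ := exists_sections he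
  exact B.contDiff_curvature_comp hs hp contDiff_coe_stereo fun ζ => (areaJac_stereo_pos ζ).ne'

/-- Minus the curvature is a positive density `P` on the plane. Change it to a density `p` that
gives each region the prescribed mass, and choose a diffeomorphism of the plane that pulls `P` back
to `p`: the `P`-mass of the image of a region is then its `p`-mass. Both changes are confined to an
annulus, so the diffeomorphism extends over the south pole. -/
theorem exists_diffeo_of_southPole_notMem (he : B.IsEulerNumber e) (h : IsGenericCircle γ)
    (hs : southPole ∉ range γ) [Fintype (regions γ)] {v : regions γ → ℝ} (hv : ∀ U, v U < 0)
    (hsum : ∑ U, v U = 2 * π * e) :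
    ∃ φ : Diffeomorph (𝓡 2) (𝓡 2) S2 S2 ∞, OrientationPreserving φ ∧
      southPole ∉ range (fun t => φ (γ t)) ∧
      ∀ U : regions γ, surfaceIntegral (φ '' (U : Set S2)) B.curvature = v U := by
  have hcont : Continuous stereo := contMDiff_stereo.continuous
  set P : ℂ → ℝ := fun ζ => -(B.curvature (stereo ζ) * areaJac stereo ζ) with hP
  have hPs : ContDiff ℝ ∞ P :=
    ((contDiff_curvature_stereo he).mul (contDiff_areaJac contDiff_coe_stereo)).neg
  have hP0 : ∀ ζ, 0 < P ζ := fun ζ =>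
    neg_pos.2 (mul_neg_of_neg_of_pos (B.curvature_neg _) (areaJac_stereo_pos ζ))
  have hPi : Integrable P := (integrable_areaJac_mul (B.continuous_curvature he)).neg
  have hPint : ∑ U, -v U = ∫ ζ, P ζ := by
    have h1 := surfaceIntegral_eq_preimage isOpen_univ B.curvature
    rw [B.surfaceIntegral_univ_curvature he, preimage_univ, setIntegral_univ] at h1
    rw [Finset.sum_neg_distrib, hsum, h1, integral_neg]
  have hopen : ∀ U : regions γ, IsOpen (stereo ⁻¹' (U : Set S2)) := fun U =>
    (isOpen_of_mem_regions h U.2).preimage hcont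
  have hne : ∀ U : regions γ, (stereo ⁻¹' (U : Set S2)).Nonempty := by
    intro U
    by_contra hemp
    rw [not_nonempty_iff_eq_empty] at hemp
    have h1 : (U : Set S2) ⊆ {southPole} := fun x hx => by
      by_contra hxs
      have hx2 : (x : R3) 2 ≠ -1 := by rw [Ne, eq_southPole_iff]; exact hxs
      have : stereoProj x ∈ stereo ⁻¹' (U : Set S2) := by
        rw [mem_preimage, stereo_stereoProj hx2]; exact hx
      rw [hemp] at this
      exact this
    have h2 := (isOpen_of_mem_regions h U.2).measure_pos (volume : Measure R3).toSphere
      (nonempty_of_mem_regions U.2)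
    exact h2.ne' (measure_mono_null h1 (toSphere_singleton _))
  have hcover : ∀ᵐ ζ : ℂ, ζ ∈ ⋃ U : regions γ, stereo ⁻¹' (U : Set S2) := by
    have hc : ContDiff ℝ 1 (planeCurve γ) := (contDiff_planeCurve h hs).of_le (by simp)
    filter_upwards [measure_eq_zero_iff_ae_notMem.1 (volume_range_curve hc)] with ζ hζ
    rw [notMem_range_planeCurve hs] at hζ
    obtain ⟨U, hU, hyU⟩ := exists_mem_regions hζ
    exact mem_iUnion.2 ⟨⟨U, hU⟩, hyU⟩
  obtain ⟨p, hp, hp0, ⟨r₀, r₁, h0, h01, hout⟩, hint, hmass⟩ := exists_density hPs hP0 hPi hopen hne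
    (fun U V hUV => disjoint_left.2 fun ζ hU hV =>
      hUV (Subtype.ext (regions_eq_of_mem U.2 V.2 hU hV))) hcover
    (fun U => neg_pos.2 (hv U)) hPint
  obtain ⟨κ, κ', hκ, hκ', hl, hr, hid, hid', hdet, htr⟩ :=
    exists_plane_transport hp hPs hp0 hP0 h0 h01 hout hint
  refine ⟨sphereDiffeo hκ hκ' hl hr hid hid',
    orientationPreserving_sphereDiffeo hκ hκ' hl hr hid hid' hdet, ?_, fun U => ?_⟩
  · rintro ⟨t, ht⟩
    have h1 : sphereDiffeo hκ hκ' hl hr hid hid' southPole = southPole := sphereMap_southPole κ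
    exact hs ⟨t, (sphereDiffeo hκ hκ' hl hr hid hid').injective (ht.trans h1.symm)⟩
  · rw [surfaceIntegral_sphereDiffeo hκ hκ' hl hr hid hid' hdet (isOpen_of_mem_regions h U.2),
      ← neg_neg (v U), ← hmass U, ← integral_neg]
    refine integral_congr_ae (Eventually.of_forall fun ζ => ?_)
    simp only
    rw [← htr ζ, hP]
    ring

/-- Every generic circle can be moved such that the curvatures of its regions are any given negative
numbers with the right sum. -/
theorem exists_diffeo (he : B.IsEulerNumber e) (h : IsGenericCircle γ) [Fintype (regions γ)]
    {v : regions γ → ℝ} (hv : ∀ U, v U < 0) (hsum : ∑ U, v U = 2 * π * e) :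
    ∃ φ : Diffeomorph (𝓡 2) (𝓡 2) S2 S2 ∞, OrientationPreserving φ ∧
      southPole ∉ range (fun t => φ (γ t)) ∧
      ∀ U : regions γ, surfaceIntegral (φ '' (U : Set S2)) B.curvature = v U := by
  -- A point off the curve that a half turn can bring to the south pole; the excluded points form a
  -- null set.
  obtain ⟨x, hx, hxn⟩ : ∃ x : S2, x ∉ range γ ∧ (x : R3) + southPole ≠ 0 := by
    by_contra! hcon
    have h1 : (univ : Set S2) ⊆ range γ ∪ {-southPole} := fun x _ => by
      by_cases hx : x ∈ range γ
      · exact Or.inl hx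
      · refine Or.inr (Subtype.ext ?_)
        rw [coe_neg_sphere]
        exact eq_neg_of_add_eq_zero_left (hcon x hx)
    have h2 := isOpen_univ.measure_pos (volume : Measure R3).toSphere ⟨southPole, mem_univ _⟩
    exact h2.ne' (measure_mono_null h1 (measure_union_null
      (toSphere_range_curve ((contDiff_coe_curve h.smooth).of_le (by simp)))
      (toSphere_singleton _)))
  obtain ⟨m, hm⟩ := exists_axisTurn_eq hxn
  set ρ := axisTurn m with hρ
  have hs : southPole ∉ range fun t => ρ (γ t) := by
    rintro ⟨t, ht⟩
    exact hx ⟨t, ρ.injective (ht.trans hm.symm)⟩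
  let ε : regions γ ≃ regions fun t => ρ (γ t) := Equiv.ofBijective
    (fun U => ⟨ρ '' (U : Set S2), image_mem_regions ρ U.2⟩)
    ⟨fun U V hUV => Subtype.ext (ρ.injective.image_injective (congrArg Subtype.val hUV)),
        fun V => by
      obtain ⟨U, hU, e⟩ := exists_image_eq_of_mem_regions ρ V.2
      exact ⟨⟨U, hU⟩, Subtype.ext e⟩⟩
  have := Fintype.ofEquiv _ ε
  obtain ⟨ψ, hψ, hψs, hψv⟩ := exists_diffeo_of_southPole_notMem he (h.diffeo ρ) hs
    (v := fun V => v (ε.symm V)) (fun V => hv _) ((Equiv.sum_comp ε.symm v).trans hsum)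
  refine ⟨ρ.trans ψ, ?_, hψs, fun U => ?_⟩
  · exact (orientationPreserving_axisTurn m).trans hψ
  · have h1 := hψv (ε U)
    rw [Equiv.symm_apply_apply] at h1
    rw [← h1]
    congr 1
    show (fun z => ψ (ρ z)) '' (U : Set S2) = ψ '' (ρ '' (U : Set S2))
    rw [image_image]

end ContactCircleBundle

/-! ### Construction of Legendrian knots -/

namespace DecoratedCircle

variable (Γ : DecoratedCircle)

/-- The second parameter is moved into the period after the first, so that the interval between them
parametrizes a loop with its only corner at `p`. The endpoint `s + 2π` is excluded because the
angles differ. -/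
theorem exists_isCrossing_plus_lt (p : Γ.Vertex) : ∃ s t a b, IsCrossing Γ.curve p s t a b ∧
    Γ.plus p = {cone a b, cone (-a) (-b)} ∧ s < t ∧ t < s + 2 * π := by
  obtain ⟨s, t, a, b, hx, hp⟩ := Γ.exists_isCrossing_plus p
  have hmem := toIocMod_mem_Ioc Real.two_pi_pos s t
  have hang : ((toIocMod Real.two_pi_pos s t : ℝ) : Real.Angle) = t := by
    rw [Real.Angle.angle_eq_iff_two_pi_dvd_sub]
    refine ⟨-toIocDiv Real.two_pi_pos s t, ?_⟩
    rw [toIocMod_sub_self]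
    simp [zsmul_eq_mul, mul_comm]
  refine ⟨s, toIocMod Real.two_pi_pos s t, a, b, ⟨?_, hx.left, ?_, hx.left_vel, ?_⟩, hp, hmem.1,
    lt_of_le_of_ne hmem.2 fun e => ?_⟩
  · rw [hang]; exact hx.ne
  · rw [Γ.generic.periodic.eq_of_angle hang, hx.right]
  · rw [(velocity_periodic Γ.generic.periodic).eq_of_angle hang]; exact hx.right_vel
  · refine hx.ne ?_
    rw [← hang, e]
    simp

end DecoratedCircle

namespace ContactCircleBundle

variable {E : Type*} [TopologicalSpace E] [ChartedSpace R3 E] [IsManifold (𝓡 3) ∞ E]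
  [MulAction Circle E] {B : ContactCircleBundle E}

theorem exp_smul_ne (B : ContactCircleBundle E) {r : ℝ} (h0 : 0 < r) (h1 : r < 2 * π) (p : E) :
    Circle.exp r • p ≠ p := by
  intro h
  have h2 := B.free _ _ h
  rw [Circle.exp_eq_one] at h2
  obtain ⟨k, hk⟩ := h2
  rw [hk] at h0 h1
  have h3 : (0 : ℝ) < k := pos_of_mul_pos_left h0 Real.two_pi_pos.le
  have h4 : (k : ℝ) < 1 := by
    by_contra hge
    nlinarith [Real.two_pi_pos, not_lt.1 hge]
  have h5 : (0 : ℤ) < k := by exact_mod_cast h3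
  have h6 : k < 1 := by exact_mod_cast h4
  omega

theorem velocity_proj {L : ℝ → E} (hL : ContMDiff 𝓘(ℝ, ℝ) (𝓡 3) ∞ L) {t : ℝ}
    (h0 : mfderiv 𝓘(ℝ, ℝ) (𝓡 3) L t (1 : ℝ) = 0) : velocity (fun s => B.proj (L s)) t = 0 := by
  have h1 : ContMDiff (𝓡 3) 𝓘(ℝ, R3) ∞ fun q : E => (B.proj q : R3) :=
    contMDiff_coe_S2.comp B.smooth_proj
  have h2 := mfderiv_comp t (h1.mdifferentiableAt (by simp) (x := L t))
    (hL.mdifferentiableAt (by simp) (x := t))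
  have h3 : velocity (fun s => B.proj (L s)) t =
      mfderiv 𝓘(ℝ, ℝ) 𝓘(ℝ, R3) ((fun q : E => (B.proj q : R3)) ∘ L) t (1 : ℝ) := by
    rw [mfderiv_eq_fderiv]
    exact fderiv_apply_one_eq_deriv.symm
  rw [h3, h2]
  exact (congrArg (mfderiv (𝓡 3) 𝓘(ℝ, R3) (fun q : E => (B.proj q : R3)) (L t)) h0).trans
    (map_zero _)

/-- Closed Legendrian curves over generic circles are embedded if the ends of the strands over the
double points are different. -/
def LegendrianKnot.ofLift {γ : ℝ → S2} (h : IsGenericCircle γ) {L : ℝ → E}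
    (hL : ContMDiff 𝓘(ℝ, ℝ) (𝓡 3) ∞ L) (hper : Function.Periodic L (2 * π))
    (hp : ∀ t, B.proj (L t) = γ t)
    (hleg : ∀ t, B.form (L t) (mfderiv 𝓘(ℝ, ℝ) (𝓡 3) L t (1 : ℝ)) = 0)
    (hinj : ∀ s t : ℝ, (s : Real.Angle) ≠ t → γ s = γ t → L s ≠ L t) : B.LegendrianKnot where
  toFun := L
  smooth := hL
  periodic := hper
  injective s t hst := by
    by_contra hne
    exact hinj s t hne (by rw [← hp, ← hp, hst]) hst
  immersive t h0 := by
    have h1 := B.velocity_proj hL h0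
    simp only [hp] at h1
    exact h.immersive t h1
  legendrian := hleg
  generic_projection := by simpa only [hp] using h

/-- The sufficiency of the condition: move the curve so that its regions have the curvatures `v`,
lift it, and read off chords of the lengths `q`. -/
theorem exists_legendrianKnot {e : ℤ} (he : B.IsEulerNumber e) {Γ : DecoratedCircle}
    {n : Γ.Region →₀ ℤ} (H : (Γ.Psi '' Γ.chordVectors ∩
      {w | ∃ v ∈ Γ.negHyperplane e, w = (2 * Real.pi) • Γ.toV n - v}).Nonempty) :
    ∃ (L : B.LegendrianKnot) (c : ∀ y : doublePoints L.projection, L.ShortChord y),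
      L.IsDiagram c Γ n := by
  obtain ⟨_, ⟨q, hq, rfl⟩, v, ⟨hvsum, hvneg⟩, hqv⟩ := H
  -- A finitely supported vector without zero components exists only over a finite set.
  have hfin : Finite Γ.Region := by
    refine Finite.of_finite_univ (v.support.finite_toSet.subset fun U _ => ?_)
    exact Finsupp.mem_support_iff.2 (hvneg U).ne
  have := Fintype.ofFinite Γ.Region
  change (v.sum fun _ c => c) = 2 * π * e at hvsum
  rw [Finsupp.sum_fintype _ _ (fun _ => rfl)] at hvsum
  obtain ⟨φ, hφ, hsp, hφv⟩ := exists_diffeo he Γ.generic hvneg hvsum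
  have hqv' : ∀ U : Γ.Region, v U = 2 * π * n U - Γ.Psi q U := fun U => by
    rw [hqv]
    simp only [DecoratedCircle.toV, Finsupp.sub_apply, Finsupp.smul_apply,
      Finsupp.mapRange_apply, smul_eq_mul]
    ring
  set γ : ℝ → S2 := fun t => φ (Γ.curve t) with hγ
  have hgen : IsGenericCircle γ := Γ.generic.diffeo φ
  choose S T a b hx hplus hlt hlt' using Γ.exists_isCrossing_plus_lt
  have hvert : ∀ y : doublePoints γ, ∃ p : Γ.Vertex, φ p = y := by
    rintro ⟨_, s, t, hne, hs, ht⟩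
    exact ⟨⟨Γ.curve s, s, t, hne, rfl, φ.injective (ht.trans hs.symm)⟩, hs⟩
  choose p hp using hvert
  let a' : doublePoints γ → R3 := fun y => fderiv ℝ (radialExt φ) (p y : S2) (a (p y))
  let b' : doublePoints γ → R3 := fun y => fderiv ℝ (radialExt φ) (p y : S2) (b (p y))
  have hx' : ∀ y : doublePoints γ, IsCrossing γ y (S (p y)) (T (p y)) (a' y) (b' y) := fun y => by
    have h1 := (hx (p y)).diffeo φ Γ.generic
    rw [hp] at h1
    exact h1
  have hpinj : ∀ x : Γ.Vertex, ∃ y : doublePoints γ, p y = x := fun x => by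
    refine ⟨⟨φ x, ((hx x).diffeo φ Γ.generic).mem_doublePoints⟩, ?_⟩
    exact Subtype.ext (φ.injective (hp _))
  have hpbij : Function.Bijective p :=
    ⟨fun y z hyz => Subtype.ext (by rw [← hp y, ← hp z, hyz]), hpinj⟩
  have hreg : ∀ V : regions γ, ∃ U : Γ.Region, φ '' (U : Set S2) = V := fun V => by
    obtain ⟨U, hU, e⟩ := exists_image_eq_of_mem_regions φ V.2
    exact ⟨⟨U, hU⟩, e⟩
  choose u hu using hreg
  have : Finite (regions γ) := Finite.of_injective u fun V W hVW =>
    Subtype.ext (by rw [← hu V, ← hu W, hVW])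
  have := Fintype.ofFinite (regions γ)
  have hn : ∀ V : regions γ, surfaceIntegral (V : Set S2) B.curvature =
      2 * π * n (u V) - ∑ᶠ y : doublePoints γ, q (p y) * coverSum (V : Set S2) y (a' y) (b' y) := by
    intro V
    rw [← hu V, hφv, hqv', Γ.Psi_apply]
    congr 1
    refine (finsum_eq_of_bijective p hpbij fun y => ?_).symm
    rw [Γ.Psi_single_apply (hx (p y)) (hplus (p y)),
      ← (hx (p y)).coverSum_image φ Γ.generic (u V).2, hp]
  obtain ⟨L, hL, hper, hproj, hleg, hchord⟩ := exists_lift he hgen hsp hx' (fun y => hlt (p y))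
    (fun y => hlt' (p y)) (q := fun y => q (p y)) (n := fun V => n (u V)) hn
  have hdet : ∀ y : doublePoints γ, det3 (y : S2) (a' y) (b' y) ≠ 0 := fun y => (hx' y).det_ne hgen
  -- The strands differ by a rotation through an angle strictly between `0` and `2π`, and the action
  -- is free. This is where the open interval for the chord lengths is needed.
  have hST : ∀ y : doublePoints γ, L (S (p y)) ≠ L (T (p y)) := fun y hy => by
    have h1 := B.exp_smul_ne (hq (p y)).1 (hq (p y)).2 (L (T (p y)))
    rcases lt_or_gt_of_ne (hdet y) with hd | hd
    · have h2 := (hchord y).2 hd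
      rw [hy] at h2
      exact h1 h2
    · have h2 := (hchord y).1 hd
      rw [hy] at h2
      exact h1 h2
  have hinj : ∀ s t : ℝ, (s : Real.Angle) ≠ t → γ s = γ t → L s ≠ L t := by
    intro s t hne hst
    have key := hx' ⟨γ t, s, t, hne, hst, rfl⟩
    rcases hgen.angle_eq_or key.ne key.left key.right hst with e1 | e1 <;>
      rcases hgen.angle_eq_or key.ne key.left key.right rfl with e2 | e2
    · exact absurd (e1.trans e2.symm) hne
    · rw [hper.eq_of_angle e1, hper.eq_of_angle e2]; exact hST _
    · rw [hper.eq_of_angle e1, hper.eq_of_angle e2]; exact (hST _).symm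
    · exact absurd (e1.trans e2.symm) hne
  let K : B.LegendrianKnot := LegendrianKnot.ofLift hgen hL hper hproj hleg hinj
  have hK : K.projection = γ := funext hproj
  have hpush : ∀ y : doublePoints γ, ∀ A ∈ Γ.plus (p y), pushQuadrant φ (p y) A = cone (a' y) (b' y)
      ∨
      pushQuadrant φ (p y) A = cone (-a' y) (-b' y) := by
    intro y A hA
    rw [hplus] at hA
    rcases hA with rfl | rfl
    · exact Or.inl ((hx (p y)).pushQuadrant_cone φ Γ.generic)
    · right
      rw [(hx (p y)).neg_left.neg_right.pushQuadrant_cone φ Γ.generic, map_neg, map_neg]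
  -- The sign of the determinant of the rays of the decorated quadrant decides the direction of the
  -- chord, so that in either case the decorated quadrants are those required by the chord.
  have hc : ∀ y : doublePoints K.projection, ∃ c : K.ShortChord y, ∀ p' : Γ.Vertex, φ p' = y →
      c.length = q p' ∧ ∀ A ∈ Γ.plus p', pushQuadrant φ p' A ∈ c.plusQuadrants := by
    intro y
    obtain ⟨z, hz⟩ : ∃ z : doublePoints γ, (z : S2) = y := ⟨⟨y, hK ▸ y.2⟩, rfl⟩
    have hzp : ∀ p' : Γ.Vertex, φ p' = y → p' = p z := fun p' hp' =>
      Subtype.ext (φ.injective (hp'.trans (hz.symm.trans (hp z).symm)))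
    have hvel : ∀ {w : R3} {τ : ℝ},
        w = velocity K.projection τ ∨ w = -velocity K.projection τ →
        -w = velocity K.projection τ ∨ -w = -velocity K.projection τ := fun h =>
      h.elim (fun h => Or.inr (by rw [h])) (fun h => Or.inl (by rw [h, neg_neg]))
    have hl : a' z = velocity K.projection (S (p z)) ∨ a' z = -velocity K.projection (S (p z)) := by
      rw [hK]; exact (hx' z).left_vel
    have hr : b' z = velocity K.projection (T (p z)) ∨ b' z = -velocity K.projection (T (p z)) := by
      rw [hK]; exact (hx' z).right_vel
    have hneg : det3 (y : S2) (-b' z) (-a' z) = det3 (y : S2) (b' z) (a' z) := by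
      rw [det3_neg_mid, det3_neg_right, neg_neg]
    have hneg' : det3 (y : S2) (-a' z) (-b' z) = det3 (y : S2) (a' z) (b' z) := by
      rw [det3_neg_mid, det3_neg_right, neg_neg]
    rcases lt_or_gt_of_ne (hdet z) with hd | hd
    · refine ⟨⟨S (p z), T (p z), (hproj _).trans ((hx' z).left.trans hz),
        (hproj _).trans ((hx' z).right.trans hz),
        (hx' z).ne, q (p z), (hq _).1, (hq _).2, (hchord z).2 hd⟩, fun p' hp' => ?_⟩
      obtain rfl := hzp p' hp'
      refine ⟨rfl, fun A hA => ?_⟩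
      rw [det3_swap, neg_neg_iff_pos, hz] at hd
      rcases hpush z A hA with e | e
      · exact ⟨b' z, a' z, hr, hl, hd, e.trans (cone_comm _ _)⟩
      · exact ⟨-b' z, -a' z, hvel hr, hvel hl, by rwa [hneg],
          e.trans (cone_comm _ _)⟩
    · refine ⟨⟨T (p z), S (p z), (hproj _).trans ((hx' z).right.trans hz),
        (hproj _).trans ((hx' z).left.trans hz),
        (hx' z).ne.symm, q (p z), (hq _).1, (hq _).2, (hchord z).1 hd⟩, fun p' hp' => ?_⟩
      obtain rfl := hzp p' hp'
      refine ⟨rfl, fun A hA => ?_⟩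
      rw [hz] at hd
      rcases hpush z A hA with e | e
      · exact ⟨a' z, b' z, hl, hr, hd, e⟩
      · exact ⟨-a' z, -b' z, hvel hl, hvel hr, by rwa [hneg'], e⟩
  choose c hc using hc
  have hrange : φ '' range Γ.curve = range K.projection := by rw [hK, hγ, range_diffeo]
  have hvertex : ∀ x : Γ.Vertex, ∃ y : doublePoints K.projection, (y : S2) = φ x ∧
      q x = (c y).length ∧ ∀ A ∈ Γ.plus x, pushQuadrant φ x A ∈ (c y).plusQuadrants := fun x => by
    have hmem : φ x ∈ doublePoints K.projection := by
      rw [hK]; exact ((hx x).diffeo φ Γ.generic).mem_doublePoints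
    exact ⟨⟨φ x, hmem⟩, rfl, (hc ⟨φ x, hmem⟩ x rfl).1.symm, (hc ⟨φ x, hmem⟩ x rfl).2⟩
  refine ⟨K, c, φ, hφ, hrange, fun x => ?_, fun U => ?_⟩
  · obtain ⟨y, h1, -, h2⟩ := hvertex x
    exact ⟨y, h1, h2⟩
  · have h1 := K.two_pi_mul_defect c Γ φ hrange q hvertex U
    rw [hφv, hqv', sub_add_cancel] at h1
    exact (mul_left_cancel₀ Real.two_pi_pos.ne' h1).symm

end ContactCircleBundle

end

theorem mainTheorem6 {E : Type*} [TopologicalSpace E] [T2Space E] [SecondCountableTopology E]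
    [ChartedSpace R3 E] [IsManifold (𝓡 3) ∞ E] [MulAction Circle E]
    (B : ContactCircleBundle E) (e : ℤ) (he : B.IsEulerNumber e)
    (Γ : DecoratedCircle) (n : Γ.Region →₀ ℤ) :
    (∃ (L : B.LegendrianKnot)
        (c : ∀ y : doublePoints L.projection, L.ShortChord y), L.IsDiagram c Γ n) ↔
      (Γ.Psi '' Γ.chordVectors ∩
        {w | ∃ v ∈ Γ.negHyperplane e, w = (2 * Real.pi) • Γ.toV n - v}).Nonempty :=
  ⟨fun ⟨_, _, hd⟩ => ContactCircleBundle.LegendrianKnot.exists_chordVector he hd,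
    ContactCircleBundle.exists_legendrianKnot he⟩
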